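/- **Setting.** Let $a<b$, $T>0$, $k\ge 1$. Let $(u,q,p)$ solve the linear problem $$q=u_x,\quad p=q_x,\quad u_t+p_x=f\quad\text{in }(a,b),\ 0\le t\le T,$$ with $u(0)=u_0$, $u=u_D$ at $x=a$ and $x=b$, and $q=q_N$ at $x=b$, where $f(t)\in L^2(a,b)$ (spatial derivatives are weak; $u,q,p$ are the representatives continuous in $x$). For a mesh $\mathcal T_h:\ a=x_0<x_1<\dots<x_N=b$ put $I_i=(x_{i-1},x_i)$ and $h=\max_i(x_i-x_{i-1})$. Let $H^s(\mathcal T_h)$ be the elementwise Sobolev space and $W_h^k$ the space of functions that are polynomials of degree at most $k$ on each $I_i$. Let $(\cdot,\cdot)$ be the sum over $i$ of the $L^2(I_i)$ inner products and $\langle\eta,vn\rangle=\sum_{i=1}^N\big(\eta(x_i^-)v(x_i^-)-\eta(x_{i-1}^+)v(x_{i-1}^+)\big)$. **Method.** The HDG approximation consists, for each $t\in[0,T]$, of $u_h,q_h,p_h\in W_h^k$, values $\widehat u_h$ at all nodes $x_0,\dots,x_N$ with $\widehat u_h=u_D$ at $a$ and $b$, and values $\widehat p_h^{\,-}$ at $x_1,\dots,x_N$,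 with $u_h$ differentiable in $t$, such that $$(q_h,v)+(u_h,v_x)-\langle\widehat u_h,vn\rangle=0,\qquad (p_h,z)+(q_h,z_x)-\langle\widehat q_h,zn\rangle=0,$$ $$(u_{h,t},w)-(p_h,w_x)+\langle\widehat p_h,wn\rangle=(f,w),\qquad \langle\widehat q_h,\mu n\rangle=q_N\,\mu(b),\qquad \langle\widehat p_h,\chi n\rangle=0$$ for all $v,z,w\in W_h^k$, all nodal functions $\mu$ on $\{x_1,\dots,x_N\}$ (with $\mu(a):=0$) and all nodal functions $\chi$ with $\chi(a)=\chi(b)=0$. Here $$\widehat p_h^{\,+}=p_h^+-\tau_{pu}^+(\widehat u_h-u_h^+),\qquad \widehat q_h^{\,+}=q_h^+-\tau_{qu}^+(\widehat u_h-u_h^+),$$ $$\widehat q_h^{\,-}=q_h^-+\tau_{qu}^-(\widehat u_h-u_h^-)+\tau_{qp}^-(\widehat p_h^{\,-}-p_h^-),$$ where $+$ and $-$ denote values at the left and right ends of an element. The values at $t=0$ are the HDG approximation of the stationary problem $v+v_{xxx}=u_0+(u_0)_{xxx}$, i.e. they satisfy the same equations at $t=0$ with the third one replaced by $(u_h,w)-(p_h,w_x)+\langle\widehat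 p_h,wn\rangle=(u_0+(u_0)_{xxx},w)$. **Theorem.** Suppose that the stabilization function satisfies, at all element ends, $$\tau_{qu}^->0,\quad \tau_{qu}^-\tau_{qp}^-=1,\quad \tau_{qu}^+\in[0,1],\quad \tau_{pu}^+\in\Big[-1-\sqrt{1-(\tau_{qu}^+)^2},\ -\tfrac12-\tfrac12(\tau_{qu}^+)^2\Big],$$ and $M^{-1}\le\tau_{qu}^-\le M$ for a fixed $M$ (which holds for a suitable $M$ when the $\tau$'s are constants), and that $$u\in W^{2,\infty}(0,T;H^{k+1}(\mathcal T_h)),\qquad q,p\in W^{1,\infty}(0,T;H^{k+1}(\mathcal T_h))$$ with all the $L^\infty(0,T;H^{k+1}(\mathcal T_h))$ norms of these functions and of their time derivatives up to the indicated order at most a fixed $K$. Then there are $C$ and $h_0>0$, independent of the mesh and of the stabilization function (they may depend on $a,b,T,k,K,M$, the data and the exact solution), such that whenever $h<h_0$, $$\|u-u_h\|+\|q-q_h\|+\|p-p_h\|+\|u_t-u_{h,t}\|\le C\,h^{k+1}\qquad\text{for } 0\le t\le T,$$ where $\|\cdot\|$ is the $L^2(a,b)$ norm. -/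

import Mathlib

open MeasureTheory Set
open scoped ENNReal ContDiff Polynomial

namespace HDG

noncomputable section

/-! ### Weak derivatives and Sobolev spaces -/

/-- `w` is the `n`-th weak derivative of `v` on the open set `I ⊆ ℝ`. -/
def IsWeakDeriv (n : ℕ) (I : Set ℝ) (v w : ℝ → ℝ) : Prop :=
  LocallyIntegrableOn v I ∧ LocallyIntegrableOn w I ∧
    ∀ φ : ℝ → ℝ, ContDiff ℝ ∞ φ → HasCompactSupport φ → tsupport φ ⊆ I →
      ∫ x in I, v x * iteratedDeriv n φ x = (-1) ^ n * ∫ x in I, w x * φ x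

/-- A partition `a = x₀ < x₁ < ⋯ < x_N = b` of the interval `(a, b)` into `N` elements. The element
with index `i : Fin N` is `(node i.castSucc, node i.succ)`. -/
structure Mesh (a b : ℝ) (N : ℕ) where
  node : Fin (N + 1) → ℝ
  strictMono : StrictMono node
  node_zero : node 0 = a
  node_last : node (Fin.last N) = b

namespace Mesh

variable {a b : ℝ} {N : ℕ} (𝒯 : Mesh a b N)

/-- The left end point of the `i`-th element. -/
def left (i : Fin N) : ℝ := 𝒯.node i.castSucc

/-- The right end point of the `i`-th element. -/
def right (i : Fin N) : ℝ := 𝒯.node i.succ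

/-- The `i`-th element, an open interval. -/
def elem (i : Fin N) : Set ℝ := Ioo (𝒯.left i) (𝒯.right i)

/-- The mesh size: the largest length of an element. -/
def size : ℝ := ⨆ i : Fin N, (𝒯.right i - 𝒯.left i)

/-- The function on `(a, b)` (up to the finitely many nodes) given by a polynomial on each
element. -/
def toFun (w : Fin N → ℝ[X]) (x : ℝ) : ℝ :=
  ∑ i, (𝒯.elem i).indicator (fun y => (w i).eval y) x

end Mesh

/-- Families `(g₀, …, g_s)` of functions in `L²(a, b)` with the Hilbert norm
`(∑ l, ‖g_l‖²)^(1/2)`. The space `H^s(𝒯)` is the closed subspace singled out by `IsBrokenSobolev`,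
in which `g_l` is the `l`-th elementwise weak derivative of `g₀`; the norm is the `H^s(𝒯)` norm of
`g₀`. -/
abbrev Jet (a b : ℝ) (s : ℕ) : Type :=
  PiLp 2 (fun _ : Fin (s + 1) => Lp ℝ 2 (volume.restrict (Ioo a b)))

/-- `g` is an element of the broken Sobolev space `H^s(𝒯)` together with its elementwise weak
derivatives up to order `s`. -/
def IsBrokenSobolev {a b : ℝ} {N : ℕ} (𝒯 : Mesh a b N) {s : ℕ} (g : Jet a b s) : Prop :=
  ∀ (i : Fin N) (l : Fin s), IsWeakDeriv 1 (𝒯.elem i) (g l.castSucc) (g l.succ)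

/-- `V'` is the weak derivative on `(0, T)` of `V`, a function of time with values in a Banach
space (used for Bochner integrable functions). -/
def IsWeakTimeDeriv {E : Type*} [NormedAddCommGroup E] [NormedSpace ℝ E] (T : ℝ)
    (V V' : ℝ → E) : Prop :=
  ∀ φ : ℝ → ℝ, ContDiff ℝ ∞ φ → HasCompactSupport φ → tsupport φ ⊆ Ioo 0 T →
    ∫ t in Ioo 0 T, deriv φ t • V t = -∫ t in Ioo 0 T, φ t • V' t

/-- `v = v(t, x)` belongs to the Bochner–Sobolev space `W^{m,∞}(0, T; H^s(𝒯))`, and each of its time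
derivatives up to order `m` is bounded by `K` in `L^∞(0, T; H^s(𝒯))`. -/
def MemBochnerSobolev {a b : ℝ} {N : ℕ} (𝒯 : Mesh a b N) (T : ℝ) (m s : ℕ) (K : ℝ)
    (v : ℝ → ℝ → ℝ) : Prop :=
  ∃ D : Fin (m + 1) → ℝ → Jet a b s,
    (∀ᵐ t ∂(volume.restrict (Ioo 0 T)), v t =ᵐ[volume.restrict (Ioo a b)] (D 0 t) 0) ∧
    (∀ j, AEStronglyMeasurable (D j) (volume.restrict (Ioo 0 T)) ∧
      ∀ᵐ t ∂(volume.restrict (Ioo 0 T)), IsBrokenSobolev 𝒯 (D j t) ∧ ‖D j t‖ ≤ K) ∧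
    ∀ j : Fin m, IsWeakTimeDeriv T (D j.castSucc) (D j.succ)

/-! ### The initial-boundary value problem -/

/-- Data of the problem `u_t + u_xxx = f` on `(a, b)`: the source `f(t, x)`, the initial value, the
values of `u` at `a` and at `b`, and the values of `u_x` at `b`. -/
structure ProblemData where
  f : ℝ → ℝ → ℝ
  u₀ : ℝ → ℝ
  uDa : ℝ → ℝ
  uDb : ℝ → ℝ
  qN : ℝ → ℝ

/-- `(u, q, p)` solves `q = u_x`, `p = q_x`, `u_t + p_x = f` on `(a, b)` for `t ∈ [0, T]`, with the
initial and boundary conditions; `ut` is the time derivative of `u`. The spatial derivatives are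
weak derivatives, and `u, q, p` are the representatives that are continuous in `x`. -/
structure IsExactSolution (a b T : ℝ) (d : ProblemData) (u ut q p : ℝ → ℝ → ℝ) : Prop where
  source : ∀ t ∈ Icc 0 T, MemLp (d.f t) 2 (volume.restrict (Ioo a b))
  cont_u : ∀ t ∈ Icc 0 T, ContinuousOn (u t) (Icc a b)
  cont_q : ∀ t ∈ Icc 0 T, ContinuousOn (q t) (Icc a b)
  cont_p : ∀ t ∈ Icc 0 T, ContinuousOn (p t) (Icc a b)
  time_deriv : ∀ t ∈ Icc 0 T, ∀ x ∈ Icc a b,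
    HasDerivWithinAt (fun s => u s x) (ut t x) (Icc 0 T) t
  eq_q : ∀ t ∈ Icc 0 T, IsWeakDeriv 1 (Ioo a b) (u t) (q t)
  eq_p : ∀ t ∈ Icc 0 T, IsWeakDeriv 1 (Ioo a b) (q t) (p t)
  eq_u : ∀ t ∈ Icc 0 T, IsWeakDeriv 1 (Ioo a b) (p t) (fun x => d.f t x - ut t x)
  initial : ∀ x ∈ Icc a b, u 0 x = d.u₀ x
  boundary_a : ∀ t ∈ Icc 0 T, u t a = d.uDa t
  boundary_b : ∀ t ∈ Icc 0 T, u t b = d.uDb t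
  boundary_q : ∀ t ∈ Icc 0 T, q t b = d.qN t

/-! ### The HDG method -/

/-- The stabilization function: for the `i`-th element, `quL i = τ_qu` and `puL i = τ_pu` at its left
end, `quR i = τ_qu` and `qpR i = τ_qp` at its right end. -/
structure Stabilization (N : ℕ) where
  quL : Fin N → ℝ
  puL : Fin N → ℝ
  quR : Fin N → ℝ
  qpR : Fin N → ℝ

/-- The conditions on the stabilization function. -/
structure Stabilization.Admissible {N : ℕ} (τ : Stabilization N) : Prop where
  quR_pos : ∀ i, 0 < τ.quR i
  quR_mul_qpR : ∀ i, τ.quR i * τ.qpR i = 1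
  quL_mem : ∀ i, τ.quL i ∈ Icc (0 : ℝ) 1
  puL_mem : ∀ i, τ.puL i ∈
    Icc (-1 - Real.sqrt (1 - τ.quL i ^ 2)) (-(1 / 2) - 1 / 2 * τ.quL i ^ 2)

/-- The unknowns `(u_h, q_h, p_h, û_h, p̂_h⁻)`: piecewise polynomials `u, q, p`, the trace `uhat` at
all nodes, and the trace `phat i` at the right end of the `i`-th element. -/
structure Unknowns (N : ℕ) where
  u : Fin N → ℝ[X]
  q : Fin N → ℝ[X]
  p : Fin N → ℝ[X]
  uhat : Fin (N + 1) → ℝ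
  phat : Fin N → ℝ

/-- The space `W_h^k` of piecewise polynomials of degree at most `k`. -/
def InW {N : ℕ} (k : ℕ) (w : Fin N → ℝ[X]) : Prop := ∀ i, (w i).degree ≤ k

section Method

variable {a b : ℝ} {N : ℕ} (𝒯 : Mesh a b N) (τ : Stabilization N) (s : Unknowns N)

/-- The inner product `∑ i, ∫_{I_i} φ v` of two piecewise polynomials. -/
def inn (φ v : Fin N → ℝ[X]) : ℝ :=
  ∑ i, ∫ x in 𝒯.elem i, (φ i).eval x * (v i).eval x

/-- The inner product `∑ i, ∫_{I_i} g v` of a function with a piecewise polynomial. -/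
def innFun (g : ℝ → ℝ) (v : Fin N → ℝ[X]) : ℝ :=
  ∑ i, ∫ x in 𝒯.elem i, g x * (v i).eval x

/-- `⟨η, v n⟩`, where `ηL i, ηR i` are the values of `η` at the left and right ends of the `i`-th
element and `n` is the outward unit normal (`-1` on the left and `1` on the right). -/
def bdry (ηL ηR : Fin N → ℝ) (v : Fin N → ℝ[X]) : ℝ :=
  ∑ i, (ηR i * (v i).eval (𝒯.right i) - ηL i * (v i).eval (𝒯.left i))

/-- `⟨η, μ n⟩` for a function `μ` on the set of nodes. -/
def bdryNode (ηL ηR : Fin N → ℝ) (μ : Fin (N + 1) → ℝ) : ℝ :=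
  ∑ i, (ηR i * μ i.succ - ηL i * μ i.castSucc)

/-- The numerical trace `p̂_h⁺` at the left end of each element. -/
def phatL (i : Fin N) : ℝ :=
  (s.p i).eval (𝒯.left i) +
    τ.puL i * (s.uhat i.castSucc - (s.u i).eval (𝒯.left i)) * (-1)

/-- The numerical trace `q̂_h⁺` at the left end of each element. -/
def qhatL (i : Fin N) : ℝ :=
  (s.q i).eval (𝒯.left i) +
    τ.quL i * (s.uhat i.castSucc - (s.u i).eval (𝒯.left i)) * (-1)

/-- The numerical trace `q̂_h⁻` at the right end of each element. -/
def qhatR (i : Fin N) : ℝ :=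
  (s.q i).eval (𝒯.right i) +
    τ.quR i * (s.uhat i.succ - (s.u i).eval (𝒯.right i)) * 1 +
    τ.qpR i * (s.phat i - (s.p i).eval (𝒯.right i)) * 1

/-- The HDG equations with zero order term `D` and source `g`: a discretization of
`q = u_x`, `p = q_x`, `D + p_x = g` with `u = uDa` at `a`, `u = uDb` at `b` and `q = qN` at `b`.
With `D = (u_h)_t` it is the semidiscrete method, with `D = u_h` the stationary method. -/
structure IsHDGState (k : ℕ) (uDa uDb qN : ℝ) (D : Fin N → ℝ[X]) (g : ℝ → ℝ) : Prop where
  mem_u : InW k s.u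
  mem_q : InW k s.q
  mem_p : InW k s.p
  uhat_a : s.uhat 0 = uDa
  uhat_b : s.uhat (Fin.last N) = uDb
  eq_q : ∀ v, InW k v →
    inn 𝒯 s.q v + inn 𝒯 s.u (fun i => (v i).derivative) -
      bdry 𝒯 (fun i => s.uhat i.castSucc) (fun i => s.uhat i.succ) v = 0
  eq_p : ∀ z, InW k z →
    inn 𝒯 s.p z + inn 𝒯 s.q (fun i => (z i).derivative) -
      bdry 𝒯 (qhatL 𝒯 τ s) (qhatR 𝒯 τ s) z = 0
  eq_u : ∀ w, InW k w →
    inn 𝒯 D w - inn 𝒯 s.p (fun i => (w i).derivative) +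
      bdry 𝒯 (phatL 𝒯 τ s) s.phat w = innFun 𝒯 g w
  trans_q : ∀ μ : Fin (N + 1) → ℝ, μ 0 = 0 →
    bdryNode (qhatL 𝒯 τ s) (qhatR 𝒯 τ s) μ = qN * μ (Fin.last N)
  trans_p : ∀ χ : Fin (N + 1) → ℝ, χ 0 = 0 → χ (Fin.last N) = 0 →
    bdryNode (phatL 𝒯 τ s) s.phat χ = 0

end Method

/-- `S(t) = (u_h, q_h, p_h, û_h, p̂_h⁻)(t)`, with `ut = (u_h)_t`, is the semidiscrete HDG approximation
on `[0, T]`. The initial approximation `S 0` is the HDG approximation of the stationary problem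
`v + v_xxx = g` with `g = u₀ + u₀'''`, where `u₀'''` is given by `d3u₀`. -/
structure IsHDGSolution {a b : ℝ} {N : ℕ} (𝒯 : Mesh a b N) (τ : Stabilization N) (k : ℕ) (T : ℝ)
    (d : ProblemData) (d3u₀ : ℝ → ℝ) (S : ℝ → Unknowns N) (ut : ℝ → Fin N → ℝ[X]) : Prop where
  time_deriv : ∀ t ∈ Icc 0 T, ∀ (i : Fin N) (m : ℕ),
    HasDerivWithinAt (fun r => ((S r).u i).coeff m) ((ut t i).coeff m) (Icc 0 T) t
  equations : ∀ t ∈ Icc 0 T,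
    IsHDGState 𝒯 τ (S t) k (d.uDa t) (d.uDb t) (d.qN t) (ut t) (d.f t)
  initial : IsHDGState 𝒯 τ (S 0) k (d.uDa 0) (d.uDb 0) (d.qN 0) (S 0).u
    (fun x => d.u₀ x + d3u₀ x)

/-- The `L²(a, b)` norm of `v - w_h`, where `w_h` is a piecewise polynomial. -/
def l2Error {a b : ℝ} {N : ℕ} (𝒯 : Mesh a b N) (v : ℝ → ℝ) (w : Fin N → ℝ[X]) : ℝ≥0∞ :=
  eLpNorm (fun x => v x - 𝒯.toFun w x) 2 (volume.restrict (Ioo a b))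

end

end HDG

/-! The discrete solution is compared with a corrected projection of the exact one. The argument
combines a projection whose defects are multiples of one polynomial per element, a weighted energy
inequality of Kato type, and an estimate for increments in time.

Projection. On each element u, q, p are replaced by their `L²` projections plus multiples of the
Legendre polynomial L = `leg k l r`. As L is orthogonal to lower degrees, these multiples do not
enter the terms with differentiated test functions (`ip_leg_derivative`), so their amplitudes can be
fitted to the three flux relations of the element. Fitting all three is possible algebraically, but
then the correction c of u involves q and p, its derivative c' becomes a source in the equation for
u_t, and increments of that source would need two time derivatives of q and p, while only one is
available. Therefore c stays free, the left flux of p keeps a residual δ, and c is defined by the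
equation θ η c' = -s δ, which is a linear ODE since δ is affine in c (η is the length of the
element, s = L(l), θ η = ‖L‖²); see `isSol_of_equations` and `exists_isCorrector`. Now c' and δ act
only through the functional v ↦ δ(-v(l) + s (L,v)/(θη)). It vanishes on L and can be moved onto q by
the first equation (`exists_leftTest`, `delta_identity`). The ODE is damped at a rate of order 1/η
and starts at its equilibrium, so there is no initial layer and c is of the size of the projection
error.

Energy. For the exact equation, testing with φu for φ = W + (x - a) gives 3/2 ‖u_x‖² because φ' = 1.
Discretely φu leaves the polynomial space and is projected back; the loss at the end points is
governed by top coefficients only (`exists_weighted`). The conditions on the stabilization make the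
jump terms dissipative with a factor proportional to W, while the losses have a constant independent
of W, so a large W absorbs them (`dissipation_le`, `exists_kato`, `exists_energy_le`). The norm of u
is absorbed by the discrete Poincaré inequality. The energy does not see p. What remains is the
pairing of the source amplitudes fq of the first equation with the weighted top coefficients of p.

Static stability. Let D be the discrete error of u_t. The numerical traces of u and q vanish at b,
and p has a mean-value condition, so on fine meshes u, q, p are controlled by D and the sources
(`exists_static_le`). Moreover (L,p) is of order η^{3/2} in these quantities (`exists_leg_p_le`), so
the pairing only needs fq in a norm with weight η³ (`exists_pairing_le`).

Time. The energy inequality is applied to increments over a step σ. The pairing of increments is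
summed by parts in time, which puts a second difference on fq and none on p
(`abs_integral_increments_le`). Second differences of fq are available with weight η³: q = u_x
inherits two time derivatives from u at the cost of one power of h, and the ODE costs one power of η
for c'. Division by σ² and σ → 0 bounds D(t) by D(0), the sources and a small multiple of the
supremum of ‖D‖²; that supremum is finite on each fixed mesh (`exists_cont_le`) and is absorbed
(`exists_evolution_le`). The initial value comes from the stationary method: at time zero D - u is a
multiple of L on each element, so the energy inequality is coercive in D (`exists_initial_le`).

The remaining work turns the Bochner–Sobolev hypotheses into Lipschitz functions of time with values
in broken Sobolev jets, valid at every time (`IsExactSolution.isRegular`), and writes traces and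
projections as continuous linear functionals of jets. -/

namespace HDG

noncomputable section

/-! ### Polynomials on an interval -/

/-- The `L²(l, r)` inner product of two polynomials. -/
def ip (l r : ℝ) (v w : ℝ[X]) : ℝ := ∫ x in l..r, v.eval x * w.eval x

section ip

variable {l r : ℝ} (u v w : ℝ[X]) (c : ℝ)

lemma ip_intervalIntegrable : IntervalIntegrable (fun x => v.eval x * w.eval x) volume l r :=
  (v.continuous.mul w.continuous).intervalIntegrable _ _

lemma ip_comm : ip l r v w = ip l r w v := by
  simp only [ip, mul_comm]

lemma ip_add_left : ip l r (u + v) w = ip l r u w + ip l r v w := by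
  simp only [ip, Polynomial.eval_add, add_mul]
  exact intervalIntegral.integral_add (ip_intervalIntegrable _ _) (ip_intervalIntegrable _ _)

lemma ip_sub_left : ip l r (u - v) w = ip l r u w - ip l r v w := by
  simp only [ip, Polynomial.eval_sub, sub_mul]
  exact intervalIntegral.integral_sub (ip_intervalIntegrable _ _) (ip_intervalIntegrable _ _)

lemma ip_smul_left : ip l r (c • v) w = c * ip l r v w := by
  simp only [ip, Polynomial.eval_smul, smul_eq_mul, mul_assoc]
  exact intervalIntegral.integral_const_mul _ _

lemma ip_add_right : ip l r u (v + w) = ip l r u v + ip l r u w := by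
  rw [ip_comm, ip_add_left, ip_comm v, ip_comm w]

lemma ip_sub_right : ip l r u (v - w) = ip l r u v - ip l r u w := by
  rw [ip_comm, ip_sub_left, ip_comm v, ip_comm w]

lemma ip_smul_right : ip l r v (c • w) = c * ip l r v w := by
  rw [ip_comm, ip_smul_left, ip_comm]

lemma ip_zero_left : ip l r 0 w = 0 := by simp [ip]

lemma ip_zero_right : ip l r w 0 = 0 := by simp [ip]

lemma ip_neg_left : ip l r (-v) w = -ip l r v w := by
  rw [← zero_sub, ip_sub_left, ip_zero_left, zero_sub]

lemma ip_neg_right : ip l r v (-w) = -ip l r v w := by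
  rw [ip_comm, ip_neg_left, ip_comm]

lemma ip_mul_left : ip l r (u * v) w = ip l r u (v * w) := by
  simp only [ip, Polynomial.eval_mul, mul_assoc]

lemma ip_self_nonneg (h : l ≤ r) : 0 ≤ ip l r w w :=
  intervalIntegral.integral_nonneg h fun _ _ => mul_self_nonneg _

lemma ip_cauchy_schwarz (h : l ≤ r) : (ip l r v w) ^ 2 ≤ ip l r v v * ip l r w w := by
  have key : ∀ t : ℝ, 0 ≤ ip l r v v * (t * t) + (2 * ip l r v w) * t + ip l r w w := by
    intro t
    have := ip_self_nonneg (t • v + w) h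
    simp only [ip_add_left, ip_add_right, ip_smul_left, ip_smul_right] at this
    rw [ip_comm w v] at this
    nlinarith
  have := discrim_le_zero key
  rw [discrim] at this
  nlinarith

/-- Integration by parts for polynomials. -/
lemma ip_derivative_add : ip l r (Polynomial.derivative v) w + ip l r v (Polynomial.derivative w) =
    v.eval r * w.eval r - v.eval l * w.eval l := by
  rw [ip, ip, ← intervalIntegral.integral_add (ip_intervalIntegrable _ _)
    (ip_intervalIntegrable _ _)]
  exact intervalIntegral.integral_eq_sub_of_hasDerivAt
    (f := fun x => v.eval x * w.eval x)
    (fun x _ => (v.hasDerivAt x).mul (w.hasDerivAt x))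
    ((ip_intervalIntegrable _ _).add (ip_intervalIntegrable _ _))

lemma ip_self_eq_zero (h : l < r) (h0 : ip l r w w = 0) : w = 0 := by
  by_contra hw
  have hfin : {x | w.eval x = 0}.Finite := by
    have := w.rootSet_finite ℝ
    refine this.subset fun x hx => ?_
    rw [Polynomial.mem_rootSet]
    exact ⟨hw, by simpa using hx⟩
  obtain ⟨x, hx, hx'⟩ : ∃ x ∈ Ioo l r, w.eval x ≠ 0 := by
    by_contra hcon
    push Not at hcon
    exact (Ioo_infinite h) (hfin.subset fun x hx => hcon x hx)
  have : 0 < ip l r w w := by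
    refine intervalIntegral.integral_pos h (w.continuous.mul w.continuous).continuousOn
      (fun _ _ => mul_self_nonneg _) ⟨x, Ioo_subset_Icc_self hx, ?_⟩
    exact mul_self_pos.2 hx'
  exact this.ne' h0

lemma eval_affine (y : ℝ) :
    (w.comp (Polynomial.C c * Polynomial.X + Polynomial.C l)).eval y = w.eval (c * y + l) := by
  simp

/-- Reduction to the unit interval: the constants below depend on the degree only, and the powers of
`r - l` become explicit. -/
lemma ip_scale (h : l < r) : ip l r v w = (r - l) *
    ip 0 1 (v.comp (Polynomial.C (r - l) * Polynomial.X + Polynomial.C l))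
      (w.comp (Polynomial.C (r - l) * Polynomial.X + Polynomial.C l)) := by
  simp only [ip, eval_affine]
  have := intervalIntegral.integral_comp_mul_add (a := 0) (b := 1)
    (fun x => v.eval x * w.eval x) (sub_pos.2 h).ne' l
  rw [this]
  have h0 : r - l ≠ 0 := (sub_pos.2 h).ne'
  simp [mul_inv_cancel_left₀ h0]

end ip

lemma comp_affine_mem {n : ℕ} {w : ℝ[X]} (c d : ℝ) (hw : w ∈ Polynomial.degreeLT ℝ n) :
    w.comp (Polynomial.C c * Polynomial.X + Polynomial.C d) ∈ Polynomial.degreeLT ℝ n := by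
  rw [Polynomial.mem_degreeLT] at *
  rcases n with _ | m
  · have : w = 0 := by
      by_contra h
      rw [Polynomial.degree_eq_natDegree h] at hw
      exact absurd hw (by simp)
    simp [this]
  · rw [← Polynomial.mem_degreeLT, Polynomial.degreeLT_succ_eq_degreeLE, Polynomial.mem_degreeLE,
      ← Polynomial.natDegree_le_iff_degree_le] at hw ⊢
    refine Polynomial.natDegree_comp_le.trans ?_
    calc w.natDegree * (Polynomial.C c * Polynomial.X + Polynomial.C d).natDegree
        ≤ w.natDegree * 1 := Nat.mul_le_mul_left _ Polynomial.natDegree_linear_le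
      _ ≤ m := by simpa using hw

/-- Riesz representation on a space of polynomials. -/
lemma exists_riesz {l r : ℝ} (h : l < r) (n : ℕ) (F : ℝ[X] →ₗ[ℝ] ℝ) :
    ∃ R ∈ Polynomial.degreeLT ℝ n, ∀ v ∈ Polynomial.degreeLT ℝ n, ip l r R v = F v := by
  have : FiniteDimensional ℝ (Polynomial.degreeLT ℝ n) :=
    LinearEquiv.finiteDimensional (Polynomial.degreeLTEquiv ℝ n).symm
  let B : Polynomial.degreeLT ℝ n →ₗ[ℝ] Module.Dual ℝ (Polynomial.degreeLT ℝ n) :=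
    LinearMap.mk₂ ℝ (fun v w => ip l r v w) (fun _ _ _ => ip_add_left _ _ _)
      (fun _ _ _ => ip_smul_left _ _ _) (fun _ _ _ => ip_add_right _ _ _)
      (fun _ _ _ => ip_smul_right _ _ _)
  have hB : Function.Injective B := by
    rw [← LinearMap.ker_eq_bot, LinearMap.ker_eq_bot']
    intro m hm
    have := congrArg (fun f => f m) hm
    exact Subtype.ext (ip_self_eq_zero _ h (by simpa [B] using this))
  have hs : Function.Surjective B :=
    (LinearMap.injective_iff_surjective_of_finrank_eq_finrank
      (Subspace.dual_finrank_eq).symm).1 hB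
  obtain ⟨R, hR⟩ := hs (F ∘ₗ (Polynomial.degreeLT ℝ n).subtype)
  exact ⟨R, R.2, fun v hv => by simpa [B] using congrArg (fun f => f ⟨v, hv⟩) hR⟩

/-- A coefficient is a linear functional, hence the product with a Riesz polynomial, and
Cauchy–Schwarz applies. This serves as an explicit form of the equivalence of norms on polynomials
of bounded degree. -/
lemma exists_coeff_bound (n : ℕ) : ∃ C : ℝ, 0 < C ∧ ∀ w ∈ Polynomial.degreeLT ℝ n, ∀ j,
    (w.coeff j) ^ 2 ≤ C * ip 0 1 w w := by
  choose R hR hR' using fun j => exists_riesz (zero_lt_one' ℝ) n (Polynomial.lcoeff ℝ j)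
  refine ⟨1 + ∑ j ∈ Finset.range n, ip 0 1 (R j) (R j), ?_, fun w hw j => ?_⟩
  · have : 0 ≤ ∑ j ∈ Finset.range n, ip 0 1 (R j) (R j) :=
      Finset.sum_nonneg fun j _ => ip_self_nonneg _ zero_le_one
    linarith
  · have h0 : 0 ≤ ip 0 1 w w := ip_self_nonneg _ zero_le_one
    by_cases hj : j < n
    · have h1 : w.coeff j = ip 0 1 (R j) w := by rw [hR' j w hw]; rfl
      have h2 := ip_cauchy_schwarz (R j) w (zero_le_one' ℝ)
      have h3 : ip 0 1 (R j) (R j) ≤ ∑ j ∈ Finset.range n, ip 0 1 (R j) (R j) :=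
        Finset.single_le_sum (f := fun j => ip 0 1 (R j) (R j))
          (fun j _ => ip_self_nonneg _ zero_le_one) (Finset.mem_range.2 hj)
      rw [h1]
      nlinarith
    · have : w.coeff j = 0 := by
        apply Polynomial.coeff_eq_zero_of_degree_lt
        rw [Polynomial.mem_degreeLT] at hw
        exact hw.trans_le (by exact_mod_cast not_lt.1 hj)
      rw [this]
      have : 0 ≤ ∑ j ∈ Finset.range n, ip 0 1 (R j) (R j) :=
        Finset.sum_nonneg fun j _ => ip_self_nonneg _ zero_le_one
      simpa using mul_nonneg (by linarith) h0

lemma eval_eq_sum_of_mem {n : ℕ} {w : ℝ[X]} (hw : w ∈ Polynomial.degreeLT ℝ n) (x : ℝ) :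
    w.eval x = ∑ j ∈ Finset.range n, w.coeff j * x ^ j := by
  rcases n with _ | m
  · have : w = 0 := by
      rw [Polynomial.mem_degreeLT] at hw
      by_contra h
      rw [Polynomial.degree_eq_natDegree h] at hw
      exact absurd hw (by simp)
    simp [this]
  · refine Polynomial.eval_eq_sum_range' ?_ x
    rw [Polynomial.degreeLT_succ_eq_degreeLE, Polynomial.mem_degreeLE,
      ← Polynomial.natDegree_le_iff_degree_le] at hw
    exact Nat.lt_succ_of_le hw

/-- Inverse estimate for point values. -/
lemma exists_eval_bound (n : ℕ) : ∃ C : ℝ, 0 < C ∧ ∀ l r : ℝ, l < r →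
    ∀ w ∈ Polynomial.degreeLT ℝ n, ∀ x ∈ Icc l r, (w.eval x) ^ 2 ≤ C / (r - l) * ip l r w w := by
  obtain ⟨C, hC, hCw⟩ := exists_coeff_bound n
  -- The natural constant is `n ^ 2 * C`; `n + 1` keeps it positive for `n = 0`.
  refine ⟨(n + 1) ^ 2 * C, by positivity, fun l r h w hw x hx => ?_⟩
  have hη : 0 < r - l := sub_pos.2 h
  set v := w.comp (Polynomial.C (r - l) * Polynomial.X + Polynomial.C l) with hv
  have hvm : v ∈ Polynomial.degreeLT ℝ n := comp_affine_mem _ _ hw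
  set y := (x - l) / (r - l) with hy
  have hxy : w.eval x = v.eval y := by
    rw [hv, eval_affine, hy]
    congr 1
    field_simp
    ring
  have hy0 : 0 ≤ y := div_nonneg (by linarith [hx.1]) hη.le
  have hy1 : y ≤ 1 := (div_le_one hη).2 (by linarith [hx.2])
  have hN : 0 ≤ ip 0 1 v v := ip_self_nonneg _ zero_le_one
  rw [ip_scale w w h, ← hv, hxy, eval_eq_sum_of_mem hvm]
  have hb : |∑ j ∈ Finset.range n, v.coeff j * y ^ j| ≤ n * Real.sqrt (C * ip 0 1 v v) := by
    refine (Finset.abs_sum_le_sum_abs _ _).trans ?_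
    refine (Finset.sum_le_card_nsmul _ _ (Real.sqrt (C * ip 0 1 v v)) fun j _ => ?_).trans
      (by simp)
    rw [abs_mul, abs_of_nonneg (pow_nonneg hy0 j)]
    calc |v.coeff j| * y ^ j ≤ |v.coeff j| * 1 := by
          gcongr
          exact pow_le_one₀ hy0 hy1
      _ ≤ _ := by
          rw [mul_one]
          exact Real.abs_le_sqrt (hCw v hvm j)
  have h2 : (∑ j ∈ Finset.range n, v.coeff j * y ^ j) ^ 2 ≤ (n : ℝ) ^ 2 * (C * ip 0 1 v v) := by
    rw [← sq_abs]
    calc _ ≤ (n * Real.sqrt (C * ip 0 1 v v)) ^ 2 := by gcongr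
      _ = _ := by rw [mul_pow, Real.sq_sqrt (by positivity)]
  refine h2.trans ?_
  have : (n : ℝ) ^ 2 ≤ (n + 1) ^ 2 := by gcongr; linarith
  have e : ((n : ℝ) + 1) ^ 2 * C / (r - l) * ((r - l) * ip 0 1 v v) =
      (n + 1) ^ 2 * (C * ip 0 1 v v) := by field_simp
  rw [e]
  gcongr

lemma ip_self_le_of_bound {l r : ℝ} (h : l ≤ r) (w : ℝ[X]) {B : ℝ}
    (hB : ∀ x ∈ Icc l r, (w.eval x) ^ 2 ≤ B) : ip l r w w ≤ B * (r - l) := by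
  have := intervalIntegral.integral_mono_on (μ := volume) (f := fun x => w.eval x * w.eval x)
    (g := fun _ => B) h (ip_intervalIntegrable _ _) (by simp)
    (fun x hx => by simpa [sq] using hB x hx)
  simpa [ip, mul_comm] using this

/-- Inverse estimate for the derivative. -/
lemma exists_derivative_bound (n : ℕ) : ∃ C : ℝ, 0 < C ∧ ∀ l r : ℝ, l < r →
    ∀ w ∈ Polynomial.degreeLT ℝ n, ip l r (Polynomial.derivative w) (Polynomial.derivative w) ≤
      C / (r - l) ^ 2 * ip l r w w := by
  obtain ⟨C, hC, hCw⟩ := exists_coeff_bound n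
  refine ⟨(n + 1) ^ 4 * C, by positivity, fun l r h w hw => ?_⟩
  have hη : 0 < r - l := sub_pos.2 h
  set A : ℝ[X] := Polynomial.C (r - l) * Polynomial.X + Polynomial.C l with hA
  set v := w.comp A with hv
  have hvm : v ∈ Polynomial.degreeLT ℝ n := comp_affine_mem _ _ hw
  have hd : Polynomial.derivative v = (r - l) • (Polynomial.derivative w).comp A := by
    rw [hv, Polynomial.derivative_comp, hA]
    simp [Polynomial.smul_eq_C_mul]
  have hN : 0 ≤ ip 0 1 v v := ip_self_nonneg _ zero_le_one
  have hdv : Polynomial.derivative v ∈ Polynomial.degreeLT ℝ n := by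
    rw [Polynomial.mem_degreeLT] at hvm ⊢
    exact (Polynomial.degree_derivative_le).trans_lt hvm
  have hb : ip 0 1 (Polynomial.derivative v) (Polynomial.derivative v) ≤
      (n + 1) ^ 4 * C * ip 0 1 v v := by
    have := ip_self_le_of_bound (zero_le_one' ℝ) (Polynomial.derivative v)
      (B := (n + 1) ^ 4 * C * ip 0 1 v v) ?_
    · simpa using this
    intro y hy
    rw [eval_eq_sum_of_mem hdv]
    have hb : |∑ j ∈ Finset.range n, (Polynomial.derivative v).coeff j * y ^ j| ≤
        n * (n * Real.sqrt (C * ip 0 1 v v)) := by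
      refine (Finset.abs_sum_le_sum_abs _ _).trans ?_
      refine (Finset.sum_le_card_nsmul _ _ (n * Real.sqrt (C * ip 0 1 v v)) fun j hj => ?_).trans
        (by simp)
      rw [abs_mul, abs_of_nonneg (pow_nonneg hy.1 j), Polynomial.coeff_derivative, abs_mul]
      have hj' : (j : ℝ) + 1 ≤ n := by exact_mod_cast Finset.mem_range.1 hj
      calc |v.coeff (j + 1)| * |(j : ℝ) + 1| * y ^ j ≤ |v.coeff (j + 1)| * n * 1 := by
            have h1 : |(j : ℝ) + 1| ≤ n := by
              rw [abs_of_nonneg (by positivity)]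
              exact hj'
            have h2 : y ^ j ≤ 1 := pow_le_one₀ hy.1 hy.2
            have h3 : 0 ≤ y ^ j := pow_nonneg hy.1 j
            gcongr
        _ ≤ _ := by
            rw [mul_one, mul_comm]
            gcongr
            exact Real.abs_le_sqrt (hCw v hvm _)
    rw [← sq_abs]
    calc _ ≤ (n * (n * Real.sqrt (C * ip 0 1 v v))) ^ 2 := by gcongr
      _ = (n : ℝ) ^ 4 * (C * ip 0 1 v v) := by
        rw [mul_pow, mul_pow, Real.sq_sqrt (by positivity)]
        ring
      _ ≤ (n + 1 : ℝ) ^ 4 * (C * ip 0 1 v v) := by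
        gcongr
        linarith
      _ = _ := by ring
  rw [ip_scale w w h, ip_scale _ _ h, ← hA, ← hv]
  rw [hd, ip_smul_left, ip_smul_right] at hb
  rw [div_mul_eq_mul_div, le_div_iff₀ (by positivity)]
  nlinarith

/-! ### The Legendre polynomial of an interval -/

lemma mul_X_sub_C_mem {n : ℕ} {w : ℝ[X]} (c d : ℝ) (hw : w ∈ Polynomial.degreeLT ℝ n) :
    (Polynomial.C c + (Polynomial.X - Polynomial.C d)) * w ∈ Polynomial.degreeLT ℝ (n + 1) := by
  rw [Polynomial.mem_degreeLT] at *
  by_cases h0 : w = 0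
  · simp [h0]
  have h1 : (Polynomial.C c + (Polynomial.X - Polynomial.C d)).degree ≤ 1 := by
    have e : Polynomial.C c + (Polynomial.X - Polynomial.C d) =
        Polynomial.C (1 : ℝ) * Polynomial.X + Polynomial.C (c - d) := by
      simp; ring
    rw [e]
    exact Polynomial.degree_linear_le
  rw [Polynomial.degree_mul, Polynomial.degree_eq_natDegree h0] at *
  have h2 : w.natDegree < n := by exact_mod_cast hw
  calc _ ≤ (1 : WithBot ℕ) + (w.natDegree : WithBot ℕ) := by gcongr
    _ < _ := by
      norm_cast
      omega

lemma divByMonic_mem {k : ℕ} {R : ℝ[X]} {a : ℝ} (hR : R ∈ Polynomial.degreeLT ℝ (k + 1))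
    (h0 : R.eval a = 0) : ∃ μ ∈ Polynomial.degreeLT ℝ k,
      R = (Polynomial.X - Polynomial.C a) * μ := by
  obtain ⟨μ, hμ⟩ := Polynomial.dvd_iff_isRoot.2 h0
  refine ⟨μ, ?_, hμ⟩
  rw [Polynomial.mem_degreeLT] at *
  by_cases h : μ = 0
  · simp [h]
  rw [hμ, Polynomial.degree_mul, Polynomial.degree_X_sub_C, Polynomial.degree_eq_natDegree h] at hR
  rw [Polynomial.degree_eq_natDegree h]
  norm_cast at *
  omega

/-- The polynomial R representing the coefficient of index k is orthogonal to lower degrees. It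
cannot vanish at an end point a: otherwise R = (X - a) μ, and testing with μ would make the integral
of (x - a) μ² vanish although x - a has one sign on the interval. So R can be normalized at 1, and
its value at 0 may be divided by. -/
lemma exists_refLeg (k : ℕ) : ∃ Λ ∈ Polynomial.degreeLT ℝ (k + 1),
    (∀ v ∈ Polynomial.degreeLT ℝ k, ip 0 1 Λ v = 0) ∧ Λ.eval 1 = 1 ∧ Λ.eval 0 ≠ 0 := by
  obtain ⟨R, hR, hRv⟩ := exists_riesz (zero_lt_one' ℝ) (k + 1) (Polynomial.lcoeff ℝ k)
  have horth : ∀ v ∈ Polynomial.degreeLT ℝ k, ip 0 1 R v = 0 := by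
    intro v hv
    rw [hRv v (Polynomial.degreeLT_mono (Nat.le_succ k) hv)]
    rw [Polynomial.mem_degreeLT] at hv
    exact Polynomial.coeff_eq_zero_of_degree_lt hv
  have hR0 : R ≠ 0 := by
    intro h
    have := hRv (Polynomial.X ^ k) (by
      rw [Polynomial.mem_degreeLT, Polynomial.degree_X_pow]
      norm_cast
      omega)
    simp [h, ip_zero_left] at this
  have key : ∀ a : ℝ, (∀ x ∈ Ioo (0 : ℝ) 1, x - a ≠ 0) → (∀ x ∈ Ioo (0 : ℝ) 1, 0 < x - a) ∨
      (∀ x ∈ Ioo (0 : ℝ) 1, x - a < 0) → R.eval a ≠ 0 := by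
    intro a _ hs h0
    obtain ⟨μ, hμ, e⟩ := divByMonic_mem hR h0
    have hμ0 : μ ≠ 0 := by
      rintro rfl
      exact hR0 (by simpa using e)
    have h1 := horth μ hμ
    have hfin : {x | μ.eval x = 0}.Finite := by
      refine (μ.rootSet_finite ℝ).subset fun x hx => ?_
      rw [Polynomial.mem_rootSet]
      exact ⟨hμ0, by simpa using hx⟩
    have hcont : Continuous fun x : ℝ => (x - a) * (μ.eval x * μ.eval x) := by fun_prop
    have hI : ip 0 1 R μ = ∫ x in (0 : ℝ)..1, (x - a) * (μ.eval x * μ.eval x) := by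
      simp only [ip, e, Polynomial.eval_mul, mul_assoc]
      simp
    rw [hI] at h1
    obtain ⟨x, hx, hx'⟩ : ∃ x ∈ Ioo (0 : ℝ) 1, μ.eval x ≠ 0 := by
      by_contra hcon
      push Not at hcon
      exact (Ioo_infinite zero_lt_one) (hfin.subset fun x hx => hcon x hx)
    rcases hs with hs | hs
    · have : 0 < ∫ x in (0 : ℝ)..1, (x - a) * (μ.eval x * μ.eval x) := by
        refine intervalIntegral.integral_pos zero_lt_one hcont.continuousOn
          (fun y hy => ?_) ⟨x, Ioo_subset_Icc_self hx, mul_pos (hs x hx) (mul_self_pos.2 hx')⟩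
        refine mul_nonneg ?_ (mul_self_nonneg _)
        have hcl : closure (Ioo (0 : ℝ) 1) ⊆ {y | 0 ≤ y - a} :=
          closure_minimal (fun z hz => (hs z hz).le)
            (isClosed_le continuous_const (continuous_id.sub continuous_const))
        rw [closure_Ioo zero_ne_one] at hcl
        exact hcl (Ioc_subset_Icc_self hy)
      exact this.ne' h1
    · have : 0 < ∫ x in (0 : ℝ)..1, -((x - a) * (μ.eval x * μ.eval x)) := by
        refine intervalIntegral.integral_pos zero_lt_one hcont.neg.continuousOn
          (fun y hy => ?_) ⟨x, Ioo_subset_Icc_self hx, neg_pos.2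
            (mul_neg_of_neg_of_pos (hs x hx) (mul_self_pos.2 hx'))⟩
        have hcl : closure (Ioo (0 : ℝ) 1) ⊆ {y | y - a ≤ 0} :=
          closure_minimal (fun z hz => (hs z hz).le)
            (isClosed_le (continuous_id.sub continuous_const) continuous_const)
        rw [closure_Ioo zero_ne_one] at hcl
        have h2 : y - a ≤ 0 := hcl (Ioc_subset_Icc_self hy)
        nlinarith [mul_self_nonneg (μ.eval y)]
      rw [intervalIntegral.integral_neg, h1] at this
      simp at this
  have hR1 : R.eval 1 ≠ 0 := key 1 (fun x hx => (sub_neg.2 hx.2).ne)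
    (Or.inr fun x hx => sub_neg.2 hx.2)
  have hR00 : R.eval 0 ≠ 0 := key 0 (fun x hx => by simpa using hx.1.ne')
    (Or.inl fun x hx => by simpa using hx.1)
  refine ⟨(R.eval 1)⁻¹ • R, Submodule.smul_mem _ _ hR, fun v hv => ?_, ?_, ?_⟩
  · rw [ip_smul_left, horth v hv, mul_zero]
  · simp [hR1]
  · simp [hR1, hR00]

/-- The Legendre polynomial of degree `k` on `(0, 1)`, with value `1` at `1`. -/
def refLeg (k : ℕ) : ℝ[X] := (exists_refLeg k).choose

/-- The value of the Legendre polynomial at the left end point. -/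
def legS (k : ℕ) : ℝ := (refLeg k).eval 0

/-- The squared norm of the Legendre polynomial on `(0, 1)`. -/
def legθ (k : ℕ) : ℝ := ip 0 1 (refLeg k) (refLeg k)

/-- The Legendre polynomial of degree `k` on `(l, r)`, with value `1` at `r`. -/
def leg (k : ℕ) (l r : ℝ) : ℝ[X] :=
  (refLeg k).comp (Polynomial.C (r - l)⁻¹ * Polynomial.X + Polynomial.C (-(r - l)⁻¹ * l))

lemma legS_ne (k : ℕ) : legS k ≠ 0 := (exists_refLeg k).choose_spec.2.2.2

lemma legθ_pos (k : ℕ) : 0 < legθ k := by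
  refine (ip_self_nonneg _ zero_le_one).lt_of_ne' fun h => ?_
  have := ip_self_eq_zero _ zero_lt_one h
  have h1 := (exists_refLeg k).choose_spec.2.2.1
  rw [refLeg] at this
  rw [this] at h1
  simp at h1

section leg

variable (k : ℕ) {l r : ℝ}

lemma leg_mem : leg k l r ∈ Polynomial.degreeLT ℝ (k + 1) :=
  comp_affine_mem _ _ (exists_refLeg k).choose_spec.1

lemma leg_left : (leg k l r).eval l = legS k := by
  rw [leg, eval_affine, legS]
  congr 1
  ring

variable (h : l < r)
include h

lemma unscale_scale (w : ℝ[X]) :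
    (w.comp (Polynomial.C (r - l)⁻¹ * Polynomial.X + Polynomial.C (-(r - l)⁻¹ * l))).comp
      (Polynomial.C (r - l) * Polynomial.X + Polynomial.C l) = w := by
  rw [Polynomial.comp_assoc]
  have h0 : r - l ≠ 0 := (sub_pos.2 h).ne'
  have : (Polynomial.C (r - l)⁻¹ * Polynomial.X + Polynomial.C (-(r - l)⁻¹ * l)).comp
      (Polynomial.C (r - l) * Polynomial.X + Polynomial.C l) = (Polynomial.X : ℝ[X]) := by
    simp only [Polynomial.add_comp, Polynomial.mul_comp, Polynomial.C_comp, Polynomial.X_comp,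
      mul_add, ← mul_assoc, ← Polynomial.C_mul, inv_mul_cancel₀ h0]
    rw [add_assoc, ← Polynomial.C_add]
    simp
  rw [this, Polynomial.comp_X]

lemma leg_right : (leg k l r).eval r = 1 := by
  have h0 : r - l ≠ 0 := (sub_pos.2 h).ne'
  have e : (r - l)⁻¹ * r + -(r - l)⁻¹ * l = 1 := by field_simp; ring
  rw [leg, eval_affine, e]
  exact (exists_refLeg k).choose_spec.2.2.1

lemma leg_orth {v : ℝ[X]} (hv : v ∈ Polynomial.degreeLT ℝ k) : ip l r (leg k l r) v = 0 := by
  rw [ip_scale _ _ h, leg, unscale_scale h, refLeg,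
    (exists_refLeg k).choose_spec.2.1 _ (comp_affine_mem _ _ hv), mul_zero]

lemma leg_self : ip l r (leg k l r) (leg k l r) = legθ k * (r - l) := by
  rw [ip_scale _ _ h, leg, unscale_scale h, legθ, mul_comm]

/-- The Legendre component carries the whole top coefficient. The number (L,w)/(θη) is therefore the
measure of the top coefficient used throughout. -/
lemma sub_leg_mem {w : ℝ[X]} (hw : w ∈ Polynomial.degreeLT ℝ (k + 1)) :
    w - (ip l r (leg k l r) w / (legθ k * (r - l))) • leg k l r ∈ Polynomial.degreeLT ℝ k := by
  have hpos : 0 < legθ k * (r - l) := mul_pos (legθ_pos k) (sub_pos.2 h)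
  have low : ∀ v ∈ Polynomial.degreeLT ℝ (k + 1), v.coeff k = 0 →
      v ∈ Polynomial.degreeLT ℝ k := by
    intro v hv hc
    rw [Polynomial.mem_degreeLT, Polynomial.degree_lt_iff_coeff_zero] at *
    intro m hm
    rcases hm.eq_or_lt with rfl | hm
    · exact hc
    · exact hv m hm
  have hLc : (leg k l r).coeff k ≠ 0 := fun hc => by
    have := leg_orth k h (low _ (leg_mem k) hc)
    rw [leg_self k h] at this
    exact hpos.ne' this
  set c := w.coeff k / (leg k l r).coeff k with hc
  have hmem : w - c • leg k l r ∈ Polynomial.degreeLT ℝ k := by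
    refine low _ (Submodule.sub_mem _ hw (Submodule.smul_mem _ _ (leg_mem k))) ?_
    simp [hc, hLc]
  have h1 := leg_orth k h hmem
  rw [ip_sub_right, ip_smul_right, leg_self k h, sub_eq_zero] at h1
  rw [h1, mul_div_assoc, div_self hpos.ne', mul_one]
  exact hmem

end leg

lemma derivative_mem_degreeLT {k : ℕ} {w : ℝ[X]} (hw : w ∈ Polynomial.degreeLT ℝ (k + 1)) :
    Polynomial.derivative w ∈ Polynomial.degreeLT ℝ k := by
  rw [Polynomial.mem_degreeLT, Polynomial.degree_lt_iff_coeff_zero] at *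
  intro m hm
  rw [Polynomial.coeff_derivative, hw (m + 1) (by omega), zero_mul]

/-- This makes Legendre corrections free of charge: they change end point values but no term with a
differentiated test function. -/
lemma ip_leg_derivative {k : ℕ} {l r : ℝ} (h : l < r) {w : ℝ[X]}
    (hw : w ∈ Polynomial.degreeLT ℝ (k + 1)) :
    ip l r (leg k l r) (Polynomial.derivative w) = 0 :=
  leg_orth k h (derivative_mem_degreeLT hw)

/-- An antiderivative of a polynomial. -/
lemma exists_antiderivative {n : ℕ} {R : ℝ[X]} (hR : R ∈ Polynomial.degreeLT ℝ n) :
    ∃ A ∈ Polynomial.degreeLT ℝ (n + 1), Polynomial.derivative A = R := by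
  refine ⟨∑ j ∈ Finset.range n, Polynomial.monomial (j + 1) (R.coeff j / (j + 1)),
    Submodule.sum_mem _ fun j hj => ?_, ?_⟩
  · rw [Polynomial.mem_degreeLT]
    refine (Polynomial.degree_monomial_le _ _).trans_lt ?_
    norm_cast
    have := Finset.mem_range.1 hj
    omega
  · rw [Polynomial.derivative_sum]
    ext m
    simp only [Polynomial.derivative_monomial, Polynomial.finsetSum_coeff,
      Polynomial.coeff_monomial, Nat.add_sub_cancel]
    rw [Polynomial.mem_degreeLT, Polynomial.degree_lt_iff_coeff_zero] at hR
    by_cases hm : m < n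
    · rw [Finset.sum_eq_single m]
      · have : (m : ℝ) + 1 ≠ 0 := by positivity
        simp [this]
      · intro b _ hb
        simp [hb]
      · intro h
        exact absurd (Finset.mem_range.2 hm) h
    · rw [hR m (not_lt.1 hm)]
      refine Finset.sum_eq_zero fun j hj => ?_
      have := Finset.mem_range.1 hj
      rw [if_neg (by omega)]

lemma one_mem_degreeLT {k : ℕ} (hk : 0 < k) : (1 : ℝ[X]) ∈ Polynomial.degreeLT ℝ k := by
  rw [Polynomial.mem_degreeLT, Polynomial.degree_one]
  exact_mod_cast hk

/-- A test polynomial that represents minus the value at the left end point. -/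
lemma exists_leftTest {k : ℕ} (hk : 0 < k) : ∃ C : ℝ, 0 < C ∧ ∀ l r : ℝ, l < r →
    ∃ v ∈ Polynomial.degreeLT ℝ (k + 1), v.eval r = 0 ∧ v.eval l = 1 ∧
      ip l r v v ≤ C * (r - l) ∧ ∀ w ∈ Polynomial.degreeLT ℝ (k + 1),
        ip l r w (Polynomial.derivative v) =
          -w.eval l + legS k * (ip l r (leg k l r) w / (legθ k * (r - l))) := by
  -- R represents evaluation at 0 in degree less than k. Minus its antiderivative, normalized to
  -- vanish at 1, is the required test polynomial on the unit interval; its value 1 at 0 is the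
  -- representation tested with the constant 1.
  obtain ⟨R, hR, hRv⟩ := exists_riesz (zero_lt_one' ℝ) k (Polynomial.leval 0)
  obtain ⟨A, hA, hAR⟩ := exists_antiderivative hR
  set V : ℝ[X] := (A.eval 1) • 1 - A with hV
  have hVm : V ∈ Polynomial.degreeLT ℝ (k + 1) :=
    Submodule.sub_mem _ (Submodule.smul_mem _ _ (one_mem_degreeLT (Nat.succ_pos k))) hA
  have hV' : Polynomial.derivative V = -R := by
    simp [hV, hAR]
  have hV1 : V.eval 1 = 0 := by simp [hV]
  have hV0 : V.eval 0 = 1 := by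
    have h1 := ip_derivative_add (l := 0) (r := 1) V 1
    have h2 := hRv 1 (one_mem_degreeLT hk)
    rw [hV', Polynomial.derivative_one, ip_zero_right, ip_neg_left, h2, hV1] at h1
    simp [Polynomial.leval] at h1
    linarith
  refine ⟨ip 0 1 V V + 1, by linarith [ip_self_nonneg V (zero_le_one' ℝ)], fun l r h => ?_⟩
  have h0 : r - l ≠ 0 := (sub_pos.2 h).ne'
  set v := V.comp (Polynomial.C (r - l)⁻¹ * Polynomial.X + Polynomial.C (-(r - l)⁻¹ * l)) with hv
  have hvm : v ∈ Polynomial.degreeLT ℝ (k + 1) := comp_affine_mem _ _ hVm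
  have hlow : ∀ w ∈ Polynomial.degreeLT ℝ k, ip l r w (Polynomial.derivative v) = -w.eval l := by
    intro w hw
    have hd : Polynomial.derivative v = (r - l)⁻¹ • (Polynomial.derivative V).comp
        (Polynomial.C (r - l)⁻¹ * Polynomial.X + Polynomial.C (-(r - l)⁻¹ * l)) := by
      rw [hv, Polynomial.derivative_comp]
      simp [Polynomial.smul_eq_C_mul]
    rw [hd, ip_smul_right, ip_scale _ _ h, unscale_scale h, hV', ip_neg_right, ip_comm,
      hRv _ (comp_affine_mem _ _ hw), inv_mul_cancel_left₀ h0]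
    simp [Polynomial.leval]
  refine ⟨v, hvm, ?_, ?_, ?_, fun w hw => ?_⟩
  · have e : (r - l)⁻¹ * r + -(r - l)⁻¹ * l = 1 := by field_simp; ring
    rw [hv, eval_affine, e, hV1]
  · have e : (r - l)⁻¹ * l + -(r - l)⁻¹ * l = 0 := by ring
    rw [hv, eval_affine, e, hV0]
  · rw [ip_scale _ _ h, hv, unscale_scale h, mul_comm]
    have := sub_pos.2 h
    gcongr
    linarith
  -- On degree less than k the functional is -w(l) exactly. The Legendre part of w does not see the
  -- derivative of v, so its contribution s (L,w)/(θη) to w(l) has to be added back.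
  · have h1 := hlow _ (sub_leg_mem k h hw)
    rw [ip_sub_left, ip_smul_left, ip_leg_derivative h hvm] at h1
    simp only [Polynomial.eval_sub, Polynomial.eval_smul, leg_left k, smul_eq_mul] at h1
    linarith

/-- The `L²` projection of a polynomial onto the polynomials of degree at most `k`. -/
lemma exists_polyProj {l r : ℝ} (h : l < r) (n : ℕ) (g : ℝ[X]) :
    ∃ R ∈ Polynomial.degreeLT ℝ n, (∀ v ∈ Polynomial.degreeLT ℝ n, ip l r R v = ip l r g v) ∧
      ip l r R R ≤ ip l r g g := by
  obtain ⟨R, hR, hRv⟩ := exists_riesz h n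
    (LinearMap.mk₂ ℝ (fun v w => ip l r v w) (fun _ _ _ => ip_add_left _ _ _)
      (fun _ _ _ => ip_smul_left _ _ _) (fun _ _ _ => ip_add_right _ _ _)
      (fun _ _ _ => ip_smul_right _ _ _) g)
  have hRv' : ∀ v ∈ Polynomial.degreeLT ℝ n, ip l r R v = ip l r g v := fun v hv => by
    simpa using hRv v hv
  refine ⟨R, hR, hRv', ?_⟩
  have h1 := ip_self_nonneg (g - R) h.le
  rw [ip_sub_left, ip_sub_right, ip_sub_right] at h1
  have h2 := hRv' R hR
  have h3 := ip_comm (l := l) (r := r) g R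
  linarith

/-- The projection of the product of a polynomial with an affine weight. -/
lemma exists_weighted (k : ℕ) : ∃ C : ℝ, 0 < C ∧ ∀ l r : ℝ, l < r → ∀ c : ℝ, 0 ≤ c →
    ∀ w ∈ Polynomial.degreeLT ℝ (k + 1), ∃ T ∈ Polynomial.degreeLT ℝ (k + 1),
      (∀ v ∈ Polynomial.degreeLT ℝ (k + 1), ip l r T v =
        ip l r ((Polynomial.C c + (Polynomial.X - Polynomial.C l)) * w) v) ∧
      (T.eval l - c * w.eval l) ^ 2 ≤ C * (ip l r (leg k l r) w) ^ 2 ∧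
      (T.eval r - (c + (r - l)) * w.eval r) ^ 2 ≤ C * (ip l r (leg k l r) w) ^ 2 ∧
      ip l r T T ≤ (c + (r - l)) ^ 2 * ip l r w w := by
  obtain ⟨C, hC, hCe⟩ := exists_eval_bound (k + 1)
  have hθ := legθ_pos k
  refine ⟨(2 * C * legθ k + 2) / (legθ k) ^ 2, by positivity, fun l r h c hc w hw => ?_⟩
  have hη : 0 < r - l := sub_pos.2 h
  have weight_bound : ∀ d : ℝ, 0 ≤ d → ∀ y : ℝ[X],
      ip l r ((Polynomial.C d + (Polynomial.X - Polynomial.C l)) * y)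
        ((Polynomial.C d + (Polynomial.X - Polynomial.C l)) * y) ≤
        (d + (r - l)) ^ 2 * ip l r y y := by
    intro d hd y
    rw [ip, ip, ← intervalIntegral.integral_const_mul]
    refine intervalIntegral.integral_mono_on h.le (ip_intervalIntegrable _ _)
      ((ip_intervalIntegrable _ _).const_mul _) fun x hx => ?_
    simp only [Polynomial.eval_mul, Polynomial.eval_add, Polynomial.eval_sub, Polynomial.eval_C,
      Polynomial.eval_X]
    have : (d + (x - l)) ^ 2 ≤ (d + (r - l)) ^ 2 := by
      have := hx.1; have := hx.2
      gcongr
    nlinarith [mul_self_nonneg (y.eval x)]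
  set L := leg k l r with hL
  set t := ip l r L w / (legθ k * (r - l)) with ht
  set y := w - t • L with hy
  have hym : y ∈ Polynomial.degreeLT ℝ k := sub_leg_mem k h hw
  obtain ⟨Z, hZ, hZv, hZn⟩ := exists_polyProj h (k + 1)
    ((Polynomial.C 0 + (Polynomial.X - Polynomial.C l)) * L)
  have hZn' := hZn.trans (weight_bound 0 le_rfl L)
  rw [leg_self k h, zero_add] at hZn'
  have hZx : ∀ x ∈ Icc l r, (Z.eval x) ^ 2 ≤ C * legθ k * (r - l) ^ 2 := by
    intro x hx
    refine (hCe l r h Z hZ x hx).trans ?_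
    calc _ ≤ C / (r - l) * ((r - l) ^ 2 * (legθ k * (r - l))) := by gcongr
      _ = _ := by field_simp
  have hkey : ∀ z : ℝ, z ^ 2 ≤ (2 * C * legθ k + 2) * (r - l) ^ 2 →
      (t * z) ^ 2 ≤ (2 * C * legθ k + 2) / (legθ k) ^ 2 * (ip l r L w) ^ 2 := by
    intro z hz
    calc (t * z) ^ 2 = t ^ 2 * z ^ 2 := by ring
      _ ≤ t ^ 2 * ((2 * C * legθ k + 2) * (r - l) ^ 2) := by gcongr
      _ = _ := by rw [ht]; field_simp
  -- Multiplication by the weight is exact on the part y of degree less than k; only the Legendre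
  -- part has to be projected. Hence the deviation of T from the weighted w is t times a fixed
  -- polynomial, where t is the top coefficient, and its bound does not depend on c.
  set T := (Polynomial.C c + (Polynomial.X - Polynomial.C l)) * y + t • (c • L + Z) with hT
  have hTw : T = (Polynomial.C c + (Polynomial.X - Polynomial.C l)) * w +
      t • (Z - (Polynomial.C 0 + (Polynomial.X - Polynomial.C l)) * L) := by
    rw [hT, hy]
    simp only [Polynomial.smul_eq_C_mul, Polynomial.C_0]
    ring
  have hTm : T ∈ Polynomial.degreeLT ℝ (k + 1) := Submodule.add_mem _ (mul_X_sub_C_mem c l hym)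
    (Submodule.smul_mem _ _ (Submodule.add_mem _ (Submodule.smul_mem _ _ (leg_mem k)) hZ))
  have hTv : ∀ v ∈ Polynomial.degreeLT ℝ (k + 1), ip l r T v =
      ip l r ((Polynomial.C c + (Polynomial.X - Polynomial.C l)) * w) v := by
    intro v hv
    rw [hTw, ip_add_left, ip_smul_left, ip_sub_left, hZv v hv, sub_self, mul_zero, add_zero]
  refine ⟨T, hTm, hTv, ?_, ?_, ?_⟩
  · have e : T.eval l - c * w.eval l = t * Z.eval l := by
      rw [hTw]
      simp
    rw [e]
    refine hkey _ ((hZx l (left_mem_Icc.2 h.le)).trans ?_)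
    have : 0 ≤ C * legθ k := by positivity
    gcongr
    linarith
  · have e : T.eval r - (c + (r - l)) * w.eval r = t * (Z.eval r - (r - l)) := by
      rw [hTw]
      simp [hL, leg_right k h]
    rw [e]
    refine hkey _ ?_
    have := hZx r (right_mem_Icc.2 h.le)
    nlinarith [sq_nonneg (Z.eval r + (r - l))]
  · refine le_trans ?_ (weight_bound c hc w)
    have h1 := ip_self_nonneg ((Polynomial.C c + (Polynomial.X - Polynomial.C l)) * w - T) h.le
    have h2 := hTv T hTm
    have h3 := ip_comm (l := l) (r := r) ((Polynomial.C c + (Polynomial.X - Polynomial.C l)) * w) T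
    rw [ip_sub_left, ip_sub_right, ip_sub_right] at h1
    linarith

/-! ### The discrete equations on one element -/

/-- Discrete unknowns on one element: polynomials, numerical traces at the two ends, and the
amplitudes of the sources, which are multiples of the Legendre polynomial. -/
structure ElemState where
  u : ℝ[X]
  q : ℝ[X]
  p : ℝ[X]
  D : ℝ[X]
  ul : ℝ
  ur : ℝ
  ql : ℝ
  qr : ℝ
  pl : ℝ
  pr : ℝ
  fu : ℝ
  fq : ℝ
  fp : ℝ
  δ : ℝ

namespace ElemState

/-- The sum of the squares of the independent jumps. -/
def jump (e : ElemState) (l r : ℝ) : ℝ :=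
  (e.ul - e.u.eval l) ^ 2 + (e.ur - e.u.eval r) ^ 2 + (e.pr - e.p.eval r) ^ 2

lemma jump_nonneg (e : ElemState) (l r : ℝ) : 0 ≤ e.jump l r := by
  unfold jump
  positivity

/-- The HDG equations on the element `(l, r)`, integrated by parts. -/
structure IsSol (e : ElemState) (k : ℕ) (l r tL sL tR : ℝ) : Prop where
  mem_u : e.u ∈ Polynomial.degreeLT ℝ (k + 1)
  mem_q : e.q ∈ Polynomial.degreeLT ℝ (k + 1)
  mem_p : e.p ∈ Polynomial.degreeLT ℝ (k + 1)
  mem_D : e.D ∈ Polynomial.degreeLT ℝ (k + 1)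
  eq_u : ∀ v ∈ Polynomial.degreeLT ℝ (k + 1), ip l r (Polynomial.derivative e.u) v +
    (e.ur - e.u.eval r) * v.eval r - (e.ul - e.u.eval l) * v.eval l =
      ip l r e.q v - e.fq * ip l r (leg k l r) v
  eq_q : ∀ v ∈ Polynomial.degreeLT ℝ (k + 1), ip l r (Polynomial.derivative e.q) v +
    (e.qr - e.q.eval r) * v.eval r - (e.ql - e.q.eval l) * v.eval l =
      ip l r e.p v - e.fp * ip l r (leg k l r) v
  -- Together with `flux_pl`, δ enters through -δ v(l) + s δ (L,v)/(θη), which vanishes for v = L.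
  -- This is the effect of the corrector ODE.
  eq_p : ∀ v ∈ Polynomial.degreeLT ℝ (k + 1), ip l r (Polynomial.derivative e.p) v +
    (e.pr - e.p.eval r) * v.eval r - (e.pl - e.p.eval l) * v.eval l =
      (e.fu - legS k * e.δ / (legθ k * (r - l))) * ip l r (leg k l r) v - ip l r e.D v
  flux_ql : e.ql - e.q.eval l = -tL * (e.ul - e.u.eval l)
  flux_pl : e.pl - e.p.eval l = -sL * (e.ul - e.u.eval l) + e.δ
  -- The second coefficient is the inverse of the first because the two parameters at the right end
  -- have product one.
  flux_qr : e.qr - e.q.eval r = tR * (e.ur - e.u.eval r) + tR⁻¹ * (e.pr - e.p.eval r)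

end ElemState

/-- The inner product weighted by the affine function with slope one and value `c` at `l`. -/
def wip (l r c : ℝ) (v w : ℝ[X]) : ℝ :=
  ip l r ((Polynomial.C c + (Polynomial.X - Polynomial.C l)) * v) w

lemma wip_comm (l r c : ℝ) (v w : ℝ[X]) : wip l r c v w = wip l r c w v := by
  rw [wip, wip, ip_mul_left, ip_mul_left, mul_comm v]

lemma wip_eq (l r c : ℝ) (v w : ℝ[X]) : wip l r c v w =
    c * ip l r v w + ip l r ((Polynomial.X - Polynomial.C l) * v) w := by
  rw [wip, add_mul, ip_add_left, ← Polynomial.smul_eq_C_mul, ip_smul_left]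

lemma wip_derivative_add (l r c : ℝ) (v w : ℝ[X]) :
    wip l r c (Polynomial.derivative v) w + wip l r c (Polynomial.derivative w) v =
      (c + (r - l)) * (v.eval r * w.eval r) - c * (v.eval l * w.eval l) - ip l r v w := by
  have h := ip_derivative_add (l := l) (r := r)
    ((Polynomial.C c + (Polynomial.X - Polynomial.C l)) * v) w
  have h1 : Polynomial.derivative ((Polynomial.C c + (Polynomial.X - Polynomial.C l)) * v) =
      v + (Polynomial.C c + (Polynomial.X - Polynomial.C l)) * Polynomial.derivative v := by
    simp
  rw [h1, ip_add_left] at h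
  rw [wip_comm l r c (Polynomial.derivative w) v, wip, wip]
  simp at h
  linarith

lemma young_mul {z X Y K ε : ℝ} (hX : 0 ≤ X) (hY : 0 ≤ Y) (hK : 0 ≤ K) (hε : 0 < ε)
    (hz : z ^ 2 ≤ K * X * Y) : |z| ≤ ε * X + K / (4 * ε) * Y := by
  refine abs_le_of_sq_le_sq (hz.trans ?_) (by positivity)
  have : 0 ≤ (ε * X - K / (4 * ε) * Y) ^ 2 := sq_nonneg _
  have e : (ε * X + K / (4 * ε) * Y) ^ 2 = (ε * X - K / (4 * ε) * Y) ^ 2 + K * X * Y := by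
    field_simp
    ring
  linarith

/-- Conditions on the stabilization function at the ends of one element. -/
structure ElemAdm (M tL sL tR : ℝ) : Prop where
  one_le : 1 ≤ M
  tL_nonneg : 0 ≤ tL
  tL_le : tL ≤ 1
  -- The only consequence needed of the lower bound -1 - √(1 - tL²).
  sL_ge : -2 ≤ sL
  sL_le : sL ≤ -(1 / 2) - 1 / 2 * tL ^ 2
  tR_pos : 0 < tR
  tR_le : tR ≤ M
  tR_inv_le : tR⁻¹ ≤ M

namespace ElemState.IsSol

variable {e : ElemState} {k : ℕ} {l r tL sL tR M : ℝ}

/-- Discrete form of the computation of (u_xxx, φu) with φ' = 1. The three equations are tested with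
the projected weighted u, p, q, the last one with a minus sign; the second and first equations
tested with u and q supply the terms in which the weight is differentiated. The brackets after the
volume terms are, in order: contributions of the numerical traces, which telescope over the mesh;
quadratic jump terms, which dissipate; jump terms without weight; defects of the projected weights.
-/
lemma kato_identity (he : e.IsSol k l r tL sL tR) (c : ℝ) {Tu Tq Tp : ℝ[X]}
    (hTu : Tu ∈ Polynomial.degreeLT ℝ (k + 1)) (hTq : Tq ∈ Polynomial.degreeLT ℝ (k + 1))
    (hTp : Tp ∈ Polynomial.degreeLT ℝ (k + 1))
    (hu : ∀ v ∈ Polynomial.degreeLT ℝ (k + 1), ip l r Tu v = wip l r c e.u v)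
    (hq : ∀ v ∈ Polynomial.degreeLT ℝ (k + 1), ip l r Tq v = wip l r c e.q v)
    (hp : ∀ v ∈ Polynomial.degreeLT ℝ (k + 1), ip l r Tp v = wip l r c e.p v) :
    wip l r c e.D e.u + 3 / 2 * ip l r e.q e.q
      + ((c + (r - l)) * (e.pr * e.ur - 1 / 2 * e.qr ^ 2) - c * (e.pl * e.ul - 1 / 2 * e.ql ^ 2)
        - (e.ur * e.qr - e.ul * e.ql))
      + ((c + (r - l)) * (1 / 2 * (e.qr - e.q.eval r) ^ 2 -
          (e.ur - e.u.eval r) * (e.pr - e.p.eval r))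
        - c * (1 / 2 * (e.ql - e.q.eval l) ^ 2 - (e.ul - e.u.eval l) * (e.pl - e.p.eval l)))
      + ((e.ur - e.u.eval r) * (e.qr - e.q.eval r) - (e.ul - e.u.eval l) * (e.ql - e.q.eval l))
      + ((e.pr - e.p.eval r) * (Tu.eval r - (c + (r - l)) * e.u.eval r)
        + (e.ur - e.u.eval r) * (Tp.eval r - (c + (r - l)) * e.p.eval r)
        - (e.qr - e.q.eval r) * (Tq.eval r - (c + (r - l)) * e.q.eval r))
      - ((e.pl - e.p.eval l) * (Tu.eval l - c * e.u.eval l)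
        + (e.ul - e.u.eval l) * (Tp.eval l - c * e.p.eval l)
        - (e.ql - e.q.eval l) * (Tq.eval l - c * e.q.eval l)) =
    (e.fu - legS k * e.δ / (legθ k * (r - l))) * ip l r (leg k l r) Tu
      - e.fq * wip l r c e.p (leg k l r) + e.fp * ip l r (leg k l r) Tq
      + e.fp * ip l r (leg k l r) e.u + e.fq * ip l r (leg k l r) e.q := by
  have hsucc : ∀ {w : ℝ[X]}, w ∈ Polynomial.degreeLT ℝ (k + 1) →
      Polynomial.derivative w ∈ Polynomial.degreeLT ℝ (k + 1) := fun hw =>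
    Polynomial.degreeLT_mono (Nat.le_succ k) (derivative_mem_degreeLT hw)
  have e1 := he.eq_p Tu hTu
  have e2 := he.eq_u Tp hTp
  have e3 := he.eq_q Tq hTq
  have e4 := he.eq_q e.u he.mem_u
  have e5 := he.eq_u e.q he.mem_q
  rw [ip_comm _ Tu, hu _ (hsucc he.mem_p), wip_comm l r c e.u, ip_comm e.D, hu _ he.mem_D] at e1
  rw [ip_comm _ Tp, hp _ (hsucc he.mem_u), wip_comm l r c e.p, ip_comm e.q, hp _ he.mem_q, ip_comm _ Tp,
    hp _ (leg_mem k)] at e2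
  rw [ip_comm _ Tq, hq _ (hsucc he.mem_q), wip_comm l r c e.q, ip_comm e.p, hq _ he.mem_p] at e3
  have i1 := wip_derivative_add l r c e.p e.u
  have i2 := wip_derivative_add l r c e.q e.q
  have i3 := ip_derivative_add (l := l) (r := r) e.u e.q
  rw [ip_comm e.u] at i3
  rw [wip_comm l r c e.u e.D] at e1
  rw [wip_comm l r c e.q e.p] at e3
  linear_combination e1 + e2 - e3 - e4 - e5 + (-1) * i1 + (1 / 2) * i2 + i3

end ElemState.IsSol

/-! ### Bounds for the terms of the weighted energy identity. -/

lemma ip_leg_sq_le (k : ℕ) {l r : ℝ} (h : l < r) (w : ℝ[X]) :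
    (ip l r (leg k l r) w) ^ 2 ≤ legθ k * (r - l) * ip l r w w := by
  rw [← leg_self k h]
  exact ip_cauchy_schwarz _ _ h.le

/-- The factor x - l is at most `r - l` and compensates the inverse estimate for the derivative of
v. -/
lemma ip_X_sub_C_mul_sq_le {l r : ℝ} (h : l < r) {u v : ℝ[X]} {Kd Kv : ℝ} (hKd : 0 ≤ Kd)
    (h2 : ip l r (Polynomial.derivative v) (Polynomial.derivative v) ≤
      Kd / (r - l) ^ 2 * ip l r v v) (hvn : ip l r v v ≤ Kv * (r - l)) :
    (ip l r ((Polynomial.X - Polynomial.C l) * u) (Polynomial.derivative v)) ^ 2 ≤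
      Kd * Kv * (r - l) * ip l r u u := by
  have hηpos := sub_pos.2 h
  have hnu := ip_self_nonneg u h.le
  have h1 := ip_cauchy_schwarz ((Polynomial.X - Polynomial.C l) * u) (Polynomial.derivative v)
    h.le
  have h3 : ip l r ((Polynomial.X - Polynomial.C l) * u)
      ((Polynomial.X - Polynomial.C l) * u) ≤ (r - l) ^ 2 * ip l r u u := by
    rw [ip, ip, ← intervalIntegral.integral_const_mul]
    refine intervalIntegral.integral_mono_on h.le (ip_intervalIntegrable _ _)
      ((ip_intervalIntegrable _ _).const_mul _) fun x hx => ?_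
    simp only [Polynomial.eval_mul, Polynomial.eval_sub, Polynomial.eval_C, Polynomial.eval_X]
    have h5 : (x - l) ^ 2 ≤ (r - l) ^ 2 := by
      have h6 := hx.1; have h7 := hx.2
      have : 0 ≤ x - l := by linarith
      gcongr
    nlinarith [mul_self_nonneg (u.eval x)]
  have h4 := ip_self_nonneg (Polynomial.derivative v) h.le
  have h5 : ip l r (Polynomial.derivative v) (Polynomial.derivative v) ≤
      Kd / (r - l) ^ 2 * (Kv * (r - l)) := h2.trans (by gcongr)
  refine h1.trans ((mul_le_mul h3 h5 h4 (by positivity)).trans (le_of_eq ?_))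
  field_simp

lemma source_sum_le {G1 G2 G3 G4 η x y z w : ℝ} (h1 : 0 ≤ G1) (h2 : 0 ≤ G2) (h3 : 0 ≤ G3)
    (h4 : 0 ≤ G4) (hη : 0 ≤ η) :
    G3 * (η * z ^ 2) + 1 * (η * y ^ 2) + G4 * (η * w ^ 2) + G1 * (η * x ^ 2) + G1 * (η * z ^ 2) +
        G2 * (η * z ^ 2) + G2 * (η * y ^ 2) ≤
      (G3 + G4 + 1 + G1 + G2) * (η * (x ^ 2 + y ^ 2 + z ^ 2 + w ^ 2)) := by
  have hx : 0 ≤ η * x ^ 2 := by positivity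
  have hy : 0 ≤ η * y ^ 2 := by positivity
  have hz : 0 ≤ η * z ^ 2 := by positivity
  have hw : 0 ≤ η * w ^ 2 := by positivity
  have e : (G3 + G4 + 1 + G1 + G2) * (η * (x ^ 2 + y ^ 2 + z ^ 2 + w ^ 2)) =
      (G3 * (η * z ^ 2) + 1 * (η * y ^ 2) + G4 * (η * w ^ 2) + G1 * (η * x ^ 2) +
        G1 * (η * z ^ 2) + G2 * (η * z ^ 2) + G2 * (η * y ^ 2)) +
      (G3 * (η * x ^ 2 + η * y ^ 2 + η * w ^ 2) + G4 * (η * x ^ 2 + η * y ^ 2 + η * z ^ 2) +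
        (η * x ^ 2 + η * z ^ 2 + η * w ^ 2) + G1 * (η * y ^ 2 + η * w ^ 2) +
        G2 * (η * x ^ 2 + η * w ^ 2)) := by ring
  rw [e]
  exact le_add_of_nonneg_right (by positivity)

lemma mul_sq_le_mul {x y X Y : ℝ} (h1 : x ^ 2 ≤ X) (h2 : y ^ 2 ≤ Y) :
    (x * y) ^ 2 ≤ X * Y := by
  rw [mul_pow]
  exact mul_le_mul h1 h2 (sq_nonneg _) ((sq_nonneg _).trans h1)

/-- Products of jumps with jumps, or with defects of projected weights. The coefficient of J
contains no bound of the weight; this is essential, since the weight is afterwards chosen large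
enough to beat that coefficient. -/
lemma jump_terms_le {nu nq J F KB P Q ε A B A' S q q' xu yu xq yq xp yp : ℝ}
    (hnu : 0 ≤ nu) (hnq : 0 ≤ nq) (hJ : 0 ≤ J) (hF : 0 ≤ F) (hKB : 0 ≤ KB) (hP : 0 ≤ P)
    (hQ : 0 ≤ Q) (hε : 0 < ε) (hA : A ^ 2 ≤ J) (hB : B ^ 2 ≤ J) (hA' : A' ^ 2 ≤ J)
    (hS : S ^ 2 ≤ 4 * J) (hq : q ^ 2 ≤ Q * J) (hq' : q' ^ 2 ≤ J) (hxu : xu ^ 2 ≤ KB * nu)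
    (hyu : yu ^ 2 ≤ KB * nu) (hxq : xq ^ 2 ≤ KB * nq) (hyq : yq ^ 2 ≤ KB * nq)
    (hxp : xp ^ 2 ≤ P * (J + F)) (hyp : yp ^ 2 ≤ P * (J + F)) :
    -(A * q) - B * xu - A * xp + q * xq - S * yu + A' * yp - q' * yq ≤
      (3 + Q / 4 + P / 2 + (6 + Q) * KB / (4 * ε)) * J + 2 * ε * (nu + nq) + P / 2 * F := by
  have hJF : 0 ≤ J + F := by positivity
  have t1 := (neg_le_abs _).trans (young_mul hJ hJ hQ one_pos
    ((mul_sq_le_mul hA hq).trans_eq (by ring)))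
  have t2 := (neg_le_abs _).trans (young_mul hnu hJ hKB hε
    ((mul_sq_le_mul hB hxu).trans_eq (by ring)))
  have t3 := (neg_le_abs _).trans (young_mul hJ hJF hP one_pos
    ((mul_sq_le_mul hA hxp).trans_eq (by ring)))
  have t4 := (le_abs_self _).trans (young_mul hnq hJ (mul_nonneg hKB hQ) hε
    ((mul_sq_le_mul hq hxq).trans_eq (by ring)))
  have t5 := (neg_le_abs _).trans (young_mul hnu hJ (mul_nonneg hKB zero_le_four) hε
    ((mul_sq_le_mul hS hyu).trans_eq (by ring)))
  have t6 := (le_abs_self _).trans (young_mul hJ hJF hP one_pos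
    ((mul_sq_le_mul hA' hyp).trans_eq (by ring)))
  have t7 := (neg_le_abs _).trans (young_mul hnq hJ hKB hε
    ((mul_sq_le_mul hq' hyq).trans_eq (by ring)))
  refine (le_of_eq_of_le (by ring) (add_le_add (add_le_add (add_le_add (add_le_add (add_le_add
    (add_le_add t1 t2) t3) t4) t5) t6) t7)).trans (le_of_eq ?_)
  field_simp
  ring

/-- After `delta_identity` every δ term carries a factor of order √η, so that η δ² suffices on the
right-hand side. Here the constant may depend on the bound `Wm` of the weight. -/
lemma delta_terms_le {nu nq δ fq c Wm η a b x ε Kv Kd θ : ℝ} (hnu : 0 ≤ nu) (hnq : 0 ≤ nq)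
    (hη : 0 ≤ η) (hε : 0 < ε) (hKv : 0 ≤ Kv) (hKd : 0 ≤ Kd) (hθ : 0 ≤ θ) (hc : c ^ 2 ≤ Wm ^ 2)
    (ha : a ^ 2 ≤ nq * (Kv * η)) (hb : b ^ 2 ≤ θ * η * (Kv * η))
    (hx : x ^ 2 ≤ Kd * Kv * η * nu) :
    δ * (c * a) - δ * (c * (fq * b)) - δ * x ≤ ε * (nu + nq) + 1 * (η * fq ^ 2) +
      (Kv * Wm ^ 2 / (4 * ε) + θ * Kv * Wm ^ 2 / 4 + Kd * Kv / (4 * ε)) * (η * δ ^ 2) := by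
  have hδη : 0 ≤ η * δ ^ 2 := by positivity
  have hfqη : 0 ≤ η * fq ^ 2 := by positivity
  have d1 := (le_abs_self _).trans (young_mul hnq hδη (mul_nonneg hKv (sq_nonneg Wm)) hε
    ((mul_sq_le_mul (le_refl (δ ^ 2)) (mul_sq_le_mul hc ha)).trans_eq (by ring)))
  have d2 := (neg_le_abs _).trans (young_mul hfqη hδη
    (mul_nonneg (mul_nonneg hθ hKv) (sq_nonneg Wm)) one_pos
    ((mul_sq_le_mul (le_refl (δ ^ 2)) (mul_sq_le_mul hc
      (mul_sq_le_mul (le_refl (fq ^ 2)) hb))).trans_eq (by ring)))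
  have d3 := (neg_le_abs _).trans (young_mul hnu hδη (mul_nonneg hKd hKv) hε
    ((mul_sq_le_mul (le_refl (δ ^ 2)) hx).trans_eq (by ring)))
  refine (le_of_eq_of_le (by ring) (add_le_add (add_le_add d1 d2) d3)).trans (le_of_eq ?_)
  field_simp
  ring

lemma source_term_le {f g ν X ε K η : ℝ} (hν : 0 ≤ ν) (hη : 0 ≤ η) (hK : 0 ≤ K)
    (hε : 0 < ε) (hg : g ^ 2 ≤ X) (hX : X ≤ K * η * ν) :
    f * g ≤ ε * ν + K / (4 * ε) * (η * f ^ 2) :=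
  (le_abs_self _).trans (young_mul hν (mul_nonneg hη (sq_nonneg f)) hK hε
    ((mul_sq_le_mul (le_refl (f ^ 2)) (hg.trans hX)).trans_eq (by ring)))

lemma ElemAdm.sL_sq_le {M tL sL tR : ℝ} (ha : ElemAdm M tL sL tR) : sL ^ 2 ≤ 4 := by
  have h1 := ha.sL_ge
  have h2 := ha.sL_le
  nlinarith [sq_nonneg tL]

namespace ElemState.IsSol

variable {e : ElemState} {k : ℕ} {l r tL sL tR M : ℝ}

lemma Qr_sq_le (he : e.IsSol k l r tL sL tR) (ha : ElemAdm M tL sL tR) :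
    (e.qr - e.q.eval r) ^ 2 ≤ 2 * M ^ 2 * e.jump l r := by
  have h1 : tR ^ 2 ≤ M ^ 2 := pow_le_pow_left₀ ha.tR_pos.le ha.tR_le 2
  have h2 : tR⁻¹ ^ 2 ≤ M ^ 2 := pow_le_pow_left₀ (inv_pos.2 ha.tR_pos).le ha.tR_inv_le 2
  rw [he.flux_qr, jump]
  set A := e.ur - e.u.eval r
  set B := e.pr - e.p.eval r
  have h3 : (tR * A + tR⁻¹ * B) ^ 2 ≤ 2 * (tR ^ 2 * A ^ 2 + tR⁻¹ ^ 2 * B ^ 2) := by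
    nlinarith [sq_nonneg (tR * A - tR⁻¹ * B)]
  have h4 : tR ^ 2 * A ^ 2 ≤ M ^ 2 * A ^ 2 := by gcongr
  have h5 : tR⁻¹ ^ 2 * B ^ 2 ≤ M ^ 2 * B ^ 2 := by gcongr
  nlinarith [mul_nonneg (sq_nonneg M) (sq_nonneg (e.ul - e.u.eval l))]

lemma Ql_sq_le (he : e.IsSol k l r tL sL tR) (ha : ElemAdm M tL sL tR) :
    (e.ql - e.q.eval l) ^ 2 ≤ e.jump l r := by
  rw [he.flux_ql, jump]
  have h1 : tL ^ 2 ≤ 1 := by have := ha.tL_nonneg; have := ha.tL_le; nlinarith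
  nlinarith [sq_nonneg (e.ur - e.u.eval r), sq_nonneg (e.pr - e.p.eval r),
    mul_le_mul_of_nonneg_right h1 (sq_nonneg (e.ul - e.u.eval l))]

/-- The top coefficient of `p` is controlled by jumps. -/
lemma leg_p_sq_le (he : e.IsSol k l r tL sL tR) (ha : ElemAdm M tL sL tR) (h : l < r) :
    (ip l r (leg k l r) e.p) ^ 2 ≤
      3 * ((2 * M ^ 2 + legS k ^ 2) * e.jump l r + legθ k ^ 2 * (r - l) * ((r - l) * e.fp ^ 2)) := by
  have h1 := he.eq_q (leg k l r) (leg_mem k)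
  rw [ip_comm _ (leg k l r), ip_leg_derivative h he.mem_q, leg_right k h, leg_left k,
    ip_comm e.p, leg_self k h] at h1
  have h2 : ip l r (leg k l r) e.p = (e.qr - e.q.eval r) - legS k * (e.ql - e.q.eval l) +
      legθ k * (r - l) * e.fp := by linarith
  rw [h2]
  have h3 := he.Qr_sq_le ha
  have h4 := mul_le_mul_of_nonneg_left (he.Ql_sq_le ha) (sq_nonneg (legS k))
  generalize e.qr - e.q.eval r = x at *
  generalize e.ql - e.q.eval l = y at *
  have h5 : (x - legS k * y + legθ k * (r - l) * e.fp) ^ 2 ≤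
      3 * (x ^ 2 + (legS k * y) ^ 2 + (legθ k * (r - l) * e.fp) ^ 2) := by
    nlinarith [sq_nonneg (x + legS k * y), sq_nonneg (x - legθ k * (r - l) * e.fp),
      sq_nonneg (legS k * y + legθ k * (r - l) * e.fp)]
  nlinarith

/-- At the right end the product of the jumps of u and p is exactly the cross term of half the
squared jump of q, since the stabilization parameters there are reciprocal; two squares remain. At
the left end -sL - tL²/2 ≥ 1/2 by the upper bound on sL. -/
lemma dissipation_le (he : e.IsSol k l r tL sL tR) (ha : ElemAdm M tL sL tR) (h : l < r)
    {c : ℝ} (hc : 0 ≤ c) : c / (2 * M ^ 2) * e.jump l r + c * (e.ul - e.u.eval l) * e.δ ≤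
      (c + (r - l)) * (1 / 2 * (e.qr - e.q.eval r) ^ 2 -
          (e.ur - e.u.eval r) * (e.pr - e.p.eval r))
        - c * (1 / 2 * (e.ql - e.q.eval l) ^ 2 - (e.ul - e.u.eval l) * (e.pl - e.p.eval l)) := by
  rw [he.flux_qr, he.flux_ql, he.flux_pl, jump]
  have hM := ha.one_le
  have ht := ha.tR_pos
  have hti := inv_pos.2 ht
  have hηpos := sub_pos.2 h
  set A := e.ur - e.u.eval r
  set B := e.pr - e.p.eval r
  set A' := e.ul - e.u.eval l
  have h0 : tR * tR⁻¹ = 1 := mul_inv_cancel₀ ht.ne'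
  have e1 : 1 / 2 * (tR * A + tR⁻¹ * B) ^ 2 - A * B =
      1 / 2 * (tR ^ 2 * A ^ 2 + tR⁻¹ ^ 2 * B ^ 2) := by
    linear_combination (A * B) * h0
  have h1 : 1 / M ^ 2 ≤ tR ^ 2 := by
    have : 1 / M ≤ tR := by
      rw [one_div, inv_le_comm₀ (by linarith) ht]
      exact ha.tR_inv_le
    calc 1 / M ^ 2 = (1 / M) ^ 2 := by rw [div_pow, one_pow]
      _ ≤ _ := by gcongr
  have h2 : 1 / M ^ 2 ≤ tR⁻¹ ^ 2 := by
    have : 1 / M ≤ tR⁻¹ := by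
      rw [one_div]
      exact inv_anti₀ ht ha.tR_le
    calc 1 / M ^ 2 = (1 / M) ^ 2 := by rw [div_pow, one_pow]
      _ ≤ _ := by gcongr
  have h3 : 1 / M ^ 2 ≤ 1 := by
    rw [div_le_one (by positivity)]
    nlinarith
  have e2 : c / (2 * M ^ 2) = c / 2 * (1 / M ^ 2) := by field_simp
  rw [e1, e2]
  generalize 1 / M ^ 2 = m at *
  have g1 : c / 2 * (m * A ^ 2) ≤ c / 2 * (tR ^ 2 * A ^ 2) := by gcongr
  have g2 : c / 2 * (m * B ^ 2) ≤ c / 2 * (tR⁻¹ ^ 2 * B ^ 2) := by gcongr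
  have g3 : c / 2 * (m * A' ^ 2) ≤ c / 2 * (1 * A' ^ 2) := by gcongr
  have g4 : 0 ≤ (r - l) * (1 / 2 * (tR ^ 2 * A ^ 2 + tR⁻¹ ^ 2 * B ^ 2)) := by positivity
  have g5 : 0 ≤ c * A' ^ 2 * (-(1 / 2) - 1 / 2 * tL ^ 2 - sL) := by
    have := ha.sL_le
    have : 0 ≤ -(1 / 2) - 1 / 2 * tL ^ 2 - sL := by linarith
    positivity
  nlinarith

/-- The left side is the coefficient of δ in the energy identity. With v from `exists_leftTest` it
becomes an inner product of u with the derivative of v, and the first equation tested with v turns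
the part with constant weight into a term in q. No point value of u is left. -/
lemma delta_identity (he : e.IsSol k l r tL sL tR) (c : ℝ) {Tu v : ℝ[X]}
    (hu : ∀ v ∈ Polynomial.degreeLT ℝ (k + 1), ip l r Tu v = wip l r c e.u v)
    (hv : v ∈ Polynomial.degreeLT ℝ (k + 1)) (hvr : v.eval r = 0) (hvl : v.eval l = 1)
    (hvw : ip l r Tu (Polynomial.derivative v) =
      -Tu.eval l + legS k * (ip l r (leg k l r) Tu / (legθ k * (r - l)))) :
    c * e.ul - Tu.eval l + legS k * (ip l r (leg k l r) Tu / (legθ k * (r - l))) =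
      -(c * (ip l r e.q v - e.fq * ip l r (leg k l r) v)) +
        ip l r ((Polynomial.X - Polynomial.C l) * e.u) (Polynomial.derivative v) := by
  have hdv : Polynomial.derivative v ∈ Polynomial.degreeLT ℝ (k + 1) :=
    Polynomial.degreeLT_mono (Nat.le_succ k) (derivative_mem_degreeLT hv)
  have h2 := hu _ hdv
  have h3 := wip_eq l r c e.u (Polynomial.derivative v)
  have h4 := he.eq_u v hv
  have h5 := ip_derivative_add (l := l) (r := r) e.u v
  rw [hvr, hvl] at h4 h5
  have h6 : e.ul + ip l r e.u (Polynomial.derivative v) =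
      -(ip l r e.q v - e.fq * ip l r (leg k l r) v) := by linarith
  linear_combination (-1) * hvw + h2 + h3 + c * h6

lemma jump_sq_le (e : ElemState) (l r : ℝ) : (e.ul - e.u.eval l) ^ 2 ≤ e.jump l r ∧
    (e.ur - e.u.eval r) ^ 2 ≤ e.jump l r ∧ (e.pr - e.p.eval r) ^ 2 ≤ e.jump l r := by
  have h1 := sq_nonneg (e.ul - e.u.eval l)
  have h2 := sq_nonneg (e.pr - e.p.eval r)
  have h3 := sq_nonneg (e.ur - e.u.eval r)
  rw [jump]
  exact ⟨by linarith, by linarith, by linarith⟩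

set_option maxHeartbeats 2000000 in
/-- The weighted energy inequality on one element. -/
lemma exists_kato (k : ℕ) (hk : 0 < k) (M B : ℝ) (hM : 1 ≤ M) (hB : 0 < B) (ε : ℝ) (hε : 0 < ε) :
    ∃ C₁ : ℝ, 0 < C₁ ∧ ∀ Wm : ℝ, 0 < Wm → ∃ C₂ : ℝ, 0 < C₂ ∧
      ∀ (e : ElemState) (l r tL sL tR c : ℝ), l < r → r - l ≤ B → 0 ≤ c → c ≤ Wm →
        ElemAdm M tL sL tR → e.IsSol k l r tL sL tR →
        wip l r c e.D e.u + 3 / 2 * ip l r e.q e.q + c / (2 * M ^ 2) * e.jump l r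
          + ((c + (r - l)) * (e.pr * e.ur - 1 / 2 * e.qr ^ 2)
            - c * (e.pl * e.ul - 1 / 2 * e.ql ^ 2) - (e.ur * e.qr - e.ul * e.ql)) ≤
        C₁ * e.jump l r + 5 * ε * (ip l r e.q e.q + ip l r e.u e.u)
          + C₂ * ((r - l) * (e.fu ^ 2 + e.fq ^ 2 + e.fp ^ 2 + e.δ ^ 2))
          - e.fq * wip l r c e.p (leg k l r) := by
  obtain ⟨K1, hK1, hT⟩ := exists_weighted k
  obtain ⟨Kv, hKv, hV⟩ := exists_leftTest hk
  obtain ⟨Kd, hKd, hd⟩ := exists_derivative_bound (k + 1)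
  have hθ := legθ_pos k
  obtain ⟨K3, hK3⟩ : ∃ x : ℝ, x = 3 * ((2 * M ^ 2 + legS k ^ 2) + legθ k ^ 2 * B) := ⟨_, rfl⟩
  have hK3pos : 0 < K3 := by rw [hK3]; positivity
  obtain ⟨KB, hKB⟩ : ∃ x : ℝ, x = K1 * (legθ k * B) := ⟨_, rfl⟩
  have hKBpos : 0 < KB := by rw [hKB]; positivity
  obtain ⟨CJ, hCJ⟩ : ∃ x : ℝ, x = 3 + 2 * M ^ 2 / 4 + K1 * K3 / 2 +
    (6 + 2 * M ^ 2) * KB / (4 * ε) := ⟨_, rfl⟩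
  -- `CJ`, the coefficient of the jumps, is fixed before `Wm` is introduced.
  refine ⟨CJ, by rw [hCJ]; positivity, fun Wm hWm => ?_⟩
  obtain ⟨CF, hCF⟩ : ∃ x : ℝ, x = K1 * K3 / 2 +
    (Kv * Wm ^ 2 / (4 * ε) + legθ k * Kv * Wm ^ 2 / 4 + Kd * Kv / (4 * ε)) + 1 +
    legθ k * (Wm + B) ^ 2 / (4 * ε) + legθ k / (4 * ε) := ⟨_, rfl⟩
  refine ⟨CF, by rw [hCF]; positivity, fun e l r tL sL tR c h hη hc hcW ha he => ?_⟩
  have hηpos := sub_pos.2 h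
  obtain ⟨Tu, hTu, hTu1, hTu2, hTu3, hTu4⟩ := hT l r h c hc e.u he.mem_u
  obtain ⟨Tq, hTq, hTq1, hTq2, hTq3, hTq4⟩ := hT l r h c hc e.q he.mem_q
  obtain ⟨Tp, hTp, hTp1, hTp2, hTp3, _⟩ := hT l r h c hc e.p he.mem_p
  obtain ⟨v, hv, hvr, hvl, hvn, hvw⟩ := hV l r h
  have id := he.kato_identity c hTu hTq hTp hTu1 hTq1 hTp1
  have hdiss := he.dissipation_le ha h hc
  have hQr := he.Qr_sq_le ha
  have hQl := he.Ql_sq_le ha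
  have hlp := he.leg_p_sq_le ha h
  have hlu := ip_leg_sq_le k h e.u
  have hlq := ip_leg_sq_le k h e.q
  have hlTu := ip_leg_sq_le k h Tu
  have hlTq := ip_leg_sq_le k h Tq
  have hnu := ip_self_nonneg e.u h.le
  have hnq := ip_self_nonneg e.q h.le
  have hJ := e.jump_nonneg l r
  have hvnn := ip_self_nonneg v h.le
  have hMM : 0 ≤ 2 * M ^ 2 := by positivity
  have hcB : (c + (r - l)) ^ 2 ≤ (Wm + B) ^ 2 := by gcongr
  have hc2 : c ^ 2 ≤ Wm ^ 2 := by gcongr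
  have hE := he.delta_identity c hTu1 hv hvr hvl (hvw Tu hTu)
  have hX0 : (ip l r ((Polynomial.X - Polynomial.C l) * e.u) (Polynomial.derivative v)) ^ 2 ≤
      Kd * Kv * (r - l) * ip l r e.u e.u :=
    ip_X_sub_C_mul_sq_le h hKd.le (hd l r h v hv) hvn
  have hqv := (ip_cauchy_schwarz e.q v h.le).trans
    (mul_le_mul_of_nonneg_left hvn hnq)
  have hLv := (ip_leg_sq_le k h v).trans
    (mul_le_mul_of_nonneg_left hvn (by positivity : 0 ≤ legθ k * (r - l)))
  have hKBle : ∀ {y ν m : ℝ}, 0 ≤ ν → y ^ 2 ≤ K1 * m ^ 2 → m ^ 2 ≤ legθ k * (r - l) * ν →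
      y ^ 2 ≤ KB * ν := by
    intro y ν m hν h1 h2
    refine h1.trans ((mul_le_mul_of_nonneg_left h2 hK1.le).trans ?_)
    rw [hKB, ← mul_assoc]
    exact mul_le_mul_of_nonneg_right
      (mul_le_mul_of_nonneg_left (mul_le_mul_of_nonneg_left hη hθ.le) hK1.le) hν
  have hfp0 : 0 ≤ (r - l) * e.fp ^ 2 := mul_nonneg hηpos.le (sq_nonneg _)
  have hp2 : K1 * (ip l r (leg k l r) e.p) ^ 2 ≤ K1 * K3 * (e.jump l r + (r - l) * e.fp ^ 2) := by
    rw [mul_assoc]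
    refine mul_le_mul_of_nonneg_left (hlp.trans ?_) hK1.le
    have h1 : legθ k ^ 2 * (r - l) * ((r - l) * e.fp ^ 2) ≤
        legθ k ^ 2 * B * ((r - l) * e.fp ^ 2) :=
      mul_le_mul_of_nonneg_right (mul_le_mul_of_nonneg_left hη (sq_nonneg _)) hfp0
    have h2 : 0 ≤ legθ k ^ 2 * B * e.jump l r :=
      mul_nonneg (mul_nonneg (sq_nonneg _) hB.le) hJ
    have h3 : 0 ≤ (2 * M ^ 2 + legS k ^ 2) * ((r - l) * e.fp ^ 2) :=
      mul_nonneg (by positivity) hfp0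
    rw [hK3]
    linear_combination 3 * h1 + 3 * h2 + 3 * h3
  obtain ⟨a3, a1, a2⟩ := jump_sq_le e l r
  have a4 : (sL * (e.ul - e.u.eval l)) ^ 2 ≤ 4 * e.jump l r := by
    rw [mul_pow]
    exact mul_le_mul ha.sL_sq_le a3 (sq_nonneg _) zero_le_four
  have tJ := jump_terms_le hnu hnq hJ hfp0 hKBpos.le (mul_nonneg hK1.le hK3pos.le) hMM hε
    a1 a2 a3 a4 hQr hQl (hKBle hnu hTu3 hlu) (hKBle hnu hTu2 hlu) (hKBle hnq hTq3 hlq)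
    (hKBle hnq hTq2 hlq) (hTp3.trans hp2) (hTp2.trans hp2)
  have tδ := delta_terms_le (δ := e.δ) (fq := e.fq) hnu hnq hηpos.le hε hKv.le hKd.le hθ.le hc2
    hqv hLv hX0
  have hT0 : ∀ {T : ℝ[X]} {ν : ℝ}, 0 ≤ ν → ip l r T T ≤ (c + (r - l)) ^ 2 * ν →
      legθ k * (r - l) * ip l r T T ≤ legθ k * (Wm + B) ^ 2 * (r - l) * ν := by
    intro T ν hν h1
    have h2 := mul_le_mul_of_nonneg_left (h1.trans (mul_le_mul_of_nonneg_right hcB hν))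
      (mul_nonneg hθ.le hηpos.le)
    exact h2.trans_eq (by ring)
  have hθW : 0 ≤ legθ k * (Wm + B) ^ 2 := mul_nonneg hθ.le (sq_nonneg _)
  have f1 := source_term_le (f := e.fu) hnu hηpos.le hθW hε hlTu (hT0 hnu hTu4)
  have f2 := source_term_le (f := e.fp) hnq hηpos.le hθW hε hlTq (hT0 hnq hTq4)
  have f3 := source_term_le (f := e.fp) hnu hηpos.le hθ.le hε hlu le_rfl
  have f4 := source_term_le (f := e.fq) hnq hηpos.le hθ.le hε hlq le_rfl
  -- Of the jump terms without weight, the one at the left end is -tL times a square and has the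
  -- favourable sign.
  have hAlQl : (e.ul - e.u.eval l) * (e.ql - e.q.eval l) ≤ 0 := by
    rw [he.flux_ql]
    linear_combination mul_nonneg ha.tL_nonneg (sq_nonneg (e.ul - e.u.eval l))
  have hpl := he.flux_pl
  have hsub : (e.pl - e.p.eval l) * (Tu.eval l - c * e.u.eval l) =
      -((Tu.eval l - c * e.u.eval l) * (sL * (e.ul - e.u.eval l))) +
        e.δ * (Tu.eval l - c * e.u.eval l) := by
    rw [hpl]; ring
  -- Collects all occurrences of δ: from the dissipation, from the left flux of p, and from the
  -- Legendre source.
  have hEδ : e.δ * (c * (e.ul - e.u.eval l)) - e.δ * (Tu.eval l - c * e.u.eval l) +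
      legS k * e.δ / (legθ k * (r - l)) * ip l r (leg k l r) Tu =
      -(e.δ * (c * ip l r e.q v)) + e.δ * (c * (e.fq * ip l r (leg k l r) v)) +
        e.δ * ip l r ((Polynomial.X - Polynomial.C l) * e.u) (Polynomial.derivative v) := by
    have : e.δ * (c * (e.ul - e.u.eval l)) - e.δ * (Tu.eval l - c * e.u.eval l) +
      legS k * e.δ / (legθ k * (r - l)) * ip l r (leg k l r) Tu = e.δ * (c * e.ul - Tu.eval l +
        legS k * (ip l r (leg k l r) Tu / (legθ k * (r - l)))) := by ring
    rw [this, hE]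
    ring
  rw [hsub] at id
  have hθ4 : 0 ≤ legθ k * (Wm + B) ^ 2 / (4 * ε) := by positivity
  have hθ5 : 0 ≤ legθ k / (4 * ε) := by positivity
  have hK6 : 0 ≤ K1 * K3 / 2 := by positivity
  have hK7 : 0 ≤ Kv * Wm ^ 2 / (4 * ε) + legθ k * Kv * Wm ^ 2 / 4 + Kd * Kv / (4 * ε) := by
    positivity
  rw [hCF, hCJ]
  clear hE hX0 hqv hLv hKBle hT0 hT hV hd hCF hCJ hKB hK3
  generalize legθ k * (Wm + B) ^ 2 / (4 * ε) = G1 at *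
  generalize legθ k / (4 * ε) = G2 at *
  generalize K1 * K3 / 2 = G3 at *
  generalize Kv * Wm ^ 2 / (4 * ε) + legθ k * Kv * Wm ^ 2 / 4 + Kd * Kv / (4 * ε) = G4 at *
  have hsum := source_sum_le (x := e.fu) (y := e.fq) (z := e.fp) (w := e.δ)
    hθ4 hθ5 hK6 hK7 hηpos.le
  clear hθ4 hθ5 hK6 hK7 hθW hpl a1 a2 a3 a4 hp2 hfp0 hMM hcB hc2 hlTu hlTq hlu hlq hlp hQr hQl
    hTu1 hTu2 hTu3 hTu4 hTq1 hTq2 hTq3 hTq4 hTp1 hTp2 hTp3 hvw hvn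
  linear_combination id + hdiss + tJ + tδ + f1 + f2 + f3 + f4 + hAlQl + hsum - hEδ

end ElemState.IsSol

/-! ### Consequences of the discrete equations on one element -/

lemma sub_eval_sq_le (y : ℝ[X]) {l r x : ℝ} (hx : x ∈ Icc l r) :
    (y.eval x - y.eval l) ^ 2 ≤
      (r - l) * ip l r (Polynomial.derivative y) (Polynomial.derivative y) := by
  have h1 := ip_derivative_add (l := l) (r := x) y 1
  simp only [Polynomial.derivative_one, ip_zero_right, Polynomial.eval_one, mul_one, add_zero] at h1
  have h2 := ip_cauchy_schwarz (Polynomial.derivative y) 1 hx.1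
  have h3 : ip l x 1 1 = x - l := by simp [ip]
  have h4 : ip l x (Polynomial.derivative y) (Polynomial.derivative y) ≤
      ip l r (Polynomial.derivative y) (Polynomial.derivative y) :=
    intervalIntegral.integral_mono_interval le_rfl hx.1 hx.2
      (Filter.Eventually.of_forall fun _ => mul_self_nonneg _) (ip_intervalIntegrable _ _)
  rw [h1, h3] at h2
  have h5 := ip_self_nonneg (Polynomial.derivative y) hx.1
  have h6 := hx.1
  have h7 := hx.2
  refine h2.trans ?_
  rw [mul_comm]
  exact mul_le_mul (by linarith) h4 h5 (by linarith)

/-- The discrete form of `y' = g` on one element, with jumps `A` and `A'` at the right and at the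
left end. -/
def IsLift (k : ℕ) (l r : ℝ) (y g : ℝ[X]) (A A' : ℝ) : Prop :=
  y ∈ Polynomial.degreeLT ℝ (k + 1) ∧ ∀ v ∈ Polynomial.degreeLT ℝ (k + 1),
    ip l r (Polynomial.derivative y) v + A * v.eval r - A' * v.eval l = ip l r g v

/-- Test with the derivative of y itself. Its end point values cost a factor (r - l)^{-1/2} each,
which is why the jumps are divided by the length. -/
lemma exists_lift_derivative_le (k : ℕ) : ∃ C : ℝ, 0 < C ∧ ∀ (l r : ℝ) (y g : ℝ[X]) (A A' : ℝ),
    l < r → IsLift k l r y g A A' →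
      ip l r (Polynomial.derivative y) (Polynomial.derivative y) ≤
        C * (ip l r g g + (A ^ 2 + A' ^ 2) / (r - l)) := by
  obtain ⟨C, hC, hCe⟩ := exists_eval_bound (k + 1)
  refine ⟨4 * (1 + C), by positivity, fun l r y g A A' h hy => ?_⟩
  have hd : Polynomial.derivative y ∈ Polynomial.degreeLT ℝ (k + 1) :=
    Polynomial.degreeLT_mono (Nat.le_succ k) (derivative_mem_degreeLT hy.1)
  have e := hy.2 _ hd
  have hη := sub_pos.2 h
  have hg := ip_self_nonneg g h.le
  have hX := ip_self_nonneg (Polynomial.derivative y) h.le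
  have hr := hCe l r h _ hd r (right_mem_Icc.2 h.le)
  have hl := hCe l r h _ hd l (left_mem_Icc.2 h.le)
  have hgy := ip_cauchy_schwarz g (Polynomial.derivative y) h.le
  generalize ip l r (Polynomial.derivative y) (Polynomial.derivative y) = X at *
  have hA : 0 ≤ A ^ 2 / (r - l) := by positivity
  have hA' : 0 ≤ A' ^ 2 / (r - l) := by positivity
  have t1 := (le_abs_self _).trans (young_mul hX hg one_pos.le (by norm_num : (0 : ℝ) < 1 / 4)
    (hgy.trans_eq (by ring)))
  have t2 := (neg_le_abs _).trans (young_mul hX hA hC.le (by norm_num : (0 : ℝ) < 1 / 4)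
    ((mul_sq_le_mul (le_refl (A ^ 2)) hr).trans_eq (by ring)))
  have t3 := (le_abs_self _).trans (young_mul hX hA' hC.le (by norm_num : (0 : ℝ) < 1 / 4)
    ((mul_sq_le_mul (le_refl (A' ^ 2)) hl).trans_eq (by ring)))
  rw [add_div]
  have := mul_nonneg hC.le hg
  norm_num at t1 t2 t3
  linarith

/-- The bound is expressed through the nodal value y(l) + A', since this single-valued quantity,
unlike y(l), can be summed from the boundary. -/
lemma ip_self_le_of_derivative_le {l r : ℝ} {y g : ℝ[X]} {A A' C : ℝ}
    (h : l < r) (hC : 0 ≤ C) (hX : ip l r (Polynomial.derivative y) (Polynomial.derivative y) ≤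
        C * (ip l r g g + (A ^ 2 + A' ^ 2) / (r - l))) :
    ip l r y y ≤ (4 + 2 * C) * (r - l) *
      ((y.eval l + A') ^ 2 + A ^ 2 + A' ^ 2 + (r - l) * ip l r g g) := by
  have hη := sub_pos.2 h
  have hg := ip_self_nonneg g h.le
  have h1 : ip l r y y ≤ (2 * y.eval l ^ 2 +
      2 * ((r - l) * ip l r (Polynomial.derivative y) (Polynomial.derivative y))) * (r - l) := by
    refine ip_self_le_of_bound h.le _ fun x hx => ?_
    have := sub_eval_sq_le y hx
    nlinarith [sq_nonneg (y.eval x - 2 * y.eval l)]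
  have h2 : (r - l) * ip l r (Polynomial.derivative y) (Polynomial.derivative y) ≤
      C * ((r - l) * ip l r g g + (A ^ 2 + A' ^ 2)) := by
    refine (mul_le_mul_of_nonneg_left hX hη.le).trans (le_of_eq ?_)
    field_simp
  have h3 : y.eval l ^ 2 ≤ 2 * (y.eval l + A') ^ 2 + 2 * A' ^ 2 := by
    nlinarith [sq_nonneg (y.eval l + 2 * A')]
  have hG : 0 ≤ (r - l) * ip l r g g := by positivity
  generalize (r - l) * ip l r g g = G at *
  have h4 : 2 * y.eval l ^ 2 +
      2 * ((r - l) * ip l r (Polynomial.derivative y) (Polynomial.derivative y)) ≤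
      (4 + 2 * C) * ((y.eval l + A') ^ 2 + A ^ 2 + A' ^ 2 + G) := by
    nlinarith [sq_nonneg A, mul_nonneg hC (sq_nonneg (y.eval l + A'))]
  calc _ ≤ _ := h1
    _ ≤ _ := mul_le_mul_of_nonneg_right h4 hη.le
    _ = _ := by ring

namespace ElemState

/-- The size of the sources. -/
def src (e : ElemState) (l r : ℝ) : ℝ :=
  (r - l) * (e.fu ^ 2 + e.fq ^ 2 + e.fp ^ 2) + e.δ ^ 2 / (r - l)

lemma src_eq (e : ElemState) (l r : ℝ) : e.src l r = (r - l) * e.fu ^ 2 + (r - l) * e.fq ^ 2 +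
    (r - l) * e.fp ^ 2 + e.δ ^ 2 / (r - l) := by
  rw [src]
  ring

lemma src_nonneg (e : ElemState) {l r : ℝ} (h : l < r) : 0 ≤ e.src l r := by
  have := sub_pos.2 h
  unfold src
  positivity

/-- The right-hand sides of the three equations. -/
def gu (e : ElemState) (k : ℕ) (l r : ℝ) : ℝ[X] := e.q - e.fq • leg k l r

def gq (e : ElemState) (k : ℕ) (l r : ℝ) : ℝ[X] := e.p - e.fp • leg k l r

def gp (e : ElemState) (k : ℕ) (l r : ℝ) : ℝ[X] :=
  (e.fu - legS k * e.δ / (legθ k * (r - l))) • leg k l r - e.D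

lemma ip_sub_self_le {l r : ℝ} (h : l ≤ r) (v w : ℝ[X]) :
    ip l r (v - w) (v - w) ≤ 2 * ip l r v v + 2 * ip l r w w := by
  have := ip_self_nonneg (v + w) h
  simp only [ip_sub_left, ip_sub_right, ip_add_left, ip_add_right] at *
  linarith

lemma ip_smul_leg (k : ℕ) {l r : ℝ} (h : l < r) (c : ℝ) :
    ip l r (c • leg k l r) (c • leg k l r) = legθ k * ((r - l) * c ^ 2) := by
  rw [ip_smul_left, ip_smul_right, leg_self k h]
  ring

lemma ip_gu_le (e : ElemState) (k : ℕ) {l r : ℝ} (h : l < r) :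
    ip l r (e.gu k l r) (e.gu k l r) ≤
      2 * ip l r e.q e.q + 2 * (legθ k * ((r - l) * e.fq ^ 2)) := by
  rw [← ip_smul_leg k h]
  exact ip_sub_self_le h.le _ _

lemma ip_gq_le (e : ElemState) (k : ℕ) {l r : ℝ} (h : l < r) :
    ip l r (e.gq k l r) (e.gq k l r) ≤
      2 * ip l r e.p e.p + 2 * (legθ k * ((r - l) * e.fp ^ 2)) := by
  rw [← ip_smul_leg k h]
  exact ip_sub_self_le h.le _ _

lemma ip_gp_le (e : ElemState) (k : ℕ) {l r : ℝ} (h : l < r) :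
    ip l r (e.gp k l r) (e.gp k l r) ≤ 2 * ip l r e.D e.D +
      4 * (legθ k + legS k ^ 2 / legθ k) * e.src l r := by
  refine (ip_sub_self_le h.le _ _).trans ?_
  rw [ip_smul_leg k h]
  have hη := sub_pos.2 h
  have hθ := legθ_pos k
  have h1 : (e.fu - legS k * e.δ / (legθ k * (r - l))) ^ 2 ≤
      2 * e.fu ^ 2 + 2 * (legS k * e.δ / (legθ k * (r - l))) ^ 2 := by
    nlinarith [sq_nonneg (e.fu + legS k * e.δ / (legθ k * (r - l)))]
  have h2 : legθ k * ((r - l) * (e.fu - legS k * e.δ / (legθ k * (r - l))) ^ 2) ≤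
      2 * legθ k * ((r - l) * e.fu ^ 2) + 2 * (legS k ^ 2 / legθ k) * (e.δ ^ 2 / (r - l)) := by
    have := mul_le_mul_of_nonneg_left h1 (mul_pos hθ hη).le
    have e1 : legθ k * (r - l) * (legS k * e.δ / (legθ k * (r - l))) ^ 2 =
      (legS k ^ 2 / legθ k) * (e.δ ^ 2 / (r - l)) := by field_simp
    nlinarith
  have h3 : 0 ≤ legS k ^ 2 / legθ k := by positivity
  have h4 : 0 ≤ e.δ ^ 2 / (r - l) := by positivity
  have h5 : 0 ≤ (r - l) * e.fu ^ 2 := by positivity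
  have h6 : 0 ≤ (r - l) * e.fp ^ 2 := by positivity
  have h7 : 0 ≤ (r - l) * e.fq ^ 2 := by positivity
  rw [e.src_eq]
  generalize (r - l) * e.fu ^ 2 = x1 at *
  generalize (r - l) * e.fq ^ 2 = x2 at *
  generalize (r - l) * e.fp ^ 2 = x3 at *
  generalize e.δ ^ 2 / (r - l) = x4 at *
  generalize legS k ^ 2 / legθ k = G at *
  have : 0 ≤ legθ k * (x2 + x3 + x4) + G * (x1 + x2 + x3) := by positivity
  linarith

lemma src_ge (e : ElemState) {l r : ℝ} (h : l < r) : (r - l) * e.fu ^ 2 ≤ e.src l r ∧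
    (r - l) * e.fq ^ 2 ≤ e.src l r ∧ (r - l) * e.fp ^ 2 ≤ e.src l r ∧
    e.δ ^ 2 ≤ (r - l) * e.src l r := by
  have hη := sub_pos.2 h
  have h4 : 0 ≤ e.δ ^ 2 / (r - l) := by positivity
  have h5 : 0 ≤ (r - l) * e.fu ^ 2 := by positivity
  have h6 : 0 ≤ (r - l) * e.fp ^ 2 := by positivity
  have h7 : 0 ≤ (r - l) * e.fq ^ 2 := by positivity
  have h8 : e.δ ^ 2 = (r - l) * (e.δ ^ 2 / (r - l)) := by field_simp
  rw [e.src_eq]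
  exact ⟨by linarith, by linarith, by linarith,
    h8.le.trans (mul_le_mul_of_nonneg_left (by linarith) hη.le)⟩

namespace IsSol

variable {e : ElemState} {k : ℕ} {l r tL sL tR M : ℝ}

lemma lift_u (he : e.IsSol k l r tL sL tR) :
    IsLift k l r e.u (e.gu k l r) (e.ur - e.u.eval r) (e.ul - e.u.eval l) :=
  ⟨he.mem_u, fun v hv => by rw [he.eq_u v hv, gu, ip_sub_left, ip_smul_left]⟩

lemma lift_q (he : e.IsSol k l r tL sL tR) :
    IsLift k l r e.q (e.gq k l r) (e.qr - e.q.eval r) (e.ql - e.q.eval l) :=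
  ⟨he.mem_q, fun v hv => by rw [he.eq_q v hv, gq, ip_sub_left, ip_smul_left]⟩

lemma lift_p (he : e.IsSol k l r tL sL tR) :
    IsLift k l r e.p (e.gp k l r) (e.pr - e.p.eval r) (e.pl - e.p.eval l) :=
  ⟨he.mem_p, fun v hv => by rw [he.eq_p v hv, gp, ip_sub_left, ip_smul_left]⟩

end IsSol

end ElemState

/-- Testing with the Legendre polynomial relates the two jumps. -/
lemma IsLift.jump_eq {k : ℕ} {l r : ℝ} {y g : ℝ[X]} {A A' : ℝ} (h : l < r)
    (hy : IsLift k l r y g A A') : A = legS k * A' + ip l r (leg k l r) g := by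
  have h1 := hy.2 (leg k l r) (leg_mem k)
  rw [ip_comm _ (leg k l r), ip_leg_derivative h hy.1, leg_right k h, leg_left k,
    ip_comm g] at h1
  linarith

/-- The three relations between left and right jumps, obtained by testing with L. Eliminating A and
B leaves s A' (τ - σ/τ + t) on one side. The coefficient is at least τ because σ ≤ 0 ≤ t, so A' is
determined by the data, and then A and B are. -/
lemma jump_system_le {s t τ σ A A' B E1 E2 E3 δ M J : ℝ} (hs : s ≠ 0) (ht : 0 ≤ t)
    (hσ : σ ≤ 0) (hσ2 : σ ^ 2 ≤ 4) (hτ : 0 < τ) (hτM : τ ≤ M) (hτM' : τ⁻¹ ≤ M) (hM : 1 ≤ M)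
    (hA : A = s * A' + E1) (hQ : τ * A + τ⁻¹ * B = s * (-t * A') + E2)
    (hB : B = s * (-σ * A' + δ) + E3) (hJ : J = A' ^ 2 + A ^ 2 + B ^ 2) :
    J ≤ (4 * M ^ 4 / s ^ 2 + 56 * M ^ 4 + 8) * (E1 ^ 2 + E2 ^ 2 + E3 ^ 2 + s ^ 2 * δ ^ 2) := by
  have hi := inv_pos.2 hτ
  have h0 : τ * τ⁻¹ = 1 := mul_inv_cancel₀ hτ.ne'
  have key : s * A' * (τ - σ * τ⁻¹ + t) = E2 - τ * E1 - τ⁻¹ * E3 - τ⁻¹ * (s * δ) := by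
    rw [hB, hA] at hQ
    linear_combination hQ
  have hκ : τ ≤ τ - σ * τ⁻¹ + t := by
    linear_combination ht + mul_nonneg (neg_nonneg.2 hσ) hi.le
  have hτ2 : τ ^ 2 ≤ M ^ 2 := pow_le_pow_left₀ hτ.le hτM 2
  have hi2 : τ⁻¹ ^ 2 ≤ M ^ 2 := pow_le_pow_left₀ hi.le hτM' 2
  have hM2 : 1 ≤ M ^ 2 := one_le_pow₀ hM
  obtain ⟨E, hE⟩ : ∃ x, x = E1 ^ 2 + E2 ^ 2 + E3 ^ 2 + s ^ 2 * δ ^ 2 := ⟨_, rfl⟩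
  have hsδ : 0 ≤ s ^ 2 * δ ^ 2 := by positivity
  have hE0 : 0 ≤ E := by rw [hE]; positivity
  have h1 : (s * A' * τ) ^ 2 ≤ 4 * M ^ 2 * E := by
    have h2 : (s * A' * τ) ^ 2 ≤ (s * A' * (τ - σ * τ⁻¹ + t)) ^ 2 := by
      rw [mul_pow, mul_pow _ (τ - σ * τ⁻¹ + t)]
      gcongr
    have h3 : (E2 - τ * E1 - τ⁻¹ * E3 - τ⁻¹ * (s * δ)) ^ 2 ≤
        4 * (E2 ^ 2 + (τ * E1) ^ 2 + (τ⁻¹ * E3) ^ 2 + (τ⁻¹ * (s * δ)) ^ 2) := by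
      generalize τ * E1 = x
      generalize τ⁻¹ * E3 = y
      generalize τ⁻¹ * (s * δ) = z
      linear_combination sq_nonneg (E2 + x) + sq_nonneg (E2 + y) + sq_nonneg (E2 + z) +
        sq_nonneg (x - y) + sq_nonneg (x - z) + sq_nonneg (y - z)
    rw [key] at h2
    have h4 : (τ * E1) ^ 2 ≤ M ^ 2 * E1 ^ 2 := by rw [mul_pow]; gcongr
    have h5 : (τ⁻¹ * E3) ^ 2 ≤ M ^ 2 * E3 ^ 2 := by rw [mul_pow]; gcongr
    have h6 : (τ⁻¹ * (s * δ)) ^ 2 ≤ M ^ 2 * (s ^ 2 * δ ^ 2) := by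
      rw [mul_pow, mul_pow s]; gcongr
    have h7 : E2 ^ 2 ≤ M ^ 2 * E2 ^ 2 := le_mul_of_one_le_left (sq_nonneg _) hM2
    rw [hE]
    linear_combination h2 + h3 + 4 * h4 + 4 * h5 + 4 * h6 + 4 * h7
  have h2 : (s * A') ^ 2 ≤ 4 * M ^ 4 * E := by
    have : (s * A') ^ 2 = (s * A' * τ) ^ 2 * τ⁻¹ ^ 2 := by
      linear_combination (-(s * A') ^ 2 * (1 + τ * τ⁻¹)) * h0
    rw [this]
    calc _ ≤ 4 * M ^ 2 * E * M ^ 2 := by gcongr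
      _ = _ := by ring
  have h3 : A' ^ 2 ≤ 4 * M ^ 4 / s ^ 2 * E := by
    have hs2 : 0 < s ^ 2 := by positivity
    rw [div_mul_eq_mul_div, le_div_iff₀ hs2]
    linear_combination h2
  have hE1 : E1 ^ 2 ≤ E := by
    rw [hE]; linear_combination sq_nonneg E2 + sq_nonneg E3 + hsδ
  have h4 : A ^ 2 ≤ 2 * (4 * M ^ 4 * E) + 2 * E := by
    rw [hA]
    linear_combination sq_nonneg (s * A' - E1) + 2 * h2 + 2 * hE1
  have h5 : B ^ 2 ≤ 3 * (4 * (4 * M ^ 4 * E)) + 6 * E := by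
    have h6 : (σ * (s * A')) ^ 2 ≤ 4 * (4 * M ^ 4 * E) := by
      rw [mul_pow]
      exact mul_le_mul hσ2 h2 (sq_nonneg _) zero_le_four
    have h7 : B ^ 2 ≤ 3 * ((σ * (s * A')) ^ 2 + (s * δ) ^ 2 + E3 ^ 2) := by
      rw [show B = -(σ * (s * A')) + s * δ + E3 by rw [hB]; ring]
      generalize σ * (s * A') = x
      generalize s * δ = y
      linear_combination sq_nonneg (x + y) + sq_nonneg (x + E3) + sq_nonneg (y - E3)
    have h8 : (s * δ) ^ 2 + E3 ^ 2 ≤ E := by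
      rw [hE]; linear_combination sq_nonneg E1 + sq_nonneg E2
    linear_combination h7 + 3 * h6 + 3 * h8 + 3 * hE0
  rw [hJ, ← hE]
  linear_combination h3 + h4 + h5

namespace ElemState.IsSol

variable {e : ElemState} {k : ℕ} {l r tL sL tR M : ℝ}

/-- Tests with L remove the derivatives and leave a linear system for the jumps whose data are inner
products with L; each of these gains √η from the norm of L. -/
lemma exists_jump_le (k : ℕ) (M : ℝ) (hM : 1 ≤ M) : ∃ C : ℝ, 0 < C ∧
    ∀ (e : ElemState) (l r tL sL tR : ℝ), l < r → ElemAdm M tL sL tR → e.IsSol k l r tL sL tR →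
      e.jump l r ≤ C * ((r - l) * (ip l r e.q e.q + ip l r e.p e.p + ip l r e.D e.D + e.src l r)) := by
  have hθ := legθ_pos k
  have hs := legS_ne k
  obtain ⟨G, hG⟩ : ∃ x, x = 2 * legθ k + legθ k * (2 * legθ k) + legθ k * (2 * legθ k) +
    legθ k * (4 * (legθ k + legS k ^ 2 / legθ k)) + legS k ^ 2 := ⟨_, rfl⟩
  obtain ⟨C, hC⟩ : ∃ x, x = 4 * M ^ 4 / legS k ^ 2 + 56 * M ^ 4 + 8 := ⟨_, rfl⟩
  have hG0 : 0 < G := by rw [hG]; positivity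
  have hC0 : 0 < C := by rw [hC]; positivity
  refine ⟨C * G, by positivity, fun e l r tL sL tR h ha he => ?_⟩
  have hη := sub_pos.2 h
  have h1 := he.lift_u.jump_eq h
  have h2 := he.lift_q.jump_eq h
  have h3 := he.lift_p.jump_eq h
  rw [he.flux_qr, he.flux_ql] at h2
  rw [he.flux_pl] at h3
  have hsys := jump_system_le (J := e.jump l r) hs ha.tL_nonneg
    (by nlinarith [ha.sL_le, sq_nonneg tL]) ha.sL_sq_le ha.tR_pos ha.tR_le ha.tR_inv_le hM
    h1 h2 h3 rfl
  rw [← hC] at hsys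
  refine hsys.trans ?_
  rw [mul_assoc]
  refine mul_le_mul_of_nonneg_left ?_ hC0.le
  have b1 := (ip_leg_sq_le k h (e.gu k l r)).trans
    (mul_le_mul_of_nonneg_left (e.ip_gu_le k h) (by positivity))
  have b2 := (ip_leg_sq_le k h (e.gq k l r)).trans
    (mul_le_mul_of_nonneg_left (e.ip_gq_le k h) (by positivity))
  have b3 := (ip_leg_sq_le k h (e.gp k l r)).trans
    (mul_le_mul_of_nonneg_left (e.ip_gp_le k h) (by positivity))
  obtain ⟨s1, s2, s3, s4⟩ := e.src_ge h
  have hS := e.src_nonneg h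
  have hq := ip_self_nonneg e.q h.le
  have hp := ip_self_nonneg e.p h.le
  have hD := ip_self_nonneg e.D h.le
  have b4 : legS k ^ 2 * e.δ ^ 2 ≤ legS k ^ 2 * ((r - l) * e.src l r) := by gcongr
  have c1 : legθ k * (r - l) * (2 * ip l r e.q e.q + 2 * (legθ k * ((r - l) * e.fq ^ 2))) ≤
    legθ k * (r - l) * (2 * ip l r e.q e.q + 2 * (legθ k * e.src l r)) := by gcongr
  have c2 : legθ k * (r - l) * (2 * ip l r e.p e.p + 2 * (legθ k * ((r - l) * e.fp ^ 2))) ≤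
    legθ k * (r - l) * (2 * ip l r e.p e.p + 2 * (legθ k * e.src l r)) := by gcongr
  generalize ip l r e.q e.q = nq at *
  generalize ip l r e.p e.p = np at *
  generalize ip l r e.D e.D = nD at *
  generalize e.src l r = S at *
  clear hsys h1 h2 h3 ha he s1 s2 s3 s4
  have hθθ : 0 ≤ legS k ^ 2 / legθ k := by positivity
  rw [hG]
  have : 0 ≤ (r - l) * ((legθ k * (2 * legθ k) + legθ k * (2 * legθ k) +
    legθ k * (4 * (legθ k + legS k ^ 2 / legθ k)) + legS k ^ 2) * (nq + np + nD) +
    2 * legθ k * S) := by positivity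
  linear_combination b1 + c1 + b2 + c2 + b3 + b4 + this

/-- Since k > 0, L is orthogonal to constants and (L,p) = (L, p - p(l)). The difference costs a
derivative of p, which the third equation bounds by D, the sources and jumps. The norm of L gives
one factor of η and the oscillation of p two more in the square. -/
lemma exists_leg_p_le (k : ℕ) (hk : 0 < k) (M : ℝ) (hM : 1 ≤ M) : ∃ C : ℝ, 0 < C ∧
    ∀ (e : ElemState) (l r tL sL tR : ℝ), l < r → ElemAdm M tL sL tR → e.IsSol k l r tL sL tR →
      (ip l r (leg k l r) e.p) ^ 2 ≤ C * ((r - l) ^ 3 *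
        (ip l r e.q e.q + ip l r e.p e.p + ip l r e.D e.D + e.src l r)) := by
  obtain ⟨CJ, hCJ, hJ⟩ := exists_jump_le k M hM
  obtain ⟨Cd, hCd, hd⟩ := exists_lift_derivative_le k
  have hθ := legθ_pos k
  refine ⟨legθ k * (Cd * (2 + 4 * (legθ k + legS k ^ 2 / legθ k) + 9 * CJ + 2)), by positivity,
    fun e l r tL sL tR h ha he => ?_⟩
  have hη := sub_pos.2 h
  have hj := hJ e l r tL sL tR h ha he
  have hX := hd l r _ _ _ _ h he.lift_p
  obtain ⟨s1, s2, s3, s4⟩ := e.src_ge h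
  have hS := e.src_nonneg h
  have hq := ip_self_nonneg e.q h.le
  have hp := ip_self_nonneg e.p h.le
  have hD := ip_self_nonneg e.D h.le
  have hg := e.ip_gp_le k h
  obtain ⟨a3, a1, a2⟩ := jump_sq_le e l r
  have hB' : (e.pl - e.p.eval l) ^ 2 ≤ 8 * e.jump l r + 2 * e.δ ^ 2 := by
    rw [he.flux_pl]
    have h4 : (sL * (e.ul - e.u.eval l)) ^ 2 ≤ 4 * e.jump l r := by
      rw [mul_pow]
      exact mul_le_mul ha.sL_sq_le a3 (sq_nonneg _) zero_le_four
    nlinarith [sq_nonneg (sL * (e.ul - e.u.eval l) + e.δ)]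
  have hN : ((e.pr - e.p.eval r) ^ 2 + (e.pl - e.p.eval l) ^ 2) / (r - l) ≤
      9 * CJ * (ip l r e.q e.q + ip l r e.p e.p + ip l r e.D e.D + e.src l r) +
        2 * e.src l r := by
    rw [div_le_iff₀ hη]
    linear_combination a2 + hB' + 9 * hj + 2 * s4
  have hL : (ip l r (leg k l r) e.p) ^ 2 ≤ legθ k * (r - l) *
      ((r - l) * ip l r (Polynomial.derivative e.p) (Polynomial.derivative e.p) * (r - l)) := by
    have h1 : ip l r (leg k l r) e.p = ip l r (leg k l r) (e.p - Polynomial.C (e.p.eval l)) := by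
      rw [ip_sub_right, ← mul_one (Polynomial.C _), ← Polynomial.smul_eq_C_mul, ip_smul_right,
        leg_orth k h (one_mem_degreeLT hk)]
      ring
    rw [h1]
    refine (ip_leg_sq_le k h _).trans (mul_le_mul_of_nonneg_left ?_ (by positivity))
    refine ip_self_le_of_bound h.le _ fun x hx => ?_
    simpa using sub_eval_sq_le e.p hx
  have hX' : ip l r (Polynomial.derivative e.p) (Polynomial.derivative e.p) ≤
      Cd * (2 + 4 * (legθ k + legS k ^ 2 / legθ k) + 9 * CJ + 2) *
        (ip l r e.q e.q + ip l r e.p e.p + ip l r e.D e.D + e.src l r) := by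
    refine hX.trans ?_
    rw [mul_assoc]
    refine mul_le_mul_of_nonneg_left ?_ hCd.le
    have hG : 0 ≤ 4 * (legθ k + legS k ^ 2 / legθ k) := by positivity
    generalize 4 * (legθ k + legS k ^ 2 / legθ k) = G at *
    generalize ip l r e.q e.q = nq at *
    generalize ip l r e.p e.p = np at *
    generalize ip l r e.D e.D = nD at *
    generalize e.src l r = S at *
    have : 0 ≤ G * (nq + np + nD) := by positivity
    linarith
  refine hL.trans ?_
  linear_combination mul_le_mul_of_nonneg_left hX' (by positivity : 0 ≤ legθ k * (r - l) ^ 3)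

end ElemState.IsSol

/-! ### Sums over the mesh -/

lemma sum_succ_sub_castSucc {N : ℕ} (g : Fin (N + 1) → ℝ) :
    ∑ i : Fin N, (g i.succ - g i.castSucc) = g (Fin.last N) - g 0 := by
  have h1 := Fin.sum_univ_succ g
  have h2 := Fin.sum_univ_castSucc g
  rw [Finset.sum_sub_distrib]
  linarith

lemma abs_sub_last_le {N : ℕ} (g : Fin (N + 1) → ℝ) (j : Fin (N + 1)) :
    |g j - g (Fin.last N)| ≤ ∑ i : Fin N, |g i.succ - g i.castSucc| := by
  -- Freezing g to the left of j turns the sum over the whole mesh into the increment from j to the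
  -- last node.
  have h1 := sum_succ_sub_castSucc fun x => g (max j x)
  rw [max_eq_right (Fin.le_last j), max_eq_left (Fin.zero_le j)] at h1
  rw [abs_sub_comm, ← h1]
  refine (Finset.abs_sum_le_sum_abs _ _).trans (Finset.sum_le_sum fun i _ => ?_)
  rcases le_or_gt j i.castSucc with h | h
  · rw [max_eq_right h, max_eq_right (h.trans i.castSucc_lt_succ.le)]
  · rw [max_eq_left h.le, max_eq_left (Fin.castSucc_lt_iff_succ_le.1 h), sub_self, abs_zero]
    positivity

namespace Mesh

variable {a b : ℝ} {N : ℕ} (𝒯 : Mesh a b N)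

lemma left_lt_right (i : Fin N) : 𝒯.left i < 𝒯.right i :=
  𝒯.strictMono i.castSucc_lt_succ

lemma len_pos (i : Fin N) : 0 < 𝒯.right i - 𝒯.left i := sub_pos.2 (𝒯.left_lt_right i)

lemma len_le_size (i : Fin N) : 𝒯.right i - 𝒯.left i ≤ 𝒯.size :=
  le_ciSup (f := fun i : Fin N => 𝒯.right i - 𝒯.left i) (Set.finite_range _).bddAbove i

lemma le_left (i : Fin N) : a ≤ 𝒯.left i := by
  have h := 𝒯.strictMono.monotone (Fin.zero_le i.castSucc)
  rwa [𝒯.node_zero] at h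

lemma right_le (i : Fin N) : 𝒯.right i ≤ b := by
  have h := 𝒯.strictMono.monotone (Fin.le_last i.succ)
  rwa [𝒯.node_last] at h

lemma len_le (i : Fin N) : 𝒯.right i - 𝒯.left i ≤ b - a := by
  linarith [𝒯.le_left i, 𝒯.right_le i]

lemma sum_len : ∑ i, (𝒯.right i - 𝒯.left i) = b - a := by
  have h := sum_succ_sub_castSucc 𝒯.node
  rwa [𝒯.node_zero, 𝒯.node_last] at h

lemma size_nonneg : 0 ≤ 𝒯.size := Real.iSup_nonneg fun i => (𝒯.len_pos i).le

lemma le (𝒯 : Mesh a b N) : a ≤ b := by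
  have := 𝒯.sum_len
  have h : 0 ≤ ∑ i, (𝒯.right i - 𝒯.left i) := Finset.sum_nonneg fun i _ => (𝒯.len_pos i).le
  linarith

/-- The square of the `L²` norm of a piecewise polynomial. -/
def normSq (y : Fin N → ℝ[X]) : ℝ := ∑ i, ip (𝒯.left i) (𝒯.right i) (y i) (y i)

lemma normSq_nonneg (y : Fin N → ℝ[X]) : 0 ≤ 𝒯.normSq y :=
  Finset.sum_nonneg fun i _ => ip_self_nonneg _ (𝒯.left_lt_right i).le

/-- A sum over the elements weighted by their lengths. -/
def lenSum (f : Fin N → ℝ) : ℝ := ∑ i, (𝒯.right i - 𝒯.left i) * f i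

lemma lenSum_nonneg {f : Fin N → ℝ} (hf : ∀ i, 0 ≤ f i) : 0 ≤ 𝒯.lenSum f :=
  Finset.sum_nonneg fun i _ => mul_nonneg (𝒯.len_pos i).le (hf i)

lemma lenSum_le {f : Fin N → ℝ} (hf : ∀ i, 0 ≤ f i) : 𝒯.lenSum f ≤ 𝒯.size * ∑ i, f i := by
  rw [Finset.mul_sum]
  exact Finset.sum_le_sum fun i _ => mul_le_mul_of_nonneg_right (𝒯.len_le_size i) (hf i)

/-- Tested with 1, the equation says that the nodal values grow by the integral of g over each
element; summation starts at the right end, where the value is zero. -/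
lemma sq_nodal_le {y g : Fin N → ℝ[X]} {k : ℕ} {A A' : Fin N → ℝ} {yn : Fin (N + 1) → ℝ}
    (hy : ∀ i, IsLift k (𝒯.left i) (𝒯.right i) (y i) (g i) (A i) (A' i))
    (hl : ∀ i, yn i.castSucc = (y i).eval (𝒯.left i) + A' i)
    (hr : ∀ i, yn i.succ = (y i).eval (𝒯.right i) + A i) (h0 : yn (Fin.last N) = 0)
    (j : Fin (N + 1)) : yn j ^ 2 ≤ (b - a) * 𝒯.normSq g := by
  have h1 : ∀ i, yn i.succ - yn i.castSucc = ip (𝒯.left i) (𝒯.right i) 1 (g i) := by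
    intro i
    have h2 := (hy i).2 1 (one_mem_degreeLT (Nat.succ_pos k))
    have h3 := ip_derivative_add (l := 𝒯.left i) (r := 𝒯.right i) (y i) 1
    simp only [Polynomial.derivative_one, ip_zero_right, Polynomial.eval_one, mul_one,
      add_zero] at h2 h3
    rw [hl, hr, ip_comm 1]
    linarith
  have h2 := abs_sub_last_le yn j
  rw [h0, sub_zero] at h2
  have h3 : (∑ i : Fin N, |yn i.succ - yn i.castSucc|) ^ 2 ≤ (b - a) * 𝒯.normSq g := by
    rw [← 𝒯.sum_len, normSq]
    refine Finset.sum_sq_le_sum_mul_sum_of_sq_le_mul _ (fun i _ => (𝒯.len_pos i).le)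
      (fun i _ => ip_self_nonneg _ (𝒯.left_lt_right i).le) fun i _ => ?_
    rw [sq_abs, h1]
    refine (ip_cauchy_schwarz _ _ (𝒯.left_lt_right i).le).trans_eq ?_
    simp [ip]
  rw [← sq_abs]
  exact (pow_le_pow_left₀ (abs_nonneg _) h2 2).trans h3

end Mesh

/-- A Poincaré inequality common to u, q and p minus a constant: nodal values from `sq_nodal_le`,
oscillation inside the elements from `exists_lift_derivative_le`. -/
lemma exists_normSq_lift_le (k : ℕ) (a b : ℝ) (hab : a < b) : ∃ C : ℝ, 0 < C ∧
    ∀ (N : ℕ) (𝒯 : Mesh a b N) (y g : Fin N → ℝ[X]) (A A' : Fin N → ℝ) (yn : Fin (N + 1) → ℝ),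
      (∀ i, IsLift k (𝒯.left i) (𝒯.right i) (y i) (g i) (A i) (A' i)) →
      (∀ i, yn i.castSucc = (y i).eval (𝒯.left i) + A' i) →
      (∀ i, yn i.succ = (y i).eval (𝒯.right i) + A i) → yn (Fin.last N) = 0 →
      𝒯.normSq y ≤ C * (𝒯.normSq g + 𝒯.lenSum fun i => A i ^ 2 + A' i ^ 2) := by
  obtain ⟨C, hC, hd⟩ := exists_lift_derivative_le k
  have hba := sub_pos.2 hab
  refine ⟨(4 + 2 * C) * (2 * (b - a) ^ 2 + 1), by positivity,
    fun N 𝒯 y g A A' yn hy hl hr h0 => ?_⟩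
  have h1 : ∀ i, ip (𝒯.left i) (𝒯.right i) (y i) (y i) ≤ (4 + 2 * C) *
      ((𝒯.right i - 𝒯.left i) * ((b - a) * 𝒯.normSq g) +
        (𝒯.right i - 𝒯.left i) * (A i ^ 2 + A' i ^ 2) +
        (b - a) ^ 2 * ip (𝒯.left i) (𝒯.right i) (g i) (g i)) := by
    intro i
    have hη := 𝒯.len_pos i
    refine (ip_self_le_of_derivative_le (𝒯.left_lt_right i) hC.le
      (hd _ _ _ _ _ _ (𝒯.left_lt_right i) (hy i))).trans ?_
    rw [mul_assoc]
    refine mul_le_mul_of_nonneg_left ?_ (by positivity)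
    have h2 := 𝒯.sq_nodal_le hy hl hr h0 i.castSucc
    rw [hl] at h2
    have h3 := mul_le_mul_of_nonneg_left h2 hη.le
    have h4 : (𝒯.right i - 𝒯.left i) ^ 2 ≤ (b - a) ^ 2 := by
      have := 𝒯.len_le i
      gcongr
    have h5 := mul_le_mul_of_nonneg_right h4 (ip_self_nonneg (g i) (𝒯.left_lt_right i).le)
    linear_combination h3 + h5
  have h2 := Finset.sum_le_sum fun i (_ : i ∈ Finset.univ) => h1 i
  rw [← Finset.mul_sum, Finset.sum_add_distrib, Finset.sum_add_distrib, ← Finset.sum_mul,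
    𝒯.sum_len, ← Finset.mul_sum] at h2
  rw [Mesh.lenSum]
  refine h2.trans ?_
  rw [mul_assoc]
  refine mul_le_mul_of_nonneg_left ?_ (by positivity)
  have h3 : 0 ≤ ∑ i, (𝒯.right i - 𝒯.left i) * (A i ^ 2 + A' i ^ 2) :=
    Finset.sum_nonneg fun i _ => mul_nonneg (𝒯.len_pos i).le (by positivity)
  have h4 := 𝒯.normSq_nonneg g
  have h5 : ∑ i, ip (𝒯.left i) (𝒯.right i) (g i) (g i) = 𝒯.normSq g := rfl
  rw [h5]
  have : 0 ≤ (b - a) ^ 2 * ∑ i, (𝒯.right i - 𝒯.left i) * (A i ^ 2 + A' i ^ 2) := by positivity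
  linear_combination h4 + 2 * this

/-! ### The discrete equations on the mesh -/

section

variable {a b : ℝ} {N : ℕ}

/-- The HDG error equations on the whole mesh, with homogeneous boundary conditions. -/
structure IsGlobalSol (𝒯 : Mesh a b N) (k : ℕ) (τ : Stabilization N) (e : Fin N → ElemState) :
    Prop where
  sol : ∀ i, (e i).IsSol k (𝒯.left i) (𝒯.right i) (τ.quL i) (τ.puL i) (τ.quR i)
  nodal_u : ∃ y : Fin (N + 1) → ℝ, y 0 = 0 ∧ y (Fin.last N) = 0 ∧
    ∀ i, (e i).ul = y i.castSucc ∧ (e i).ur = y i.succ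
  nodal_q : ∃ y : Fin (N + 1) → ℝ, y (Fin.last N) = 0 ∧
    ∀ i, (e i).ql = y i.castSucc ∧ (e i).qr = y i.succ
  nodal_p : ∃ y : Fin (N + 1) → ℝ, ∀ i, (e i).pl = y i.castSucc ∧ (e i).pr = y i.succ

/-- The stabilization parameters are admissible with bound `M`. -/
def Stabilization.Adm (τ : Stabilization N) (M : ℝ) : Prop :=
  ∀ i, ElemAdm M (τ.quL i) (τ.puL i) (τ.quR i)

variable (𝒯 : Mesh a b N) (e : Fin N → ElemState)

/-- The sum of the squares of all jumps. -/
def jumpSum : ℝ := ∑ i, (e i).jump (𝒯.left i) (𝒯.right i)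

/-- The sum of the sizes of all sources. -/
def srcSum : ℝ := ∑ i, (e i).src (𝒯.left i) (𝒯.right i)

/-- The sum of the squares of all source amplitudes, weighted by the lengths. -/
def srcSum' : ℝ := 𝒯.lenSum fun i => (e i).fu ^ 2 + (e i).fq ^ 2 + (e i).fp ^ 2 + (e i).δ ^ 2

/-- The weighted `L²` inner product of two piecewise polynomials. -/
def wipSum (W : ℝ) (v w : Fin N → ℝ[X]) : ℝ :=
  ∑ i, wip (𝒯.left i) (𝒯.right i) (W + (𝒯.left i - a)) (v i) (w i)

/-- The pairing of amplitudes with the weighted top coefficients of a piecewise polynomial. -/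
def pairing (k : ℕ) (W : ℝ) (f : Fin N → ℝ) (p : Fin N → ℝ[X]) : ℝ :=
  ∑ i, f i * wip (𝒯.left i) (𝒯.right i) (W + (𝒯.left i - a)) (p i)
    (leg k (𝒯.left i) (𝒯.right i))

lemma jumpSum_nonneg : 0 ≤ jumpSum 𝒯 e := Finset.sum_nonneg fun i _ => (e i).jump_nonneg _ _

lemma srcSum_nonneg : 0 ≤ srcSum 𝒯 e :=
  Finset.sum_nonneg fun i _ => (e i).src_nonneg (𝒯.left_lt_right i)

variable {𝒯 e} {k : ℕ} {τ : Stabilization N} {M : ℝ}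

/-- The numerical traces are single valued and the weight is continuous, so interior nodes cancel.
At b both traces of u and q vanish, at a that of u does; what is left is W/2 times the square of the
trace of q at a. No condition on the trace of p is needed, since it occurs multiplied by that of u.
-/
lemma IsGlobalSol.telescope (he : IsGlobalSol 𝒯 k τ e) {W : ℝ} (hW : 0 ≤ W) :
    0 ≤ ∑ i, ((W + (𝒯.left i - a) + (𝒯.right i - 𝒯.left i)) *
        ((e i).pr * (e i).ur - 1 / 2 * (e i).qr ^ 2)
      - (W + (𝒯.left i - a)) * ((e i).pl * (e i).ul - 1 / 2 * (e i).ql ^ 2)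
      - ((e i).ur * (e i).qr - (e i).ul * (e i).ql)) := by
  obtain ⟨un, hu0, huN, hu⟩ := he.nodal_u
  obtain ⟨qn, hqN, hq⟩ := he.nodal_q
  obtain ⟨pn, hp⟩ := he.nodal_p
  have h1 := sum_succ_sub_castSucc fun j => (W + (𝒯.node j - a)) *
    (pn j * un j - 1 / 2 * qn j ^ 2) - un j * qn j
  have h2 : ∑ i, ((W + (𝒯.left i - a) + (𝒯.right i - 𝒯.left i)) *
        ((e i).pr * (e i).ur - 1 / 2 * (e i).qr ^ 2)
      - (W + (𝒯.left i - a)) * ((e i).pl * (e i).ul - 1 / 2 * (e i).ql ^ 2)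
      - ((e i).ur * (e i).qr - (e i).ul * (e i).ql)) = ∑ i : Fin N, (((W + (𝒯.node i.succ - a)) *
    (pn i.succ * un i.succ - 1 / 2 * qn i.succ ^ 2) - un i.succ * qn i.succ) -
      ((W + (𝒯.node i.castSucc - a)) *
    (pn i.castSucc * un i.castSucc - 1 / 2 * qn i.castSucc ^ 2) - un i.castSucc * qn i.castSucc)) := by
    refine Finset.sum_congr rfl fun i _ => ?_
    rw [(hu i).1, (hu i).2, (hq i).1, (hq i).2, (hp i).1, (hp i).2, Mesh.left, Mesh.right]
    ring
  rw [h2, h1, hu0, huN, hqN, 𝒯.node_zero]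
  have : 0 ≤ W * qn 0 ^ 2 := by positivity
  linarith

lemma IsGlobalSol.normSq_gu_le (𝒯 : Mesh a b N) (k : ℕ) (e : Fin N → ElemState) :
    𝒯.normSq (fun i => (e i).gu k (𝒯.left i) (𝒯.right i)) ≤
      2 * 𝒯.normSq (fun i => (e i).q) + 2 * legθ k * 𝒯.lenSum fun i => (e i).fq ^ 2 := by
  rw [Mesh.normSq, Mesh.normSq, Mesh.lenSum, Finset.mul_sum, Finset.mul_sum,
    ← Finset.sum_add_distrib]
  exact Finset.sum_le_sum fun i _ => ((e i).ip_gu_le k (𝒯.left_lt_right i)).trans_eq (by ring)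

lemma IsGlobalSol.normSq_gq_le (𝒯 : Mesh a b N) (k : ℕ) (e : Fin N → ElemState) :
    𝒯.normSq (fun i => (e i).gq k (𝒯.left i) (𝒯.right i)) ≤
      2 * 𝒯.normSq (fun i => (e i).p) + 2 * legθ k * 𝒯.lenSum fun i => (e i).fp ^ 2 := by
  rw [Mesh.normSq, Mesh.normSq, Mesh.lenSum, Finset.mul_sum, Finset.mul_sum,
    ← Finset.sum_add_distrib]
  exact Finset.sum_le_sum fun i _ => ((e i).ip_gq_le k (𝒯.left_lt_right i)).trans_eq (by ring)

lemma IsGlobalSol.normSq_gp_le (𝒯 : Mesh a b N) (k : ℕ) (e : Fin N → ElemState) :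
    𝒯.normSq (fun i => (e i).gp k (𝒯.left i) (𝒯.right i)) ≤
      2 * 𝒯.normSq (fun i => (e i).D) +
        4 * (legθ k + legS k ^ 2 / legθ k) * srcSum 𝒯 e := by
  rw [Mesh.normSq, Mesh.normSq, srcSum, Finset.mul_sum, Finset.mul_sum,
    ← Finset.sum_add_distrib]
  exact Finset.sum_le_sum fun i _ => (e i).ip_gp_le k (𝒯.left_lt_right i)

end

/-- The discrete Poincaré inequality. -/
lemma exists_normSq_u_le (k : ℕ) (a b : ℝ) (hab : a < b) : ∃ C : ℝ, 0 < C ∧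
    ∀ (N : ℕ) (𝒯 : Mesh a b N) (τ : Stabilization N) (e : Fin N → ElemState),
      IsGlobalSol 𝒯 k τ e → 𝒯.normSq (fun i => (e i).u) ≤
        C * (𝒯.normSq (fun i => (e i).q) + (𝒯.lenSum fun i => (e i).fq ^ 2) +
          𝒯.lenSum fun i => (e i).jump (𝒯.left i) (𝒯.right i)) := by
  obtain ⟨C, hC, h⟩ := exists_normSq_lift_le k a b hab
  have hθ := legθ_pos k
  refine ⟨C * (2 + 2 * legθ k), by positivity, fun N 𝒯 τ e he => ?_⟩
  obtain ⟨un, hu0, huN, hu⟩ := he.nodal_u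
  refine (h N 𝒯 _ _ _ _ un (fun i => (he.sol i).lift_u) (fun i => ?_) (fun i => ?_) huN).trans ?_
  · rw [← (hu i).1]; ring
  · rw [← (hu i).2]; ring
  rw [mul_assoc]
  refine mul_le_mul_of_nonneg_left ?_ hC.le
  have h1 := IsGlobalSol.normSq_gu_le 𝒯 k e
  have h2 : (𝒯.lenSum fun i => ((e i).ur - (e i).u.eval (𝒯.right i)) ^ 2 +
      ((e i).ul - (e i).u.eval (𝒯.left i)) ^ 2) ≤
      𝒯.lenSum fun i => (e i).jump (𝒯.left i) (𝒯.right i) := by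
    refine Finset.sum_le_sum fun i _ => mul_le_mul_of_nonneg_left ?_ (𝒯.len_pos i).le
    dsimp only [ElemState.jump]
    nlinarith [sq_nonneg ((e i).pr - (e i).p.eval (𝒯.right i))]
  have h3 := 𝒯.normSq_nonneg fun i => (e i).q
  have h4 : 0 ≤ 𝒯.lenSum fun i => (e i).fq ^ 2 := 𝒯.lenSum_nonneg fun i => sq_nonneg _
  have h5 : 0 ≤ 𝒯.lenSum fun i => (e i).jump (𝒯.left i) (𝒯.right i) :=
    𝒯.lenSum_nonneg fun i => (e i).jump_nonneg _ _
  linear_combination h1 + h2 + h5 + 2 * h4 + 2 * legθ k * h3 + 2 * legθ k * h5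

/-- The weighted energy inequality. -/
theorem exists_energy_le (k : ℕ) (hk : 0 < k) (a b : ℝ) (hab : a < b) (M : ℝ) (hM : 1 ≤ M) :
    ∃ W C : ℝ, 0 < W ∧ 0 < C ∧
      ∀ (N : ℕ) (𝒯 : Mesh a b N) (τ : Stabilization N) (e : Fin N → ElemState), τ.Adm M →
        IsGlobalSol 𝒯 k τ e →
        wipSum 𝒯 W (fun i => (e i).D) (fun i => (e i).u) + 𝒯.normSq (fun i => (e i).q) +
            jumpSum 𝒯 e ≤
          C * srcSum' 𝒯 e - pairing 𝒯 k W (fun i => (e i).fq) (fun i => (e i).p) := by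
  obtain ⟨CP, hCP, hP⟩ := exists_normSq_u_le k a b hab
  have hba := sub_pos.2 hab
  -- This ε, after the Poincaré inequality, leaves a loss of at most ‖q‖²/2 out of 3/2 ‖q‖².
  obtain ⟨ε, hε, hε2⟩ : ∃ ε : ℝ, 0 < ε ∧ 5 * ε * (1 + CP) = 1 / 2 :=
    ⟨1 / (10 * (1 + CP)), by positivity, by field_simp; norm_num⟩
  obtain ⟨C₁, hC₁, h1⟩ := ElemState.IsSol.exists_kato k hk M (b - a) hM hba ε hε
  -- The dissipation W/(2M²) pays for the losses C₁, for the jumps produced by the Poincaré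
  -- inequality, and leaves 1.
  obtain ⟨W, hW⟩ : ∃ W : ℝ, W = 2 * M ^ 2 * (C₁ + 1 + 5 * ε * CP * (b - a)) := ⟨_, rfl⟩
  have hW0 : 0 < W := by rw [hW]; positivity
  obtain ⟨C₂, hC₂, h2⟩ := h1 (W + (b - a)) (by positivity)
  refine ⟨W, C₂ + 5 * ε * CP, hW0, by positivity, fun N 𝒯 τ e hτ he => ?_⟩
  have h3 : ∀ i, _ := fun i => h2 (e i) (𝒯.left i) (𝒯.right i) _ _ _ (W + (𝒯.left i - a))
    (𝒯.left_lt_right i) (𝒯.len_le i) (by linarith [𝒯.le_left i])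
    (by linarith [𝒯.left_lt_right i, 𝒯.right_le i]) (hτ i) (he.sol i)
  have h4 : ∀ i, wip (𝒯.left i) (𝒯.right i) (W + (𝒯.left i - a)) (e i).D (e i).u +
      3 / 2 * ip (𝒯.left i) (𝒯.right i) (e i).q (e i).q +
      (1 + 5 * ε * CP * (b - a)) * (e i).jump (𝒯.left i) (𝒯.right i) +
      ((W + (𝒯.left i - a) + (𝒯.right i - 𝒯.left i)) *
        ((e i).pr * (e i).ur - 1 / 2 * (e i).qr ^ 2)
      - (W + (𝒯.left i - a)) * ((e i).pl * (e i).ul - 1 / 2 * (e i).ql ^ 2)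
      - ((e i).ur * (e i).qr - (e i).ul * (e i).ql)) ≤
      5 * ε * (ip (𝒯.left i) (𝒯.right i) (e i).q (e i).q +
        ip (𝒯.left i) (𝒯.right i) (e i).u (e i).u) +
      C₂ * ((𝒯.right i - 𝒯.left i) * ((e i).fu ^ 2 + (e i).fq ^ 2 + (e i).fp ^ 2 + (e i).δ ^ 2)) -
      (e i).fq * wip (𝒯.left i) (𝒯.right i) (W + (𝒯.left i - a)) (e i).p
        (leg k (𝒯.left i) (𝒯.right i)) := by
    intro i
    have h5 : (C₁ + 1 + 5 * ε * CP * (b - a)) ≤ (W + (𝒯.left i - a)) / (2 * M ^ 2) := by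
      rw [le_div_iff₀ (by positivity)]
      linear_combination 𝒯.le_left i - hW
    have h6 := mul_le_mul_of_nonneg_right h5 ((e i).jump_nonneg (𝒯.left i) (𝒯.right i))
    linear_combination h3 i + h6
  have h5 := Finset.sum_le_sum fun i (_ : i ∈ Finset.univ) => h4 i
  simp only [Finset.sum_add_distrib, Finset.sum_sub_distrib, ← Finset.mul_sum] at h5
  have h6 := he.telescope hW0.le
  simp only [Finset.sum_sub_distrib] at h6
  have h7 := hP N 𝒯 τ e he
  have h8 : (𝒯.lenSum fun i => (e i).jump (𝒯.left i) (𝒯.right i)) ≤ (b - a) * jumpSum 𝒯 e := by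
    rw [Mesh.lenSum, jumpSum, Finset.mul_sum]
    exact Finset.sum_le_sum fun i _ =>
      mul_le_mul_of_nonneg_right (𝒯.len_le i) ((e i).jump_nonneg _ _)
  have h9 : (𝒯.lenSum fun i => (e i).fq ^ 2) ≤ srcSum' 𝒯 e :=
    Finset.sum_le_sum fun i _ => mul_le_mul_of_nonneg_left
      (by nlinarith [sq_nonneg (e i).fu, sq_nonneg (e i).fp, sq_nonneg (e i).δ]) (𝒯.len_pos i).le
  have h11 : 𝒯.normSq (fun i => (e i).q) =
    ∑ i, ip (𝒯.left i) (𝒯.right i) (e i).q (e i).q := rfl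
  have h12 : 𝒯.normSq (fun i => (e i).u) =
    ∑ i, ip (𝒯.left i) (𝒯.right i) (e i).u (e i).u := rfl
  have h13 : srcSum' 𝒯 e = ∑ i, (𝒯.right i - 𝒯.left i) *
    ((e i).fu ^ 2 + (e i).fq ^ 2 + (e i).fp ^ 2 + (e i).δ ^ 2) := rfl
  have h14 : jumpSum 𝒯 e = ∑ i, (e i).jump (𝒯.left i) (𝒯.right i) := rfl
  rw [← h11, ← h12, ← h13, ← h14] at h5
  rw [wipSum, pairing]
  have hεCP : 0 ≤ 5 * ε * CP := by positivity
  have h7' := mul_le_mul_of_nonneg_left (h7.trans (mul_le_mul_of_nonneg_left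
    (add_le_add (add_le_add le_rfl h9) h8) hCP.le)) (by positivity : 0 ≤ 5 * ε)
  linear_combination h5 + h6 + h7' + hε2 * 𝒯.normSq (fun i => (e i).q)

/-! ### Weighted inner products -/

lemma ip_affine_mul_self_le {l r c : ℝ} (h : l ≤ r) (hc : 0 ≤ c) (v : ℝ[X]) :
    ip l r ((Polynomial.C c + (Polynomial.X - Polynomial.C l)) * v)
      ((Polynomial.C c + (Polynomial.X - Polynomial.C l)) * v) ≤
        (c + (r - l)) ^ 2 * ip l r v v := by
  rw [ip, ip, ← intervalIntegral.integral_const_mul]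
  refine intervalIntegral.integral_mono_on h (ip_intervalIntegrable _ _)
    ((ip_intervalIntegrable _ _).const_mul _) fun x hx => ?_
  simp only [Polynomial.eval_mul, Polynomial.eval_sub, Polynomial.eval_C, Polynomial.eval_X,
    Polynomial.eval_add]
  have h6 := hx.1
  have h7 := hx.2
  have h5 : (c + (x - l)) ^ 2 ≤ (c + (r - l)) ^ 2 := by
    have : 0 ≤ x - l := by linarith
    gcongr
  nlinarith [mul_self_nonneg (v.eval x)]

lemma wip_sq_le {l r c : ℝ} (h : l ≤ r) (hc : 0 ≤ c) (v w : ℝ[X]) :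
    (wip l r c v w) ^ 2 ≤ (c + (r - l)) ^ 2 * ip l r v v * ip l r w w :=
  (ip_cauchy_schwarz _ _ h).trans
    (mul_le_mul_of_nonneg_right (ip_affine_mul_self_le h hc v) (ip_self_nonneg _ h))

lemma le_wip_self {l r c : ℝ} (h : l ≤ r) (v : ℝ[X]) : c * ip l r v v ≤ wip l r c v v := by
  rw [wip, ip, ip, ← intervalIntegral.integral_const_mul]
  refine intervalIntegral.integral_mono_on h ((ip_intervalIntegrable _ _).const_mul _)
    (ip_intervalIntegrable _ _) fun x hx => ?_
  simp only [Polynomial.eval_mul, Polynomial.eval_sub, Polynomial.eval_C, Polynomial.eval_X,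
    Polynomial.eval_add]
  nlinarith [mul_self_nonneg (v.eval x), hx.1]

section

variable {a b : ℝ} {N : ℕ} (𝒯 : Mesh a b N)

lemma wipSum_sq_le {W : ℝ} (hW : 0 ≤ W) (v w : Fin N → ℝ[X]) :
    (wipSum 𝒯 W v w) ^ 2 ≤ (W + (b - a)) ^ 2 * 𝒯.normSq v * 𝒯.normSq w := by
  rw [wipSum, Mesh.normSq, Mesh.normSq, Finset.mul_sum _ _ ((W + (b - a)) ^ 2)]
  have hv := fun i => ip_self_nonneg (v i) (𝒯.left_lt_right i).le
  have hw := fun i => ip_self_nonneg (w i) (𝒯.left_lt_right i).le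
  refine Finset.sum_sq_le_sum_mul_sum_of_sq_le_mul _
    (fun i _ => mul_nonneg (sq_nonneg _) (hv i)) (fun i _ => hw i) fun i _ => ?_
  have h1 := 𝒯.le_left i
  have h2 := 𝒯.right_le i
  have h3 := 𝒯.left_lt_right i
  refine (wip_sq_le h3.le (by linarith) _ _).trans ?_
  refine mul_le_mul_of_nonneg_right (mul_le_mul_of_nonneg_right ?_ (hv i)) (hw i)
  exact pow_le_pow_left₀ (by linarith) (by linarith) 2

lemma le_wipSum_self {W : ℝ} (v : Fin N → ℝ[X]) : W * 𝒯.normSq v ≤ wipSum 𝒯 W v v := by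
  rw [wipSum, Mesh.normSq, Finset.mul_sum]
  refine Finset.sum_le_sum fun i _ => le_trans ?_ (le_wip_self (𝒯.left_lt_right i).le _)
  exact mul_le_mul_of_nonneg_right (by linarith [𝒯.le_left i])
    (ip_self_nonneg (v i) (𝒯.left_lt_right i).le)

lemma wipSum_self_le {W : ℝ} (hW : 0 ≤ W) (v : Fin N → ℝ[X]) :
    wipSum 𝒯 W v v ≤ (W + (b - a)) * 𝒯.normSq v := by
  have h1 := 𝒯.le
  have h2 := 𝒯.normSq_nonneg v
  refine le_trans (le_abs_self _) (abs_le_of_sq_le_sq ?_ (mul_nonneg (by linarith) h2))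
  exact (wipSum_sq_le 𝒯 hW v v).trans_eq (by ring)

/-- Cauchy–Schwarz with a free choice of how powers of the element length are split between the
amplitudes and p. -/
lemma pairing_sq_le_of_le {k : ℕ} {W : ℝ} (f : Fin N → ℝ) (p : Fin N → ℝ[X]) {X : Fin N → ℝ}
    {w : Fin N → ℝ} (hX : ∀ i, 0 ≤ X i) (hw : ∀ i, 0 ≤ w i)
    (h : ∀ i, (wip (𝒯.left i) (𝒯.right i) (W + (𝒯.left i - a)) (p i)
      (leg k (𝒯.left i) (𝒯.right i))) ^ 2 ≤ w i * X i) :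
    (pairing 𝒯 k W f p) ^ 2 ≤ (∑ i, w i * f i ^ 2) * ∑ i, X i := by
  refine Finset.sum_sq_le_sum_mul_sum_of_sq_le_mul _
    (fun i _ => mul_nonneg (hw i) (sq_nonneg _)) (fun i _ => hX i) fun i _ => ?_
  rw [mul_pow]
  refine (mul_le_mul_of_nonneg_left (h i) (sq_nonneg _)).trans_eq (by ring)

end

/-! ### Stability for the stationary equations -/

lemma IsLift.sub_const {k : ℕ} {l r : ℝ} {y g : ℝ[X]} {A A' : ℝ} (h : IsLift k l r y g A A')
    (c : ℝ) : IsLift k l r (y - Polynomial.C c) g A A' := by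
  refine ⟨Submodule.sub_mem _ h.1 ?_, fun v hv => by simpa using h.2 v hv⟩
  have := Submodule.smul_mem (Polynomial.degreeLT ℝ (k + 1)) c (one_mem_degreeLT (Nat.succ_pos k))
  rwa [Polynomial.smul_eq_C_mul, mul_one] at this

section

variable {a b : ℝ} {N : ℕ} {𝒯 : Mesh a b N} {k : ℕ} {τ : Stabilization N}
  {e : Fin N → ElemState} {M : ℝ}

/-- For p = q_x and q = u_x the integral of p (x - a) is the boundary value of q (x - a) - u, which
vanishes by the three boundary conditions. This linear condition fixes the additive constant of p,
for which no boundary value is prescribed. -/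
lemma IsGlobalSol.sum_ip_p (he : IsGlobalSol 𝒯 k τ e) (hk : 0 < k) :
    ∑ i, ip (𝒯.left i) (𝒯.right i) (e i).p (Polynomial.X - Polynomial.C a) =
      ∑ i, (e i).fp * ip (𝒯.left i) (𝒯.right i) (leg k (𝒯.left i) (𝒯.right i))
        (Polynomial.X - Polynomial.C a) := by
  obtain ⟨un, hu0, huN, hu⟩ := he.nodal_u
  obtain ⟨qn, hqN, hq⟩ := he.nodal_q
  have hz : (Polynomial.X - Polynomial.C a : ℝ[X]) ∈ Polynomial.degreeLT ℝ (k + 1) := by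
    rw [Polynomial.mem_degreeLT, Polynomial.degree_X_sub_C]
    exact_mod_cast Nat.succ_lt_succ hk
  have h1 : ∀ i, ip (𝒯.left i) (𝒯.right i) (e i).p (Polynomial.X - Polynomial.C a) -
      (e i).fp * ip (𝒯.left i) (𝒯.right i) (leg k (𝒯.left i) (𝒯.right i))
        (Polynomial.X - Polynomial.C a) =
      (qn i.succ * (𝒯.node i.succ - a) - un i.succ) -
        (qn i.castSucc * (𝒯.node i.castSucc - a) - un i.castSucc) := by
    intro i
    have h2 := (he.sol i).eq_q _ hz
    have h3 := (he.sol i).eq_u 1 (one_mem_degreeLT (Nat.succ_pos k))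
    have h4 := ip_derivative_add (l := 𝒯.left i) (r := 𝒯.right i) (e i).q
      (Polynomial.X - Polynomial.C a)
    have h5 := ip_derivative_add (l := 𝒯.left i) (r := 𝒯.right i) (e i).u 1
    rw [leg_orth k (𝒯.left_lt_right i) (one_mem_degreeLT hk)] at h3
    simp only [Polynomial.derivative_sub, Polynomial.derivative_X, Polynomial.derivative_C,
      sub_zero, Polynomial.eval_sub, Polynomial.eval_X, Polynomial.eval_C,
      Polynomial.derivative_one, ip_zero_right, Polynomial.eval_one] at h2 h3 h4 h5
    rw [(hu i).1, (hu i).2] at h3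
    rw [(hq i).1, (hq i).2] at h2
    change _ = (qn i.succ * (𝒯.right i - a) - un i.succ) -
        (qn i.castSucc * (𝒯.left i - a) - un i.castSucc)
    linear_combination h3 - h2 + h4 - h5
  rw [← sub_eq_zero, ← Finset.sum_sub_distrib, Finset.sum_congr rfl fun i _ => h1 i,
    sum_succ_sub_castSucc fun j => qn j * (𝒯.node j - a) - un j, hqN, huN, hu0, 𝒯.node_zero]
  ring

lemma Mesh.sum_ip_const (𝒯 : Mesh a b N) (c : ℝ) :
    ∑ i, ip (𝒯.left i) (𝒯.right i) (Polynomial.C c) (Polynomial.X - Polynomial.C a) =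
      c * ((b - a) ^ 2 / 2) := by
  have h1 : ∀ i, ip (𝒯.left i) (𝒯.right i) (Polynomial.C c) (Polynomial.X - Polynomial.C a) =
      c * ((𝒯.node i.succ - a) ^ 2 / 2) - c * ((𝒯.node i.castSucc - a) ^ 2 / 2) := by
    intro i
    simp [ip, Mesh.left, Mesh.right]
    ring
  rw [Finset.sum_congr rfl fun i _ => h1 i,
    sum_succ_sub_castSucc fun j => c * ((𝒯.node j - a) ^ 2 / 2), 𝒯.node_zero, 𝒯.node_last]
  ring

lemma Mesh.sum_ip_X_sub_le (𝒯 : Mesh a b N) : ∑ i, ip (𝒯.left i) (𝒯.right i)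
    (Polynomial.X - Polynomial.C a) (Polynomial.X - Polynomial.C a) ≤ (b - a) ^ 3 := by
  have h1 : ∀ i, ip (𝒯.left i) (𝒯.right i) (Polynomial.X - Polynomial.C a)
      (Polynomial.X - Polynomial.C a) ≤ (b - a) ^ 2 * (𝒯.right i - 𝒯.left i) := fun i => by
    refine ip_self_le_of_bound (𝒯.left_lt_right i).le _ fun x hx => ?_
    simp only [Polynomial.eval_sub, Polynomial.eval_X, Polynomial.eval_C]
    have h1 := 𝒯.le_left i
    have h2 := 𝒯.right_le i
    exact pow_le_pow_left₀ (by linarith [hx.1]) (by linarith [hx.2]) 2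
  refine (Finset.sum_le_sum fun i _ => h1 i).trans_eq ?_
  rw [← Finset.mul_sum, 𝒯.sum_len]
  ring

lemma ElemState.IsSol.Bl_sq_le {e : ElemState} {l r tL sL tR : ℝ} (he : e.IsSol k l r tL sL tR)
    (ha : ElemAdm M tL sL tR) :
    (e.pl - e.p.eval l) ^ 2 ≤ 8 * e.jump l r + 2 * e.δ ^ 2 := by
  rw [he.flux_pl]
  have h4 : (sL * (e.ul - e.u.eval l)) ^ 2 ≤ 4 * e.jump l r := by
    rw [mul_pow]
    exact mul_le_mul ha.sL_sq_le (jump_sq_le e l r).1 (sq_nonneg _) zero_le_four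
  nlinarith [sq_nonneg (sL * (e.ul - e.u.eval l) + e.δ)]

lemma lenSum_fq_le (𝒯 : Mesh a b N) (e : Fin N → ElemState) :
    (𝒯.lenSum fun i => (e i).fq ^ 2) ≤ srcSum 𝒯 e :=
  Finset.sum_le_sum fun i _ => ((e i).src_ge (𝒯.left_lt_right i)).2.1

lemma lenSum_fp_le (𝒯 : Mesh a b N) (e : Fin N → ElemState) :
    (𝒯.lenSum fun i => (e i).fp ^ 2) ≤ srcSum 𝒯 e :=
  Finset.sum_le_sum fun i _ => ((e i).src_ge (𝒯.left_lt_right i)).2.2.1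

lemma lenSum_δ_le (𝒯 : Mesh a b N) (e : Fin N → ElemState) :
    (𝒯.lenSum fun i => (e i).δ ^ 2) ≤ (b - a) ^ 2 * srcSum 𝒯 e := by
  rw [srcSum, Finset.mul_sum]
  refine Finset.sum_le_sum fun i _ => ?_
  have hη := 𝒯.len_pos i
  have h1 := mul_le_mul_of_nonneg_left ((e i).src_ge (𝒯.left_lt_right i)).2.2.2 hη.le
  have h2 : (𝒯.right i - 𝒯.left i) ^ 2 ≤ (b - a) ^ 2 := by
    have := 𝒯.len_le i
    gcongr
  have h3 := mul_le_mul_of_nonneg_right h2 ((e i).src_nonneg (𝒯.left_lt_right i))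
  linear_combination h1 + h3

end

/-- With the length as a further weight the jumps become `size ^ 2` times norms, hence absorbable on
fine meshes. -/
lemma exists_lenSum_jump_le (k : ℕ) (M : ℝ) (hM : 1 ≤ M) : ∃ C : ℝ, 0 < C ∧
    ∀ (a b : ℝ) (N : ℕ) (𝒯 : Mesh a b N) (τ : Stabilization N) (e : Fin N → ElemState), τ.Adm M →
      IsGlobalSol 𝒯 k τ e → (𝒯.lenSum fun i => (e i).jump (𝒯.left i) (𝒯.right i)) ≤
        C * (𝒯.size ^ 2 * (𝒯.normSq (fun i => (e i).q) + 𝒯.normSq (fun i => (e i).p) +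
          𝒯.normSq (fun i => (e i).D) + srcSum 𝒯 e)) := by
  obtain ⟨C, hC, h⟩ := ElemState.IsSol.exists_jump_le k M hM
  refine ⟨C, hC, fun a b N 𝒯 τ e hτ he => ?_⟩
  simp only [Mesh.normSq, srcSum]
  rw [← Finset.sum_add_distrib, ← Finset.sum_add_distrib, ← Finset.sum_add_distrib,
    Finset.mul_sum, Finset.mul_sum]
  refine Finset.sum_le_sum fun i _ => ?_
  have hη := 𝒯.len_pos i
  have hlt := 𝒯.left_lt_right i
  refine (mul_le_mul_of_nonneg_left (h _ _ _ _ _ _ hlt (hτ i) (he.sol i)) hη.le).trans ?_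
  have h2 : (𝒯.right i - 𝒯.left i) ^ 2 ≤ 𝒯.size ^ 2 := by
    have := 𝒯.len_le_size i
    gcongr
  have h3 : 0 ≤ ip (𝒯.left i) (𝒯.right i) (e i).q (e i).q +
      ip (𝒯.left i) (𝒯.right i) (e i).p (e i).p +
      ip (𝒯.left i) (𝒯.right i) (e i).D (e i).D + (e i).src (𝒯.left i) (𝒯.right i) := by
    have h4 := ip_self_nonneg (e i).q hlt.le
    have h5 := ip_self_nonneg (e i).p hlt.le
    have h6 := ip_self_nonneg (e i).D hlt.le
    have h7 := (e i).src_nonneg hlt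
    positivity
  have h4 := mul_le_mul_of_nonneg_left (mul_le_mul_of_nonneg_right h2 h3) hC.le
  linear_combination h4

/-- The third equation controls p minus its trace c at b; the moment condition `sum_ip_p` then
controls c. -/
lemma exists_normSq_p_le (k : ℕ) (hk : 0 < k) (a b : ℝ) (hab : a < b) (M : ℝ) : ∃ C : ℝ, 0 < C ∧
    ∀ (N : ℕ) (𝒯 : Mesh a b N) (τ : Stabilization N) (e : Fin N → ElemState), τ.Adm M →
      IsGlobalSol 𝒯 k τ e → 𝒯.normSq (fun i => (e i).p) ≤
        C * (𝒯.normSq (fun i => (e i).D) + srcSum 𝒯 e +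
          𝒯.lenSum fun i => (e i).jump (𝒯.left i) (𝒯.right i)) := by
  obtain ⟨C, hC, h⟩ := exists_normSq_lift_le k a b hab
  have hθ := legθ_pos k
  have hba := sub_pos.2 hab
  obtain ⟨G, hG⟩ : ∃ G, G = 4 * (legθ k + legS k ^ 2 / legθ k) := ⟨_, rfl⟩
  have hG0 : 0 < G := by rw [hG]; positivity
  refine ⟨18 * C * (2 + G + 9 + 2 * (b - a) ^ 2) + 16 * legθ k, by positivity,
    fun N 𝒯 τ e hτ he => ?_⟩
  obtain ⟨pn, hp⟩ := he.nodal_p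
  obtain ⟨c, hc⟩ : ∃ c, c = pn (Fin.last N) := ⟨_, rfl⟩
  have h1 := h N 𝒯 (fun i => (e i).p - Polynomial.C c) _ _ _ (fun j => pn j - c)
    (fun i => (he.sol i).lift_p.sub_const c)
    (fun i => by rw [← (hp i).1]; simp) (fun i => by rw [← (hp i).2]; simp)
    (by rw [hc, sub_self])
  have h2 := IsGlobalSol.normSq_gp_le 𝒯 k e
  rw [← hG] at h2
  have h3 : (𝒯.lenSum fun i => ((e i).pr - (e i).p.eval (𝒯.right i)) ^ 2 +
      ((e i).pl - (e i).p.eval (𝒯.left i)) ^ 2) ≤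
      9 * (𝒯.lenSum fun i => (e i).jump (𝒯.left i) (𝒯.right i)) +
        2 * 𝒯.lenSum fun i => (e i).δ ^ 2 := by
    simp only [Mesh.lenSum]
    rw [Finset.mul_sum, Finset.mul_sum, ← Finset.sum_add_distrib]
    refine Finset.sum_le_sum fun i _ => ?_
    have h4 := (he.sol i).Bl_sq_le (hτ i)
    have h5 := (ElemState.IsSol.jump_sq_le (e i) (𝒯.left i) (𝒯.right i)).2.2
    have h6 := mul_le_mul_of_nonneg_left (add_le_add h5 h4) (𝒯.len_pos i).le
    linear_combination h6
  have h4 := lenSum_δ_le 𝒯 e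
  have h5 := lenSum_fp_le 𝒯 e
  have hD := 𝒯.normSq_nonneg fun i => (e i).D
  have hS := srcSum_nonneg 𝒯 e
  have hJ : 0 ≤ 𝒯.lenSum fun i => (e i).jump (𝒯.left i) (𝒯.right i) :=
    𝒯.lenSum_nonneg fun i => (e i).jump_nonneg _ _
  have hY := 𝒯.normSq_nonneg fun i => (e i).p - Polynomial.C c
  -- the mean value
  have h6 := he.sum_ip_p hk
  have h7 : (∑ i, (e i).fp * ip (𝒯.left i) (𝒯.right i) (leg k (𝒯.left i) (𝒯.right i))
      (Polynomial.X - Polynomial.C a)) ^ 2 ≤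
        (legθ k * 𝒯.lenSum fun i => (e i).fp ^ 2) * (b - a) ^ 3 := by
    refine le_trans (Finset.sum_sq_le_sum_mul_sum_of_sq_le_mul Finset.univ
      (f := fun i => legθ k * ((𝒯.right i - 𝒯.left i) * (e i).fp ^ 2))
      (g := fun i => ip (𝒯.left i) (𝒯.right i) (Polynomial.X - Polynomial.C a)
        (Polynomial.X - Polynomial.C a))
      (fun i _ => ?_) (fun i _ => ip_self_nonneg _ (𝒯.left_lt_right i).le) fun i _ => ?_) ?_
    · have := 𝒯.len_pos i
      positivity
    · rw [mul_pow]
      exact (mul_le_mul_of_nonneg_left (ip_leg_sq_le k (𝒯.left_lt_right i) _)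
        (sq_nonneg _)).trans_eq (by ring)
    · rw [← Finset.mul_sum]
      exact mul_le_mul_of_nonneg_left 𝒯.sum_ip_X_sub_le (mul_nonneg hθ.le
        (𝒯.lenSum_nonneg fun i => sq_nonneg _))
  have h8 : (∑ i, ip (𝒯.left i) (𝒯.right i) ((e i).p - Polynomial.C c)
      (Polynomial.X - Polynomial.C a)) ^ 2 ≤
        𝒯.normSq (fun i => (e i).p - Polynomial.C c) * (b - a) ^ 3 := by
    refine le_trans (Finset.sum_sq_le_sum_mul_sum_of_sq_le_mul Finset.univ
      (fun i _ => ip_self_nonneg ((e i).p - Polynomial.C c) (𝒯.left_lt_right i).le)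
      (fun i _ => ip_self_nonneg (Polynomial.X - Polynomial.C a) (𝒯.left_lt_right i).le)
      fun i _ => ip_cauchy_schwarz _ _ (𝒯.left_lt_right i).le) ?_
    exact mul_le_mul_of_nonneg_left 𝒯.sum_ip_X_sub_le hY
  have h9 : c * ((b - a) ^ 2 / 2) =
      (∑ i, (e i).fp * ip (𝒯.left i) (𝒯.right i) (leg k (𝒯.left i) (𝒯.right i))
      (Polynomial.X - Polynomial.C a)) - ∑ i, ip (𝒯.left i) (𝒯.right i) ((e i).p - Polynomial.C c)
      (Polynomial.X - Polynomial.C a) := by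
    rw [← h6, ← 𝒯.sum_ip_const, ← Finset.sum_sub_distrib]
    refine Finset.sum_congr rfl fun i _ => ?_
    rw [ip_sub_left]
    ring
  have h10 : c ^ 2 * (b - a) ≤ 8 * (legθ k * 𝒯.lenSum fun i => (e i).fp ^ 2) +
      8 * 𝒯.normSq (fun i => (e i).p - Polynomial.C c) := by
    have h11 : (c * ((b - a) ^ 2 / 2)) ^ 2 ≤ 2 * ((legθ k * 𝒯.lenSum fun i => (e i).fp ^ 2) *
        (b - a) ^ 3) + 2 * (𝒯.normSq (fun i => (e i).p - Polynomial.C c) * (b - a) ^ 3) := by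
      rw [h9]
      generalize (∑ i, (e i).fp * ip (𝒯.left i) (𝒯.right i) (leg k (𝒯.left i) (𝒯.right i))
        (Polynomial.X - Polynomial.C a)) = x at *
      generalize ∑ i, ip (𝒯.left i) (𝒯.right i) ((e i).p - Polynomial.C c)
        (Polynomial.X - Polynomial.C a) = y at *
      linear_combination 2 * h7 + 2 * h8 + sq_nonneg (x + y)
    have h12 : 0 < (b - a) ^ 3 := by positivity
    refine le_of_mul_le_mul_right ?_ h12
    linear_combination 4 * h11
  have h11 : 𝒯.normSq (fun i => (e i).p) ≤ 2 * 𝒯.normSq (fun i => (e i).p - Polynomial.C c) +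
      2 * (c ^ 2 * (b - a)) := by
    have h13 : c ^ 2 * (b - a) = ∑ i, ip (𝒯.left i) (𝒯.right i) (-Polynomial.C c)
        (-Polynomial.C c) := by
      rw [← 𝒯.sum_len, Finset.mul_sum]
      refine Finset.sum_congr rfl fun i _ => ?_
      simp [ip]
      ring
    rw [h13, Mesh.normSq, Mesh.normSq, Finset.mul_sum, Finset.mul_sum, ← Finset.sum_add_distrib]
    refine Finset.sum_le_sum fun i _ => ?_
    have := ElemState.ip_sub_self_le (𝒯.left_lt_right i).le ((e i).p - Polynomial.C c)
      (-Polynomial.C c)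
    simpa using this
  have h12 : 𝒯.normSq (fun i => (e i).p) ≤ 18 * 𝒯.normSq (fun i => (e i).p - Polynomial.C c) +
      16 * legθ k * srcSum 𝒯 e := by
    linear_combination h11 + 2 * h10 + 16 * legθ k * h5
  refine h12.trans ?_
  have h13 : 𝒯.normSq (fun i => (e i).p - Polynomial.C c) ≤ C * ((2 + G + 9 + 2 * (b - a) ^ 2) *
      (𝒯.normSq (fun i => (e i).D) + srcSum 𝒯 e +
          𝒯.lenSum fun i => (e i).jump (𝒯.left i) (𝒯.right i))) := by
    refine h1.trans (mul_le_mul_of_nonneg_left ?_ hC.le)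
    have : 0 ≤ (9 + G + 2 * (b - a) ^ 2) * 𝒯.normSq (fun i => (e i).D) + 11 * srcSum 𝒯 e +
      (2 + G + 2 * (b - a) ^ 2) * 𝒯.lenSum fun i => (e i).jump (𝒯.left i) (𝒯.right i) := by
      positivity
    linear_combination h2 + h3 + 2 * h4 + this
  linear_combination 18 * h13 + 16 * legθ k * hD + 16 * legθ k * hJ

lemma exists_normSq_q_le (k : ℕ) (a b : ℝ) (hab : a < b) (M : ℝ) : ∃ C : ℝ, 0 < C ∧
    ∀ (N : ℕ) (𝒯 : Mesh a b N) (τ : Stabilization N) (e : Fin N → ElemState), τ.Adm M →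
      IsGlobalSol 𝒯 k τ e → 𝒯.normSq (fun i => (e i).q) ≤
        C * (𝒯.normSq (fun i => (e i).p) + srcSum 𝒯 e +
          𝒯.lenSum fun i => (e i).jump (𝒯.left i) (𝒯.right i)) := by
  obtain ⟨C, hC, h⟩ := exists_normSq_lift_le k a b hab
  have hθ := legθ_pos k
  refine ⟨C * (2 + 2 * legθ k + (2 * M ^ 2 + 1)), by positivity, fun N 𝒯 τ e hτ he => ?_⟩
  obtain ⟨qn, hqN, hq⟩ := he.nodal_q
  refine (h N 𝒯 _ _ _ _ qn (fun i => (he.sol i).lift_q) (fun i => ?_) (fun i => ?_) hqN).trans ?_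
  · rw [← (hq i).1]; ring
  · rw [← (hq i).2]; ring
  rw [mul_assoc]
  refine mul_le_mul_of_nonneg_left ?_ hC.le
  have h1 := IsGlobalSol.normSq_gq_le 𝒯 k e
  have h2 : (𝒯.lenSum fun i => ((e i).qr - (e i).q.eval (𝒯.right i)) ^ 2 +
      ((e i).ql - (e i).q.eval (𝒯.left i)) ^ 2) ≤
      (2 * M ^ 2 + 1) * 𝒯.lenSum fun i => (e i).jump (𝒯.left i) (𝒯.right i) := by
    simp only [Mesh.lenSum]
    rw [Finset.mul_sum]
    refine Finset.sum_le_sum fun i _ => ?_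
    have h3 := mul_le_mul_of_nonneg_left (add_le_add ((he.sol i).Qr_sq_le (hτ i))
      ((he.sol i).Ql_sq_le (hτ i))) (𝒯.len_pos i).le
    linear_combination h3
  have h3 := 𝒯.normSq_nonneg fun i => (e i).p
  have h4 := lenSum_fp_le 𝒯 e
  have hS := srcSum_nonneg 𝒯 e
  have h5 : 0 ≤ 𝒯.lenSum fun i => (e i).jump (𝒯.left i) (𝒯.right i) :=
    𝒯.lenSum_nonneg fun i => (e i).jump_nonneg _ _
  have : 0 ≤ (2 * legθ k + (2 * M ^ 2 + 1)) * 𝒯.normSq (fun i => (e i).p) +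
    (2 + (2 * M ^ 2 + 1)) * srcSum 𝒯 e +
    (2 + 2 * legθ k) * 𝒯.lenSum fun i => (e i).jump (𝒯.left i) (𝒯.right i) := by positivity
  linear_combination h1 + h2 + 2 * legθ k * h4 + this

/-- Stability on fine meshes: the state is controlled by `D` and the sources. -/
theorem exists_static_le (k : ℕ) (hk : 0 < k) (a b : ℝ) (hab : a < b) (M : ℝ) (hM : 1 ≤ M) :
    ∃ C h₀ : ℝ, 0 < C ∧ 0 < h₀ ∧
      ∀ (N : ℕ) (𝒯 : Mesh a b N) (τ : Stabilization N) (e : Fin N → ElemState), 𝒯.size < h₀ →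
        τ.Adm M → IsGlobalSol 𝒯 k τ e →
        𝒯.normSq (fun i => (e i).u) + 𝒯.normSq (fun i => (e i).q) + 𝒯.normSq (fun i => (e i).p) ≤
          C * (𝒯.normSq (fun i => (e i).D) + srcSum 𝒯 e) := by
  obtain ⟨CJ, hCJ, hJ⟩ := exists_lenSum_jump_le k M hM
  obtain ⟨Cp, hCp, hp⟩ := exists_normSq_p_le k hk a b hab M
  obtain ⟨Cq, hCq, hq⟩ := exists_normSq_q_le k a b hab M
  obtain ⟨Cu, hCu, hu⟩ := exists_normSq_u_le k a b hab
  obtain ⟨D, hD⟩ : ∃ D, D = (Cq + 1) * Cp * (1 + CJ) + Cq * (1 + CJ) := ⟨_, rfl⟩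
  have hD0 : 0 < D := by rw [hD]; positivity
  -- The threshold makes D `size`² ≤ 1/2, so that the jump contributions of q and p can be moved to
  -- the left. The norm of u does not enter this loop and is recovered last.
  refine ⟨Cu * (1 + CJ) * (2 * D + 1) + 2 * D, min 1 (1 / (2 * D)), by positivity, by positivity,
    fun N 𝒯 τ e hsz hτ he => ?_⟩
  have h1 := hJ a b N 𝒯 τ e hτ he
  have h2 := hp N 𝒯 τ e hτ he
  have h3 := hq N 𝒯 τ e hτ he
  have h4 := hu N 𝒯 τ e he
  have h5 := lenSum_fq_le 𝒯 e
  have hs0 := 𝒯.size_nonneg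
  have hs1 : 𝒯.size ≤ 1 := hsz.le.trans (min_le_left _ _)
  have hs2 : D * 𝒯.size ^ 2 ≤ 1 / 2 := by
    have h6 : 𝒯.size ≤ 1 / (2 * D) := hsz.le.trans (min_le_right _ _)
    have h7 : 𝒯.size ^ 2 ≤ 1 / (2 * D) := by nlinarith
    have h8 := mul_le_mul_of_nonneg_left h7 hD0.le
    have h9 : D * (1 / (2 * D)) = 1 / 2 := by field_simp
    linarith
  have hs3 : 𝒯.size ^ 2 ≤ 1 := by nlinarith
  have hx : 0 ≤ 𝒯.size ^ 2 := sq_nonneg _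
  have n1 := 𝒯.normSq_nonneg fun i => (e i).u
  have n2 := 𝒯.normSq_nonneg fun i => (e i).q
  have n3 := 𝒯.normSq_nonneg fun i => (e i).p
  have n4 := 𝒯.normSq_nonneg fun i => (e i).D
  have n5 := srcSum_nonneg 𝒯 e
  generalize 𝒯.normSq (fun i => (e i).u) = nu at *
  generalize 𝒯.normSq (fun i => (e i).q) = nq at *
  generalize 𝒯.normSq (fun i => (e i).p) = np at *
  generalize 𝒯.normSq (fun i => (e i).D) = nD at *
  generalize srcSum 𝒯 e = S at *
  generalize (𝒯.lenSum fun i => (e i).jump (𝒯.left i) (𝒯.right i)) = J at *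
  generalize (𝒯.lenSum fun i => (e i).fq ^ 2) = F at *
  generalize 𝒯.size ^ 2 = x at *
  clear hJ hp hq hu he hτ hsz
  have h6 : J ≤ CJ * (x * (nq + np)) + CJ * (nD + S) := by
    have := mul_le_mul_of_nonneg_left hs3 (mul_nonneg hCJ.le (add_nonneg n4 n5))
    linear_combination h1 + this
  have h7 : nq + np ≤ D * (nD + S) + D * x * (nq + np) := by
    have hr : 0 ≤ ((Cq + 1) * Cp + Cq) * (x * (nq + np)) + Cq * nD := by positivity
    rw [hD]
    linear_combination h3 + (1 + Cq) * h2 + ((1 + Cq) * Cp + Cq) * h6 + hr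
  have h8 : nq + np ≤ 2 * D * (nD + S) := by
    have := mul_le_mul_of_nonneg_right hs2 (add_nonneg n2 n3)
    linear_combination 2 * h7 + 2 * this
  have h9 : J ≤ CJ * ((2 * D + 1) * (nD + S)) := by
    have h10 := mul_le_mul_of_nonneg_right hs3 (add_nonneg n2 n3)
    have h11 := mul_le_mul_of_nonneg_left (h10.trans_eq (one_mul _) |>.trans h8) hCJ.le
    linear_combination h6 + h11
  have h10 : nu ≤ Cu * ((1 + CJ) * (2 * D + 1) * (nD + S)) := by
    refine h4.trans (mul_le_mul_of_nonneg_left ?_ hCu.le)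
    linear_combination h8 + h9 + h5 + n3 + n4
  linear_combination h8 + h10

/-- The pairing with the weighted top coefficients of `p` is of higher order. -/
theorem exists_pairing_le (k : ℕ) (hk : 0 < k) (a b : ℝ) (hab : a < b) (M : ℝ) (hM : 1 ≤ M)
    (W : ℝ) (hW : 0 ≤ W) : ∃ C h₀ : ℝ, 0 < C ∧ 0 < h₀ ∧
      ∀ (N : ℕ) (𝒯 : Mesh a b N) (τ : Stabilization N) (e : Fin N → ElemState), 𝒯.size < h₀ →
        τ.Adm M → IsGlobalSol 𝒯 k τ e → ∀ f : Fin N → ℝ,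
        (pairing 𝒯 k W f (fun i => (e i).p)) ^ 2 ≤
          (∑ i, (𝒯.right i - 𝒯.left i) ^ 3 * f i ^ 2) *
            (C * (𝒯.normSq (fun i => (e i).D) + srcSum 𝒯 e)) := by
  obtain ⟨Cs, h₀, hCs, hh₀, hs⟩ := exists_static_le k hk a b hab M hM
  obtain ⟨CL, hCL, hL⟩ := ElemState.IsSol.exists_leg_p_le k hk M hM
  have hθ := legθ_pos k
  have hba := sub_pos.2 hab
  obtain ⟨G, hG⟩ : ∃ G, G = 2 * ((W + (b - a)) ^ 2 * CL) + 2 * legθ k := ⟨_, rfl⟩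
  have hG0 : 0 < G := by rw [hG]; positivity
  refine ⟨G * (Cs + 1), h₀, by positivity, hh₀, fun N 𝒯 τ e hsz hτ he f => ?_⟩
  have hlt := 𝒯.left_lt_right
  have hnn : ∀ i, 0 ≤ ip (𝒯.left i) (𝒯.right i) (e i).q (e i).q +
      ip (𝒯.left i) (𝒯.right i) (e i).p (e i).p +
      ip (𝒯.left i) (𝒯.right i) (e i).D (e i).D + (e i).src (𝒯.left i) (𝒯.right i) := fun i => by
    have h4 := ip_self_nonneg (e i).q (hlt i).le
    have h5 := ip_self_nonneg (e i).p (hlt i).le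
    have h6 := ip_self_nonneg (e i).D (hlt i).le
    have h7 := (e i).src_nonneg (hlt i)
    positivity
  have key := pairing_sq_le_of_le 𝒯 (k := k) (W := W) f (fun i => (e i).p)
    (X := fun i => G * (ip (𝒯.left i) (𝒯.right i) (e i).q (e i).q +
      ip (𝒯.left i) (𝒯.right i) (e i).p (e i).p +
      ip (𝒯.left i) (𝒯.right i) (e i).D (e i).D + (e i).src (𝒯.left i) (𝒯.right i)))
    (w := fun i => (𝒯.right i - 𝒯.left i) ^ 3) (fun i => mul_nonneg hG0.le (hnn i))
    (fun i => pow_nonneg (𝒯.len_pos i).le 3) fun i => ?_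
  · refine key.trans (mul_le_mul_of_nonneg_left ?_ (Finset.sum_nonneg fun i _ =>
      mul_nonneg (pow_nonneg (𝒯.len_pos i).le 3) (sq_nonneg _)))
    rw [← Finset.mul_sum, Finset.sum_add_distrib, Finset.sum_add_distrib, Finset.sum_add_distrib,
      mul_assoc]
    refine mul_le_mul_of_nonneg_left ?_ hG0.le
    have h1 := hs N 𝒯 τ e hsz hτ he
    have h2 := 𝒯.normSq_nonneg fun i => (e i).u
    simp only [Mesh.normSq, srcSum] at h1 h2 ⊢
    linear_combination h1 + h2
  · have h1 := hL _ _ _ _ _ _ (hlt i) (hτ i) (he.sol i)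
    have hη := 𝒯.len_pos i
    have hp := ip_self_nonneg (e i).p (hlt i).le
    have h4 := ip_self_nonneg (e i).q (hlt i).le
    have h6 := ip_self_nonneg (e i).D (hlt i).le
    have h7 := (e i).src_nonneg (hlt i)
    -- The weight is split at the left end point: the constant part uses the sharp bound of (L,p),
    -- the part x - l brings the missing factor of η itself.
    have h2 : (ip (𝒯.left i) (𝒯.right i) ((Polynomial.X - Polynomial.C (𝒯.left i)) * (e i).p)
        (leg k (𝒯.left i) (𝒯.right i))) ^ 2 ≤ legθ k * ((𝒯.right i - 𝒯.left i) ^ 3 *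
          ip (𝒯.left i) (𝒯.right i) (e i).p (e i).p) := by
      have h3 := wip_sq_le (hlt i).le le_rfl (e i).p (leg k (𝒯.left i) (𝒯.right i))
      rw [wip_eq, zero_mul, zero_add, zero_add, leg_self k (hlt i)] at h3
      exact h3.trans_eq (by ring)
    have hc : (W + (𝒯.left i - a)) ^ 2 ≤ (W + (b - a)) ^ 2 :=
      pow_le_pow_left₀ (by linarith [𝒯.le_left i]) (by linarith [hlt i, 𝒯.right_le i]) 2
    have h3 := mul_le_mul hc h1 (sq_nonneg _) (sq_nonneg _)
    rw [wip_eq, hG, ip_comm (e i).p]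
    generalize ip (𝒯.left i) (𝒯.right i) ((Polynomial.X - Polynomial.C (𝒯.left i)) * (e i).p)
        (leg k (𝒯.left i) (𝒯.right i)) = y at *
    generalize ip (𝒯.left i) (𝒯.right i) (leg k (𝒯.left i) (𝒯.right i)) (e i).p = z at *
    generalize W + (𝒯.left i - a) = c at *
    have h8 : 0 ≤ 2 * legθ k * ((𝒯.right i - 𝒯.left i) ^ 3 *
      (ip (𝒯.left i) (𝒯.right i) (e i).q (e i).q + ip (𝒯.left i) (𝒯.right i) (e i).D (e i).D +
        (e i).src (𝒯.left i) (𝒯.right i))) := by positivity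
    linear_combination sq_nonneg (c * z - y) + 2 * h3 + 2 * h2 + h8

/-! ### Continuous dependence on a fixed mesh -/

/-- The converse of the lifting bound: test with g and use the inverse estimate for the derivative
of y. Negative powers of the length are harmless, as this is used on a fixed mesh only. -/
lemma exists_lift_source_le (k : ℕ) : ∃ C : ℝ, 0 < C ∧ ∀ (l r : ℝ) (y g : ℝ[X]) (A A' : ℝ),
    l < r → g ∈ Polynomial.degreeLT ℝ (k + 1) → IsLift k l r y g A A' →
      ip l r g g ≤ C * (ip l r y y / (r - l) ^ 2 + (A ^ 2 + A' ^ 2) / (r - l)) := by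
  obtain ⟨C, hC, hCe⟩ := exists_eval_bound (k + 1)
  obtain ⟨Cd, hCd, hd⟩ := exists_derivative_bound (k + 1)
  refine ⟨4 * (C + Cd), by positivity, fun l r y g A A' h hg hy => ?_⟩
  have e := hy.2 _ hg
  have hη := sub_pos.2 h
  have hX := ip_self_nonneg g h.le
  have hr := hCe l r h _ hg r (right_mem_Icc.2 h.le)
  have hl := hCe l r h _ hg l (left_mem_Icc.2 h.le)
  have hy2 := hd l r h y hy.1
  have hgy := ip_cauchy_schwarz (Polynomial.derivative y) g h.le
  have hyn := ip_self_nonneg y h.le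
  have hgy' := hgy.trans (mul_le_mul_of_nonneg_right hy2 hX)
  generalize ip l r g g = X at *
  have hA : 0 ≤ A ^ 2 / (r - l) := by positivity
  have hA' : 0 ≤ A' ^ 2 / (r - l) := by positivity
  have hY : 0 ≤ ip l r y y / (r - l) ^ 2 := by positivity
  have t1 := (le_abs_self _).trans (young_mul hX hY hCd.le (by norm_num : (0 : ℝ) < 1 / 4)
    (hgy'.trans_eq (by ring)))
  have t2 := (le_abs_self _).trans (young_mul hX hA hC.le (by norm_num : (0 : ℝ) < 1 / 4)
    ((mul_sq_le_mul (le_refl (A ^ 2)) hr).trans_eq (by ring)))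
  have t3 := (neg_le_abs _).trans (young_mul hX hA' hC.le (by norm_num : (0 : ℝ) < 1 / 4)
    ((mul_sq_le_mul (le_refl (A' ^ 2)) hl).trans_eq (by ring)))
  rw [add_div]
  have h1 := mul_nonneg hC.le hY
  have h2 := mul_nonneg hCd.le (add_nonneg hA hA')
  norm_num at t1 t2 t3
  linear_combination 4 * t1 + 4 * t2 + 4 * t3 + 4 * h1 + 4 * h2 - 4 * e

lemma Mesh.exists_pos_le_len {a b : ℝ} {N : ℕ} (𝒯 : Mesh a b N) :
    ∃ m : ℝ, 0 < m ∧ ∀ i, m ≤ 𝒯.right i - 𝒯.left i := by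
  rcases isEmpty_or_nonempty (Fin N) with h | h
  · exact ⟨1, one_pos, fun i => h.elim i⟩
  · obtain ⟨i, hi⟩ := Finite.exists_min fun i => 𝒯.right i - 𝒯.left i
    exact ⟨_, 𝒯.len_pos i, hi⟩

section

variable {k : ℕ} {l r tL sL tR M : ℝ} {e : ElemState}

lemma ElemState.IsSol.gq_mem (he : e.IsSol k l r tL sL tR) :
    e.gq k l r ∈ Polynomial.degreeLT ℝ (k + 1) :=
  Submodule.sub_mem _ he.mem_p (Submodule.smul_mem _ _ (leg_mem k))

lemma ElemState.IsSol.gp_mem (he : e.IsSol k l r tL sL tR) :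
    e.gp k l r ∈ Polynomial.degreeLT ℝ (k + 1) :=
  Submodule.sub_mem _ (Submodule.smul_mem _ _ (leg_mem k)) he.mem_D

lemma ElemState.ip_p_le (e : ElemState) (k : ℕ) (h : l < r) : ip l r e.p e.p ≤
    2 * ip l r (e.gq k l r) (e.gq k l r) + 2 * (legθ k * ((r - l) * e.fp ^ 2)) := by
  have := ip_sub_self_le h.le (e.gq k l r) (-(e.fp • leg k l r))
  rw [ip_neg_left, ip_neg_right, neg_neg, ip_smul_leg k h] at this
  simpa [gq] using this

lemma ElemState.ip_D_le (e : ElemState) (k : ℕ) (h : l < r) : ip l r e.D e.D ≤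
    2 * ip l r (e.gp k l r) (e.gp k l r) +
      4 * (legθ k + legS k ^ 2 / legθ k) * e.src l r := by
  -- As a function of D, `gp` is a reflection: replacing D by `gp` returns D. So the bound of `gp`
  -- by D also bounds D by `gp`.
  have h1 := ElemState.ip_gp_le ⟨e.u, e.q, e.p, e.gp k l r, e.ul, e.ur, e.ql, e.qr, e.pl, e.pr,
    e.fu, e.fq, e.fp, e.δ⟩ k h
  simpa [gp, src] using h1

end

/-- Continuous dependence on `u` and the sources, with a constant depending on the mesh. -/
theorem exists_cont_le (k : ℕ) (hk : 0 < k) {a b : ℝ} (hab : a < b) {M : ℝ} (hM : 1 ≤ M)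
    {N : ℕ} (𝒯 : Mesh a b N) {τ : Stabilization N} (hτ : τ.Adm M) : ∃ C : ℝ, 0 < C ∧
      ∀ e : Fin N → ElemState, IsGlobalSol 𝒯 k τ e →
        𝒯.normSq (fun i => (e i).D) + 𝒯.normSq (fun i => (e i).p) ≤
          C * (𝒯.normSq (fun i => (e i).u) + srcSum 𝒯 e) := by
  obtain ⟨C, hC, hl⟩ := exists_lift_source_le k
  obtain ⟨W, CE, hW, hCE, hE⟩ := exists_energy_le k hk a b hab M hM
  obtain ⟨m, hm, hmi⟩ := 𝒯.exists_pos_le_len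
  have hθ := legθ_pos k
  have hba := sub_pos.2 hab
  have hlt := 𝒯.left_lt_right
  obtain ⟨G, hG⟩ : ∃ G, G = 4 * (legθ k + legS k ^ 2 / legθ k) := ⟨_, rfl⟩
  have hG0 : 0 < G := by rw [hG]; positivity
  have hlift : ∀ (l r : ℝ) (y g : ℝ[X]) (A A' : ℝ), l < r → m ≤ r - l →
      g ∈ Polynomial.degreeLT ℝ (k + 1) → IsLift k l r y g A A' →
      ip l r g g ≤ C * (1 / m ^ 2 + 1 / m) * (ip l r y y + (A ^ 2 + A' ^ 2)) := by
    intro l r y g A A' h hmη hg hy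
    refine (hl l r y g A A' h hg hy).trans ?_
    rw [mul_assoc]
    refine mul_le_mul_of_nonneg_left ?_ hC.le
    have hy0 := ip_self_nonneg y h.le
    have h1 : ip l r y y / (r - l) ^ 2 ≤ ip l r y y / m ^ 2 := by gcongr
    have h2 : (A ^ 2 + A' ^ 2) / (r - l) ≤ (A ^ 2 + A' ^ 2) / m := by gcongr
    have h3 : 0 ≤ ip l r y y / m := by positivity
    have h4 : 0 ≤ (A ^ 2 + A' ^ 2) / m ^ 2 := by positivity
    have h5 : (1 / m ^ 2 + 1 / m) * (ip l r y y + (A ^ 2 + A' ^ 2)) = ip l r y y / m ^ 2 +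
      (A ^ 2 + A' ^ 2) / m + (ip l r y y / m + (A ^ 2 + A' ^ 2) / m ^ 2) := by ring
    linarith
  obtain ⟨K, hK⟩ : ∃ K, K = C * (1 / m ^ 2 + 1 / m) := ⟨_, rfl⟩
  have hK0 : 0 < K := by rw [hK]; positivity
  rw [← hK] at hlift
  obtain ⟨C1, hC1⟩ : ∃ C1, C1 = 2 * K * (1 + (2 * M ^ 2 + 1)) + 2 * legθ k := ⟨_, rfl⟩
  have hC10 : 0 < C1 := by rw [hC1]; positivity
  obtain ⟨C2, hC2⟩ : ∃ C2, C2 = 2 * K * (C1 + 9 + 2 * (b - a)) + G := ⟨_, rfl⟩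
  have hC20 : 0 < C2 := by rw [hC2]; positivity
  obtain ⟨C3, hC3⟩ : ∃ C3, C3 = C1 + C2 := ⟨_, rfl⟩
  have hC30 : 0 < C3 := by rw [hC3]; positivity
  obtain ⟨Wb, hWb⟩ : ∃ Wb, Wb = W + (b - a) := ⟨_, rfl⟩
  have hWb0 : 0 < Wb := by rw [hWb]; positivity
  obtain ⟨CS, hCS⟩ : ∃ CS, CS = 1 + (b - a) ^ 2 := ⟨_, rfl⟩
  have hCS0 : 0 < CS := by rw [hCS]; positivity
  -- On a fixed mesh D and p are bounded by C₃ times ‖q‖², jumps and sources. With this ε the terms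
  -- ε‖D‖² and ε‖p‖² in the energy inequality are absorbed, although the inner product of D with u
  -- has no sign.
  obtain ⟨ε, hε⟩ : ∃ ε, ε = 1 / (4 * C3) := ⟨_, rfl⟩
  have hε0 : 0 < ε := by rw [hε]; positivity
  have hε1 : C3 * ε = 1 / 4 := by rw [hε]; field_simp
  refine ⟨C3 * (1 + 2 * (CE * CS + Wb ^ 2 / (4 * ε) + legθ k * Wb ^ 2 / (4 * ε)) + 2), by positivity,
    fun e he => ?_⟩
  have p1 : 𝒯.normSq (fun i => (e i).p) ≤
      C1 * (𝒯.normSq (fun i => (e i).q) + jumpSum 𝒯 e + srcSum 𝒯 e) := by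
    simp only [Mesh.normSq, jumpSum, srcSum]
    rw [← Finset.sum_add_distrib, ← Finset.sum_add_distrib, Finset.mul_sum]
    refine Finset.sum_le_sum fun i _ => ?_
    have h1 := (e i).ip_p_le k (hlt i)
    have h2 := hlift _ _ _ _ _ _ (hlt i) (hmi i) (he.sol i).gq_mem (he.sol i).lift_q
    have h3 := ((e i).src_ge (hlt i)).2.2.1
    have h4 := mul_le_mul_of_nonneg_left (add_le_add ((he.sol i).Qr_sq_le (hτ i))
      ((he.sol i).Ql_sq_le (hτ i))) hK0.le
    have hq := ip_self_nonneg (e i).q (hlt i).le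
    have hJ := (e i).jump_nonneg (𝒯.left i) (𝒯.right i)
    have hS := (e i).src_nonneg (hlt i)
    have hr : 0 ≤ (2 * K * (2 * M ^ 2 + 1) + 2 * legθ k) * ip (𝒯.left i) (𝒯.right i) (e i).q (e i).q
      + (2 * K + 2 * legθ k) * (e i).jump (𝒯.left i) (𝒯.right i)
      + 2 * K * (1 + (2 * M ^ 2 + 1)) * (e i).src (𝒯.left i) (𝒯.right i) := by positivity
    rw [hC1]
    linear_combination h1 + 2 * h2 + 2 * legθ k * h3 + 2 * h4 + hr
  have p2 : 𝒯.normSq (fun i => (e i).D) ≤ 2 * K * 𝒯.normSq (fun i => (e i).p) +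
      18 * K * jumpSum 𝒯 e + (4 * K * (b - a) + G) * srcSum 𝒯 e := by
    simp only [Mesh.normSq, jumpSum, srcSum]
    rw [Finset.mul_sum, Finset.mul_sum, Finset.mul_sum, ← Finset.sum_add_distrib,
      ← Finset.sum_add_distrib]
    refine Finset.sum_le_sum fun i _ => ?_
    have h1 := (e i).ip_D_le k (hlt i)
    rw [← hG] at h1
    have h2 := hlift _ _ _ _ _ _ (hlt i) (hmi i) (he.sol i).gp_mem (he.sol i).lift_p
    have hS := (e i).src_nonneg (hlt i)
    have h3 := ((e i).src_ge (hlt i)).2.2.2.trans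
      (mul_le_mul_of_nonneg_right (𝒯.len_le i) hS)
    have h4 := (he.sol i).Bl_sq_le (hτ i)
    have h5 := (ElemState.IsSol.jump_sq_le (e i) (𝒯.left i) (𝒯.right i)).2.2
    have h6 : (0 : ℝ) ≤ 2 * K := by positivity
    linear_combination h1 + 2 * h2 + 2 * K * h4 + 2 * K * h5 + 4 * K * h3
  have n1 := 𝒯.normSq_nonneg fun i => (e i).u
  have n2 := 𝒯.normSq_nonneg fun i => (e i).q
  have n3 := 𝒯.normSq_nonneg fun i => (e i).p
  have n4 := 𝒯.normSq_nonneg fun i => (e i).D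
  have n5 := srcSum_nonneg 𝒯 e
  have n6 := jumpSum_nonneg 𝒯 e
  have hS' : srcSum' 𝒯 e ≤ CS * srcSum 𝒯 e := by
    have h1 := lenSum_δ_le 𝒯 e
    have h2 : srcSum' 𝒯 e ≤ srcSum 𝒯 e + 𝒯.lenSum fun i => (e i).δ ^ 2 := by
      simp only [srcSum', srcSum, Mesh.lenSum]
      rw [← Finset.sum_add_distrib]
      refine Finset.sum_le_sum fun i _ => ?_
      rw [ElemState.src]
      have := 𝒯.len_pos i
      have : 0 ≤ (e i).δ ^ 2 / (𝒯.right i - 𝒯.left i) := by positivity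
      linarith
    rw [hCS]
    linarith
  have hen := hE N 𝒯 τ e hτ he
  have t1 := (neg_le_abs _).trans (young_mul n4 n1 (sq_nonneg Wb) hε0
    (by rw [hWb]; exact wipSum_sq_le 𝒯 hW.le (fun i => (e i).D) (fun i => (e i).u)))
  have t2 : -pairing 𝒯 k W (fun i => (e i).fq) (fun i => (e i).p) ≤
      ε * 𝒯.normSq (fun i => (e i).p) + legθ k * Wb ^ 2 / (4 * ε) * srcSum 𝒯 e := by
    refine (neg_le_abs _).trans (young_mul n3 n5 (by positivity) hε0 ?_)
    refine (pairing_sq_le_of_le 𝒯 _ _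
      (X := fun i => Wb ^ 2 * legθ k * ip (𝒯.left i) (𝒯.right i) (e i).p (e i).p)
      (w := fun i => (𝒯.right i - 𝒯.left i)) (fun i => ?_)
      (fun i => (𝒯.len_pos i).le) fun i => ?_).trans ?_
    · have := ip_self_nonneg (e i).p (hlt i).le
      positivity
    · have h1 := 𝒯.le_left i
      have h2 := 𝒯.right_le i
      have h3 := hlt i
      refine (wip_sq_le h3.le (by linarith) _ _).trans ?_
      rw [leg_self k h3]
      have hc : (W + (𝒯.left i - a) + (𝒯.right i - 𝒯.left i)) ^ 2 ≤ Wb ^ 2 := by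
        rw [hWb]
        exact pow_le_pow_left₀ (by linarith) (by linarith) 2
      have h4 : 0 ≤ ip (𝒯.left i) (𝒯.right i) (e i).p (e i).p *
        (legθ k * (𝒯.right i - 𝒯.left i)) := mul_nonneg (ip_self_nonneg _ h3.le)
          (mul_pos hθ (𝒯.len_pos i)).le
      linear_combination mul_le_mul_of_nonneg_right hc h4
    · rw [← Finset.mul_sum]
      have h1 : ∑ i, (𝒯.right i - 𝒯.left i) * (e i).fq ^ 2 ≤ srcSum 𝒯 e := lenSum_fq_le 𝒯 e
      refine (mul_le_mul_of_nonneg_right h1 (mul_nonneg (by positivity) n3)).trans_eq ?_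
      rw [Mesh.normSq]
      ring
  rw [hC3]
  generalize 𝒯.normSq (fun i => (e i).u) = nu at *
  generalize 𝒯.normSq (fun i => (e i).q) = nq at *
  generalize 𝒯.normSq (fun i => (e i).p) = np at *
  generalize 𝒯.normSq (fun i => (e i).D) = nD at *
  generalize srcSum 𝒯 e = S at *
  generalize srcSum' 𝒯 e = S' at *
  generalize jumpSum 𝒯 e = J at *
  generalize wipSum 𝒯 W _ _ = w at *
  generalize pairing 𝒯 k W _ _ = P at *
  clear hE hl hlift he hτ hmi hlt
  have p3 : nD ≤ C2 * (nq + J + S) := by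
    have hr : 0 ≤ (2 * K * (9 + 2 * (b - a)) + G) * nq + (2 * K * (2 * (b - a)) + G) * J +
      (18 * K) * S := by positivity
    rw [hC2]
    linear_combination p2 + 2 * K * p1 + hr
  have p4 : nD + np ≤ C3 * (nq + J + S) := by rw [hC3]; linear_combination p1 + p3
  have hG10 : 0 ≤ Wb ^ 2 / (4 * ε) := by positivity
  have hG20 : 0 ≤ legθ k * Wb ^ 2 / (4 * ε) := by positivity
  generalize Wb ^ 2 / (4 * ε) = G1 at *
  generalize legθ k * Wb ^ 2 / (4 * ε) = G2 at *
  rw [← hC3]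
  have p5 : nq + J ≤ CE * CS * S + ε * nD + G1 * nu + ε * np + G2 * S := by
    linear_combination hen + CE * hS' + t1 + t2
  have p6 : ε * (nD + np) ≤ 1 / 4 * (nq + J + S) := by
    linear_combination ε * p4 + (nq + J + S) * hε1
  have p7 : nq + J ≤ 2 * (CE * CS + G1 + G2) * (nu + S) + S := by
    have hr : 0 ≤ (CE * CS + G2) * nu + G1 * S := by positivity
    linarith
  have p8 := mul_le_mul_of_nonneg_left p7 hC30.le
  have hr : 0 ≤ C3 * (3 * nu + S) := by positivity
  linear_combination p4 + p8 + hr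

/-! ### Differences of states -/

/-- The equations are linear, hence time increments of solutions are solutions. This is what allows
the energy inequality to be used without differentiating p or the sources in time. -/
instance : Sub ElemState := ⟨fun e e' => ⟨e.u - e'.u, e.q - e'.q, e.p - e'.p, e.D - e'.D,
  e.ul - e'.ul, e.ur - e'.ur, e.ql - e'.ql, e.qr - e'.qr, e.pl - e'.pl, e.pr - e'.pr,
  e.fu - e'.fu, e.fq - e'.fq, e.fp - e'.fp, e.δ - e'.δ⟩⟩

lemma ElemState.IsSol.sub {e e' : ElemState} {k : ℕ} {l r tL sL tR : ℝ}
    (h : e.IsSol k l r tL sL tR) (h' : e'.IsSol k l r tL sL tR) :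
    (e - e').IsSol k l r tL sL tR where
  mem_u := Submodule.sub_mem _ h.mem_u h'.mem_u
  mem_q := Submodule.sub_mem _ h.mem_q h'.mem_q
  mem_p := Submodule.sub_mem _ h.mem_p h'.mem_p
  mem_D := Submodule.sub_mem _ h.mem_D h'.mem_D
  eq_u v hv := by
    change ip l r (Polynomial.derivative (e.u - e'.u)) v +
      (e.ur - e'.ur - (e.u - e'.u).eval r) * v.eval r -
      (e.ul - e'.ul - (e.u - e'.u).eval l) * v.eval l =
      ip l r (e.q - e'.q) v - (e.fq - e'.fq) * ip l r (leg k l r) v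
    simp only [Polynomial.derivative_sub, ip_sub_left, Polynomial.eval_sub]
    linear_combination h.eq_u v hv - h'.eq_u v hv
  eq_q v hv := by
    change ip l r (Polynomial.derivative (e.q - e'.q)) v +
      (e.qr - e'.qr - (e.q - e'.q).eval r) * v.eval r -
      (e.ql - e'.ql - (e.q - e'.q).eval l) * v.eval l =
      ip l r (e.p - e'.p) v - (e.fp - e'.fp) * ip l r (leg k l r) v
    simp only [Polynomial.derivative_sub, ip_sub_left, Polynomial.eval_sub]
    linear_combination h.eq_q v hv - h'.eq_q v hv
  eq_p v hv := by
    change ip l r (Polynomial.derivative (e.p - e'.p)) v +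
      (e.pr - e'.pr - (e.p - e'.p).eval r) * v.eval r -
      (e.pl - e'.pl - (e.p - e'.p).eval l) * v.eval l =
      (e.fu - e'.fu - legS k * (e.δ - e'.δ) / (legθ k * (r - l))) * ip l r (leg k l r) v -
        ip l r (e.D - e'.D) v
    simp only [Polynomial.derivative_sub, ip_sub_left, Polynomial.eval_sub]
    linear_combination h.eq_p v hv - h'.eq_p v hv
  flux_ql := by
    change e.ql - e'.ql - (e.q - e'.q).eval l = -tL * (e.ul - e'.ul - (e.u - e'.u).eval l)
    simp only [Polynomial.eval_sub]
    linear_combination h.flux_ql - h'.flux_ql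
  flux_pl := by
    change e.pl - e'.pl - (e.p - e'.p).eval l = -sL * (e.ul - e'.ul - (e.u - e'.u).eval l) +
      (e.δ - e'.δ)
    simp only [Polynomial.eval_sub]
    linear_combination h.flux_pl - h'.flux_pl
  flux_qr := by
    change e.qr - e'.qr - (e.q - e'.q).eval r = tR * (e.ur - e'.ur - (e.u - e'.u).eval r) +
      tR⁻¹ * (e.pr - e'.pr - (e.p - e'.p).eval r)
    simp only [Polynomial.eval_sub]
    linear_combination h.flux_qr - h'.flux_qr

lemma IsGlobalSol.sub {a b : ℝ} {N : ℕ} {𝒯 : Mesh a b N} {k : ℕ} {τ : Stabilization N}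
    {e e' : Fin N → ElemState} (h : IsGlobalSol 𝒯 k τ e) (h' : IsGlobalSol 𝒯 k τ e') :
    IsGlobalSol 𝒯 k τ (fun i => e i - e' i) where
  sol i := (h.sol i).sub (h'.sol i)
  nodal_u := by
    obtain ⟨y, h0, hN, hy⟩ := h.nodal_u
    obtain ⟨y', h0', hN', hy'⟩ := h'.nodal_u
    exact ⟨fun j => y j - y' j, by simp [h0, h0'], by simp [hN, hN'],
      fun i => ⟨congrArg₂ (· - ·) (hy i).1 (hy' i).1, congrArg₂ (· - ·) (hy i).2 (hy' i).2⟩⟩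
  nodal_q := by
    obtain ⟨y, hN, hy⟩ := h.nodal_q
    obtain ⟨y', hN', hy'⟩ := h'.nodal_q
    exact ⟨fun j => y j - y' j, by simp [hN, hN'],
      fun i => ⟨congrArg₂ (· - ·) (hy i).1 (hy' i).1, congrArg₂ (· - ·) (hy i).2 (hy' i).2⟩⟩
  nodal_p := by
    obtain ⟨y, hy⟩ := h.nodal_p
    obtain ⟨y', hy'⟩ := h'.nodal_p
    exact ⟨fun j => y j - y' j,
      fun i => ⟨congrArg₂ (· - ·) (hy i).1 (hy' i).1, congrArg₂ (· - ·) (hy i).2 (hy' i).2⟩⟩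

/-! ### Dependence on the coefficients -/

section

variable {l r c : ℝ}

lemma wip_add_left (u v w : ℝ[X]) : wip l r c (u + v) w = wip l r c u w + wip l r c v w := by
  rw [wip, mul_add, ip_add_left, wip, wip]

lemma wip_smul_left (x : ℝ) (v w : ℝ[X]) : wip l r c (x • v) w = x * wip l r c v w := by
  rw [wip, mul_smul_comm, ip_smul_left, wip]

lemma wip_sub_left (u v w : ℝ[X]) : wip l r c (u - v) w = wip l r c u w - wip l r c v w := by
  rw [wip, mul_sub, ip_sub_left, wip, wip]

lemma wip_smul_right (x : ℝ) (v w : ℝ[X]) : wip l r c v (x • w) = x * wip l r c v w := by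
  rw [wip_comm, wip_smul_left, wip_comm]

lemma wip_sub_right (u v w : ℝ[X]) : wip l r c u (v - w) = wip l r c u v - wip l r c u w := by
  rw [wip_comm, wip_sub_left, wip_comm l r c v, wip_comm l r c w]

/-- The inner product as a bilinear map. -/
def ipBilin (l r : ℝ) : ℝ[X] →ₗ[ℝ] ℝ[X] →ₗ[ℝ] ℝ :=
  LinearMap.mk₂ ℝ (fun v w => ip l r v w) (fun _ _ _ => ip_add_left _ _ _)
    (fun _ _ _ => ip_smul_left _ _ _) (fun _ _ _ => ip_add_right _ _ _)
    (fun _ _ _ => ip_smul_right _ _ _)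

/-- The weighted inner product as a bilinear map. -/
def wipBilin (l r c : ℝ) : ℝ[X] →ₗ[ℝ] ℝ[X] →ₗ[ℝ] ℝ :=
  LinearMap.mk₂ ℝ (fun v w => wip l r c v w) wip_add_left wip_smul_left
    (fun u v w => by rw [wip_comm, wip_add_left, wip_comm l r c v, wip_comm l r c w])
    (fun x v w => wip_smul_right x v w)

lemma eq_sum_smul_X_pow {n : ℕ} {v : ℝ[X]} (hv : v ∈ Polynomial.degreeLT ℝ n) :
    v = ∑ j ∈ Finset.range n, v.coeff j • (Polynomial.X : ℝ[X]) ^ j := by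
  refine Polynomial.funext fun x => ?_
  rw [eval_eq_sum_of_mem hv, Polynomial.eval_finsetSum]
  simp

/-- Limits and derivatives of families of polynomials are taken coefficientwise; this formula
transfers them to inner products. -/
lemma bilin_eq_sum (B : ℝ[X] →ₗ[ℝ] ℝ[X] →ₗ[ℝ] ℝ) {n : ℕ} {v w : ℝ[X]}
    (hv : v ∈ Polynomial.degreeLT ℝ n) (hw : w ∈ Polynomial.degreeLT ℝ n) :
    B v w = ∑ j ∈ Finset.range n, ∑ m ∈ Finset.range n,
      v.coeff j * w.coeff m * B (Polynomial.X ^ j) (Polynomial.X ^ m) := by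
  conv_lhs => rw [eq_sum_smul_X_pow hv, eq_sum_smul_X_pow hw]
  simp only [map_sum, LinearMap.sum_apply, map_smul, LinearMap.smul_apply, smul_eq_mul,
    Finset.mul_sum]
  rw [Finset.sum_comm]
  refine Finset.sum_congr rfl fun j _ => Finset.sum_congr rfl fun m _ => by ring

open Filter Topology in
lemma tendsto_bilin (B : ℝ[X] →ₗ[ℝ] ℝ[X] →ₗ[ℝ] ℝ) {n : ℕ} {ι : Type*} {F : Filter ι}
    {v w : ι → ℝ[X]} {v₀ w₀ : ℝ[X]} (hv : ∀ᶠ i in F, v i ∈ Polynomial.degreeLT ℝ n)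
    (hw : ∀ᶠ i in F, w i ∈ Polynomial.degreeLT ℝ n) (hv₀ : v₀ ∈ Polynomial.degreeLT ℝ n)
    (hw₀ : w₀ ∈ Polynomial.degreeLT ℝ n)
    (h1 : ∀ j, Tendsto (fun i => (v i).coeff j) F (𝓝 (v₀.coeff j)))
    (h2 : ∀ j, Tendsto (fun i => (w i).coeff j) F (𝓝 (w₀.coeff j))) :
    Tendsto (fun i => B (v i) (w i)) F (𝓝 (B v₀ w₀)) := by
  rw [bilin_eq_sum B hv₀ hw₀]
  refine Tendsto.congr' (f₁ := fun i => ∑ j ∈ Finset.range n, ∑ m ∈ Finset.range n,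
      (v i).coeff j * (w i).coeff m * B (Polynomial.X ^ j) (Polynomial.X ^ m)) ?_ ?_
  · filter_upwards [hv, hw] with i hi hi' using (bilin_eq_sum B hi hi').symm
  · exact tendsto_finsetSum _ fun j _ => tendsto_finsetSum _ fun m _ =>
      ((h1 j).mul (h2 m)).mul_const _

lemma hasDerivWithinAt_bilin (B : ℝ[X] →ₗ[ℝ] ℝ[X] →ₗ[ℝ] ℝ) {n : ℕ} {v w : ℝ → ℝ[X]}
    {v' w' : ℝ[X]} {S : Set ℝ} {t : ℝ} (ht : t ∈ S) (hv : ∀ s ∈ S, v s ∈ Polynomial.degreeLT ℝ n)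
    (hw : ∀ s ∈ S, w s ∈ Polynomial.degreeLT ℝ n) (hv' : v' ∈ Polynomial.degreeLT ℝ n)
    (hw' : w' ∈ Polynomial.degreeLT ℝ n)
    (h1 : ∀ j, HasDerivWithinAt (fun s => (v s).coeff j) (v'.coeff j) S t)
    (h2 : ∀ j, HasDerivWithinAt (fun s => (w s).coeff j) (w'.coeff j) S t) :
    HasDerivWithinAt (fun s => B (v s) (w s)) (B v' (w t) + B (v t) w') S t := by
  rw [bilin_eq_sum B hv' (hw t ht), bilin_eq_sum B (hv t ht) hw', ← Finset.sum_add_distrib]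
  refine HasDerivWithinAt.congr (f := fun s => ∑ j ∈ Finset.range n, ∑ m ∈ Finset.range n,
      (v s).coeff j * (w s).coeff m * B (Polynomial.X ^ j) (Polynomial.X ^ m)) ?_
      (fun s hs => bilin_eq_sum B (hv s hs) (hw s hs)) (bilin_eq_sum B (hv t ht) (hw t ht))
  refine HasDerivWithinAt.fun_sum fun j _ => ?_
  rw [← Finset.sum_add_distrib]
  refine HasDerivWithinAt.fun_sum fun m _ => ?_
  refine (((h1 j).fun_mul (h2 m)).mul_const (B (Polynomial.X ^ j) (Polynomial.X ^ m))).congr_deriv ?_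
  ring

end

/-! ### Continuity and summation by parts for functions of time. -/

open Filter Topology in
lemma continuousOn_of_sq_le {f : ℝ → ℝ} {S : Set ℝ} {g : ℝ → ℝ → ℝ}
    (h : ∀ t ∈ S, ∀ s ∈ S, (f s - f t) ^ 2 ≤ g t s)
    (hg : ∀ t ∈ S, Tendsto (g t) (𝓝[S] t) (𝓝 0)) : ContinuousOn f S := by
  intro t ht
  rw [ContinuousWithinAt, tendsto_iff_dist_tendsto_zero]
  have h1 : Tendsto (fun s => Real.sqrt (g t s)) (𝓝[S] t) (𝓝 0) := by
    simpa using (hg t ht).sqrt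
  refine squeeze_zero' (Eventually.of_forall fun _ => dist_nonneg) ?_ h1
  filter_upwards [self_mem_nhdsWithin] with s hs
  rw [Real.dist_eq]
  exact Real.abs_le_sqrt (h t ht s hs)

/-- Summation by parts for time increments. -/
lemma abs_integral_increments_le {N : ℕ} {T σ t A B : ℝ} {F P : ℝ → Fin N → ℝ}
    (hF : ∀ i, ContinuousOn (fun s => F s i) (Icc 0 T))
    (hP : ∀ i, ContinuousOn (fun s => P s i) (Icc 0 T)) (hσ : 0 < σ) (hσt : σ ≤ t)
    (ht : t + σ ≤ T) (hA : ∀ s ∈ Icc 0 (T - σ), ∀ s' ∈ Icc 0 T,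
      |∑ i, (F (s + σ) i - F s i) * P s' i| ≤ A)
    (hB : ∀ s ∈ Icc 0 (T - 2 * σ), ∀ s' ∈ Icc 0 T,
      |∑ i, (F (s + 2 * σ) i - 2 * F (s + σ) i + F s i) * P s' i| ≤ B) :
    |∫ s in 0..t, ∑ i, (F (s + σ) i - F s i) * (P (s + σ) i - P s i)| ≤ t * B + 2 * σ * A := by
  have hF' : ∀ i, ContinuousOn (fun s => F (s + σ) i) (Icc 0 (T - σ)) := fun i =>
    (hF i).comp (by fun_prop) fun s hs => ⟨by linarith [hs.1], by linarith [hs.2]⟩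
  have hFm : ∀ i, ContinuousOn (fun s => F (s - σ) i) (Icc σ T) := fun i =>
    (hF i).comp (by fun_prop) fun s hs => ⟨by linarith [hs.1], by linarith [hs.2]⟩
  have hsub : Icc 0 (T - σ) ⊆ Icc 0 T := Icc_subset_Icc le_rfl (by linarith)
  obtain ⟨B0, hB0⟩ : ∃ B0 : ℝ → ℝ, B0 = fun s => ∑ i, (F (s + σ) i - F s i) * P s i := ⟨_, rfl⟩
  obtain ⟨Bm, hBm⟩ : ∃ Bm : ℝ → ℝ, Bm = fun s => ∑ i, (F s i - F (s - σ) i) * P s i := ⟨_, rfl⟩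
  have c0 : ContinuousOn B0 (Icc 0 (T - σ)) := by
    rw [hB0]
    exact continuousOn_finsetSum _ fun i _ =>
      ((hF' i).sub ((hF i).mono hsub)).mul ((hP i).mono hsub)
  have hsub' : Icc σ T ⊆ Icc 0 T := Icc_subset_Icc hσ.le le_rfl
  have cm : ContinuousOn Bm (Icc σ T) := by
    rw [hBm]
    exact continuousOn_finsetSum _ fun i _ =>
      (((hF i).mono hsub').sub (hFm i)).mul ((hP i).mono hsub')
  have i0 : ∀ x ∈ Icc 0 (T - σ), ∀ y ∈ Icc 0 (T - σ), IntervalIntegrable B0 volume x y :=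
    fun x hx y hy => (c0.mono (uIcc_subset_Icc hx hy)).intervalIntegrable
  have im : ∀ x ∈ Icc σ T, ∀ y ∈ Icc σ T, IntervalIntegrable Bm volume x y :=
    fun x hx y hy => (cm.mono (uIcc_subset_Icc hx hy)).intervalIntegrable
  have m0 : (0 : ℝ) ∈ Icc 0 (T - σ) := ⟨le_rfl, by linarith⟩
  have mσ : σ ∈ Icc 0 (T - σ) := ⟨hσ.le, by linarith⟩
  have mt : t ∈ Icc 0 (T - σ) := ⟨by linarith, by linarith⟩
  have m1 : σ ∈ Icc σ T := ⟨le_rfl, by linarith⟩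
  have m2 : t ∈ Icc σ T := ⟨hσt, by linarith⟩
  have m3 : t + σ ∈ Icc σ T := ⟨by linarith, ht⟩
  -- `Bm` and `B0` pair P(s) with the backward and the forward increment of F at s. The shift by σ
  -- moves P to the same time in both.
  have e1 : ∫ s in 0..t, ∑ i, (F (s + σ) i - F s i) * (P (s + σ) i - P s i) =
      (∫ s in 0..t, Bm (s + σ)) - ∫ s in 0..t, B0 s := by
    rw [← intervalIntegral.integral_sub _ (i0 0 m0 t mt)]
    · refine intervalIntegral.integral_congr fun s _ => ?_
      simp only [hBm, hB0, ← Finset.sum_sub_distrib, add_sub_cancel_right]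
      exact Finset.sum_congr rfl fun i _ => by ring
    · have := (im σ m1 (t + σ) m3).comp_add_right σ
      simpa using this
  rw [e1, intervalIntegral.integral_comp_add_right Bm σ, zero_add,
    ← intervalIntegral.integral_add_adjacent_intervals (im σ m1 t m2) (im t m2 (t + σ) m3),
    ← intervalIntegral.integral_add_adjacent_intervals (i0 0 m0 σ mσ) (i0 σ mσ t mt)]
  -- On the common interval from σ to t the difference of `Bm` and `B0` is minus a second difference
  -- of F paired with P(s). The two leftover intervals have length σ and are estimated by A.
  have e2 : (∫ s in σ..t, Bm s) - ∫ s in σ..t, B0 s = ∫ s in σ..t, (Bm s - B0 s) :=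
    (intervalIntegral.integral_sub (im σ m1 t m2) (i0 σ mσ t mt)).symm
  have b1 : |∫ s in σ..t, (Bm s - B0 s)| ≤ B * |t - σ| := by
    rw [← Real.norm_eq_abs]
    refine intervalIntegral.norm_integral_le_of_norm_le_const fun s hs => ?_
    rw [uIoc_of_le hσt] at hs
    rw [Real.norm_eq_abs]
    have h1 := hB (s - σ) ⟨by linarith [hs.1], by linarith [hs.2]⟩ s
      ⟨by linarith [hs.1], by linarith [hs.2]⟩
    rw [← abs_neg, ← Finset.sum_neg_distrib] at h1
    convert h1 using 2
    simp only [hBm, hB0, ← Finset.sum_sub_distrib]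
    refine Finset.sum_congr rfl fun i _ => ?_
    rw [show s - σ + 2 * σ = s + σ by ring, show s - σ + σ = s by ring]
    ring
  have b2 : |∫ s in t..(t + σ), Bm s| ≤ A * |t + σ - t| := by
    rw [← Real.norm_eq_abs]
    refine intervalIntegral.norm_integral_le_of_norm_le_const fun s hs => ?_
    rw [uIoc_of_le (by linarith)] at hs
    have h1 := hA (s - σ) ⟨by linarith [hs.1], by linarith [hs.2]⟩ s
      ⟨by linarith [hs.1], by linarith [hs.2]⟩
    simpa [hBm] using h1
  have b3 : |∫ s in 0..σ, B0 s| ≤ A * |σ - 0| := by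
    rw [← Real.norm_eq_abs]
    refine intervalIntegral.norm_integral_le_of_norm_le_const fun s hs => ?_
    rw [uIoc_of_le hσ.le] at hs
    have h1 := hA s ⟨by linarith [hs.1], by linarith [hs.2]⟩ s
      ⟨by linarith [hs.1], by linarith [hs.2]⟩
    simpa [hB0] using h1
  rw [abs_of_nonneg (sub_nonneg.2 hσt)] at b1
  rw [add_sub_cancel_left, abs_of_pos hσ] at b2
  rw [sub_zero, abs_of_pos hσ] at b3
  have hB0' : 0 ≤ B := (abs_nonneg _).trans
    (hB 0 ⟨le_rfl, by linarith⟩ 0 ⟨le_rfl, by linarith⟩)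
  rw [show (∫ s in σ..t, Bm s) + (∫ s in t..(t + σ), Bm s) -
    ((∫ s in 0..σ, B0 s) + ∫ s in σ..t, B0 s) = (∫ s in σ..t, (Bm s - B0 s)) +
      (∫ s in t..(t + σ), Bm s) - ∫ s in 0..σ, B0 s by rw [← e2]; ring]
  refine (abs_sub _ _).trans (le_trans (add_le_add (abs_add_le _ _) le_rfl) ?_)
  nlinarith

/-! ### Evolution of the discrete error -/

section

variable {a b : ℝ} {N : ℕ}

/-- A family of solutions of the discrete error equations that solves the evolution problem, with
sources of size `H` which are regular in time. -/
structure IsEvolution (𝒯 : Mesh a b N) (k : ℕ) (τ : Stabilization N) (T H : ℝ)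
    (e : ℝ → Fin N → ElemState) : Prop where
  sol : ∀ t ∈ Icc 0 T, IsGlobalSol 𝒯 k τ (e t)
  deriv : ∀ t ∈ Icc 0 T, ∀ i m,
    HasDerivWithinAt (fun s => (e s i).u.coeff m) ((e t i).D.coeff m) (Icc 0 T) t
  src_le : ∀ t ∈ Icc 0 T, srcSum 𝒯 (e t) ≤ H ^ 2
  inc_le : ∀ t ∈ Icc 0 T, ∀ s ∈ Icc 0 T,
    srcSum' 𝒯 (fun i => e t i - e s i) ≤ (t - s) ^ 2 * H ^ 2
  -- Only fq is paired with p, so only fq needs second differences. Of the weight η³ one factor is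
  -- the usual length; the other two reflect the smallness of the top coefficients of p and pay for
  -- missing regularity.
  inc2_le : ∀ σ, 0 < σ → ∀ s ∈ Icc 0 (T - 2 * σ), ∑ i, (𝒯.right i - 𝒯.left i) ^ 3 *
    ((e (s + 2 * σ) i).fq - 2 * (e (s + σ) i).fq + (e s i).fq) ^ 2 ≤ σ ^ 4 * H ^ 2

variable {𝒯 : Mesh a b N} {k : ℕ} {τ : Stabilization N} {T H M : ℝ} {e : ℝ → Fin N → ElemState}

lemma srcSum'_le (𝒯 : Mesh a b N) (e : Fin N → ElemState) :
    srcSum' 𝒯 e ≤ (1 + (b - a) ^ 2) * srcSum 𝒯 e := by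
  have h1 := lenSum_δ_le 𝒯 e
  have h2 : srcSum' 𝒯 e ≤ srcSum 𝒯 e + 𝒯.lenSum fun i => (e i).δ ^ 2 := by
    simp only [srcSum', srcSum, Mesh.lenSum]
    rw [← Finset.sum_add_distrib]
    refine Finset.sum_le_sum fun i _ => ?_
    rw [ElemState.src]
    have := 𝒯.len_pos i
    have : 0 ≤ (e i).δ ^ 2 / (𝒯.right i - 𝒯.left i) := by positivity
    linarith
  linarith

lemma srcSum_le_srcSum' {m : ℝ} (hm : 0 < m) (hmi : ∀ i, m ≤ 𝒯.right i - 𝒯.left i)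
    (e : Fin N → ElemState) : srcSum 𝒯 e ≤ (1 + 1 / m ^ 2) * srcSum' 𝒯 e := by
  simp only [srcSum', srcSum, Mesh.lenSum]
  rw [Finset.mul_sum]
  refine Finset.sum_le_sum fun i _ => ?_
  rw [ElemState.src]
  have hη := 𝒯.len_pos i
  have hmη := hmi i
  generalize 𝒯.right i - 𝒯.left i = η at *
  have h1 : (e i).δ ^ 2 / η ≤ 1 / m ^ 2 * (η * (e i).δ ^ 2) := by
    have h2 : (e i).δ ^ 2 / η = (e i).δ ^ 2 * η * (1 / η ^ 2) := by field_simp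
    have h3 : 1 / η ^ 2 ≤ 1 / m ^ 2 := by
      gcongr
    rw [h2]
    have := mul_le_mul_of_nonneg_left h3 (by positivity : 0 ≤ (e i).δ ^ 2 * η)
    linarith
  have h2 : 0 ≤ η * (e i).δ ^ 2 + 1 / m ^ 2 * (η * ((e i).fu ^ 2 + (e i).fq ^ 2 + (e i).fp ^ 2)) := by
    positivity
  linarith

lemma sum_cube_le (𝒯 : Mesh a b N) (f : Fin N → ℝ) :
    ∑ i, (𝒯.right i - 𝒯.left i) ^ 3 * f i ^ 2 ≤ (b - a) ^ 2 * 𝒯.lenSum fun i => f i ^ 2 := by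
  rw [Mesh.lenSum, Finset.mul_sum]
  refine Finset.sum_le_sum fun i _ => ?_
  have hη := 𝒯.len_pos i
  have h1 : (𝒯.right i - 𝒯.left i) ^ 2 ≤ (b - a) ^ 2 := by
    have := 𝒯.len_le i
    gcongr
  have h2 : 0 ≤ (𝒯.right i - 𝒯.left i) * f i ^ 2 := by positivity
  linear_combination mul_le_mul_of_nonneg_right h1 h2

lemma lenSum_fq_le' (𝒯 : Mesh a b N) (e : Fin N → ElemState) :
    (𝒯.lenSum fun i => (e i).fq ^ 2) ≤ srcSum' 𝒯 e :=
  Finset.sum_le_sum fun i _ => mul_le_mul_of_nonneg_left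
    (by nlinarith [sq_nonneg (e i).fu, sq_nonneg (e i).fp, sq_nonneg (e i).δ]) (𝒯.len_pos i).le

namespace IsEvolution

lemma continuousOn_fq (he : IsEvolution 𝒯 k τ T H e) (i : Fin N) :
    ContinuousOn (fun t => (e t i).fq) (Icc 0 T) := by
  refine continuousOn_of_sq_le (g := fun t s => (s - t) ^ 2 * H ^ 2 / (𝒯.right i - 𝒯.left i))
    (fun t ht s hs => ?_) fun t ht => ?_
  · have hη := 𝒯.len_pos i
    rw [le_div_iff₀ hη, mul_comm]
    refine le_trans ?_ ((lenSum_fq_le' 𝒯 _).trans (he.inc_le s hs t ht))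
    exact Finset.single_le_sum (f := fun i => (𝒯.right i - 𝒯.left i) *
      (e s i - e t i).fq ^ 2) (fun j _ => mul_nonneg (𝒯.len_pos j).le (sq_nonneg _))
      (Finset.mem_univ i)
  · have : Continuous fun s => (s - t) ^ 2 * H ^ 2 / (𝒯.right i - 𝒯.left i) := by fun_prop
    have h := this.tendsto t
    simp only [sub_self, ne_eq, OfNat.ofNat_ne_zero, not_false_eq_true, zero_pow, zero_mul,
      zero_div] at h
    exact h.mono_left nhdsWithin_le_nhds

open Filter Topology in
lemma tendsto_normSq_sub (he : IsEvolution 𝒯 k τ T H e) {t : ℝ} (ht : t ∈ Icc 0 T) :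
    Tendsto (fun s => 𝒯.normSq fun i => (e s i).u - (e t i).u) (𝓝[Icc 0 T] t) (𝓝 0) := by
  have h : ∀ i, Tendsto (fun s => ipBilin (𝒯.left i) (𝒯.right i) ((e s i).u - (e t i).u)
      ((e s i).u - (e t i).u)) (𝓝[Icc 0 T] t) (𝓝 (ipBilin (𝒯.left i) (𝒯.right i) 0 0)) := by
    intro i
    have hm : ∀ᶠ s in 𝓝[Icc 0 T] t, (e s i).u - (e t i).u ∈ Polynomial.degreeLT ℝ (k + 1) := by
      filter_upwards [self_mem_nhdsWithin] with s hs
      exact Submodule.sub_mem _ ((he.sol s hs).sol i).mem_u ((he.sol t ht).sol i).mem_u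
    have hc : ∀ j, Tendsto (fun s => ((e s i).u - (e t i).u).coeff j) (𝓝[Icc 0 T] t)
        (𝓝 ((0 : ℝ[X]).coeff j)) := by
      intro j
      have := (he.deriv t ht i j).continuousWithinAt.tendsto.sub_const ((e t i).u.coeff j)
      simpa using this
    exact tendsto_bilin _ hm hm (Submodule.zero_mem _) (Submodule.zero_mem _) hc hc
  have := tendsto_finsetSum Finset.univ fun i _ => h i
  simp only [ipBilin, LinearMap.mk₂_apply, ip_zero_left, Finset.sum_const_zero] at this
  exact this

/-- The unknowns depend continuously on time. -/
lemma continuousOn_wip_p (he : IsEvolution 𝒯 k τ T H e) (hk : 0 < k) (hab : a < b) (hM : 1 ≤ M)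
    (hτ : τ.Adm M) (i : Fin N) {c : ℝ} (hc : 0 ≤ c) (w : ℝ[X]) :
    ContinuousOn (fun t => wip (𝒯.left i) (𝒯.right i) c (e t i).p w) (Icc 0 T) := by
  obtain ⟨C, hC, hcont⟩ := exists_cont_le k hk hab hM 𝒯 hτ
  obtain ⟨m, hm, hmi⟩ := 𝒯.exists_pos_le_len
  obtain ⟨K, hK⟩ : ∃ K, K = (c + (𝒯.right i - 𝒯.left i)) ^ 2 *
    ip (𝒯.left i) (𝒯.right i) w w := ⟨_, rfl⟩
  have hK0 : 0 ≤ K := by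
    rw [hK]
    exact mul_nonneg (sq_nonneg _) (ip_self_nonneg _ (𝒯.left_lt_right i).le)
  refine continuousOn_of_sq_le (g := fun t s => K * (C * ((𝒯.normSq fun i => (e s i).u - (e t i).u) +
    (1 + 1 / m ^ 2) * ((s - t) ^ 2 * H ^ 2)))) (fun t ht s hs => ?_) fun t ht => ?_
  · rw [← wip_sub_left]
    refine (wip_sq_le (𝒯.left_lt_right i).le hc _ _).trans ?_
    have h1 := hcont _ ((he.sol s hs).sub (he.sol t ht))
    have h2 := he.inc_le s hs t ht
    have h3 := srcSum_le_srcSum' hm hmi fun i => e s i - e t i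
    have h4 : ip (𝒯.left i) (𝒯.right i) ((e s i).p - (e t i).p) ((e s i).p - (e t i).p) ≤
        𝒯.normSq fun i => (e s i - e t i).p :=
      Finset.single_le_sum (f := fun i => ip (𝒯.left i) (𝒯.right i) (e s i - e t i).p
        (e s i - e t i).p) (fun j _ => ip_self_nonneg _ (𝒯.left_lt_right j).le) (Finset.mem_univ i)
    have h5 := 𝒯.normSq_nonneg fun i => (e s i - e t i).D
    have h6 : ip (𝒯.left i) (𝒯.right i) ((e s i).p - (e t i).p) ((e s i).p - (e t i).p) ≤
        C * ((𝒯.normSq fun i => (e s i).u - (e t i).u) +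
          (1 + 1 / m ^ 2) * ((s - t) ^ 2 * H ^ 2)) := by
      refine h4.trans (le_trans (by linarith) (h1.trans (mul_le_mul_of_nonneg_left ?_ hC.le)))
      refine add_le_add le_rfl (h3.trans (mul_le_mul_of_nonneg_left h2 (by positivity)))
    have h7 := mul_le_mul_of_nonneg_left h6 hK0
    refine le_trans (le_of_eq ?_) h7
    rw [hK]
    ring
  · have h1 := he.tendsto_normSq_sub ht
    have h2 : Continuous fun s => (1 + 1 / m ^ 2) * ((s - t) ^ 2 * H ^ 2) := by fun_prop
    have h3 := (h2.tendsto t).mono_left (nhdsWithin_le_nhds (s := Icc 0 T))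
    have h4 := ((h1.add h3).const_mul C).const_mul K
    simpa using h4

/-- The bound is not uniform in the mesh. It only guarantees that the supremum of ‖D‖² is finite, so
that a multiple of it may be subtracted later. -/
lemma exists_normSq_D_le (he : IsEvolution 𝒯 k τ T H e) (hk : 0 < k) (hab : a < b) (hM : 1 ≤ M)
    (hτ : τ.Adm M) : ∃ Y : ℝ, ∀ t ∈ Icc 0 T, 𝒯.normSq (fun i => (e t i).D) ≤ Y := by
  obtain ⟨C, hC, hcont⟩ := exists_cont_le k hk hab hM 𝒯 hτ
  have h : ContinuousOn (fun t => 𝒯.normSq fun i => (e t i).u) (Icc 0 T) := by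
    refine continuousOn_finsetSum _ fun i _ t ht => ?_
    have hm : ∀ s ∈ Icc 0 T, (e s i).u ∈ Polynomial.degreeLT ℝ (k + 1) := fun s hs =>
      ((he.sol s hs).sol i).mem_u
    exact (hasDerivWithinAt_bilin (ipBilin (𝒯.left i) (𝒯.right i)) ht hm hm
      ((he.sol t ht).sol i).mem_D ((he.sol t ht).sol i).mem_D (he.deriv t ht i)
      (he.deriv t ht i)).continuousWithinAt
  obtain ⟨Y, hY⟩ := isCompact_Icc.bddAbove_image h
  refine ⟨C * (Y + H ^ 2), fun t ht => ?_⟩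
  have h1 := hcont _ (he.sol t ht)
  have h2 : 𝒯.normSq (fun i => (e t i).u) ≤ Y := hY (mem_image_of_mem _ ht)
  have h3 := he.src_le t ht
  have h4 := 𝒯.normSq_nonneg fun i => (e t i).p
  have h5 := mul_le_mul_of_nonneg_left (add_le_add h2 h3) hC.le
  linarith

/-- The energy of time increments. -/
lemma increment_le (he : IsEvolution 𝒯 k τ T H e) (hk : 0 < k) (hab : a < b) (hM : 1 ≤ M)
    (hτ : τ.Adm M) {W CE Q : ℝ} (hW : 0 ≤ W) (hCE : 0 ≤ CE) (hQ0 : 0 ≤ Q)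
    (hE : ∀ e' : Fin N → ElemState, IsGlobalSol 𝒯 k τ e' →
      wipSum 𝒯 W (fun i => (e' i).D) (fun i => (e' i).u) + 𝒯.normSq (fun i => (e' i).q) +
        jumpSum 𝒯 e' ≤ CE * srcSum' 𝒯 e' - pairing 𝒯 k W (fun i => (e' i).fq) fun i => (e' i).p)
    (hQ : ∀ s ∈ Icc 0 T, ∀ (f : Fin N → ℝ) (X : ℝ), 0 ≤ X →
      ∑ i, (𝒯.right i - 𝒯.left i) ^ 3 * f i ^ 2 ≤ X ^ 2 * H ^ 2 →
        |pairing 𝒯 k W f fun i => (e s i).p| ≤ X * Q)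
    {σ t : ℝ} (hσ : 0 < σ) (hσt : σ ≤ t) (ht : t + σ ≤ T) :
    wipSum 𝒯 W (fun i => (e (t + σ) i).u - (e t i).u) (fun i => (e (t + σ) i).u - (e t i).u) ≤
      wipSum 𝒯 W (fun i => (e σ i).u - (e 0 i).u) (fun i => (e σ i).u - (e 0 i).u) +
        2 * σ ^ 2 * (CE * T * H ^ 2 + (T + 2 * (b - a)) * Q) := by
  have hba := sub_pos.2 hab
  have hcW : ∀ i, 0 ≤ W + (𝒯.left i - a) := fun i => by linarith [𝒯.le_left i]
  have hmem : ∀ s ∈ Icc 0 (T - σ), s ∈ Icc 0 T ∧ s + σ ∈ Icc 0 T := fun s hs =>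
    ⟨⟨hs.1, by linarith [hs.2]⟩, ⟨by linarith [hs.1], by linarith [hs.2]⟩⟩
  have htsub : Icc 0 t ⊆ Icc 0 (T - σ) := Icc_subset_Icc le_rfl (by linarith)
  have hFc := he.continuousOn_fq
  have hPc : ∀ i, ContinuousOn (fun s => wip (𝒯.left i) (𝒯.right i) (W + (𝒯.left i - a)) (e s i).p
      (leg k (𝒯.left i) (𝒯.right i))) (Icc 0 T) := fun i =>
    he.continuousOn_wip_p hk hab hM hτ i (hcW i) _
  -- A comes from first differences of fq, where η³ ≤ (b - a)² η reduces the weight to the one in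
  -- `inc_le`; B comes from `inc2_le`.
  have hint := abs_integral_increments_le (A := (b - a) * σ * Q) (B := σ ^ 2 * Q) hFc hPc hσ hσt ht
    (fun s hs s' hs' => by
      refine hQ s' hs' (fun i => (e (s + σ) i).fq - (e s i).fq) ((b - a) * σ) (by positivity) ?_
      have h1 := he.inc_le (s + σ) (hmem s hs).2 s (hmem s hs).1
      have h2 := (lenSum_fq_le' 𝒯 fun i => e (s + σ) i - e s i).trans h1
      have h3 := (sum_cube_le 𝒯 fun i => (e (s + σ) i).fq - (e s i).fq).trans
        (mul_le_mul_of_nonneg_left h2 (sq_nonneg (b - a)))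
      exact h3.trans_eq (by ring))
    (fun s hs s' hs' => by
      refine hQ s' hs' (fun i => (e (s + 2 * σ) i).fq - 2 * (e (s + σ) i).fq + (e s i).fq) (σ ^ 2)
        (by positivity) ?_
      exact (he.inc2_le σ hσ s hs).trans_eq (by ring))
  -- the derivative of the energy
  obtain ⟨g, hg⟩ : ∃ g : ℝ → ℝ, g = fun s => wipSum 𝒯 W (fun i => (e (s + σ) i).u - (e s i).u)
    (fun i => (e (s + σ) i).u - (e s i).u) := ⟨_, rfl⟩
  have hder : ∀ s ∈ Icc 0 (T - σ), HasDerivWithinAt g (2 * wipSum 𝒯 W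
      (fun i => (e (s + σ) i).D - (e s i).D) (fun i => (e (s + σ) i).u - (e s i).u))
      (Icc 0 (T - σ)) s := by
    intro s hs
    have h1 : ∀ i, HasDerivWithinAt (fun s => wipBilin (𝒯.left i) (𝒯.right i) (W + (𝒯.left i - a))
        ((e (s + σ) i).u - (e s i).u) ((e (s + σ) i).u - (e s i).u)) _ (Icc 0 (T - σ)) s := fun i => by
      have hm : ∀ s ∈ Icc 0 (T - σ), (e (s + σ) i).u - (e s i).u ∈ Polynomial.degreeLT ℝ (k + 1) :=
        fun s hs => Submodule.sub_mem _ ((he.sol _ (hmem s hs).2).sol i).mem_u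
          ((he.sol _ (hmem s hs).1).sol i).mem_u
      have hm' : (e (s + σ) i).D - (e s i).D ∈ Polynomial.degreeLT ℝ (k + 1) :=
        Submodule.sub_mem _ ((he.sol _ (hmem s hs).2).sol i).mem_D
          ((he.sol _ (hmem s hs).1).sol i).mem_D
      have hd : ∀ j, HasDerivWithinAt (fun s => ((e (s + σ) i).u - (e s i).u).coeff j)
          (((e (s + σ) i).D - (e s i).D).coeff j) (Icc 0 (T - σ)) s := fun j => by
        simp only [Polynomial.coeff_sub]
        refine HasDerivWithinAt.sub ?_ ((he.deriv s (hmem s hs).1 i j).mono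
          fun x hx => (hmem x hx).1)
        have h2 := (he.deriv (s + σ) (hmem s hs).2 i j).scomp s
          ((hasDerivWithinAt_id s (Icc 0 (T - σ))).add_const σ) (fun x hx => (hmem x hx).2)
        simpa [Function.comp_def] using h2
      exact hasDerivWithinAt_bilin _ hs hm hm hm' hm' hd hd
    have h2 := HasDerivWithinAt.fun_sum fun i (_ : i ∈ Finset.univ) => h1 i
    rw [hg]
    refine h2.congr_deriv ?_
    rw [wipSum, Finset.mul_sum]
    refine Finset.sum_congr rfl fun i _ => ?_
    change wip _ _ _ _ _ + wip _ _ _ _ _ = _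
    rw [wip_comm _ _ _ ((e (s + σ) i).u - (e s i).u) ((e (s + σ) i).D - (e s i).D)]
    ring
  obtain ⟨R, hR⟩ : ∃ R : ℝ → ℝ, R = fun s => ∑ i, ((e (s + σ) i).fq - (e s i).fq) *
    (wip (𝒯.left i) (𝒯.right i) (W + (𝒯.left i - a)) (e (s + σ) i).p
      (leg k (𝒯.left i) (𝒯.right i)) - wip (𝒯.left i) (𝒯.right i) (W + (𝒯.left i - a)) (e s i).p
      (leg k (𝒯.left i) (𝒯.right i))) := ⟨_, rfl⟩
  have hRc : ContinuousOn R (Icc 0 (T - σ)) := by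
    have hs1 : ContinuousOn (fun s : ℝ => s + σ) (Icc 0 (T - σ)) := by fun_prop
    rw [hR]
    exact continuousOn_finsetSum _ fun i _ => (((hFc i).comp hs1 fun x hx => (hmem x hx).2).sub
      ((hFc i).mono fun x hx => (hmem x hx).1)).mul
      (((hPc i).comp hs1 fun x hx => (hmem x hx).2).sub ((hPc i).mono fun x hx => (hmem x hx).1))
  have hle : ∀ s ∈ Icc 0 (T - σ), 2 * wipSum 𝒯 W (fun i => (e (s + σ) i).D - (e s i).D)
      (fun i => (e (s + σ) i).u - (e s i).u) ≤ 2 * (CE * (σ ^ 2 * H ^ 2)) - 2 * R s := by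
    intro s hs
    have h1 := hE _ ((he.sol _ (hmem s hs).2).sub (he.sol _ (hmem s hs).1))
    have h2 := he.inc_le (s + σ) (hmem s hs).2 s (hmem s hs).1
    have h3 : pairing 𝒯 k W (fun i => (e (s + σ) i - e s i).fq) (fun i => (e (s + σ) i - e s i).p) =
        R s := by
      rw [pairing, hR]
      exact Finset.sum_congr rfl fun i _ => by rw [← wip_sub_left]; rfl
    have h4 := 𝒯.normSq_nonneg fun i => (e (s + σ) i - e s i).q
    have h5 := jumpSum_nonneg 𝒯 fun i => e (s + σ) i - e s i
    rw [h3] at h1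
    rw [add_sub_cancel_left] at h2
    have h6 := mul_le_mul_of_nonneg_left h2 hCE
    change wipSum 𝒯 W (fun i => (e (s + σ) i).D - (e s i).D)
      (fun i => (e (s + σ) i).u - (e s i).u) + _ + _ ≤ _ at h1
    linarith
  have ht0 : 0 ≤ t := hσ.le.trans hσt
  have hφ : ContinuousOn (fun s => 2 * (CE * (σ ^ 2 * H ^ 2)) - 2 * R s) (Icc 0 t) :=
    continuousOn_const.sub (continuousOn_const.mul (hRc.mono htsub))
  -- Only an upper bound of the derivative of the energy by a continuous function is used; no
  -- integrability of the derivative itself is required.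
  have hfin := intervalIntegral.sub_le_integral_of_hasDeriv_right_of_le ht0
    (fun s hs => (hder s (htsub hs)).continuousWithinAt.mono htsub)
    (fun s hs => ((hder s (htsub ⟨hs.1.le, hs.2.le⟩)).hasDerivAt
      (Icc_mem_nhds hs.1 (by linarith [hs.2]))).hasDerivWithinAt)
    (hφ.integrableOn_compact isCompact_Icc) (fun s hs => hle s (htsub ⟨hs.1.le, hs.2.le⟩))
  have hRi : IntervalIntegrable R volume 0 t :=
    ((hRc.mono htsub).mono (by rw [uIcc_of_le ht0])).intervalIntegrable
  rw [intervalIntegral.integral_sub (by simp) (hRi.const_mul 2),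
    intervalIntegral.integral_const, intervalIntegral.integral_const_mul, sub_zero,
    smul_eq_mul] at hfin
  have hRle : |∫ s in 0..t, R s| ≤ t * (σ ^ 2 * Q) + 2 * σ * ((b - a) * σ * Q) := by
    rw [hR]
    exact hint
  have hRle' := (neg_le_abs _).trans hRle
  rw [hg] at hfin
  simp only [zero_add] at hfin
  have h1 : t * (CE * (σ ^ 2 * H ^ 2)) ≤ T * (CE * (σ ^ 2 * H ^ 2)) :=
    mul_le_mul_of_nonneg_right (by linarith) (by positivity)
  have h2 : t * (σ ^ 2 * Q) ≤ T * (σ ^ 2 * Q) :=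
    mul_le_mul_of_nonneg_right (by linarith) (by positivity)
  linear_combination hfin + 2 * hRle' + 2 * h1 + 2 * h2

-- Difference quotients of u converge to D coefficientwise, also one-sidedly at the ends of the time
-- interval. This converts bounds for increments into bounds for D without a second time derivative.
open Filter Topology in
lemma tendsto_quotient (he : IsEvolution 𝒯 k τ T H e) {W t : ℝ} (ht : t ∈ Icc 0 T) {ι : Type*}
    {F : Filter ι} {s : ι → ℝ} (hs : Tendsto s F (𝓝[Icc 0 T \ {t}] t)) :
    Tendsto (fun i => wipSum 𝒯 W (fun j => (e (s i) j).u - (e t j).u)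
      (fun j => (e (s i) j).u - (e t j).u) / (s i - t) ^ 2) F
      (𝓝 (wipSum 𝒯 W (fun j => (e t j).D) fun j => (e t j).D)) := by
  have h1 : ∀ j, Tendsto (fun i => wipBilin (𝒯.left j) (𝒯.right j) (W + (𝒯.left j - a))
      ((s i - t)⁻¹ • ((e (s i) j).u - (e t j).u)) ((s i - t)⁻¹ • ((e (s i) j).u - (e t j).u))) F
      (𝓝 (wipBilin (𝒯.left j) (𝒯.right j) (W + (𝒯.left j - a)) (e t j).D (e t j).D)) := by
    intro j
    have hm : ∀ᶠ i in F, (s i - t)⁻¹ • ((e (s i) j).u - (e t j).u) ∈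
        Polynomial.degreeLT ℝ (k + 1) := by
      filter_upwards [hs self_mem_nhdsWithin] with i hi
      exact Submodule.smul_mem _ _ (Submodule.sub_mem _ ((he.sol _ hi.1).sol j).mem_u
        ((he.sol t ht).sol j).mem_u)
    have hc : ∀ m, Tendsto (fun i => ((s i - t)⁻¹ • ((e (s i) j).u - (e t j).u)).coeff m) F
        (𝓝 ((e t j).D.coeff m)) := by
      intro m
      have h2 := (hasDerivWithinAt_iff_tendsto_slope.1 (he.deriv t ht j m)).comp hs
      refine h2.congr fun i => ?_
      simp [slope]
    exact tendsto_bilin _ hm hm ((he.sol t ht).sol j).mem_D ((he.sol t ht).sol j).mem_D hc hc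
  have h2 := tendsto_finsetSum Finset.univ fun j _ => h1 j
  refine h2.congr fun i => ?_
  rw [wipSum, Finset.sum_div]
  refine Finset.sum_congr rfl fun j _ => ?_
  change wip _ _ _ _ _ = _
  rw [wip_smul_left, wip_smul_right, div_eq_mul_inv, ← inv_pow]
  ring

end IsEvolution

end

/-- The bound at the initial time. -/
lemma exists_initial_le (k : ℕ) (hk : 0 < k) (a b : ℝ) (hab : a < b) (M : ℝ) (hM : 1 ≤ M) :
    ∃ C h₀ : ℝ, 0 < C ∧ 0 < h₀ ∧ ∀ (N : ℕ) (𝒯 : Mesh a b N) (τ : Stabilization N)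
      (e : Fin N → ElemState) (ρ : Fin N → ℝ) (H : ℝ), 𝒯.size < h₀ → τ.Adm M →
      IsGlobalSol 𝒯 k τ e → srcSum 𝒯 e ≤ H ^ 2 →
      (∀ i, (e i).D = (e i).u + ρ i • leg k (𝒯.left i) (𝒯.right i)) →
      (𝒯.lenSum fun i => ρ i ^ 2) ≤ H ^ 2 → 𝒯.normSq (fun i => (e i).D) ≤ C * H ^ 2 := by
  obtain ⟨W, CE, hW, hCE, hE⟩ := exists_energy_le k hk a b hab M hM
  obtain ⟨CP, h₀, hCP, hh₀, hP⟩ := exists_pairing_le k hk a b hab M hM W hW.le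
  have hθ := legθ_pos k
  have hba := sub_pos.2 hab
  obtain ⟨Wb, hWb⟩ : ∃ Wb, Wb = W + (b - a) := ⟨_, rfl⟩
  have hWb0 : 0 < Wb := by rw [hWb]; positivity
  -- Two Young inequalities with this ε consume half of the coercivity W.
  obtain ⟨ε, hε⟩ : ∃ ε, ε = W / 4 := ⟨_, rfl⟩
  have hε0 : 0 < ε := by rw [hε]; positivity
  obtain ⟨K1, hK1⟩ : ∃ K1, K1 = Wb ^ 2 * legθ k / (4 * ε) := ⟨_, rfl⟩
  obtain ⟨K2, hK2⟩ : ∃ K2, K2 = (b - a) ^ 2 * CP / (4 * ε) := ⟨_, rfl⟩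
  have hK10 : 0 < K1 := by rw [hK1]; positivity
  have hK20 : 0 < K2 := by rw [hK2]; positivity
  refine ⟨2 / W * (CE * (1 + (b - a) ^ 2) + K1 + K2 + ε), h₀, by positivity, hh₀,
    fun N 𝒯 τ e ρ H hsz hτ he hS hD hρ => ?_⟩
  have h1 := hE N 𝒯 τ e hτ he
  have h2 := hP N 𝒯 τ e hsz hτ he fun i => (e i).fq
  have n2 := 𝒯.normSq_nonneg fun i => (e i).q
  have n4 := 𝒯.normSq_nonneg fun i => (e i).D
  have n5 := srcSum_nonneg 𝒯 e
  have n6 := jumpSum_nonneg 𝒯 e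
  have hH := sq_nonneg H
  have h3 := srcSum'_le 𝒯 e
  -- Substituting u = D - ρ L turns the indefinite product of D and u into the square of D up to a
  -- source.
  have h4 : wipSum 𝒯 W (fun i => (e i).D) (fun i => (e i).D) -
      wipSum 𝒯 W (fun i => (e i).D) (fun i => ρ i • leg k (𝒯.left i) (𝒯.right i)) =
      wipSum 𝒯 W (fun i => (e i).D) (fun i => (e i).u) := by
    rw [wipSum, wipSum, wipSum, ← Finset.sum_sub_distrib]
    refine Finset.sum_congr rfl fun i _ => ?_
    rw [← wip_sub_right]
    congr 1
    rw [hD]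
    simp
  have h5 := le_wipSum_self 𝒯 (W := W) fun i => (e i).D
  have h6 : 𝒯.normSq (fun i => ρ i • leg k (𝒯.left i) (𝒯.right i)) ≤ legθ k * H ^ 2 := by
    refine le_trans (le_of_eq ?_) (mul_le_mul_of_nonneg_left hρ hθ.le)
    rw [Mesh.normSq, Mesh.lenSum, Finset.mul_sum]
    exact Finset.sum_congr rfl fun i _ => ElemState.ip_smul_leg k (𝒯.left_lt_right i) _
  have t1 := (le_abs_self _).trans (young_mul n4 hH (by positivity : 0 ≤ Wb ^ 2 * legθ k) hε0
    ((wipSum_sq_le 𝒯 hW.le (fun i => (e i).D)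
      (fun i => ρ i • leg k (𝒯.left i) (𝒯.right i))).trans (by
        rw [← hWb]
        refine (mul_le_mul_of_nonneg_left h6 (mul_nonneg (sq_nonneg _) n4)).trans_eq (by ring))))
  have h7 : ∑ i, (𝒯.right i - 𝒯.left i) ^ 3 * (e i).fq ^ 2 ≤ (b - a) ^ 2 * H ^ 2 :=
    (sum_cube_le 𝒯 _).trans (mul_le_mul_of_nonneg_left ((lenSum_fq_le 𝒯 e).trans hS)
      (sq_nonneg _))
  have h8 : (pairing 𝒯 k W (fun i => (e i).fq) fun i => (e i).p) ^ 2 ≤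
      (b - a) ^ 2 * CP * (𝒯.normSq (fun i => (e i).D) + H ^ 2) * H ^ 2 := by
    refine h2.trans ((mul_le_mul h7 (mul_le_mul_of_nonneg_left (add_le_add le_rfl hS) hCP.le)
      (by positivity) (by positivity)).trans_eq (by ring))
  have t2 := (neg_le_abs _).trans (young_mul (add_nonneg n4 hH) hH (by positivity) hε0 h8)
  rw [← hK1] at t1
  rw [← hK2] at t2
  have h9 := mul_le_mul_of_nonneg_left (h3.trans (mul_le_mul_of_nonneg_left hS
    (by positivity : 0 ≤ 1 + (b - a) ^ 2))) hCE.le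
  have h10 : W / 2 * 𝒯.normSq (fun i => (e i).D) ≤
      (CE * (1 + (b - a) ^ 2) + K1 + K2 + ε) * H ^ 2 := by
    rw [hε] at t1 t2 ⊢
    linear_combination h1 + t1 + t2 + h9 + h4 + h5 + n2 + n6
  have h11 := mul_le_mul_of_nonneg_left h10 (by positivity : 0 ≤ 2 / W)
  refine le_trans (le_of_eq ?_) (h11.trans_eq (by ring))
  field_simp

open Filter Topology in
/-- The error bound for the discrete evolution problem. -/
theorem exists_evolution_le (k : ℕ) (hk : 0 < k) (a b : ℝ) (hab : a < b) (M : ℝ) (hM : 1 ≤ M)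
    (T : ℝ) (hT : 0 < T) : ∃ C h₀ : ℝ, 0 < C ∧ 0 < h₀ ∧
      ∀ (N : ℕ) (𝒯 : Mesh a b N) (τ : Stabilization N) (e : ℝ → Fin N → ElemState)
        (ρ : Fin N → ℝ) (H : ℝ), 𝒯.size < h₀ → τ.Adm M → IsEvolution 𝒯 k τ T H e →
        (∀ i, (e 0 i).D = (e 0 i).u + ρ i • leg k (𝒯.left i) (𝒯.right i)) →
        (𝒯.lenSum fun i => ρ i ^ 2) ≤ H ^ 2 → ∀ t ∈ Icc 0 T,
        𝒯.normSq (fun i => (e t i).u) + 𝒯.normSq (fun i => (e t i).q) +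
          𝒯.normSq (fun i => (e t i).p) + 𝒯.normSq (fun i => (e t i).D) ≤ C * H ^ 2 := by
  obtain ⟨C₀, h₁, hC₀, hh₁, h0⟩ := exists_initial_le k hk a b hab M hM
  obtain ⟨W, CE, hW, hCE, hE⟩ := exists_energy_le k hk a b hab M hM
  obtain ⟨CP, h₂, hCP, hh₂, hP⟩ := exists_pairing_le k hk a b hab M hM W hW.le
  obtain ⟨CS, h₃, hCS, hh₃, hS⟩ := exists_static_le k hk a b hab M hM
  have hba := sub_pos.2 hab
  obtain ⟨Wb, hWb⟩ : ∃ Wb, Wb = W + (b - a) := ⟨_, rfl⟩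
  have hWb0 : 0 < Wb := by rw [hWb]; positivity
  -- With this ε the pairing contributes exactly W/2 times the supremum of ‖D‖².
  obtain ⟨ε, hε0, hε⟩ : ∃ ε : ℝ, 0 < ε ∧ 2 * (T + 2 * (b - a)) * ε = W / 2 :=
    ⟨W / (4 * (T + 2 * (b - a))), by positivity, by field_simp; norm_num⟩
  obtain ⟨G, hG⟩ : ∃ G, G = Wb * C₀ + 2 * (CE * T) + 2 * (T + 2 * (b - a)) * (CP / (4 * ε)) +
    W / 2 := ⟨_, rfl⟩
  have hG0 : 0 < G := by rw [hG]; positivity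
  refine ⟨CS * (2 * G / W + C₀ + 1) + 2 * G / W + C₀, min h₁ (min h₂ h₃), by positivity,
    by positivity, fun N 𝒯 τ e ρ H hsz hτ he hD hρ => ?_⟩
  have hsz1 : 𝒯.size < h₁ := hsz.trans_le (min_le_left _ _)
  have hsz2 : 𝒯.size < h₂ := hsz.trans_le ((min_le_right _ _).trans (min_le_left _ _))
  have hsz3 : 𝒯.size < h₃ := hsz.trans_le ((min_le_right _ _).trans (min_le_right _ _))
  have hH := sq_nonneg H
  have m0 : (0 : ℝ) ∈ Icc 0 T := ⟨le_rfl, hT.le⟩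
  have hinit := h0 N 𝒯 τ (e 0) ρ H hsz1 hτ (he.sol 0 m0) (he.src_le 0 m0) hD hρ
  -- Any bound Y of ‖D‖² improves itself: the pairing at each time is bounded through Y, and the
  -- increment estimate returns at most Y/2 plus data. Applied to the supremum this gives the final
  -- bound; time zero, not covered by the limit, uses the initial bound.
  have key : ∀ Y, (∀ t ∈ Icc 0 T, 𝒯.normSq (fun i => (e t i).D) ≤ Y) → ∀ t ∈ Ioc 0 T,
      W * 𝒯.normSq (fun i => (e t i).D) ≤ W / 2 * Y + G * H ^ 2 := by
    intro Y hY t ht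
    have hY0 : 0 ≤ Y := (𝒯.normSq_nonneg _).trans (hY 0 m0)
    obtain ⟨Q, hQ⟩ : ∃ Q, Q = ε * (Y + H ^ 2) + CP / (4 * ε) * H ^ 2 := ⟨_, rfl⟩
    have hQ0 : 0 ≤ Q := by rw [hQ]; positivity
    have hpair : ∀ s ∈ Icc 0 T, ∀ (f : Fin N → ℝ) (X : ℝ), 0 ≤ X →
        ∑ i, (𝒯.right i - 𝒯.left i) ^ 3 * f i ^ 2 ≤ X ^ 2 * H ^ 2 →
          |pairing 𝒯 k W f fun i => (e s i).p| ≤ X * Q := by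
      intro s hs f X hX hf
      have h1 := hP N 𝒯 τ (e s) hsz2 hτ (he.sol s hs) f
      have h2 : CP * (𝒯.normSq (fun i => (e s i).D) + srcSum 𝒯 (e s)) ≤ CP * (Y + H ^ 2) :=
        mul_le_mul_of_nonneg_left (add_le_add (hY s hs) (he.src_le s hs)) hCP.le
      have h3 : 0 ≤ CP * (𝒯.normSq (fun i => (e s i).D) + srcSum 𝒯 (e s)) :=
        mul_nonneg hCP.le (add_nonneg (𝒯.normSq_nonneg _) (srcSum_nonneg 𝒯 _))
      have h4 := h1.trans (mul_le_mul hf h2 h3 (by positivity))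
      refine (young_mul (by positivity : 0 ≤ X * (Y + H ^ 2)) (by positivity : 0 ≤ X * H ^ 2)
        hCP.le hε0 (h4.trans_eq (by ring))).trans_eq ?_
      rw [hQ]
      ring
    -- The increment at the positive time is taken backwards from t, so that t = T is included.
    have hinc : ∀ σ, 0 < σ → 2 * σ ≤ t →
        wipSum 𝒯 W (fun i => (e (t - σ) i).u - (e t i).u) (fun i => (e (t - σ) i).u - (e t i).u) /
          (t - σ - t) ^ 2 ≤
        wipSum 𝒯 W (fun i => (e σ i).u - (e 0 i).u) (fun i => (e σ i).u - (e 0 i).u) /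
          (σ - 0) ^ 2 + 2 * (CE * T * H ^ 2 + (T + 2 * (b - a)) * Q) := by
      intro σ hσ hσt
      have h1 := he.increment_le hk hab hM hτ hW.le hCE.le hQ0 (fun e' he' => hE N 𝒯 τ e' hτ he')
        hpair hσ (t := t - σ) (by linarith) (by linarith [ht.2])
      rw [sub_add_cancel] at h1
      have h2 : wipSum 𝒯 W (fun i => (e (t - σ) i).u - (e t i).u)
          (fun i => (e (t - σ) i).u - (e t i).u) = wipSum 𝒯 W
          (fun i => (e t i).u - (e (t - σ) i).u) (fun i => (e t i).u - (e (t - σ) i).u) := by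
        rw [wipSum, wipSum]
        refine Finset.sum_congr rfl fun i _ => ?_
        simp only [wip_sub_left, wip_sub_right]
        ring
      have hσ2 : 0 < σ ^ 2 := by positivity
      rw [h2, show (t - σ - t) ^ 2 = σ ^ 2 by ring, sub_zero, div_add' _ _ _ hσ2.ne',
        div_le_div_iff_of_pos_right hσ2]
      linarith
    have hpos : ∀ᶠ σ : ℝ in 𝓝[>] 0, 0 < σ ∧ 2 * σ ≤ t := by
      filter_upwards [Ioc_mem_nhdsGT (show (0 : ℝ) < t / 2 by linarith [ht.1])] with σ hσ
      exact ⟨hσ.1, by linarith [hσ.2]⟩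
    have htI : t ∈ Icc 0 T := ⟨ht.1.le, ht.2⟩
    have lim1 := he.tendsto_quotient (W := W) htI (F := 𝓝[>] (0 : ℝ)) (s := fun σ => t - σ) (by
      refine tendsto_nhdsWithin_iff.2 ⟨?_, ?_⟩
      · have : Continuous fun σ : ℝ => t - σ := by fun_prop
        have h := this.tendsto 0
        rw [sub_zero] at h
        exact h.mono_left nhdsWithin_le_nhds
      · filter_upwards [hpos] with σ hσ
        refine ⟨⟨by linarith [hσ.2], by linarith [ht.2, hσ.1]⟩, fun h => ?_⟩
        have h' : t - σ = t := h
        linarith [hσ.1])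
    have lim2 := he.tendsto_quotient (W := W) m0 (F := 𝓝[>] (0 : ℝ)) (s := fun σ => σ) (by
      refine tendsto_nhdsWithin_iff.2 ⟨tendsto_id.mono_left nhdsWithin_le_nhds, ?_⟩
      filter_upwards [hpos] with σ hσ
      refine ⟨⟨hσ.1.le, by linarith [ht.2, hσ.2, hσ.1]⟩, fun h => ?_⟩
      have h' : σ = 0 := h
      linarith [hσ.1])
    have hlim := le_of_tendsto_of_tendsto lim1 (lim2.add_const _)
      (hpos.mono fun σ hσ => hinc σ hσ.1 hσ.2)
    have h1 := le_wipSum_self 𝒯 (W := W) fun i => (e t i).D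
    have h2 := wipSum_self_le 𝒯 hW.le fun i => (e 0 i).D
    rw [← hWb] at h2
    have h3 := mul_le_mul_of_nonneg_left hinit hWb0.le
    rw [hQ] at hlim
    rw [hG]
    linear_combination h1 + hlim + h2 + h3 + (Y + H ^ 2) * hε
  obtain ⟨Y₀, hY₀⟩ := he.exists_normSq_D_le hk hab hM hτ
  have hbdd : BddAbove ((fun t => 𝒯.normSq fun i => (e t i).D) '' Icc 0 T) :=
    ⟨Y₀, by rintro _ ⟨t, ht, rfl⟩; exact hY₀ t ht⟩
  obtain ⟨Y, hYdef⟩ : ∃ Y, Y = sSup ((fun t => 𝒯.normSq fun i => (e t i).D) '' Icc 0 T) :=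
    ⟨_, rfl⟩
  have hY : ∀ t ∈ Icc 0 T, 𝒯.normSq (fun i => (e t i).D) ≤ Y := fun t ht => by
    rw [hYdef]
    exact le_csSup hbdd (mem_image_of_mem _ ht)
  have hY0 : 0 ≤ Y := (𝒯.normSq_nonneg _).trans (hY 0 m0)
  have hYle : Y ≤ max (Y / 2 + G / W * H ^ 2) (C₀ * H ^ 2) := by
    conv_lhs => rw [hYdef]
    refine csSup_le ⟨_, mem_image_of_mem _ m0⟩ ?_
    rintro _ ⟨t, ht, rfl⟩
    rcases ht.1.eq_or_lt with h | h
    · rw [← h]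
      exact hinit.trans (le_max_right _ _)
    · refine le_trans ?_ (le_max_left _ _)
      have h1 := key Y hY t ⟨h, ht.2⟩
      refine le_of_mul_le_mul_left (h1.trans_eq ?_) hW
      field_simp
  have hYfin : Y ≤ (2 * G / W + C₀) * H ^ 2 := by
    have h1 : 0 ≤ C₀ * H ^ 2 := by positivity
    have h2 : 0 ≤ G / W * H ^ 2 := by positivity
    have h3 : (2 * G / W + C₀) * H ^ 2 = 2 * (G / W * H ^ 2) + C₀ * H ^ 2 := by ring
    rw [h3]
    rcases max_choice (Y / 2 + G / W * H ^ 2) (C₀ * H ^ 2) with h | h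
    · rw [h] at hYle
      linarith
    · rw [h] at hYle
      linarith
  intro t ht
  have h1 := hS N 𝒯 τ (e t) hsz3 hτ (he.sol t ht)
  have h2 := mul_le_mul_of_nonneg_left (add_le_add ((hY t ht).trans hYfin) (he.src_le t ht)) hCS.le
  linear_combination h1 + h2 + (hY t ht) + hYfin

/-! ### Integration by parts and the lemma of du Bois-Reymond -/

section

variable {E : Type*} [NormedAddCommGroup E] [NormedSpace ℝ E] {α β : ℝ}

/-- Primitives of integrable functions are absolutely continuous, so integration by parts needs no
continuity of w. -/
theorem integral_deriv_mul_primitive {w φ : ℝ → ℝ} (hφ : ContDiff ℝ 1 φ)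
    (hw : IntervalIntegrable w volume α β) :
    ∫ x in α..β, deriv φ x * (∫ t in α..x, w t) =
      φ β * (∫ t in α..β, w t) - ∫ x in α..β, φ x * w x := by
  have hac : AbsolutelyContinuousOnInterval φ α β := hφ.contDiffOn.absolutelyContinuousOnInterval
  have hG := hw.absolutelyContinuousOnInterval_intervalIntegral (c := α) left_mem_uIcc
  have h := hac.integral_mul_deriv_eq_deriv_mul hG
  have hd : ∫ x in α..β, φ x * deriv (fun x => ∫ t in α..x, w t) x = ∫ x in α..β, φ x * w x := by
    apply intervalIntegral.integral_congr_ae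
    filter_upwards [hw.ae_hasDerivAt_integral] with x hx hmem
    rw [(hx (uIoc_subset_uIcc hmem) α left_mem_uIcc).deriv]
  rw [hd] at h
  simp only [intervalIntegral.integral_same, mul_zero, sub_zero] at h
  rw [h]; ring

theorem intervalIntegrable_smul_of_continuous {w : ℝ → E} {φ : ℝ → ℝ} (hφ : Continuous φ)
    (hw : IntervalIntegrable w volume α β) :
    IntervalIntegrable (fun x => φ x • w x) volume α β :=
  hw.continuousOn_smul hφ.continuousOn

theorem continuousOn_primitive_interval {w : ℝ → E} (hw : IntervalIntegrable w volume α β) :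
    ContinuousOn (fun x => ∫ t in α..x, w t) (uIcc α β) :=
  intervalIntegral.continuousOn_primitive_interval' hw left_mem_uIcc

/-- Continuous functionals separate points, which reduces the statement to the scalar case. -/
theorem integral_deriv_smul_primitive [CompleteSpace E] {w : ℝ → E} {φ : ℝ → ℝ} (hφ : ContDiff ℝ 1 φ)
    (hw : IntervalIntegrable w volume α β) :
    ∫ x in α..β, deriv φ x • (∫ t in α..x, w t) =
      φ β • (∫ t in α..β, w t) - ∫ x in α..β, φ x • w x := by
  refine (SeparatingDual.eq_iff_forall_dual_eq (R := ℝ)).2 fun L => ?_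
  have hφ' : Continuous (deriv φ) := hφ.continuous_deriv le_rfl
  have h1 : IntervalIntegrable (fun x => deriv φ x • ∫ t in α..x, w t) volume α β :=
    intervalIntegrable_smul_of_continuous hφ'
      (continuousOn_primitive_interval hw).intervalIntegrable
  have h2 := intervalIntegrable_smul_of_continuous hφ.continuous hw
  rw [map_sub, map_smul, ← L.intervalIntegral_comp_comm h1, ← L.intervalIntegral_comp_comm h2,
    ← L.intervalIntegral_comp_comm hw]
  have h3 := integral_deriv_mul_primitive (w := fun x => L (w x)) hφ
    ⟨L.integrable_comp hw.1, L.integrable_comp hw.2⟩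
  simp only [map_smul, smul_eq_mul]
  rw [← h3]
  apply intervalIntegral.integral_congr
  intro x hx
  simp only
  rw [← L.intervalIntegral_comp_comm]
  exact hw.mono_set (uIcc_subset_uIcc_left hx)

/-- The primitive of ψ vanishes to the left of the support by construction and to the right of it
because the mean of ψ is zero. -/
theorem exists_test_antiderivative {ψ : ℝ → ℝ} (hψ : ContDiff ℝ ∞ ψ) (hc : HasCompactSupport ψ)
    (hs : tsupport ψ ⊆ Ioo α β) (h0 : ∫ x in α..β, ψ x = 0) :
    ∃ φ : ℝ → ℝ, ContDiff ℝ ∞ φ ∧ HasCompactSupport φ ∧ tsupport φ ⊆ Ioo α β ∧ deriv φ = ψ := by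
  by_cases hne : (tsupport ψ).Nonempty
  swap
  · rw [not_nonempty_iff_eq_empty, tsupport_eq_empty_iff] at hne
    subst hne
    exact ⟨0, contDiff_const, HasCompactSupport.zero, by simp, by simp⟩
  have hK : IsCompact (tsupport ψ) := hc
  obtain ⟨x₀, hx₀, hmin⟩ := hK.exists_isLeast hne
  obtain ⟨x₁, hx₁, hmax⟩ := hK.exists_isGreatest hne
  have hzero : ∀ x, x ∉ Icc x₀ x₁ → ψ x = 0 := fun x hx =>
    image_eq_zero_of_notMem_tsupport fun h => hx ⟨hmin h, hmax h⟩
  have hx₀' := hs hx₀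
  have hx₁' := hs hx₁
  have hder : ∀ x, HasDerivAt (fun x => ∫ t in α..x, ψ t) (ψ x) x := fun x =>
    intervalIntegral.integral_hasDerivAt_right (hψ.continuous.intervalIntegrable _ _)
      (hψ.continuous.stronglyMeasurableAtFilter _ _) hψ.continuous.continuousAt
  have hd : deriv (fun x => ∫ t in α..x, ψ t) = ψ := funext fun x => (hder x).deriv
  have hout : ∀ x, x ∉ Icc x₀ x₁ → ∫ t in α..x, ψ t = 0 := by
    intro x hx
    rw [mem_Icc, not_and_or, not_le, not_le] at hx
    rcases hx with hx | hx
    · apply intervalIntegral.integral_zero_ae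
      refine Filter.Eventually.of_forall fun t ht => hzero t fun h => ?_
      have : t ≤ max α x := ht.2
      have := max_lt hx₀'.1 hx
      linarith [h.1]
    · rw [← h0, ← sub_eq_zero, intervalIntegral.integral_interval_sub_left
        (hψ.continuous.intervalIntegrable _ _) (hψ.continuous.intervalIntegrable _ _)]
      apply intervalIntegral.integral_zero_ae
      refine Filter.Eventually.of_forall fun t ht => hzero t fun h => ?_
      have : min β x < t := ht.1
      have := lt_min hx₁'.2 hx
      linarith [h.2]
  have hsub : tsupport (fun x => ∫ t in α..x, ψ t) ⊆ Icc x₀ x₁ := by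
    refine closure_minimal ?_ isClosed_Icc
    intro x hx
    by_contra h
    exact hx (hout x h)
  refine ⟨fun x => ∫ t in α..x, ψ t, ?_, ?_, ?_, hd⟩
  · rw [contDiff_infty_iff_deriv]
    exact ⟨fun x => (hder x).differentiableAt, by rw [hd]; exact hψ⟩
  · exact HasCompactSupport.of_support_subset_isCompact isCompact_Icc
      ((subset_tsupport _).trans hsub)
  · exact hsub.trans (Icc_subset_Ioo hx₀'.1 hx₁'.2)

theorem exists_test_integral_one (hαβ : α < β) :
    ∃ θ : ℝ → ℝ, ContDiff ℝ ∞ θ ∧ HasCompactSupport θ ∧ tsupport θ ⊆ Ioo α β ∧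
      ∫ x in α..β, θ x = 1 := by
  let f : ContDiffBump ((α + β) / 2) := ⟨(β - α) / 8, (β - α) / 4, by linarith, by linarith⟩
  have hs : tsupport (f.normed volume) ⊆ Ioo α β := by
    rw [f.tsupport_normed_eq, Real.closedBall_eq_Icc]
    exact Icc_subset_Ioo (by simp only [f]; linarith) (by simp only [f]; linarith)
  refine ⟨f.normed volume, f.contDiff_normed, f.hasCompactSupport_normed, hs, ?_⟩
  rw [intervalIntegral.integral_of_le hαβ.le, ← f.integral_normed (μ := volume)]
  apply setIntegral_eq_integral_of_forall_compl_eq_zero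
  intro x hx
  exact image_eq_zero_of_notMem_tsupport fun h => hx (Ioo_subset_Ioc_self (hs h))

theorem setIntegral_smul_of_tsupport {g : ℝ → ℝ} {s : Set ℝ} (hg : tsupport g ⊆ s) (f : ℝ → E) :
    ∫ x in s, g x • f x = ∫ x, g x • f x := by
  apply setIntegral_eq_integral_of_forall_compl_eq_zero
  intro x hx
  rw [image_eq_zero_of_notMem_tsupport fun h => hx (hg h), zero_smul]

/-- V minus the primitive of w is orthogonal to derivatives of test functions, hence to all test
functions of mean zero. Subtracting from an arbitrary test function its mean times a fixed θ of
integral one shows that this difference is constant, equal to its pairing with θ. The vector-valued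
form serves both space and time. -/
theorem eq_primitive_of_weak_deriv [CompleteSpace E] (hαβ : α < β) {V w : ℝ → E} (hV : IntegrableOn V (Ioo α β))
    (hw : IntegrableOn w (Ioo α β))
    (h : ∀ φ : ℝ → ℝ, ContDiff ℝ ∞ φ → HasCompactSupport φ → tsupport φ ⊆ Ioo α β →
      ∫ t in Ioo α β, deriv φ t • V t = -∫ t in Ioo α β, φ t • w t) :
    ∃ c : E, ∀ᵐ x ∂(volume.restrict (Ioo α β)), V x = c + ∫ t in α..x, w t := by
  have hV' : IntervalIntegrable V volume α β :=
    (intervalIntegrable_iff_integrableOn_Ioo_of_le hαβ.le).2 hV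
  have hw' : IntervalIntegrable w volume α β :=
    (intervalIntegrable_iff_integrableOn_Ioo_of_le hαβ.le).2 hw
  have hconv : ∀ g : ℝ → E, ∫ t in Ioo α β, g t = ∫ t in α..β, g t := fun g => by
    rw [intervalIntegral.integral_of_le hαβ.le, integral_Ioc_eq_integral_Ioo]
  have hG' : IntervalIntegrable (fun x => ∫ t in α..x, w t) volume α β :=
    (continuousOn_primitive_interval hw').intervalIntegrable
  set W : ℝ → E := fun x => V x - ∫ t in α..x, w t with hWdef
  have hW : IntervalIntegrable W volume α β := hV'.sub hG'
  have horth : ∀ φ : ℝ → ℝ, ContDiff ℝ ∞ φ → HasCompactSupport φ → tsupport φ ⊆ Ioo α β →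
      ∫ t in α..β, deriv φ t • W t = 0 := by
    intro φ h1 h2 h3
    have hφ1 : ContDiff ℝ 1 φ := h1.of_le (by exact_mod_cast le_top)
    have hcd : Continuous (deriv φ) := hφ1.continuous_deriv le_rfl
    have e1 := h φ h1 h2 h3
    rw [hconv, hconv] at e1
    have e2 := integral_deriv_smul_primitive hφ1 hw'
    have hβ : φ β = 0 := image_eq_zero_of_notMem_tsupport fun hb => (h3 hb).2.ne rfl
    rw [hβ, zero_smul, zero_sub] at e2
    simp only [hWdef, smul_sub]
    rw [intervalIntegral.integral_sub (intervalIntegrable_smul_of_continuous hcd hV')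
      (intervalIntegrable_smul_of_continuous hcd hG'), e1, e2, sub_self]
  obtain ⟨θ, hθ1, hθ2, hθ3, hθ4⟩ := exists_test_integral_one hαβ
  set c := ∫ t in α..β, θ t • W t with hc
  refine ⟨c, ?_⟩
  have key := isOpen_Ioo.ae_eq_zero_of_integral_contDiff_smul_eq_zero (μ := volume)
    (U := Ioo α β) (f := fun x => W x - c) ?_ ?_
  · rw [ae_restrict_iff' measurableSet_Ioo]
    filter_upwards [key] with x hx hm
    have := hx hm
    rw [sub_eq_zero] at this
    rw [← this]; simp [hWdef]
  · apply IntegrableOn.locallyIntegrableOn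
    exact ((intervalIntegrable_iff_integrableOn_Ioo_of_le hαβ.le).1
      (hW.sub intervalIntegrable_const))
  · intro ψ h1 h2 h3
    rw [← setIntegral_smul_of_tsupport h3, hconv]
    simp only [smul_sub]
    rw [intervalIntegral.integral_sub (intervalIntegrable_smul_of_continuous h1.continuous hW)
      (intervalIntegrable_smul_of_continuous h1.continuous intervalIntegrable_const)]
    set m := ∫ t in α..β, ψ t with hm
    have hiψ : IntervalIntegrable ψ volume α β := h1.continuous.intervalIntegrable _ _
    have hiθ : IntervalIntegrable θ volume α β := hθ1.continuous.intervalIntegrable _ _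
    obtain ⟨φ, p1, p2, p3, p4⟩ := exists_test_antiderivative (α := α) (β := β)
      (ψ := fun x => ψ x - m * θ x) (h1.sub (contDiff_const.mul hθ1)) (h2.sub hθ2.mul_left)
      ((tsupport_sub ψ (fun x => m * θ x)).trans
        (union_subset h3 ((tsupport_mul_subset_right (f := fun _ => m)).trans hθ3)))
      (by rw [intervalIntegral.integral_sub hiψ (hiθ.const_mul m),
            intervalIntegral.integral_const_mul, hθ4]; ring)
    have e := horth φ p1 p2 p3
    rw [p4] at e
    simp only [sub_smul, mul_smul] at e
    have hm' : IntervalIntegrable (fun x => m • θ x • W x) volume α β :=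
      (intervalIntegrable_smul_of_continuous hθ1.continuous hW).smul m
    rw [intervalIntegral.integral_sub (intervalIntegrable_smul_of_continuous h1.continuous hW) hm',
      intervalIntegral.integral_smul, ← hc] at e
    rw [intervalIntegral.integral_smul_const, ← hm]
    exact e

end

/-! ### Weak derivatives on intervals -/

theorem tsupport_iteratedDeriv_subset_tsupport (m : ℕ) (φ : ℝ → ℝ) :
    tsupport (iteratedDeriv m φ) ⊆ tsupport φ := by
  induction m with
  | zero => simp
  | succ m ih =>
    rw [iteratedDeriv_succ]
    exact (tsupport_deriv_subset (f := iteratedDeriv m φ)).trans ih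

theorem setIntegral_mul_iteratedDeriv {φ : ℝ → ℝ} {s : Set ℝ} (hs : tsupport φ ⊆ s) (m : ℕ)
    (g : ℝ → ℝ) : ∫ x in s, g x * iteratedDeriv m φ x = ∫ x, g x * iteratedDeriv m φ x := by
  apply setIntegral_eq_integral_of_forall_compl_eq_zero
  intro x hx
  rw [image_eq_zero_of_notMem_tsupport fun h =>
    hx (hs (tsupport_iteratedDeriv_subset_tsupport m φ h)), mul_zero]

theorem setIntegral_mul_of_tsupport {φ : ℝ → ℝ} {s : Set ℝ} (hs : tsupport φ ⊆ s)
    (g : ℝ → ℝ) : ∫ x in s, g x * φ x = ∫ x, g x * φ x := by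
  simpa using setIntegral_mul_iteratedDeriv hs 0 g

theorem IsWeakDeriv.mono {n : ℕ} {I J : Set ℝ} {v w : ℝ → ℝ} (h : IsWeakDeriv n I v w)
    (hJI : J ⊆ I) : IsWeakDeriv n J v w := by
  obtain ⟨h1, h2, h3⟩ := h
  refine ⟨h1.mono_set hJI, h2.mono_set hJI, fun φ a1 a2 a3 => ?_⟩
  have e := h3 φ a1 a2 (a3.trans hJI)
  rwa [setIntegral_mul_iteratedDeriv (a3.trans hJI), setIntegral_mul_of_tsupport (a3.trans hJI),
    ← setIntegral_mul_iteratedDeriv a3, ← setIntegral_mul_of_tsupport a3] at e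

theorem setIntegral_mul_congr {I : Set ℝ} {v v' : ℝ → ℝ} (hv : v =ᵐ[volume.restrict I] v')
    (f : ℝ → ℝ) : ∫ x in I, v x * f x = ∫ x in I, v' x * f x :=
  integral_congr_ae (hv.mul (Filter.EventuallyEq.refl _ f))

theorem IsWeakDeriv.congr {n : ℕ} {I : Set ℝ} {v w v' w' : ℝ → ℝ} (h : IsWeakDeriv n I v w)
    (hv : v =ᵐ[volume.restrict I] v') (hw : w =ᵐ[volume.restrict I] w') :
    IsWeakDeriv n I v' w' := by
  obtain ⟨h1, h2, h3⟩ := h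
  refine ⟨(locallyIntegrableOn_congr hv).1 h1, (locallyIntegrableOn_congr hw).1 h2,
    fun φ a1 a2 a3 => ?_⟩
  rw [← setIntegral_mul_congr hv, ← setIntegral_mul_congr hw, h3 φ a1 a2 a3]

theorem IsWeakDeriv.unique {n : ℕ} {I : Set ℝ} (hI : IsOpen I) {v w w' : ℝ → ℝ}
    (h : IsWeakDeriv n I v w) (h' : IsWeakDeriv n I v w') : w =ᵐ[volume.restrict I] w' := by
  rw [Filter.EventuallyEq, ae_restrict_iff' hI.measurableSet]
  have hl : LocallyIntegrableOn (fun x => w x - w' x) I := h.2.1.sub h'.2.1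
  have key := hI.ae_eq_zero_of_integral_contDiff_smul_eq_zero (μ := volume) hl ?_
  · filter_upwards [key] with x hx hm
    exact sub_eq_zero.1 (hx hm)
  · intro g a1 a2 a3
    have e1 := h.2.2 g a1 a2 a3
    rw [h'.2.2 g a1 a2 a3] at e1
    have e2 : ∫ x in I, w x * g x = ∫ x in I, w' x * g x :=
      (mul_left_cancel₀ (pow_ne_zero n (by norm_num)) e1).symm
    have hint : ∀ f : ℝ → ℝ, LocallyIntegrableOn f I → IntegrableOn (fun x => f x * g x) I := by
      intro f hf
      have hk : IntegrableOn (fun x => f x * g x) (tsupport g) :=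
        (hf.integrableOn_compact_subset a3 a2).mul_continuousOn a1.continuous.continuousOn a2
      refine (hk.integrable_of_forall_notMem_eq_zero fun x hx => ?_).integrableOn
      rw [image_eq_zero_of_notMem_tsupport hx, mul_zero]
    rw [← setIntegral_smul_of_tsupport a3]
    simp only [smul_eq_mul, mul_sub]
    simp only [mul_comm (g _)]
    rw [integral_sub (hint w h.2.1) (hint w' h'.2.1), e2, sub_self]

theorem IsWeakDeriv.comp {m n : ℕ} {I : Set ℝ} {u v w : ℝ → ℝ} (h : IsWeakDeriv m I u v)
    (h' : IsWeakDeriv n I v w) : IsWeakDeriv (m + n) I u w := by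
  refine ⟨h.1, h'.2.1, fun φ a1 a2 a3 => ?_⟩
  have b1 : ContDiff ℝ ∞ (iteratedDeriv n φ) := by
    rw [iteratedDeriv_eq_iterate]; exact ContDiff.iterate_deriv n a1
  have b2 : HasCompactSupport (iteratedDeriv n φ) :=
    a2.mono' ((subset_tsupport _).trans (tsupport_iteratedDeriv_subset_tsupport n φ))
  have b3 := (tsupport_iteratedDeriv_subset_tsupport n φ).trans a3
  have e1 := h.2.2 _ b1 b2 b3
  rw [h'.2.2 φ a1 a2 a3] at e1
  have e2 : iteratedDeriv m (iteratedDeriv n φ) = iteratedDeriv (m + n) φ := by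
    simp only [iteratedDeriv_eq_iterate, ← Function.iterate_add_apply]
  rw [e2] at e1
  rw [e1]; ring

section

variable {l r : ℝ}

/-- The value at the left end of `(l, r)` of a function `v` with weak derivative `w`. -/
def traceL (l r : ℝ) (v w : ℝ → ℝ) : ℝ :=
  (r - l)⁻¹ * ((∫ x in Ioo l r, v x) + ∫ x in Ioo l r, w x * (x - r))

/-- The value at the right end of `(l, r)` of a function `v` with weak derivative `w`. -/
def traceR (l r : ℝ) (v w : ℝ → ℝ) : ℝ :=
  (r - l)⁻¹ * ((∫ x in Ioo l r, v x) + ∫ x in Ioo l r, w x * (x - l))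

theorem setIntegral_Ioo_eq (hlr : l ≤ r) (g : ℝ → ℝ) :
    ∫ x in Ioo l r, g x = ∫ x in l..r, g x := by
  rw [intervalIntegral.integral_of_le hlr, integral_Ioc_eq_integral_Ioo]

theorem integral_mul_deriv_add_of_ae_primitive (hlr : l < r) {v w : ℝ → ℝ} {c : ℝ}
    (hw : IntegrableOn w (Ioo l r))
    (hc : ∀ᵐ x ∂(volume.restrict (Ioo l r)), v x = c + ∫ t in l..x, w t) (P : ℝ[X]) :
    (∫ x in Ioo l r, v x * P.derivative.eval x) + ∫ x in Ioo l r, w x * P.eval x =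
      (c + ∫ t in l..r, w t) * P.eval r - c * P.eval l := by
  have hw' : IntervalIntegrable w volume l r :=
    (intervalIntegrable_iff_integrableOn_Ioo_of_le hlr.le).2 hw
  have h := integral_deriv_mul_primitive (φ := fun x => P.eval x)
    (by simpa [Polynomial.coe_aeval_eq_eval] using Polynomial.contDiff_aeval (𝕜 := ℝ) P 1) hw'
  have e1 : ∫ x in Ioo l r, v x * P.derivative.eval x =
      ∫ x in Ioo l r, (c * P.derivative.eval x + deriv (fun x => P.eval x) x * ∫ t in l..x, w t) := by
    refine integral_congr_ae (hc.mono fun x hx => ?_)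
    simp only [hx, Polynomial.deriv]; ring
  have e2 : ∫ x in l..r, c * P.derivative.eval x = c * (P.eval r - P.eval l) := by
    rw [intervalIntegral.integral_const_mul]
    congr 1
    exact intervalIntegral.integral_eq_sub_of_hasDerivAt (fun x _ => P.hasDerivAt x)
      (P.derivative.continuous.intervalIntegrable _ _)
  have i1 : IntervalIntegrable (fun x => c * P.derivative.eval x) volume l r :=
    (continuous_const.mul P.derivative.continuous).intervalIntegrable _ _
  have i2 : IntervalIntegrable (fun x => deriv (fun x => P.eval x) x * ∫ t in l..x, w t)
      volume l r := by
    refine (ContinuousOn.mul ?_ (continuousOn_primitive_interval hw')).intervalIntegrable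
    exact ((P.derivative.continuous).congr fun x => (P.deriv (x := x)).symm).continuousOn
  rw [e1, setIntegral_Ioo_eq hlr.le, setIntegral_Ioo_eq hlr.le,
    intervalIntegral.integral_add i1 i2, e2, h]
  have e3 : ∫ x in l..r, w x * P.eval x = ∫ x in l..r, P.eval x * w x := by
    simp only [mul_comm]
  rw [e3]; ring

/-- Integration by parts against x - r, which vanishes at r, isolates the left end value, and
symmetrically for the right one. Traces so defined are integrals of v and w, hence continuous in
`L²` and insensitive to null sets. -/
theorem IsWeakDeriv.ae_eq_trace (hlr : l < r) {v w : ℝ → ℝ} (hv : IntegrableOn v (Ioo l r))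
    (hw : IntegrableOn w (Ioo l r)) (h : IsWeakDeriv 1 (Ioo l r) v w) :
    (∀ᵐ x ∂(volume.restrict (Ioo l r)), v x = traceL l r v w + ∫ t in l..x, w t) ∧
      traceR l r v w = traceL l r v w + ∫ t in l..r, w t := by
  obtain ⟨c, hc⟩ := eq_primitive_of_weak_deriv hlr hv hw fun φ a1 a2 a3 => by
    have e := h.2.2 φ a1 a2 a3
    simp only [iteratedDeriv_one, pow_one, neg_mul, one_mul] at e
    simp only [smul_eq_mul, mul_comm (deriv φ _), mul_comm (φ _)]
    exact e
  have hne : r - l ≠ 0 := sub_ne_zero.2 hlr.ne'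
  have hL : traceL l r v w = c := by
    have e := integral_mul_deriv_add_of_ae_primitive hlr hw hc (Polynomial.X - Polynomial.C r)
    simp at e
    rw [traceL, e, inv_mul_eq_iff_eq_mul₀ hne]; ring
  have hR : traceR l r v w = c + ∫ t in l..r, w t := by
    have e := integral_mul_deriv_add_of_ae_primitive hlr hw hc (Polynomial.X - Polynomial.C l)
    simp at e
    rw [traceR, e]; field_simp
  rw [hL, hR]
  exact ⟨hc, rfl⟩

theorem IsWeakDeriv.integral_mul_deriv_add (hlr : l < r) {v w : ℝ → ℝ}
    (hv : IntegrableOn v (Ioo l r)) (hw : IntegrableOn w (Ioo l r))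
    (h : IsWeakDeriv 1 (Ioo l r) v w) (P : ℝ[X]) :
    (∫ x in Ioo l r, v x * P.derivative.eval x) + ∫ x in Ioo l r, w x * P.eval x =
      traceR l r v w * P.eval r - traceL l r v w * P.eval l := by
  obtain ⟨h1, h2⟩ := h.ae_eq_trace hlr hv hw
  rw [integral_mul_deriv_add_of_ae_primitive hlr hw h1, h2]

theorem IsWeakDeriv.trace_eq (hlr : l < r) {v w : ℝ → ℝ} (hv : ContinuousOn v (Icc l r))
    (hw : IntegrableOn w (Ioo l r)) (h : IsWeakDeriv 1 (Ioo l r) v w) :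
    traceL l r v w = v l ∧ traceR l r v w = v r := by
  have hvi : IntegrableOn v (Ioo l r) := hv.integrableOn_Icc.mono_set Ioo_subset_Icc_self
  obtain ⟨h1, h2⟩ := h.ae_eq_trace hlr hvi hw
  have hw' : IntervalIntegrable w volume l r :=
    (intervalIntegrable_iff_integrableOn_Ioo_of_le hlr.le).2 hw
  have hG : ContinuousOn (fun x => traceL l r v w + ∫ t in l..x, w t) (Icc l r) := by
    have := continuousOn_primitive_interval hw'
    rw [uIcc_of_le hlr.le] at this
    exact continuousOn_const.add this
  have heq : EqOn v (fun x => traceL l r v w + ∫ t in l..x, w t) (Icc l r) := by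
    have := Measure.eqOn_open_of_ae_eq h1 isOpen_Ioo
      (hv.mono Ioo_subset_Icc_self) (hG.mono Ioo_subset_Icc_self)
    refine this.of_subset_closure hv hG Ioo_subset_Icc_self ?_
    rw [closure_Ioo hlr.ne]
  have e1 := heq (left_mem_Icc.2 hlr.le)
  have e2 := heq (right_mem_Icc.2 hlr.le)
  simp only [intervalIntegral.integral_same, add_zero] at e1 e2
  exact ⟨e1.symm, by rw [h2, e2]⟩

theorem traceL_congr {v w v' w' : ℝ → ℝ} (hv : v =ᵐ[volume.restrict (Ioo l r)] v')
    (hw : w =ᵐ[volume.restrict (Ioo l r)] w') : traceL l r v w = traceL l r v' w' := by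
  rw [traceL, traceL, integral_congr_ae hv, setIntegral_mul_congr hw]

theorem traceR_congr {v w v' w' : ℝ → ℝ} (hv : v =ᵐ[volume.restrict (Ioo l r)] v')
    (hw : w =ᵐ[volume.restrict (Ioo l r)] w') : traceR l r v w = traceR l r v' w' := by
  rw [traceR, traceR, integral_congr_ae hv, setIntegral_mul_congr hw]

end

/-! ### The `L²` projection on polynomials and its errors -/

section

variable {l r : ℝ} {g g' : ℝ → ℝ}

theorem IntegrableOn.mul_polynomial (hg : IntegrableOn g (Ioo l r)) (P : ℝ[X]) :
    IntegrableOn (fun x => g x * P.eval x) (Ioo l r) := by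
  have h := (integrableOn_Icc_iff_integrableOn_Ioo).2 hg
  exact (h.mul_continuousOn P.continuous.continuousOn isCompact_Icc).mono_set Ioo_subset_Icc_self

theorem ip_eq_setIntegral (hlr : l ≤ r) (v w : ℝ[X]) :
    ip l r v w = ∫ x in Ioo l r, v.eval x * w.eval x := by
  rw [ip, setIntegral_Ioo_eq hlr]

theorem integrableOn_eval (v : ℝ[X]) : IntegrableOn (fun x => v.eval x) (Ioo l r) :=
  v.continuous.continuousOn.integrableOn_Icc.mono_set Ioo_subset_Icc_self

/-- The polynomial representing the functional `v ↦ coeff v j` in `L²(l, r)`. -/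
def coeffRep (k : ℕ) (l r : ℝ) (j : ℕ) : ℝ[X] :=
  if h : l < r then (exists_riesz h (k + 1) (Polynomial.lcoeff ℝ j)).choose else 0

/-- The `L²(l, r)` projection on polynomials of degree at most `k`. -/
def proj (k : ℕ) (l r : ℝ) (g : ℝ → ℝ) : ℝ[X] :=
  ∑ j ∈ Finset.range (k + 1), Polynomial.monomial j (∫ x in Ioo l r, g x * (coeffRep k l r j).eval x)

theorem proj_mem (k : ℕ) : proj k l r g ∈ Polynomial.degreeLT ℝ (k + 1) := by
  refine Submodule.sum_mem _ fun j hj => ?_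
  rw [Polynomial.mem_degreeLT]
  exact (Polynomial.degree_monomial_le _ _).trans_lt (by exact_mod_cast Finset.mem_range.1 hj)

theorem coeff_proj (k m : ℕ) : (proj k l r g).coeff m =
    if m ∈ Finset.range (k + 1) then ∫ x in Ioo l r, g x * (coeffRep k l r m).eval x else 0 := by
  rw [proj, Polynomial.finsetSum_coeff]
  simp only [Polynomial.coeff_monomial]
  rw [Finset.sum_ite_eq']

theorem proj_spec (hlr : l < r) (hg : IntegrableOn g (Ioo l r)) (k : ℕ) {v : ℝ[X]}
    (hv : v ∈ Polynomial.degreeLT ℝ (k + 1)) :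
    ip l r (proj k l r g) v = ∫ x in Ioo l r, g x * v.eval x := by
  let F : ℝ[X] →ₗ[ℝ] ℝ :=
    { toFun := fun v => ∫ x in Ioo l r, g x * v.eval x
      map_add' := fun v w => by
        simp only [Polynomial.eval_add, mul_add]
        exact integral_add (IntegrableOn.mul_polynomial hg v) (IntegrableOn.mul_polynomial hg w)
      map_smul' := fun c v => by
        simp only [Polynomial.eval_smul, smul_eq_mul, RingHom.id_apply, mul_left_comm _ c]
        exact integral_const_mul c _ }
  obtain ⟨R, hR, hRF⟩ := exists_riesz hlr (k + 1) F
  suffices h : proj k l r g = R by rw [h, hRF v hv]; rfl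
  ext m
  rw [coeff_proj]
  split_ifs with hm
  · have hE := (exists_riesz hlr (k + 1) (Polynomial.lcoeff ℝ m)).choose_spec
    have e : coeffRep k l r m = (exists_riesz hlr (k + 1) (Polynomial.lcoeff ℝ m)).choose := by
      rw [coeffRep, dif_pos hlr]
    rw [← e] at hE
    have e1 := hE.2 R hR
    have e2 := hRF _ hE.1
    rw [ip_comm, e1] at e2
    exact e2.symm
  · rw [Polynomial.mem_degreeLT] at hR
    refine (Polynomial.coeff_eq_zero_of_degree_lt (hR.trans_le ?_)).symm
    rw [Finset.mem_range, not_lt] at hm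
    exact_mod_cast hm

theorem proj_congr (k : ℕ) (h : g =ᵐ[volume.restrict (Ioo l r)] g') :
    proj k l r g = proj k l r g' := by
  rw [proj, proj]
  simp only [setIntegral_mul_congr h]

theorem eq_of_ip_eq {k : ℕ} (hlr : l < r) {v w : ℝ[X]} (hv : v ∈ Polynomial.degreeLT ℝ (k + 1))
    (hw : w ∈ Polynomial.degreeLT ℝ (k + 1))
    (h : ∀ z ∈ Polynomial.degreeLT ℝ (k + 1), ip l r v z = ip l r w z) : v = w := by
  have h0 := h (v - w) (Submodule.sub_mem _ hv hw)
  rw [← sub_eq_zero, ← ip_sub_left] at h0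
  exact sub_eq_zero.1 (ip_self_eq_zero (w := v - w) hlr h0)

/-- The error of the `L²` projection at the left end. -/
def rhoL (k : ℕ) (l r : ℝ) (v w : ℝ → ℝ) : ℝ := traceL l r v w - (proj k l r v).eval l

/-- The error of the `L²` projection at the right end. -/
def rhoR (k : ℕ) (l r : ℝ) (v w : ℝ → ℝ) : ℝ := traceR l r v w - (proj k l r v).eval r

/-- Induction on the order: integrate the Taylor polynomial of the first derivative, starting from
the left trace. Each integration gains a factor `r - l`, and the left trace is matched exactly. -/
theorem exists_taylor (hlr : l < r) {m : ℕ} : ∀ {g : ℕ → ℝ → ℝ},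
    (∀ j, j ≤ m + 1 → IntegrableOn (g j) (Ioo l r)) →
    (∀ j, j < m + 1 → IsWeakDeriv 1 (Ioo l r) (g j) (g (j + 1))) →
    ∃ T ∈ Polynomial.degreeLT ℝ (m + 1),
      (∀ᵐ x ∂(volume.restrict (Ioo l r)),
        |g 0 x - T.eval x| ≤ (r - l) ^ m * ∫ y in Ioo l r, |g (m + 1) y|) ∧
      traceL l r (g 0) (g 1) = T.eval l ∧
      |traceR l r (g 0) (g 1) - T.eval r| ≤ (r - l) ^ m * ∫ y in Ioo l r, |g (m + 1) y| := by
  induction m with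
  | zero =>
    intro g hg hd
    obtain ⟨h1, h2⟩ := (hd 0 (by omega)).ae_eq_trace hlr (hg 0 (by omega)) (hg 1 le_rfl)
    have hb : ∀ x ∈ Icc l r, |∫ t in l..x, g 1 t| ≤ ∫ y in Ioo l r, |g 1 y| := by
      intro x hx
      refine (intervalIntegral.abs_integral_le_integral_abs hx.1).trans ?_
      rw [← setIntegral_Ioo_eq hx.1]
      exact setIntegral_mono_set (hg 1 le_rfl).abs
        (Filter.Eventually.of_forall fun y => abs_nonneg _)
        (Ioo_subset_Ioo_right hx.2).eventuallyLE
    refine ⟨Polynomial.C (traceL l r (g 0) (g 1)), ?_, ?_, by simp, ?_⟩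
    · rw [Polynomial.mem_degreeLT]
      exact (Polynomial.degree_C_le).trans_lt (by simp)
    · filter_upwards [h1, ae_restrict_mem measurableSet_Ioo] with x hx hm
      rw [hx]
      simpa using hb x (Ioo_subset_Icc_self hm)
    · rw [h2]
      simpa using hb r (right_mem_Icc.2 hlr.le)
  | succ m ih =>
    intro g hg hd
    obtain ⟨T, hT, hT1, -, -⟩ := ih (g := fun j => g (j + 1)) (fun j hj => hg (j + 1) (by omega))
      (fun j hj => hd (j + 1) (by omega))
    simp only [zero_add] at hT1
    obtain ⟨A, hA, hAT⟩ := exists_antiderivative hT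
    obtain ⟨h1, h2⟩ := (hd 0 (by omega)).ae_eq_trace hlr (hg 0 (by omega)) (hg 1 (by omega))
    set c := traceL l r (g 0) (g 1) with hc
    set B := ∫ y in Ioo l r, |g (m + 1 + 1) y| with hB
    have hB0 : 0 ≤ B := integral_nonneg fun y => abs_nonneg _
    have hgi : ∀ x ∈ Icc l r, IntervalIntegrable (g 1) volume l x := fun x hx =>
      (intervalIntegrable_iff_integrableOn_Ioo_of_le hx.1).2
        ((hg 1 (by omega)).mono_set (Ioo_subset_Ioo_right hx.2))
    have hb : ∀ x ∈ Icc l r,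
        |(c + ∫ t in l..x, g 1 t) - (A.eval x - A.eval l + c)| ≤ (r - l) ^ (m + 1) * B := by
      intro x hx
      have e1 : A.eval x - A.eval l = ∫ t in l..x, T.eval t := by
        rw [← hAT]
        exact (intervalIntegral.integral_eq_sub_of_hasDerivAt (fun x _ => A.hasDerivAt x)
          (A.derivative.continuous.intervalIntegrable _ _)).symm
      have e2 : (c + ∫ t in l..x, g 1 t) - (A.eval x - A.eval l + c) =
          ∫ t in l..x, (g 1 t - T.eval t) := by
        rw [intervalIntegral.integral_sub (hgi x hx) (T.continuous.intervalIntegrable _ _), e1]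
        ring
      rw [e2, ← Real.norm_eq_abs]
      have e3 : ‖∫ t in l..x, (g 1 t - T.eval t)‖ ≤ (r - l) ^ m * B * |x - l| := by
        refine intervalIntegral.norm_integral_le_of_norm_le_const_ae ?_
        rw [ae_restrict_iff' measurableSet_Ioo] at hT1
        -- The almost everywhere bound holds on the open interval, whereas the interval integral
        -- runs over a half-open one that may contain r.
        have hne : ∀ᵐ t : ℝ, t ≠ r := by simp [ae_iff, measure_singleton]
        filter_upwards [hT1, hne] with t ht htr hm
        rw [uIoc_of_le hx.1] at hm
        exact ht ⟨hm.1, lt_of_le_of_ne (hm.2.trans hx.2) htr⟩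
      refine e3.trans ?_
      rw [abs_of_nonneg (sub_nonneg.2 hx.1), pow_succ, mul_right_comm]
      have : 0 ≤ r - l := sub_nonneg.2 hlr.le
      have hx2 : x - l ≤ r - l := by linarith [hx.2]
      gcongr
    refine ⟨A - Polynomial.C (A.eval l) + Polynomial.C c, ?_, ?_, by simp, ?_⟩
    · have hC : ∀ y : ℝ, Polynomial.C y ∈ Polynomial.degreeLT ℝ (m + 1 + 1) := fun y => by
        rw [Polynomial.mem_degreeLT]
        exact (Polynomial.degree_C_le).trans_lt (by exact_mod_cast Nat.succ_pos _)
      exact Submodule.add_mem _ (Submodule.sub_mem _ hA (hC _)) (hC _)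
    · filter_upwards [h1, ae_restrict_mem measurableSet_Ioo] with x hx hm
      rw [hx]
      simpa using hb x (Ioo_subset_Icc_self hm)
    · rw [h2]
      simpa using hb r (right_mem_Icc.2 hlr.le)

/-- The variance of |g| on the interval is nonnegative. -/
theorem sq_integral_abs_le (hlr : l < r) (hg : IntegrableOn g (Ioo l r))
    (hg2 : IntegrableOn (fun x => g x ^ 2) (Ioo l r)) :
    (∫ x in Ioo l r, |g x|) ^ 2 ≤ (r - l) * ∫ x in Ioo l r, g x ^ 2 := by
  have hη : 0 < r - l := sub_pos.2 hlr
  set A := ∫ x in Ioo l r, |g x| with hA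
  set m := A / (r - l) with hm
  have h0 : 0 ≤ ∫ x in Ioo l r, (|g x| - m) ^ 2 := integral_nonneg fun x => sq_nonneg _
  have hc : IntegrableOn (fun _ : ℝ => m ^ 2) (Ioo l r) := by
    simp [integrableOn_const_iff]
  have e : ∫ x in Ioo l r, (|g x| - m) ^ 2 =
      (∫ x in Ioo l r, g x ^ 2) - 2 * m * A + m ^ 2 * (r - l) := by
    have : ∀ x, (|g x| - m) ^ 2 = g x ^ 2 - 2 * m * |g x| + m ^ 2 := fun x => by
      rw [← sq_abs (g x)]; ring
    simp only [this]
    have hs : IntegrableOn (fun x => g x ^ 2 - 2 * m * |g x|) (Ioo l r) :=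
      hg2.sub (hg.abs.const_mul (2 * m))
    rw [integral_add hs hc,
      integral_sub hg2 (hg.abs.const_mul (2 * m)), integral_const_mul, ← hA]
    congr 1
    simp [hlr.le, mul_comm]
  rw [e] at h0
  have h1 : A = m * (r - l) := by rw [hm]; field_simp
  rw [h1] at h0 ⊢
  nlinarith

/-- The projection reproduces the Taylor polynomial T, so R = Pg - T is the projection of g - T and
has norm at most √(r-l) B; the inverse estimate then bounds R at the end points. Lower orders m < k
are included because the derivative of u is used with one weak derivative less. -/
theorem exists_proj_error_le (k : ℕ) : ∃ C : ℝ, 0 < C ∧ ∀ (l r : ℝ), l < r → ∀ (m : ℕ), m ≤ k →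
    ∀ g : ℕ → ℝ → ℝ, (∀ j, j ≤ m + 1 → IntegrableOn (g j) (Ioo l r)) →
    IntegrableOn (fun x => g 0 x ^ 2) (Ioo l r) →
    IntegrableOn (fun x => g (m + 1) x ^ 2) (Ioo l r) →
    (∀ j, j < m + 1 → IsWeakDeriv 1 (Ioo l r) (g j) (g (j + 1))) →
    rhoL k l r (g 0) (g 1) ^ 2 ≤ C * (r - l) ^ (2 * m + 1) * ∫ x in Ioo l r, g (m + 1) x ^ 2 ∧
    rhoR k l r (g 0) (g 1) ^ 2 ≤ C * (r - l) ^ (2 * m + 1) * ∫ x in Ioo l r, g (m + 1) x ^ 2 ∧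
    ∫ x in Ioo l r, (g 0 x - (proj k l r (g 0)).eval x) ^ 2 ≤
      C * (r - l) ^ (2 * m + 2) * ∫ x in Ioo l r, g (m + 1) x ^ 2 := by
  obtain ⟨C₁, hC₁, hev⟩ := exists_eval_bound (k + 1)
  refine ⟨2 * C₁ + 4, by linarith, fun l r hlr m hm g hg hg0 hgm hd => ?_⟩
  have hη : 0 < r - l := sub_pos.2 hlr
  obtain ⟨T, hT, hT1, hT2, hT3⟩ := exists_taylor hlr hg hd
  replace hT : T ∈ Polynomial.degreeLT ℝ (k + 1) := Polynomial.degreeLT_mono (by omega) hT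
  set B := (r - l) ^ m * ∫ y in Ioo l r, |g (m + 1) y| with hB
  set G := ∫ x in Ioo l r, g (m + 1) x ^ 2 with hG
  have hB2 : B ^ 2 ≤ (r - l) ^ (2 * m + 1) * G := by
    rw [hB, mul_pow]
    have := sq_integral_abs_le hlr (hg (m + 1) le_rfl) hgm
    calc _ ≤ ((r - l) ^ m) ^ 2 * ((r - l) * G) := by gcongr
      _ = _ := by ring
  have hg00 := hg 0 (by omega)
  set R := proj k l r (g 0) - T with hRdef
  have hR : R ∈ Polynomial.degreeLT ℝ (k + 1) := Submodule.sub_mem _ (proj_mem k) hT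
  have hTi : IntegrableOn (fun x => T.eval x) (Ioo l r) := integrableOn_eval T
  have hc : IntegrableOn (fun _ : ℝ => B ^ 2) (Ioo l r) := by simp [integrableOn_const_iff]
  have hRi : IntegrableOn (fun x => R.eval x * R.eval x) (Ioo l r) := by
    simpa using integrableOn_eval (l := l) (r := r) (R * R)
  have hconst : ∫ _ in Ioo l r, B ^ 2 = (r - l) * B ^ 2 := by simp [hlr.le]
  have hRR : ip l r R R ≤ (r - l) * B ^ 2 := by
    have e1 : ip l r R R = ∫ x in Ioo l r, (g 0 x - T.eval x) * R.eval x := by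
      simp only [sub_mul]
      rw [integral_sub (IntegrableOn.mul_polynomial hg00 R) (IntegrableOn.mul_polynomial hTi R),
        ← proj_spec hlr hg00 k hR, ← ip_eq_setIntegral hlr.le, ← ip_sub_left]
    have e2 : ∫ x in Ioo l r, (g 0 x - T.eval x) * R.eval x ≤
        ∫ x in Ioo l r, (1 / 2 * B ^ 2 + 1 / 2 * (R.eval x * R.eval x)) := by
      refine integral_mono_ae (IntegrableOn.mul_polynomial (hg00.sub hTi) R)
        ((hc.const_mul _).add (hRi.const_mul _)) ?_
      filter_upwards [hT1] with x hx
      have := sq_le_sq' (abs_le.1 hx).1 (abs_le.1 hx).2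
      nlinarith [sq_nonneg (g 0 x - T.eval x - R.eval x)]
    rw [integral_add (hc.const_mul _) (hRi.const_mul _), integral_const_mul, integral_const_mul,
      ← ip_eq_setIntegral hlr.le, hconst] at e2
    linarith
  have hRe : ∀ x ∈ Icc l r, R.eval x ^ 2 ≤ C₁ * B ^ 2 := by
    intro x hx
    refine (hev l r hlr R hR x hx).trans ?_
    calc C₁ / (r - l) * ip l r R R ≤ C₁ / (r - l) * ((r - l) * B ^ 2) := by gcongr
      _ = C₁ * B ^ 2 := by field_simp
  have hG0 : 0 ≤ G := integral_nonneg fun x => sq_nonneg _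
  refine ⟨?_, ?_, ?_⟩
  · have e : rhoL k l r (g 0) (g 1) = -R.eval l := by
      rw [rhoL, hT2, hRdef, Polynomial.eval_sub]; ring
    rw [e, neg_sq]
    have := hRe l (left_mem_Icc.2 hlr.le)
    nlinarith
  · have e : rhoR k l r (g 0) (g 1) = (traceR l r (g 0) (g 1) - T.eval r) - R.eval r := by
      rw [rhoR, hRdef, Polynomial.eval_sub]; ring
    rw [e]
    have h1 := hRe r (right_mem_Icc.2 hlr.le)
    have h2 := sq_le_sq' (abs_le.1 hT3).1 (abs_le.1 hT3).2
    nlinarith [sq_nonneg ((traceR l r (g 0) (g 1) - T.eval r) + R.eval r)]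
  · have e1 : ∫ x in Ioo l r, (g 0 x - (proj k l r (g 0)).eval x) ^ 2 ≤
        ∫ x in Ioo l r, (2 * B ^ 2 + 2 * (R.eval x * R.eval x)) := by
      refine integral_mono_ae ?_ ((hc.const_mul _).add (hRi.const_mul _)) ?_
      · have : ∀ x, (g 0 x - (proj k l r (g 0)).eval x) ^ 2 = g 0 x ^ 2 -
            2 * (g 0 x * (proj k l r (g 0)).eval x) +
            (proj k l r (g 0) * proj k l r (g 0)).eval x := fun x => by
          rw [Polynomial.eval_mul]; ring
        simp only [this]
        exact (hg0.sub ((IntegrableOn.mul_polynomial hg00 _).const_mul 2)).add (integrableOn_eval _)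
      · filter_upwards [hT1] with x hx
        have h1 := sq_le_sq' (abs_le.1 hx).1 (abs_le.1 hx).2
        have h2 : g 0 x - (proj k l r (g 0)).eval x = (g 0 x - T.eval x) - R.eval x := by
          rw [hRdef, Polynomial.eval_sub]; ring
        rw [h2]
        nlinarith [sq_nonneg (g 0 x - T.eval x + R.eval x)]
    rw [integral_add (hc.const_mul _) (hRi.const_mul _), integral_const_mul, integral_const_mul,
      ← ip_eq_setIntegral hlr.le, hconst] at e1
    have e2 : (r - l) * B ^ 2 ≤ (r - l) ^ (2 * m + 2) * G := by
      calc _ ≤ (r - l) * ((r - l) ^ (2 * m + 1) * G) := by gcongr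
        _ = _ := by ring
    have e3 : 0 ≤ (r - l) ^ (2 * m + 2) * G := by positivity
    nlinarith

end

/-! ### Functions of time with values in a Banach space -/

section

variable {E : Type*} [NormedAddCommGroup E] [NormedSpace ℝ E] {T K : ℝ}

/-- A set of full measure in (0, T) is dense in [0, T]. This is how almost everywhere statements in
time are upgraded to all times for continuous representatives. -/
theorem mem_of_ae_mem {X : Type*} [TopologicalSpace X] {J : ℝ → X} (hT : 0 < T)
    (hJ : ContinuousOn J (Icc 0 T)) {A : Set X} (hA : IsClosed A)
    (h : ∀ᵐ t ∂(volume.restrict (Ioo 0 T)), J t ∈ A) : ∀ t ∈ Icc 0 T, J t ∈ A := by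
  rw [ae_restrict_iff' measurableSet_Ioo] at h
  have hd : Icc 0 T ⊆ closure (Ioo 0 T ∩ {t | t ∈ Ioo 0 T → J t ∈ A}) := by
    rw [← closure_Ioo hT.ne]
    exact closure_minimal ((Measure.dense_of_ae h).open_subset_closure_inter isOpen_Ioo)
      isClosed_closure
  intro t ht
  have hmaps : MapsTo J (Ioo 0 T ∩ {t | t ∈ Ioo 0 T → J t ∈ A}) A := fun s hs => hs.2 hs.1
  have hcl : closure (Ioo 0 T ∩ {t | t ∈ Ioo 0 T → J t ∈ A}) ⊆ Icc 0 T :=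
    closure_minimal (inter_subset_left.trans Ioo_subset_Icc_self) isClosed_Icc
  have := hmaps.closure_of_continuousOn (hJ.mono hcl) (hd ht)
  rwa [hA.closure_eq] at this

theorem exists_good_seq (hT : 0 < T) {good : ℝ → Prop}
    (h : ∀ᵐ t ∂(volume.restrict (Ioo 0 T)), good t) {t : ℝ} (ht : t ∈ Icc 0 T) :
    ∃ s : ℕ → ℝ, (∀ n, s n ∈ Icc 0 T ∧ good (s n)) ∧ Filter.Tendsto s Filter.atTop (nhds t) := by
  rw [ae_restrict_iff' measurableSet_Ioo] at h
  have hd : Icc 0 T ⊆ closure (Ioo 0 T ∩ {t | t ∈ Ioo 0 T → good t}) := by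
    rw [← closure_Ioo hT.ne]
    exact closure_minimal ((Measure.dense_of_ae h).open_subset_closure_inter isOpen_Ioo)
      isClosed_closure
  obtain ⟨s, hs, hs'⟩ := mem_closure_iff_seq_limit.1 (hd ht)
  exact ⟨s, fun n => ⟨Ioo_subset_Icc_self (hs n).1, (hs n).2 (hs n).1⟩, hs'⟩

theorem norm_integral_le_of_ae_bound {V : ℝ → E}
    (hb : ∀ᵐ t ∂(volume.restrict (Ioo 0 T)), ‖V t‖ ≤ K) {s t : ℝ} (hs : s ∈ Icc 0 T)
    (ht : t ∈ Icc 0 T) : ‖∫ x in s..t, V x‖ ≤ K * |t - s| := by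
  refine intervalIntegral.norm_integral_le_of_norm_le_const_ae ?_
  rw [ae_restrict_iff' measurableSet_Ioo] at hb
  have hne : ∀ᵐ x : ℝ, x ≠ T := by simp [ae_iff, measure_singleton]
  filter_upwards [hb, hne] with x hx hxT hm
  have h1 : min s t < x := hm.1
  have h2 : x ≤ max s t := hm.2
  exact hx ⟨(le_min hs.1 ht.1).trans_lt h1, lt_of_le_of_ne (h2.trans (max_le hs.2 ht.2)) hxT⟩

theorem IsWeakTimeDeriv.exists_primitive [CompleteSpace E] (hT : 0 < T) {V V' : ℝ → E}
    (h : IsWeakTimeDeriv T V V')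
    (hV : IntegrableOn V (Ioo 0 T)) (hV' : IntegrableOn V' (Ioo 0 T)) :
    ∃ J : ℝ → E, (∀ᵐ t ∂(volume.restrict (Ioo 0 T)), V t = J t) ∧
      ∀ s ∈ Icc 0 T, ∀ t ∈ Icc 0 T, J t - J s = ∫ x in s..t, V' x := by
  obtain ⟨c, hc⟩ := eq_primitive_of_weak_deriv hT hV hV' h
  refine ⟨fun t => c + ∫ x in (0)..t, V' x, hc, fun s hs t ht => ?_⟩
  have hi : ∀ x ∈ Icc 0 T, IntervalIntegrable V' volume 0 x := fun x hx =>
    (intervalIntegrable_iff_integrableOn_Ioo_of_le hx.1).2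
      (hV'.mono_set (Ioo_subset_Ioo_right hx.2))
  rw [add_sub_add_left_eq_sub, intervalIntegral.integral_interval_sub_left (hi t ht) (hi s hs)]

/-- A Lipschitz derivative gives a quadratic Taylor remainder; two time derivatives in `L^∞` are
used only in this form. -/
theorem norm_sub_sub_smul_le [CompleteSpace E] {J₀ J₁ V : ℝ → E}
    (hVJ : ∀ᵐ t ∂(volume.restrict (Ioo 0 T)), V t = J₁ t)
    (hV : IntegrableOn V (Ioo 0 T))
    (h0 : ∀ s ∈ Icc 0 T, ∀ t ∈ Icc 0 T, J₀ t - J₀ s = ∫ x in s..t, V x)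
    (h1 : ∀ s ∈ Icc 0 T, ∀ t ∈ Icc 0 T, ‖J₁ t - J₁ s‖ ≤ K * |t - s|) (hK : 0 ≤ K)
    {s t : ℝ} (hs : s ∈ Icc 0 T) (ht : t ∈ Icc 0 T) :
    ‖J₀ t - J₀ s - (t - s) • J₁ s‖ ≤ K * (t - s) ^ 2 := by
  have hsub : uIoc s t ⊆ Ioc 0 T := by
    intro x hx
    exact ⟨(le_min hs.1 ht.1).trans_lt hx.1, hx.2.trans (max_le hs.2 ht.2)⟩
  have hi : IntervalIntegrable V volume s t := by
    rw [intervalIntegrable_iff]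
    exact ((integrableOn_Ioc_iff_integrableOn_Ioo).2 hV).mono_set hsub
  have e : J₀ t - J₀ s - (t - s) • J₁ s = ∫ x in s..t, (V x - J₁ s) := by
    rw [intervalIntegral.integral_sub hi intervalIntegrable_const, h0 s hs t ht,
      intervalIntegral.integral_const]
  rw [e]
  have hb : ‖∫ x in s..t, (V x - J₁ s)‖ ≤ K * |t - s| * |t - s| := by
    refine intervalIntegral.norm_integral_le_of_norm_le_const_ae ?_
    rw [ae_restrict_iff' measurableSet_Ioo] at hVJ
    have hne : ∀ᵐ x : ℝ, x ≠ T := by simp [ae_iff, measure_singleton]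
    filter_upwards [hVJ, hne] with x hx hxT hm
    have hxm := hsub hm
    rw [hx ⟨hxm.1, lt_of_le_of_ne hxm.2 hxT⟩]
    refine (h1 s hs x ⟨hxm.1.le, hxm.2⟩).trans ?_
    refine mul_le_mul_of_nonneg_left ?_ hK
    exact abs_sub_left_of_mem_uIcc (uIoc_subset_uIcc hm)
  rw [mul_assoc, abs_mul_abs_self] at hb
  rw [pow_two]; exact hb

theorem hasDerivWithinAt_of_norm_le {J₀ : ℝ → E} {d : E} {t : ℝ} {s : Set ℝ}
    (h : ∀ x ∈ s, ‖J₀ x - J₀ t - (x - t) • d‖ ≤ K * (x - t) ^ 2) :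
    HasDerivWithinAt J₀ d s t := by
  rw [hasDerivWithinAt_iff_isLittleO]
  have h1 : (fun x => J₀ x - J₀ t - (x - t) • d) =O[nhdsWithin t s] fun x => (x - t) ^ 2 := by
    refine Asymptotics.IsBigO.of_bound K ?_
    filter_upwards [self_mem_nhdsWithin] with x hx
    rw [Real.norm_of_nonneg (sq_nonneg _)]
    exact h x hx
  refine h1.trans_isLittleO ?_
  have h2 : (fun x => (x - t) ^ 2) =o[nhds t] fun x => x - t := by
    have := Asymptotics.isLittleO_pow_sub_sub t (m := 2) (by norm_num)
    simpa using this
  exact h2.mono nhdsWithin_le_nhds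

end

/-! ### Continuous functionals on jets -/

/-- The space `L²(a, b)`. -/
abbrev L2 (a b : ℝ) : Type := Lp ℝ 2 (volume.restrict (Ioo a b))

section

variable {a b l r : ℝ} {s : ℕ}

/-- The `j`-th component of a jet. -/
def jetFn (a b : ℝ) (s j : ℕ) : Jet a b s →L[ℝ] L2 a b :=
  -- Components out of range are zero, so that jets can be read as sequences indexed by natural
  -- numbers.
  if h : j < s + 1 then PiLp.proj 2 (fun _ : Fin (s + 1) => L2 a b) ⟨j, h⟩ else 0

theorem jetFn_of_lt {j : ℕ} (h : j < s + 1) (g : Jet a b s) : jetFn a b s j g = g ⟨j, h⟩ := by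
  rw [jetFn, dif_pos h]; rfl

theorem norm_jetFn_le (j : ℕ) (g : Jet a b s) : ‖jetFn a b s j g‖ ≤ ‖g‖ := by
  by_cases h : j < s + 1
  · rw [jetFn_of_lt h]
    exact PiLp.norm_apply_le g _
  · rw [jetFn, dif_neg h]; simp

theorem isBrokenSobolev_iff {N : ℕ} {𝒯 : Mesh a b N} {g : Jet a b s} : IsBrokenSobolev 𝒯 g ↔
    ∀ i, ∀ j < s, IsWeakDeriv 1 (𝒯.elem i) (jetFn a b s j g) (jetFn a b s (j + 1) g) := by
  constructor
  · intro h i j hj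
    rw [jetFn_of_lt (by omega), jetFn_of_lt (by omega)]
    exact h i ⟨j, hj⟩
  · intro h i l
    have := h i l l.2
    rw [jetFn_of_lt (by omega), jetFn_of_lt (by omega)] at this
    exact this

theorem L2.integrableOn (g : L2 a b) (h : Ioo l r ⊆ Ioo a b) : IntegrableOn g (Ioo l r) := by
  have : IntegrableOn g (Ioo a b) := (Lp.memLp g).integrable (by norm_num)
  exact this.mono_set h

theorem L2.integrableOn_sq (g : L2 a b) (h : Ioo l r ⊆ Ioo a b) :
    IntegrableOn (fun x => g x ^ 2) (Ioo l r) := by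
  have : IntegrableOn (fun x => g x ^ 2) (Ioo a b) := (Lp.memLp g).integrable_sq
  exact this.mono_set h

/-- The functional is the inner product with ψ cut off to the subinterval. Projections, traces and
tests of weak derivatives are built from such functionals, so each of them is linear and commutes
with limits and time derivatives. -/
theorem exists_clm_integral (h : Ioo l r ⊆ Ioo a b) {ψ : ℝ → ℝ} (hψ : Continuous ψ) :
    ∃ L : L2 a b →L[ℝ] ℝ, ∀ g, L g = ∫ x in Ioo l r, g x * ψ x := by
  have hm : MemLp ((Ioo l r).indicator ψ) 2 (volume.restrict (Ioo a b)) := by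
    obtain ⟨C, hC⟩ := isCompact_Icc.exists_bound_of_continuousOn (s := Icc l r) hψ.continuousOn
    refine MemLp.of_bound (hψ.aestronglyMeasurable.indicator measurableSet_Ioo) |C|
      (Filter.Eventually.of_forall fun x => ?_)
    by_cases hx : x ∈ Ioo l r
    · rw [indicator_of_mem hx]
      exact (hC x (Ioo_subset_Icc_self hx)).trans (le_abs_self C)
    · rw [indicator_of_notMem hx]; simp
  refine ⟨innerSL ℝ hm.toLp, fun g => ?_⟩
  rw [innerSL_apply_apply, L2.inner_def]
  have e1 : ∫ x in Ioo a b, inner ℝ ((hm.toLp : ℝ → ℝ) x) (g x) =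
      ∫ x in Ioo a b, (Ioo l r).indicator (fun x => g x * ψ x) x := by
    refine integral_congr_ae ?_
    filter_upwards [hm.coeFn_toLp] with x hx
    rw [hx]
    by_cases hx : x ∈ Ioo l r
    · simp [indicator_of_mem hx, mul_comm]
    · simp [indicator_of_notMem hx]
  rw [e1, setIntegral_indicator measurableSet_Ioo, inter_eq_right.2 h]

theorem exists_clm_coeff_proj (h : Ioo l r ⊆ Ioo a b) (k m j : ℕ) :
    ∃ L : Jet a b s →L[ℝ] ℝ, ∀ g, L g = (proj k l r (jetFn a b s j g)).coeff m := by
  by_cases hm : m ∈ Finset.range (k + 1)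
  · obtain ⟨L, hL⟩ := exists_clm_integral h (coeffRep k l r m).continuous
    refine ⟨L.comp (jetFn a b s j), fun g => ?_⟩
    rw [coeff_proj, if_pos hm, ContinuousLinearMap.comp_apply, hL]
  · refine ⟨0, fun g => ?_⟩
    rw [coeff_proj, if_neg hm]; simp

theorem exists_clm_eval_proj (h : Ioo l r ⊆ Ioo a b) (k j : ℕ) (x : ℝ) :
    ∃ L : Jet a b s →L[ℝ] ℝ, ∀ g, L g = (proj k l r (jetFn a b s j g)).eval x := by
  choose L hL using fun m => exists_clm_coeff_proj (s := s) h k m j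
  refine ⟨∑ m ∈ Finset.range (k + 1), x ^ m • L m, fun g => ?_⟩
  rw [eval_eq_sum_of_mem (proj_mem k)]
  simp [hL, mul_comm]

theorem exists_clm_integral_jet (h : Ioo l r ⊆ Ioo a b) (j : ℕ) {ψ : ℝ → ℝ} (hψ : Continuous ψ) :
    ∃ L : Jet a b s →L[ℝ] ℝ, ∀ g, L g = ∫ x in Ioo l r, jetFn a b s j g x * ψ x := by
  obtain ⟨L, hL⟩ := exists_clm_integral h hψ
  exact ⟨L.comp (jetFn a b s j), fun g => by rw [ContinuousLinearMap.comp_apply, hL]⟩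

theorem exists_clm_rhoL (h : Ioo l r ⊆ Ioo a b) (k i j : ℕ) :
    ∃ L : Jet a b s →L[ℝ] ℝ, ∀ g, L g = rhoL k l r (jetFn a b s i g) (jetFn a b s j g) := by
  obtain ⟨L₁, h1⟩ := exists_clm_integral_jet (s := s) h i (continuous_const (y := (1 : ℝ)))
  obtain ⟨L₂, h2⟩ := exists_clm_integral_jet (s := s) h j (continuous_id.sub (continuous_const (y := r)))
  obtain ⟨L₃, h3⟩ := exists_clm_eval_proj (s := s) h k i l
  refine ⟨(r - l)⁻¹ • (L₁ + L₂) - L₃, fun g => ?_⟩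
  simp [rhoL, traceL, h1, h2, h3, mul_add]

theorem exists_clm_rhoR (h : Ioo l r ⊆ Ioo a b) (k i j : ℕ) :
    ∃ L : Jet a b s →L[ℝ] ℝ, ∀ g, L g = rhoR k l r (jetFn a b s i g) (jetFn a b s j g) := by
  obtain ⟨L₁, h1⟩ := exists_clm_integral_jet (s := s) h i (continuous_const (y := (1 : ℝ)))
  obtain ⟨L₂, h2⟩ := exists_clm_integral_jet (s := s) h j (continuous_id.sub (continuous_const (y := l)))
  obtain ⟨L₃, h3⟩ := exists_clm_eval_proj (s := s) h k i r
  refine ⟨(r - l)⁻¹ • (L₁ + L₂) - L₃, fun g => ?_⟩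
  simp [rhoR, traceR, h1, h2, h3, mul_add]

/-- An intersection, over test functions, of equalizers of continuous functionals. -/
theorem isClosed_setOf_isWeakDeriv (h : Ioo l r ⊆ Ioo a b) (i j : ℕ) :
    IsClosed {g : Jet a b s | IsWeakDeriv 1 (Ioo l r) (jetFn a b s i g) (jetFn a b s j g)} := by
  have hli : ∀ g : L2 a b, LocallyIntegrableOn g (Ioo l r) := fun g =>
    (L2.integrableOn g h).locallyIntegrableOn
  have e : {g : Jet a b s | IsWeakDeriv 1 (Ioo l r) (jetFn a b s i g) (jetFn a b s j g)} =
      ⋂ (φ : ℝ → ℝ) (_ : ContDiff ℝ ∞ φ) (_ : HasCompactSupport φ) (_ : tsupport φ ⊆ Ioo l r),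
        {g : Jet a b s | ∫ x in Ioo l r, jetFn a b s i g x * iteratedDeriv 1 φ x =
          (-1) ^ 1 * ∫ x in Ioo l r, jetFn a b s j g x * φ x} := by
    ext g
    simp only [mem_ofPred_eq, mem_iInter, IsWeakDeriv]
    exact ⟨fun H => H.2.2, fun H => ⟨hli _, hli _, H⟩⟩
  rw [e]
  refine isClosed_iInter fun φ => isClosed_iInter fun h1 => isClosed_iInter fun h2 =>
    isClosed_iInter fun h3 => ?_
  have hc : Continuous (iteratedDeriv 1 φ) := h1.continuous_iteratedDeriv 1 (by exact_mod_cast le_top)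
  obtain ⟨L₁, e1⟩ := exists_clm_integral_jet (s := s) h i hc
  obtain ⟨L₂, e2⟩ := exists_clm_integral_jet (s := s) h j h1.continuous
  simp only [← e1, ← e2]
  exact isClosed_eq L₁.continuous (continuous_const.mul L₂.continuous)

theorem isWeakDeriv_linear (h : Ioo l r ⊆ Ioo a b) {i j : ℕ} {g g' : Jet a b s} (c : ℝ)
    (hg : IsWeakDeriv 1 (Ioo l r) (jetFn a b s i g) (jetFn a b s j g))
    (hg' : IsWeakDeriv 1 (Ioo l r) (jetFn a b s i g') (jetFn a b s j g')) :
    IsWeakDeriv 1 (Ioo l r) (jetFn a b s i (g + c • g')) (jetFn a b s j (g + c • g')) := by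
  have hli : ∀ g : L2 a b, LocallyIntegrableOn g (Ioo l r) := fun g =>
    (L2.integrableOn g h).locallyIntegrableOn
  refine ⟨hli _, hli _, fun φ h1 h2 h3 => ?_⟩
  have hc : Continuous (iteratedDeriv 1 φ) := h1.continuous_iteratedDeriv 1 (by exact_mod_cast le_top)
  obtain ⟨L₁, e1⟩ := exists_clm_integral_jet (s := s) h i hc
  obtain ⟨L₂, e2⟩ := exists_clm_integral_jet (s := s) h j h1.continuous
  have f1 := hg.2.2 φ h1 h2 h3
  have f2 := hg'.2.2 φ h1 h2 h3
  rw [← e1, ← e2] at f1 f2 ⊢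
  rw [map_add, map_smul, map_add, map_smul, f1, f2, smul_eq_mul, smul_eq_mul]
  ring

end

/-! ### Lipschitz continuous representatives of Bochner–Sobolev functions -/

/-- A Lipschitz continuous function of time with values in the broken Sobolev space. -/
structure IsLipJet {a b : ℝ} {N : ℕ} (𝒯 : Mesh a b N) (T : ℝ) (s : ℕ) (K : ℝ)
    (J : ℝ → Jet a b s) : Prop where
  broken : ∀ t ∈ Icc 0 T, IsBrokenSobolev 𝒯 (J t)
  bound : ∀ t ∈ Icc 0 T, ‖J t‖ ≤ K
  lip : ∀ s ∈ Icc 0 T, ∀ t ∈ Icc 0 T, ‖J t - J s‖ ≤ K * |t - s|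

section

variable {a b : ℝ} {N : ℕ} {𝒯 : Mesh a b N} {T K : ℝ} {s : ℕ}

theorem Mesh.node_mem (i : Fin (N + 1)) : 𝒯.node i ∈ Icc a b := by
  have h0 := 𝒯.strictMono.monotone (Fin.zero_le i)
  have h1 := 𝒯.strictMono.monotone (Fin.le_last i)
  rw [𝒯.node_zero] at h0
  rw [𝒯.node_last] at h1
  exact ⟨h0, h1⟩

theorem Mesh.Icc_subset (i : Fin N) : Icc (𝒯.left i) (𝒯.right i) ⊆ Icc a b :=
  Icc_subset_Icc (Mesh.node_mem _).1 (Mesh.node_mem _).2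

theorem Mesh.elem_subset (i : Fin N) : Ioo (𝒯.left i) (𝒯.right i) ⊆ Ioo a b :=
  Ioo_subset_Ioo (Mesh.node_mem _).1 (Mesh.node_mem _).2

theorem Mesh.exists_mem_elem {x : ℝ} (hx : x ∈ Ioo a b) (hn : ∀ j, x ≠ 𝒯.node j) :
    ∃ i, x ∈ Ioo (𝒯.left i) (𝒯.right i) := by
  by_contra! H
  have h : ∀ j : Fin (N + 1), 𝒯.node j < x := by
    intro j
    induction j using Fin.induction with
    | zero => rw [𝒯.node_zero]; exact hx.1
    | succ j ih =>
      by_contra hlt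
      exact H j ⟨ih, lt_of_le_of_ne (not_lt.1 hlt) (hn _)⟩
  have := h (Fin.last N)
  rw [𝒯.node_last] at this
  exact absurd hx.2 this.not_gt

theorem Mesh.ae_of_elem (𝒯 : Mesh a b N) {P : ℝ → Prop}
    (h : ∀ i, ∀ᵐ x ∂(volume.restrict (Ioo (𝒯.left i) (𝒯.right i))), P x) :
    ∀ᵐ x ∂(volume.restrict (Ioo a b)), P x := by
  have h' := ae_all_iff.2 fun i => (ae_restrict_iff' measurableSet_Ioo).1 (h i)
  have hn : ∀ᵐ x : ℝ, ∀ j, x ≠ 𝒯.node j :=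
    ae_all_iff.2 fun j => by simp [ae_iff, measure_singleton]
  rw [ae_restrict_iff' measurableSet_Ioo]
  filter_upwards [h', hn] with x hx hxn hm
  obtain ⟨i, hi⟩ := Mesh.exists_mem_elem hm hxn
  exact hx i hi

theorem ae_elem_of_ae (i : Fin N) {P : ℝ → Prop} (h : ∀ᵐ x ∂(volume.restrict (Ioo a b)), P x) :
    ∀ᵐ x ∂(volume.restrict (Ioo (𝒯.left i) (𝒯.right i))), P x :=
  ae_restrict_of_ae_restrict_of_subset (Mesh.elem_subset i) h

theorem isClosed_setOf_isBrokenSobolev : IsClosed {g : Jet a b s | IsBrokenSobolev 𝒯 g} := by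
  have e : {g : Jet a b s | IsBrokenSobolev 𝒯 g} = ⋂ (i) (j) (_ : j < s),
      {g : Jet a b s | IsWeakDeriv 1 (Ioo (𝒯.left i) (𝒯.right i)) (jetFn a b s j g)
        (jetFn a b s (j + 1) g)} := by
    ext g
    simp only [mem_ofPred_eq, mem_iInter]
    exact isBrokenSobolev_iff
  rw [e]
  exact isClosed_iInter fun i => isClosed_iInter fun j => isClosed_iInter fun _ =>
    isClosed_setOf_isWeakDeriv (Mesh.elem_subset i) _ _

theorem IsBrokenSobolev.add_smul {g g' : Jet a b s} (h : IsBrokenSobolev 𝒯 g)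
    (h' : IsBrokenSobolev 𝒯 g') (c : ℝ) : IsBrokenSobolev 𝒯 (g + c • g') := by
  rw [isBrokenSobolev_iff] at *
  exact fun i j hj => isWeakDeriv_linear (Mesh.elem_subset i) c (h i j hj) (h' i j hj)

theorem IsBrokenSobolev.sub {g g' : Jet a b s} (h : IsBrokenSobolev 𝒯 g)
    (h' : IsBrokenSobolev 𝒯 g') : IsBrokenSobolev 𝒯 (g - g') := by
  have := h.add_smul h' (-1)
  rwa [neg_one_smul, ← sub_eq_add_neg] at this

theorem continuousOn_of_lip {E : Type*} [NormedAddCommGroup E] {J : ℝ → E} {A : Set ℝ}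
    (h : ∀ s ∈ A, ∀ t ∈ A, ‖J t - J s‖ ≤ K * |t - s|) : ContinuousOn J A := by
  have : LipschitzOnWith (Real.toNNReal K) J A := by
    refine LipschitzOnWith.of_dist_le_mul fun x hx y hy => ?_
    rw [dist_eq_norm, Real.dist_eq]
    exact (h y hy x hx).trans (mul_le_mul_of_nonneg_right (Real.le_coe_toNNReal K) (abs_nonneg _))
  exact this.continuousOn

theorem IsLipJet.continuousOn {J : ℝ → Jet a b s} (h : IsLipJet 𝒯 T s K J) :
    ContinuousOn J (Icc 0 T) :=
  continuousOn_of_lip h.lip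

/-- Being broken Sobolev and being bounded by K are closed conditions, so they pass from almost
every time to the continuous representative at every time. -/
theorem isLipJet_of_primitive (hT : 0 < T) {V V' J : ℝ → Jet a b s}
    (hV : ∀ᵐ t ∂(volume.restrict (Ioo 0 T)), IsBrokenSobolev 𝒯 (V t) ∧ ‖V t‖ ≤ K)
    (hV' : ∀ᵐ t ∂(volume.restrict (Ioo 0 T)), ‖V' t‖ ≤ K)
    (hJ : ∀ᵐ t ∂(volume.restrict (Ioo 0 T)), V t = J t)
    (hJ' : ∀ s ∈ Icc 0 T, ∀ t ∈ Icc 0 T, J t - J s = ∫ x in s..t, V' x) :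
    IsLipJet 𝒯 T s K J := by
  have hlip : ∀ s ∈ Icc 0 T, ∀ t ∈ Icc 0 T, ‖J t - J s‖ ≤ K * |t - s| := fun s hs t ht => by
    rw [hJ' s hs t ht]; exact norm_integral_le_of_ae_bound hV' hs ht
  have hc := continuousOn_of_lip hlip
  refine ⟨mem_of_ae_mem hT hc isClosed_setOf_isBrokenSobolev ?_, ?_, hlip⟩
  · filter_upwards [hV, hJ] with t h1 h2
    rw [← h2]; exact h1.1
  · have := mem_of_ae_mem hT hc (Metric.isClosed_closedBall (x := 0) (ε := K)) ?_
    · simpa using this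
    · filter_upwards [hV, hJ] with t h1 h2
      rw [← h2]; simpa using h1.2

theorem MemBochnerSobolev.exists_lipJet (hT : 0 < T) {v : ℝ → ℝ → ℝ}
    (h : MemBochnerSobolev 𝒯 T 1 s K v) :
    ∃ J, IsLipJet 𝒯 T s K J ∧
      ∀ᵐ t ∂(volume.restrict (Ioo 0 T)), v t =ᵐ[volume.restrict (Ioo a b)] jetFn a b s 0 (J t) := by
  obtain ⟨D, h1, h2, h3⟩ := h
  have hi : ∀ j, IntegrableOn (D j) (Ioo 0 T) := fun j =>
    Integrable.of_bound (h2 j).1 K ((h2 j).2.mono fun t ht => ht.2)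
  obtain ⟨J, hJ, hJ'⟩ := (h3 0).exists_primitive hT (hi _) (hi _)
  refine ⟨J, isLipJet_of_primitive hT (h2 _).2 ((h2 _).2.mono fun t ht => ht.2) hJ hJ', ?_⟩
  filter_upwards [h1, hJ] with t e1 e2
  rw [jetFn_of_lt (Nat.succ_pos s), ← e2]
  exact e1

theorem MemBochnerSobolev.exists_lipJet_two (hT : 0 < T) {v : ℝ → ℝ → ℝ}
    (h : MemBochnerSobolev 𝒯 T 2 s K v) (hK : 0 ≤ K) :
    ∃ J J', IsLipJet 𝒯 T s K J ∧ IsLipJet 𝒯 T s K J' ∧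
      (∀ r ∈ Icc 0 T, ∀ t ∈ Icc 0 T, ‖J t - J r - (t - r) • J' r‖ ≤ K * (t - r) ^ 2) ∧
      ∀ᵐ t ∂(volume.restrict (Ioo 0 T)), v t =ᵐ[volume.restrict (Ioo a b)] jetFn a b s 0 (J t) := by
  obtain ⟨D, h1, h2, h3⟩ := h
  have hi : ∀ j, IntegrableOn (D j) (Ioo 0 T) := fun j =>
    Integrable.of_bound (h2 j).1 K ((h2 j).2.mono fun t ht => ht.2)
  obtain ⟨J, hJ, hJ'⟩ := (h3 0).exists_primitive hT (hi _) (hi _)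
  obtain ⟨I, hI, hI'⟩ := (h3 1).exists_primitive hT (hi _) (hi _)
  have l1 : IsLipJet 𝒯 T s K J :=
    isLipJet_of_primitive hT (h2 _).2 ((h2 _).2.mono fun t ht => ht.2) hJ hJ'
  have l2 : IsLipJet 𝒯 T s K I :=
    isLipJet_of_primitive hT (h2 _).2 ((h2 _).2.mono fun t ht => ht.2) hI hI'
  refine ⟨J, I, l1, l2, fun r hr t ht => ?_, ?_⟩
  · exact norm_sub_sub_smul_le hI (hi _) hJ' l2.lip hK hr ht
  · filter_upwards [h1, hJ] with t e1 e2
    rw [jetFn_of_lt (Nat.succ_pos s), ← e2]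
    exact e1

end

/-! ### The exact solution and its jets -/

/-- An `L²` limit is an almost everywhere limit along a subsequence and must agree with the
pointwise limit. -/
theorem ae_eq_of_tendsto_Lp {a b : ℝ} {g : ℕ → L2 a b} {g₀ : L2 a b} {f : ℕ → ℝ → ℝ} {f₀ : ℝ → ℝ}
    (hg : Filter.Tendsto g Filter.atTop (nhds g₀))
    (hfg : ∀ n, f n =ᵐ[volume.restrict (Ioo a b)] g n)
    (hf : ∀ x ∈ Icc a b, Filter.Tendsto (fun n => f n x) Filter.atTop (nhds (f₀ x))) :
    f₀ =ᵐ[volume.restrict (Ioo a b)] g₀ := by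
  obtain ⟨ns, hns, hlim⟩ := (tendstoInMeasure_of_tendsto_Lp hg).exists_seq_tendsto_ae
  filter_upwards [hlim, ae_all_iff.2 hfg, ae_restrict_mem measurableSet_Ioo] with x h1 h2 hm
  have h3 := (hf x (Ioo_subset_Icc_self hm)).comp hns.tendsto_atTop
  refine tendsto_nhds_unique h3 (h1.congr fun n => ?_)
  simp [h2]

/-- The exact solution is represented, at all times, by Lipschitz continuous jets. -/
structure IsRegular {a b : ℝ} {N : ℕ} (𝒯 : Mesh a b N) (T : ℝ) (k : ℕ) (K : ℝ)
    (d : ProblemData) (u ut q p : ℝ → ℝ → ℝ) (U U' Q P : ℝ → Jet a b (k + 1)) : Prop where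
  lip_U : IsLipJet 𝒯 T (k + 1) K U
  lip_U' : IsLipJet 𝒯 T (k + 1) K U'
  lip_Q : IsLipJet 𝒯 T (k + 1) K Q
  lip_P : IsLipJet 𝒯 T (k + 1) K P
  deriv_U : ∀ r ∈ Icc 0 T, ∀ t ∈ Icc 0 T, ‖U t - U r - (t - r) • U' r‖ ≤ K * (t - r) ^ 2
  u_eq : ∀ t ∈ Icc 0 T, u t =ᵐ[volume.restrict (Ioo a b)] jetFn a b (k + 1) 0 (U t)
  ux_eq : ∀ t ∈ Icc 0 T, q t =ᵐ[volume.restrict (Ioo a b)] jetFn a b (k + 1) 1 (U t)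
  q_eq : ∀ t ∈ Icc 0 T, q t =ᵐ[volume.restrict (Ioo a b)] jetFn a b (k + 1) 0 (Q t)
  qx_eq : ∀ t ∈ Icc 0 T, p t =ᵐ[volume.restrict (Ioo a b)] jetFn a b (k + 1) 1 (Q t)
  p_eq : ∀ t ∈ Icc 0 T, p t =ᵐ[volume.restrict (Ioo a b)] jetFn a b (k + 1) 0 (P t)
  px_eq : ∀ t ∈ Icc 0 T,
    (fun x => d.f t x - ut t x) =ᵐ[volume.restrict (Ioo a b)] jetFn a b (k + 1) 1 (P t)
  ut_eq : ∀ t ∈ Icc 0 T, ut t =ᵐ[volume.restrict (Ioo a b)] jetFn a b (k + 1) 0 (U' t)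
  uxx_eq : ∀ t ∈ Icc 0 T, jetFn a b (k + 1) 2 (U t) = jetFn a b (k + 1) 1 (Q t)

section

variable {a b : ℝ} {N : ℕ} {𝒯 : Mesh a b N} {T K : ℝ} {k : ℕ}

theorem ae_eq_jetFn_succ {v w : ℝ → ℝ} {g : Jet a b (k + 1)} {j : ℕ} (hj : j < k + 1)
    (hg : IsBrokenSobolev 𝒯 g) (h : IsWeakDeriv 1 (Ioo a b) v w)
    (hv : v =ᵐ[volume.restrict (Ioo a b)] jetFn a b (k + 1) j g) :
    w =ᵐ[volume.restrict (Ioo a b)] jetFn a b (k + 1) (j + 1) g := by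
  refine 𝒯.ae_of_elem fun i => ?_
  have h1 := (h.mono (Mesh.elem_subset (𝒯 := 𝒯) i)).congr (ae_elem_of_ae i hv)
    (Filter.EventuallyEq.refl _ _)
  exact h1.unique isOpen_Ioo (isBrokenSobolev_iff.1 hg i j hj)

theorem tendsto_jetFn {J : ℝ → Jet a b (k + 1)} {A : Set ℝ} {t : ℝ} (j : ℕ)
    (hJ : ContinuousWithinAt J A t) {s : ℕ → ℝ} (hs : ∀ n, s n ∈ A)
    (hst : Filter.Tendsto s Filter.atTop (nhds t)) :
    Filter.Tendsto (fun n => jetFn a b (k + 1) j (J (s n))) Filter.atTop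
      (nhds (jetFn a b (k + 1) j (J t))) := by
  have h1 : Filter.Tendsto s Filter.atTop (nhdsWithin t A) :=
    tendsto_nhdsWithin_iff.2 ⟨hst, Filter.Eventually.of_forall hs⟩
  exact (((jetFn a b (k + 1) j).continuous.tendsto _).comp hJ.tendsto).comp h1

theorem jetFn_eq_of_ae (hT : 0 < T) {J I : ℝ → Jet a b (k + 1)} (hJ : ContinuousOn J (Icc 0 T))
    (hI : ContinuousOn I (Icc 0 T)) (i j : ℕ)
    (h : ∀ᵐ t ∂(volume.restrict (Ioo 0 T)), jetFn a b (k + 1) i (J t) = jetFn a b (k + 1) j (I t)) :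
    ∀ t ∈ Icc 0 T, jetFn a b (k + 1) i (J t) = jetFn a b (k + 1) j (I t) := by
  have := mem_of_ae_mem (J := fun t => jetFn a b (k + 1) i (J t) - jetFn a b (k + 1) j (I t)) hT
    (((jetFn a b (k + 1) i).continuous.comp_continuousOn hJ).sub
      ((jetFn a b (k + 1) j).continuous.comp_continuousOn hI)) (isClosed_singleton (x := 0))
    (h.mono fun t ht => by simp [ht])
  exact fun t ht => sub_eq_zero.1 (this t ht)

/-- For u, continuity in time at each point x identifies the jet at every time. Neither q nor p is
assumed continuous in time; they are identified through q = u_x and p = q_x, since the derivatives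
of the jets of u and q are continuous in time and agree with the jets of q and p almost everywhere.
The time derivative is the limit of difference quotients, taken pointwise and in `L²`. -/
theorem IsExactSolution.isRegular (hk : 0 < k) (hT : 0 < T) (hK : 0 ≤ K) {d : ProblemData}
    {u ut q p : ℝ → ℝ → ℝ} (hsol : IsExactSolution a b T d u ut q p)
    (hu : MemBochnerSobolev 𝒯 T 2 (k + 1) K u) (hq : MemBochnerSobolev 𝒯 T 1 (k + 1) K q)
    (hp : MemBochnerSobolev 𝒯 T 1 (k + 1) K p) :
    ∃ U U' Q P, IsRegular 𝒯 T k K d u ut q p U U' Q P := by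
  obtain ⟨U, U', lU, lU', dU, eU⟩ := hu.exists_lipJet_two hT hK
  obtain ⟨Q, lQ, eQ⟩ := hq.exists_lipJet hT
  obtain ⟨P, lP, eP⟩ := hp.exists_lipJet hT
  have hmem : ∀ᵐ t ∂(volume.restrict (Ioo 0 T)), t ∈ Icc 0 T := by
    filter_upwards [ae_restrict_mem measurableSet_Ioo] with t ht using Ioo_subset_Icc_self ht
  have u_eq : ∀ t ∈ Icc 0 T, u t =ᵐ[volume.restrict (Ioo a b)] jetFn a b (k + 1) 0 (U t) := by
    intro t ht
    obtain ⟨s, hs, hst⟩ := exists_good_seq hT eU ht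
    refine ae_eq_of_tendsto_Lp (tendsto_jetFn 0 (lU.continuousOn t ht) (fun n => (hs n).1) hst)
      (f := fun n => u (s n)) (fun n => (hs n).2) fun x hx => ?_
    have h1 : Filter.Tendsto s Filter.atTop (nhdsWithin t (Icc 0 T)) :=
      tendsto_nhdsWithin_iff.2 ⟨hst, Filter.Eventually.of_forall fun n => (hs n).1⟩
    exact (hsol.time_deriv t ht x hx).continuousWithinAt.tendsto.comp h1
  have ux_eq : ∀ t ∈ Icc 0 T, q t =ᵐ[volume.restrict (Ioo a b)] jetFn a b (k + 1) 1 (U t) :=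
    fun t ht => ae_eq_jetFn_succ (by omega) (lU.broken t ht) (hsol.eq_q t ht) (u_eq t ht)
  have q_eq : ∀ t ∈ Icc 0 T, q t =ᵐ[volume.restrict (Ioo a b)] jetFn a b (k + 1) 0 (Q t) := by
    have h := jetFn_eq_of_ae hT lU.continuousOn lQ.continuousOn 1 0 (by
      filter_upwards [eQ, hmem] with t h1 h2
      exact Lp.ext ((ux_eq t h2).symm.trans h1))
    exact fun t ht => h t ht ▸ ux_eq t ht
  have qx_eq : ∀ t ∈ Icc 0 T, p t =ᵐ[volume.restrict (Ioo a b)] jetFn a b (k + 1) 1 (Q t) :=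
    fun t ht => ae_eq_jetFn_succ (by omega) (lQ.broken t ht) (hsol.eq_p t ht) (q_eq t ht)
  have p_eq : ∀ t ∈ Icc 0 T, p t =ᵐ[volume.restrict (Ioo a b)] jetFn a b (k + 1) 0 (P t) := by
    have h := jetFn_eq_of_ae hT lQ.continuousOn lP.continuousOn 1 0 (by
      filter_upwards [eP, hmem] with t h1 h2
      exact Lp.ext ((qx_eq t h2).symm.trans h1))
    exact fun t ht => h t ht ▸ qx_eq t ht
  have px_eq : ∀ t ∈ Icc 0 T, (fun x => d.f t x - ut t x) =ᵐ[volume.restrict (Ioo a b)]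
      jetFn a b (k + 1) 1 (P t) :=
    fun t ht => ae_eq_jetFn_succ (by omega) (lP.broken t ht) (hsol.eq_u t ht) (p_eq t ht)
  have hd : ∀ t ∈ Icc 0 T, HasDerivWithinAt U (U' t) (Icc 0 T) t := fun t ht =>
    hasDerivWithinAt_of_norm_le fun x hx => dU t ht x hx
  have ut_eq : ∀ t ∈ Icc 0 T, ut t =ᵐ[volume.restrict (Ioo a b)] jetFn a b (k + 1) 0 (U' t) := by
    intro t ht
    have hne : ∀ᵐ s ∂(volume.restrict (Ioo 0 T)), s ≠ t := by
      refine ae_restrict_of_ae ?_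
      simp [ae_iff, measure_singleton]
    obtain ⟨s, hs, hst⟩ := exists_good_seq hT hne ht
    have h1 : Filter.Tendsto s Filter.atTop (nhdsWithin t (Icc 0 T \ {t})) :=
      tendsto_nhdsWithin_iff.2 ⟨hst, Filter.Eventually.of_forall fun n => ⟨(hs n).1, (hs n).2⟩⟩
    have h2 := (hasDerivWithinAt_iff_tendsto_slope.1 (hd t ht)).comp h1
    have h3 := ((jetFn a b (k + 1) 0).continuous.tendsto _).comp h2
    refine ae_eq_of_tendsto_Lp h3 (f := fun n x => slope (fun r => u r x) t (s n)) (fun n => ?_)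
      fun x hx => (hasDerivWithinAt_iff_tendsto_slope.1 (hsol.time_deriv t ht x hx)).comp h1
    simp only [Function.comp, slope_def_module, map_smul, map_sub]
    filter_upwards [u_eq t ht, u_eq (s n) (hs n).1,
      Lp.coeFn_smul (s n - t)⁻¹ (jetFn a b (k + 1) 0 (U (s n)) - jetFn a b (k + 1) 0 (U t)),
      Lp.coeFn_sub (jetFn a b (k + 1) 0 (U (s n))) (jetFn a b (k + 1) 0 (U t))] with x e1 e2 e3 e4
    rw [e3, Pi.smul_apply, e4, Pi.sub_apply, e1, e2]
  refine ⟨U, U', Q, P, lU, lU', lQ, lP, dU, u_eq, ux_eq, q_eq, qx_eq, p_eq, px_eq, ut_eq,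
    fun t ht => ?_⟩
  exact Lp.ext ((ae_eq_jetFn_succ (by omega) (lU.broken t ht) (hsol.eq_p t ht)
    (ux_eq t ht)).symm.trans (qx_eq t ht))

end

/-! ### The corrector equation -/

theorem exists_linear_ode (lam c₀ : ℝ) {f : ℝ → ℝ} (hf : Continuous f) :
    ∃ c : ℝ → ℝ, c 0 = c₀ ∧ ∀ t, HasDerivAt c (-lam * c t + f t) t := by
  have hg : Continuous fun x => Real.exp (lam * x) * f x := by fun_prop
  refine ⟨fun t => Real.exp (-lam * t) * (c₀ + ∫ x in (0)..t, Real.exp (lam * x) * f x), by simp,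
    fun t => ?_⟩
  have h1 : HasDerivAt (fun t => Real.exp (-lam * t)) (Real.exp (-lam * t) * (-lam)) t := by
    simpa using ((hasDerivAt_id t).const_mul (-lam)).exp
  have h2 : HasDerivAt (fun t => c₀ + ∫ x in (0)..t, Real.exp (lam * x) * f x)
      (Real.exp (lam * t) * f t) t :=
    (intervalIntegral.integral_hasDerivAt_right (hg.intervalIntegrable _ _)
      (hg.stronglyMeasurableAtFilter _ _) hg.continuousAt).const_add c₀
  have h3 := h1.mul h2
  have e : Real.exp (-lam * t) * (Real.exp (lam * t) * f t) = f t := by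
    rw [← mul_assoc, ← Real.exp_add]; simp
  refine h3.congr_deriv ?_
  rw [e]; ring

/-- Z - B multiplied by the integrating factor is nonincreasing. -/
theorem le_of_deriv_le {Z Z' : ℝ → ℝ} {S μ B : ℝ}
    (hZ : ∀ t ∈ Icc 0 S, HasDerivWithinAt Z (Z' t) (Icc 0 S) t)
    (h : ∀ t ∈ Icc 0 S, Z' t ≤ -μ * (Z t - B)) (h0 : Z 0 ≤ B) : ∀ t ∈ Icc 0 S, Z t ≤ B := by
  have hW : ∀ t ∈ Icc 0 S, HasDerivWithinAt (fun t => Real.exp (μ * t) * (Z t - B))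
      (Real.exp (μ * t) * μ * (Z t - B) + Real.exp (μ * t) * Z' t) (Icc 0 S) t := by
    intro t ht
    have h1 : HasDerivAt (fun t => Real.exp (μ * t)) (Real.exp (μ * t) * μ) t := by
      simpa using ((hasDerivAt_id t).const_mul μ).exp
    exact h1.hasDerivWithinAt.fun_mul ((hZ t ht).sub_const B)
  have hanti : AntitoneOn (fun t => Real.exp (μ * t) * (Z t - B)) (Icc 0 S) := by
    refine antitoneOn_of_hasDerivWithinAt_nonpos (convex_Icc 0 S)
      (fun t ht => (hW t ht).continuousWithinAt)
      (fun t ht => (hW t (interior_subset ht)).mono interior_subset) fun t ht => ?_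
    have h1 := h t (interior_subset ht)
    have h2 := Real.exp_pos (μ * t)
    have : Real.exp (μ * t) * μ * (Z t - B) + Real.exp (μ * t) * Z' t =
        Real.exp (μ * t) * (Z' t - -μ * (Z t - B)) := by ring
    rw [this]
    exact mul_nonpos_of_nonneg_of_nonpos h2.le (by linarith)
  intro t ht
  have h1 := hanti (left_mem_Icc.2 (ht.1.trans ht.2)) ht ht.1
  simp only [mul_zero, Real.exp_zero, one_mul] at h1
  have h2 := Real.exp_pos (μ * t)
  by_contra hlt
  have := mul_pos h2 (sub_pos.2 (not_le.1 hlt))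
  linarith

section

variable {N : ℕ} {η κ : Fin N → ℝ} {s θ h : ℝ}

/-- Damping and forcing are both proportional to 1/η, so z stays of the size of d uniformly in η and
in time. The lengths in the weighted sum provide the factor h. -/
theorem sum_mul_sq_le_of_ode {S Y B : ℝ} {z d : ℝ → Fin N → ℝ} (hs : s ≠ 0) (hθ : 0 < θ)
    (hη : ∀ i, 0 < η i) (hηh : ∀ i, η i ≤ h) (hκ : ∀ i, 1 / 2 ≤ κ i) (hh : 0 < h)
    (hz : ∀ t ∈ Icc 0 S, ∀ i, HasDerivWithinAt (fun t => z t i)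
      (-(s ^ 2 * κ i / (θ * η i)) * z t i - s / (θ * η i) * d t i) (Icc 0 S) t)
    (hd : ∀ t ∈ Icc 0 S, ∑ i, d t i ^ 2 ≤ Y) (h0 : ∑ i, η i * z 0 i ^ 2 ≤ B)
    (hB : 4 * h / s ^ 2 * Y ≤ B) : ∀ t ∈ Icc 0 S, ∑ i, η i * z t i ^ 2 ≤ B := by
  have hs2 : 0 < s ^ 2 := by positivity
  refine le_of_deriv_le (μ := s ^ 2 / (2 * θ * h)) (Z := fun t => ∑ i, η i * z t i ^ 2)
    (Z' := fun t => ∑ i, η i * (2 * z t i *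
      (-(s ^ 2 * κ i / (θ * η i)) * z t i - s / (θ * η i) * d t i))) ?_ ?_ h0
  · intro t ht
    refine HasDerivWithinAt.fun_sum fun i _ => ?_
    have := ((hz t ht i).fun_pow 2).const_mul (η i)
    simpa using this
  · intro t ht
    have hterm : ∀ i, η i * (2 * z t i *
        (-(s ^ 2 * κ i / (θ * η i)) * z t i - s / (θ * η i) * d t i)) ≤
        -(s ^ 2 / (2 * θ * h)) * (η i * z t i ^ 2) + 2 / θ * d t i ^ 2 := by
      intro i
      have hi := hη i
      have e : η i * (2 * z t i *
          (-(s ^ 2 * κ i / (θ * η i)) * z t i - s / (θ * η i) * d t i)) =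
          1 / θ * (-2 * κ i * (s * z t i) ^ 2 - 2 * (s * z t i) * d t i) := by
        field_simp
      have e1 : -2 * κ i * (s * z t i) ^ 2 - 2 * (s * z t i) * d t i ≤
          -(1 / 2) * (s * z t i) ^ 2 + 2 * d t i ^ 2 := by
        nlinarith [hκ i, sq_nonneg (s * z t i), sq_nonneg (s * z t i + 2 * d t i),
          mul_nonneg (sub_nonneg.2 (hκ i)) (sq_nonneg (s * z t i))]
      have e2 : s ^ 2 / (2 * θ * h) * (η i * z t i ^ 2) ≤ 1 / θ * (1 / 2 * (s * z t i) ^ 2) := by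
        have : s ^ 2 / (2 * θ * h) * (η i * z t i ^ 2) =
            1 / θ * (1 / 2 * (s * z t i) ^ 2) * (η i / h) := by field_simp
        rw [this]
        exact mul_le_of_le_one_right (by positivity) ((div_le_one hh).2 (hηh i))
      have e3 := mul_le_mul_of_nonneg_left e1 (by positivity : 0 ≤ 1 / θ)
      rw [e]
      calc _ ≤ _ := e3
        _ = -(1 / θ * (1 / 2 * (s * z t i) ^ 2)) + 2 / θ * d t i ^ 2 := by ring
        _ ≤ _ := by linarith
    refine (Finset.sum_le_sum fun i _ => hterm i).trans ?_
    rw [Finset.sum_add_distrib, ← Finset.mul_sum, ← Finset.mul_sum]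
    have e4 := mul_le_mul_of_nonneg_left (hd t ht) (by positivity : 0 ≤ 2 / θ)
    have e5 := mul_le_mul_of_nonneg_left hB (by positivity : 0 ≤ s ^ 2 / (2 * θ * h))
    have e6 : s ^ 2 / (2 * θ * h) * (4 * h / s ^ 2 * Y) = 2 / θ * Y := by field_simp; ring
    rw [e6] at e5
    linarith

/-- Mean value inequality for a weighted Euclidean norm: apply the scalar mean value theorem to the
product with the increment itself. -/
theorem sum_mul_sq_le_of_hasDeriv {w : Fin N → ℝ} (hw : ∀ i, 0 ≤ w i) {S B : ℝ} (hS : 0 ≤ S)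
    {g g' : ℝ → Fin N → ℝ}
    (hg : ∀ t ∈ Icc 0 S, ∀ i, HasDerivWithinAt (fun t => g t i) (g' t i) (Icc 0 S) t)
    (hb : ∀ t ∈ Icc 0 S, ∑ i, w i * g' t i ^ 2 ≤ B) :
    ∑ i, w i * (g S i - g 0 i) ^ 2 ≤ S ^ 2 * B := by
  rcases hS.eq_or_lt with rfl | hS
  · simp
  set v : Fin N → ℝ := fun i => g S i - g 0 i with hv
  have hF : ∀ t ∈ Icc 0 S, HasDerivWithinAt (fun t => ∑ i, w i * v i * g t i)
      (∑ i, w i * v i * g' t i) (Icc 0 S) t := fun t ht =>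
    HasDerivWithinAt.fun_sum fun i _ => (hg t ht i).const_mul _
  obtain ⟨ξ, hξ, he⟩ := exists_hasDerivAt_eq_slope (fun t => ∑ i, w i * v i * g t i)
    (fun t => ∑ i, w i * v i * g' t i) hS (fun t ht => (hF t ht).continuousWithinAt)
    fun t ht => (hF t (Ioo_subset_Icc_self ht)).hasDerivAt (Icc_mem_nhds ht.1 ht.2)
  have e1 : ∑ i, w i * v i ^ 2 = S * ∑ i, w i * v i * g' ξ i := by
    rw [he, sub_zero, mul_div_cancel₀ _ hS.ne', ← Finset.sum_sub_distrib]
    refine Finset.sum_congr rfl fun i _ => ?_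
    simp only [hv]; ring
  have e2 : S * ∑ i, w i * v i * g' ξ i ≤
      1 / 2 * (∑ i, w i * v i ^ 2) + 1 / 2 * (S ^ 2 * ∑ i, w i * g' ξ i ^ 2) := by
    rw [Finset.mul_sum, Finset.mul_sum, Finset.mul_sum, Finset.mul_sum, ← Finset.sum_add_distrib]
    refine Finset.sum_le_sum fun i _ => ?_
    nlinarith [mul_nonneg (hw i) (sq_nonneg (v i - S * g' ξ i))]
  have e3 := mul_le_mul_of_nonneg_left (hb ξ (Ioo_subset_Icc_self hξ)) (sq_nonneg S)
  linarith

theorem sum_mul_sq_deriv_le {w : Fin N → ℝ} {T B : ℝ} (hT : 0 < T) {c c' : ℝ → Fin N → ℝ}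
    (hc : ∀ t ∈ Icc 0 T, ∀ i, HasDerivWithinAt (fun t => c t i) (c' t i) (Icc 0 T) t)
    (hb : ∀ t ∈ Icc 0 T, ∀ s ∈ Icc 0 T, ∑ i, w i * (c t i - c s i) ^ 2 ≤ (t - s) ^ 2 * B) :
    ∀ t ∈ Icc 0 T, ∑ i, w i * c' t i ^ 2 ≤ B := by
  intro t ht
  have hne : (nhdsWithin t (Icc 0 T \ {t})).NeBot := by
    have h1 : AccPt t (Filter.principal (Icc 0 T)) := by
      have := (convex_Icc (0 : ℝ) T).nontrivial_iff_nonempty_interior.2 (by simp [hT])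
      exact uniqueDiffWithinAt_iff_accPt.1 ((uniqueDiffOn_Icc hT) t ht)
    rwa [accPt_principal_iff_nhdsWithin] at h1
  have hlim : Filter.Tendsto (fun s => ∑ i, w i * slope (fun r => c r i) t s ^ 2)
      (nhdsWithin t (Icc 0 T \ {t})) (nhds (∑ i, w i * c' t i ^ 2)) :=
    tendsto_finsetSum _ fun i _ =>
      ((hasDerivWithinAt_iff_tendsto_slope.1 (hc t ht i)).pow 2).const_mul _
  refine le_of_tendsto hlim ?_
  filter_upwards [self_mem_nhdsWithin] with s hs
  have hst : s - t ≠ 0 := sub_ne_zero.2 hs.2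
  have h1 := hb s hs.1 t ht
  have e : ∑ i, w i * slope (fun r => c r i) t s ^ 2 =
      ((s - t) ^ 2)⁻¹ * ∑ i, w i * (c s i - c t i) ^ 2 := by
    rw [Finset.mul_sum]
    refine Finset.sum_congr rfl fun i _ => ?_
    rw [slope_def_field, div_pow]
    field_simp
  rw [e, inv_mul_le_iff₀ (by positivity)]
  exact h1

/-- Solutions `c` of the equations `θ η c' + s² κ c = -s d` with `c' = 0` at time zero, together
with bounds on `c`, on its increments and on its derivative. -/
structure IsCorrector (η κ : Fin N → ℝ) (s θ T B : ℝ) (d c c' : ℝ → Fin N → ℝ) : Prop where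
  deriv : ∀ t ∈ Icc 0 T, ∀ i, HasDerivWithinAt (fun t => c t i) (c' t i) (Icc 0 T) t
  ode : ∀ t ∈ Icc 0 T, ∀ i, θ * η i * c' t i = -s ^ 2 * κ i * c t i - s * d t i
  deriv_zero : ∀ i, c' 0 i = 0
  le : ∀ t ∈ Icc 0 T, ∑ i, η i * c t i ^ 2 ≤ B
  inc_le : ∀ t ∈ Icc 0 T, ∀ s ∈ Icc 0 T, ∑ i, η i * (c t i - c s i) ^ 2 ≤ (t - s) ^ 2 * B
  deriv_le : ∀ t ∈ Icc 0 T, ∑ i, η i * c' t i ^ 2 ≤ B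
  inc2_le : ∀ σ > 0, ∀ t ∈ Icc 0 (T - 2 * σ),
    ∑ i, η i ^ 3 * (c (t + 2 * σ) i - 2 * c (t + σ) i + c t i) ^ 2 ≤ σ ^ 4 * B

/-- Increments of c solve the same equation with increments of d, so both obey the bound of
`sum_mul_sq_le_of_ode`. Second differences of c are first differences of c', which by the equation
cost a factor 1/η against first differences of c and d; the weight η³ pays for it. -/
theorem exists_isCorrector (hs : s ≠ 0) (hθ : 0 < θ) (κ₁ : ℝ) :
    ∃ C : ℝ, 0 < C ∧ ∀ (N : ℕ) (η κ : Fin N → ℝ) (h T Y : ℝ) (d : ℝ → Fin N → ℝ), 0 < T →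
      0 < h → (∀ i, 0 < η i) → (∀ i, η i ≤ h) → (∀ i, 1 / 2 ≤ κ i) → (∀ i, κ i ≤ κ₁) →
      (∀ t ∈ Icc 0 T, ∑ i, d t i ^ 2 ≤ Y) →
      (∀ t ∈ Icc 0 T, ∀ s ∈ Icc 0 T, ∑ i, (d t i - d s i) ^ 2 ≤ (t - s) ^ 2 * Y) →
      ∃ c c', IsCorrector η κ s θ T (C * h * Y) d c c' := by
  have hs2 : 0 < s ^ 2 := by positivity
  set C₀ : ℝ := 4 / s ^ 2 with hC₀
  set C₁ : ℝ := 2 * (s ^ 2 * κ₁ / θ) ^ 2 * C₀ + 2 * (s / θ) ^ 2 with hC₁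
  refine ⟨C₀ + C₁, by positivity, fun N η κ h T Y d hT hh hη hηh hκ hκ₁ hd hdi => ?_⟩
  have hY : 0 ≤ Y := (Finset.sum_nonneg fun i _ => sq_nonneg _).trans
    (hd 0 (left_mem_Icc.2 hT.le))
  have hdc : ∀ i, ContinuousOn (fun t => d t i) (Icc 0 T) := by
    intro i
    refine continuousOn_of_lip (K := √Y) fun s hs t ht => ?_
    have h1 := (Finset.single_le_sum (f := fun i => (d t i - d s i) ^ 2)
      (fun i _ => sq_nonneg _) (Finset.mem_univ i)).trans (hdi t ht s hs)
    rw [Real.norm_eq_abs]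
    refine abs_le_of_sq_le_sq (h1.trans_eq ?_) (by positivity)
    rw [mul_pow, Real.sq_sqrt hY, sq_abs]; ring
  -- Constant extension of d beyond the time interval, to solve the equation on the whole line.
  set de : ℝ → Fin N → ℝ := fun t i => d (projIcc 0 T hT.le t) i with hde
  have hdec : ∀ i, Continuous fun t => de t i := fun i => by
    have := (hdc i).domRestrict.comp (continuous_projIcc (h := hT.le))
    exact this
  have hdee : ∀ t ∈ Icc 0 T, de t = d t := fun t ht => by
    simp only [hde, projIcc_of_mem hT.le ht]
  -- The initial value is the equilibrium of the equation. Otherwise c' would start with size 1/η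
  -- and the Lipschitz bound for c would fail near time zero.
  choose cc hc0 hc1 using fun i => exists_linear_ode (s ^ 2 * κ i / (θ * η i))
    (-d 0 i / (s * κ i)) (f := fun t => -(s / (θ * η i)) * de t i)
    (continuous_const.mul (hdec i))
  set c : ℝ → Fin N → ℝ := fun t i => cc i t with hc
  set c' : ℝ → Fin N → ℝ := fun t i =>
    -(s ^ 2 * κ i / (θ * η i)) * c t i - s / (θ * η i) * d t i with hc'
  have hκ0 : ∀ i, 0 < κ i := fun i => lt_of_lt_of_le (by norm_num) (hκ i)
  have hderiv : ∀ t ∈ Icc 0 T, ∀ i, HasDerivAt (fun t => c t i) (c' t i) t := fun t ht i => by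
    refine (hc1 i t).congr_deriv ?_
    simp only [hc', hc, hdee t ht]; ring
  have hlam : ∀ i, s ^ 2 * κ i / (θ * η i) * c 0 i = -(s / (θ * η i)) * d 0 i := fun i => by
    simp only [hc, hc0]
    have := hκ0 i; have := hη i
    field_simp
  have hode : ∀ t i, θ * η i * c' t i = -s ^ 2 * κ i * c t i - s * d t i := fun t i => by
    have := hη i
    simp only [hc']; field_simp
  have hCh : C₀ * h * Y = 4 * h / s ^ 2 * Y := by rw [hC₀]; ring
  have hle : ∀ t ∈ Icc 0 T, ∑ i, η i * c t i ^ 2 ≤ C₀ * h * Y := by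
    refine sum_mul_sq_le_of_ode (d := d) hs hθ hη hηh hκ hh
      (fun t ht i => (hderiv t ht i).hasDerivWithinAt) hd ?_ hCh.ge
    have e : ∀ i, η i * c 0 i ^ 2 ≤ C₀ * h * d 0 i ^ 2 := fun i => by
      simp only [hc, hc0]
      have h1 := hκ i
      have h2 : (-d 0 i / (s * κ i)) ^ 2 ≤ C₀ * d 0 i ^ 2 := by
        rw [hC₀, div_pow, neg_sq, mul_pow, div_mul_eq_mul_div]
        rw [div_le_div_iff₀ (by have := hκ0 i; positivity) hs2]
        have h3 : 1 / 4 ≤ κ i ^ 2 := by nlinarith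
        have h4 : 0 ≤ d 0 i ^ 2 * s ^ 2 := by positivity
        nlinarith
      calc η i * (-d 0 i / (s * κ i)) ^ 2 ≤ h * (C₀ * d 0 i ^ 2) :=
            mul_le_mul (hηh i) h2 (sq_nonneg _) hh.le
        _ = _ := by ring
    refine (Finset.sum_le_sum fun i _ => e i).trans ?_
    rw [← Finset.mul_sum]
    exact mul_le_mul_of_nonneg_left (hd 0 (left_mem_Icc.2 hT.le)) (by positivity)
  -- Increments from time zero come first: they solve the equation with zero initial value, and they
  -- are the initial values for increments with a fixed step.
  have hinc0 : ∀ S ∈ Icc 0 T, ∑ i, η i * (c S i - c 0 i) ^ 2 ≤ S ^ 2 * (C₀ * h * Y) := by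
    intro S hS
    have hsub : ∀ t ∈ Icc 0 S, t ∈ Icc 0 T := fun t ht => ⟨ht.1, ht.2.trans hS.2⟩
    refine sum_mul_sq_le_of_ode (z := fun t i => c t i - c 0 i) (d := fun t i => d t i - d 0 i)
      (Y := S ^ 2 * Y) hs hθ hη hηh hκ hh (fun t ht i => ?_) (fun t ht => ?_) ?_ ?_ S
      (right_mem_Icc.2 hS.1)
    · refine ((hderiv t (hsub t ht) i).sub_const _).hasDerivWithinAt.congr_deriv ?_
      simp only [hc']
      linear_combination (-1) * hlam i
    · refine (hdi t (hsub t ht) 0 (left_mem_Icc.2 hT.le)).trans ?_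
      rw [sub_zero]
      have := ht.2
      exact mul_le_mul_of_nonneg_right (pow_le_pow_left₀ ht.1 ht.2 2) hY
    · simp only [sub_self]
      simp only [ne_eq, OfNat.ofNat_ne_zero, not_false_eq_true, zero_pow, mul_zero,
        Finset.sum_const_zero]
      positivity
    · rw [hCh]; exact le_of_eq (by ring)
  have hshift : ∀ σ, 0 ≤ σ → ∀ t ∈ Icc 0 (T - σ), ∀ i,
      HasDerivWithinAt (fun t => c (t + σ) i - c t i) (c' (t + σ) i - c' t i)
        (Icc 0 (T - σ)) t := by
    intro σ hσ t ht i
    have h1 := (hderiv (t + σ) ⟨by linarith [ht.1], by linarith [ht.2]⟩ i).comp_add_const t σ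
    exact (h1.sub (hderiv t ⟨ht.1, by linarith [ht.2]⟩ i)).hasDerivWithinAt
  have hinc1 : ∀ σ ∈ Icc 0 T, ∀ t ∈ Icc 0 (T - σ),
      ∑ i, η i * (c (t + σ) i - c t i) ^ 2 ≤ σ ^ 2 * (C₀ * h * Y) := by
    intro σ hσ
    refine sum_mul_sq_le_of_ode (z := fun t i => c (t + σ) i - c t i)
      (d := fun t i => d (t + σ) i - d t i)
      (Y := σ ^ 2 * Y) hs hθ hη hηh hκ hh (fun t ht i => ?_) (fun t ht => ?_) ?_ ?_
    · refine (hshift σ hσ.1 t ht i).congr_deriv ?_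
      simp only [hc']; ring
    · have := hdi (t + σ) ⟨by linarith [ht.1, hσ.1], by linarith [ht.2]⟩ t
        ⟨ht.1, by linarith [ht.2, hσ.1]⟩
      rwa [add_sub_cancel_left] at this
    · simpa using hinc0 σ hσ
    · rw [hCh]; exact le_of_eq (by ring)
  have hinc : ∀ t ∈ Icc 0 T, ∀ s ∈ Icc 0 T,
      ∑ i, η i * (c t i - c s i) ^ 2 ≤ (t - s) ^ 2 * (C₀ * h * Y) := by
    have key : ∀ t ∈ Icc 0 T, ∀ s ∈ Icc 0 T, s ≤ t →
        ∑ i, η i * (c t i - c s i) ^ 2 ≤ (t - s) ^ 2 * (C₀ * h * Y) := by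
      intro t ht s hs hst
      have := hinc1 (t - s) ⟨by linarith, by linarith [ht.2, hs.1]⟩ s ⟨hs.1, by linarith [ht.2]⟩
      simpa using this
    intro t ht s hs
    rcases le_total s t with h1 | h1
    · exact key t ht s hs h1
    · have := key s hs t ht h1
      have e : ∀ i, (c t i - c s i) ^ 2 = (c s i - c t i) ^ 2 := fun i => by ring
      simp only [e]
      rwa [← neg_sub, neg_sq]
  have hCC : C₀ * h * Y ≤ (C₀ + C₁) * h * Y := by
    have : 0 ≤ C₁ * h * Y := by positivity
    linarith [add_mul C₀ C₁ h, add_mul (C₀ * h) (C₁ * h) Y, (by ring :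
      (C₀ + C₁) * h * Y = C₀ * h * Y + C₁ * h * Y)]
  have hderiv' : ∀ t ∈ Icc 0 T, ∀ i, HasDerivWithinAt (fun t => c t i) (c' t i) (Icc 0 T) t :=
    fun t ht i => (hderiv t ht i).hasDerivWithinAt
  refine ⟨c, c', hderiv', fun t _ => hode t, fun i => ?_, fun t ht => (hle t ht).trans hCC,
    fun t ht s hs => (hinc t ht s hs).trans (mul_le_mul_of_nonneg_left hCC (sq_nonneg _)),
    fun t ht => (sum_mul_sq_deriv_le hT hderiv' hinc t ht).trans hCC, ?_⟩
  · simp only [hc']; linear_combination (-1) * hlam i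
  · intro σ hσ t ht
    have h2 := sum_mul_sq_le_of_hasDeriv (w := fun i => η i ^ 3) (S := σ)
      (B := σ ^ 2 * (C₁ * h * Y)) (fun i => by have := hη i; positivity) hσ.le
      (g := fun r i => c (t + r + σ) i - c (t + r) i)
      (g' := fun r i => c' (t + r + σ) i - c' (t + r) i) (fun r hr i => ?_) fun r hr => ?_
    · have e : ∀ i, c (t + 2 * σ) i - 2 * c (t + σ) i + c t i =
          c (t + σ + σ) i - c (t + σ) i - (c (t + 0 + σ) i - c (t + 0) i) := fun i => by
        rw [add_zero, add_assoc, ← two_mul]; ring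
      simp only [e]
      refine h2.trans ?_
      have : 0 ≤ σ ^ 4 * (C₀ * h * Y) := by positivity
      nlinarith
    · have h1 := (hderiv (t + r + σ) ⟨by linarith [ht.1, hr.1], by linarith [ht.2, hr.2]⟩ i)
      have h3 := (hderiv (t + r) ⟨by linarith [ht.1, hr.1], by linarith [ht.2, hr.2]⟩ i)
      have h4 := (h1.comp_add_const (t + r) σ).sub h3
      exact (h4.comp_const_add t r).hasDerivWithinAt
    · have m1 : t + r + σ ∈ Icc 0 T := ⟨by linarith [ht.1, hr.1], by linarith [ht.2, hr.2]⟩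
      have m2 : t + r ∈ Icc 0 T := ⟨by linarith [ht.1, hr.1], by linarith [ht.2, hr.2]⟩
      have i1 := hinc (t + r + σ) m1 (t + r) m2
      have i2 := hdi (t + r + σ) m1 (t + r) m2
      rw [add_sub_cancel_left] at i1 i2
      have e : ∀ i, η i ^ 3 * (c' (t + r + σ) i - c' (t + r) i) ^ 2 ≤
          2 * (s ^ 2 * κ₁ / θ) ^ 2 * (η i * (c (t + r + σ) i - c (t + r) i) ^ 2) +
          2 * (s / θ) ^ 2 * h * (d (t + r + σ) i - d (t + r) i) ^ 2 := by
        intro i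
        generalize hA : c (t + r + σ) i - c (t + r) i = A
        generalize hD : d (t + r + σ) i - d (t + r) i = D
        have hi := hη i
        have e1 : c' (t + r + σ) i - c' (t + r) i =
            -(s ^ 2 * κ i / (θ * η i)) * A - s / (θ * η i) * D := by
          rw [← hA, ← hD]; simp only [hc']; ring
        have e2 : η i ^ 3 * (-(s ^ 2 * κ i / (θ * η i)) * A - s / (θ * η i) * D) ^ 2 =
            η i * (s ^ 2 * κ i / θ * A + s / θ * D) ^ 2 := by
          field_simp; ring
        have e3 : (s ^ 2 * κ i / θ * A) ^ 2 ≤ (s ^ 2 * κ₁ / θ) ^ 2 * A ^ 2 := by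
          rw [mul_pow]
          have h1 := hκ₁ i
          have h2 := (hκ0 i).le
          gcongr
        have e4 : η i * (s / θ * D) ^ 2 ≤ h * ((s / θ) ^ 2 * D ^ 2) := by
          rw [mul_pow]
          exact mul_le_mul_of_nonneg_right (hηh i) (by positivity)
        rw [e1, e2]
        have e5 : (s ^ 2 * κ i / θ * A + s / θ * D) ^ 2 ≤
            2 * (s ^ 2 * κ i / θ * A) ^ 2 + 2 * (s / θ * D) ^ 2 := by
          nlinarith [sq_nonneg (s ^ 2 * κ i / θ * A - s / θ * D)]
        calc _ ≤ η i * (2 * (s ^ 2 * κ i / θ * A) ^ 2 + 2 * (s / θ * D) ^ 2) := by gcongr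
          _ = 2 * (η i * (s ^ 2 * κ i / θ * A) ^ 2) + 2 * (η i * (s / θ * D) ^ 2) := by ring
          _ ≤ 2 * (η i * ((s ^ 2 * κ₁ / θ) ^ 2 * A ^ 2)) + 2 * (h * ((s / θ) ^ 2 * D ^ 2)) := by
            gcongr
          _ = _ := by ring
      refine (Finset.sum_le_sum fun i _ => e i).trans ?_
      rw [Finset.sum_add_distrib, ← Finset.mul_sum, ← Finset.mul_sum]
      have j1 := mul_le_mul_of_nonneg_left i1 (by positivity : 0 ≤ 2 * (s ^ 2 * κ₁ / θ) ^ 2)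
      have j2 := mul_le_mul_of_nonneg_left i2 (by positivity : 0 ≤ 2 * (s / θ) ^ 2 * h)
      refine (add_le_add j1 j2).trans (le_of_eq ?_)
      rw [hC₁]; ring

end

/-! ### Projection errors of jets -/

section

variable {a b l r : ℝ} {k : ℕ}

/-- The projection error of a jet at the left end of `(l, r)`. -/
def jumpL (k : ℕ) (l r : ℝ) (g : Jet a b (k + 1)) : ℝ :=
  rhoL k l r (jetFn a b (k + 1) 0 g) (jetFn a b (k + 1) 1 g)

/-- The projection error of a jet at the right end of `(l, r)`. -/
def jumpR (k : ℕ) (l r : ℝ) (g : Jet a b (k + 1)) : ℝ :=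
  rhoR k l r (jetFn a b (k + 1) 0 g) (jetFn a b (k + 1) 1 g)

theorem jumpL_sub (h : Ioo l r ⊆ Ioo a b) (g g' : Jet a b (k + 1)) :
    jumpL k l r (g - g') = jumpL k l r g - jumpL k l r g' := by
  obtain ⟨L, hL⟩ := exists_clm_rhoL (s := k + 1) h k 0 1
  rw [jumpL, jumpL, jumpL, ← hL, ← hL, ← hL, map_sub]

theorem jumpR_sub (h : Ioo l r ⊆ Ioo a b) (g g' : Jet a b (k + 1)) :
    jumpR k l r (g - g') = jumpR k l r g - jumpR k l r g' := by
  obtain ⟨L, hL⟩ := exists_clm_rhoR (s := k + 1) h k 0 1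
  rw [jumpR, jumpR, jumpR, ← hL, ← hL, ← hL, map_sub]

theorem hasDerivWithinAt_jumpL (h : Ioo l r ⊆ Ioo a b) {J : ℝ → Jet a b (k + 1)}
    {d : Jet a b (k + 1)} {A : Set ℝ} {t : ℝ} (hJ : HasDerivWithinAt J d A t) :
    HasDerivWithinAt (fun s => jumpL k l r (J s)) (jumpL k l r d) A t := by
  obtain ⟨L, hL⟩ := exists_clm_rhoL (s := k + 1) h k 0 1
  simp only [jumpL, ← hL]
  exact L.hasFDerivAt.comp_hasDerivWithinAt t hJ

theorem hasDerivWithinAt_coeff_proj (h : Ioo l r ⊆ Ioo a b) (m : ℕ) {J : ℝ → Jet a b (k + 1)}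
    {d : Jet a b (k + 1)} {A : Set ℝ} {t : ℝ} (hJ : HasDerivWithinAt J d A t) :
    HasDerivWithinAt (fun s => (proj k l r (jetFn a b (k + 1) 0 (J s))).coeff m)
      ((proj k l r (jetFn a b (k + 1) 0 d)).coeff m) A t := by
  obtain ⟨L, hL⟩ := exists_clm_coeff_proj (s := k + 1) h k m 0
  simp only [← hL]
  exact L.hasFDerivAt.comp_hasDerivWithinAt t hJ

theorem integral_sq_eq_norm_sq (f : L2 a b) : ∫ x in Ioo a b, f x ^ 2 = ‖f‖ ^ 2 := by
  rw [← real_inner_self_eq_norm_sq, L2.inner_def]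
  refine integral_congr_ae (Filter.Eventually.of_forall fun x => ?_)
  simp [pow_two]

theorem Mesh.sum_setIntegral_le {N : ℕ} (𝒯 : Mesh a b N) {f : ℝ → ℝ} (hf : ∀ x, 0 ≤ f x)
    (hi : IntegrableOn f (Ioo a b)) :
    ∑ i, ∫ x in Ioo (𝒯.left i) (𝒯.right i), f x ≤ ∫ x in Ioo a b, f x := by
  have hdisj : Pairwise (Function.onFun Disjoint fun i => Ioo (𝒯.left i) (𝒯.right i)) := by
    have key : ∀ i j : Fin N, i < j →
        Disjoint (Ioo (𝒯.left i) (𝒯.right i)) (Ioo (𝒯.left j) (𝒯.right j)) := by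
      intro i j hij
      have h1 : 𝒯.right i ≤ 𝒯.left j :=
        𝒯.strictMono.monotone (Fin.succ_le_castSucc_iff.2 hij)
      refine Set.disjoint_left.2 fun x hx hx' => ?_
      linarith [hx.2, hx'.1]
    intro i j hij
    rcases lt_or_gt_of_ne hij with h | h
    · exact key i j h
    · exact (key j i h).symm
  rw [← integral_iUnion_fintype (fun i => measurableSet_Ioo) hdisj
    fun i => hi.mono_set (Mesh.elem_subset i)]
  exact setIntegral_mono_set hi (Filter.Eventually.of_forall hf)
    (iUnion_subset fun i => Mesh.elem_subset i).eventuallyLE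

theorem Mesh.sum_setIntegral_sq_jetFn_le {N : ℕ} (𝒯 : Mesh a b N) {s : ℕ} (j : ℕ)
    (g : Jet a b s) :
    ∑ i, ∫ x in Ioo (𝒯.left i) (𝒯.right i), jetFn a b s j g x ^ 2 ≤ ‖g‖ ^ 2 := by
  refine (𝒯.sum_setIntegral_le (fun x => sq_nonneg _) (L2.integrableOn_sq _ subset_rfl)).trans ?_
  rw [integral_sq_eq_norm_sq]
  exact pow_le_pow_left₀ (norm_nonneg _) (norm_jetFn_le j g) 2

theorem sum_le_of_forall_le {N : ℕ} (𝒯 : Mesh a b N) {s j : ℕ} (g : Jet a b s) {A : ℝ}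
    (hA : 0 ≤ A) {x : Fin N → ℝ}
    (h : ∀ i, x i ≤ A * ∫ y in Ioo (𝒯.left i) (𝒯.right i), jetFn a b s j g y ^ 2) :
    ∑ i, x i ≤ A * ‖g‖ ^ 2 := by
  refine (Finset.sum_le_sum fun i _ => h i).trans ?_
  rw [← Finset.mul_sum]
  exact mul_le_mul_of_nonneg_left (𝒯.sum_setIntegral_sq_jetFn_le j g) hA

/-- The last bound concerns the first derivative of the jet, approximated by degree k although it
has only k weak derivatives. One power of the length is lost in the norm, two in the square, and the
weight with exponent 3 instead of 1 restores them. -/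
theorem exists_sum_jump_le (k : ℕ) (hk : 0 < k) (a b : ℝ) : ∃ C : ℝ, 0 < C ∧
    ∀ (N : ℕ) (𝒯 : Mesh a b N) (g : Jet a b (k + 1)), IsBrokenSobolev 𝒯 g →
      ∑ i, jumpL k (𝒯.left i) (𝒯.right i) g ^ 2 ≤ C * 𝒯.size ^ (2 * k + 1) * ‖g‖ ^ 2 ∧
      ∑ i, jumpR k (𝒯.left i) (𝒯.right i) g ^ 2 ≤ C * 𝒯.size ^ (2 * k + 1) * ‖g‖ ^ 2 ∧
      (∑ i, ∫ x in Ioo (𝒯.left i) (𝒯.right i), (jetFn a b (k + 1) 0 g x -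
        (proj k (𝒯.left i) (𝒯.right i) (jetFn a b (k + 1) 0 g)).eval x) ^ 2) ≤
          C * 𝒯.size ^ (2 * k + 2) * ‖g‖ ^ 2 ∧
      ∑ i, (𝒯.right i - 𝒯.left i) ^ 3 * rhoL k (𝒯.left i) (𝒯.right i) (jetFn a b (k + 1) 1 g)
        (jetFn a b (k + 1) 2 g) ^ 2 ≤ C * 𝒯.size ^ (2 * k + 2) * ‖g‖ ^ 2 := by
  obtain ⟨C, hC, h⟩ := exists_proj_error_le k
  refine ⟨C, hC, fun N 𝒯 g hg => ?_⟩
  have hsz := 𝒯.size_nonneg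
  have hg' := isBrokenSobolev_iff.1 hg
  have h0 := fun i => h _ _ (𝒯.left_lt_right i) k le_rfl (fun j => jetFn a b (k + 1) j g)
    (fun j _ => L2.integrableOn _ (Mesh.elem_subset i)) (L2.integrableOn_sq _ (Mesh.elem_subset i))
    (L2.integrableOn_sq _ (Mesh.elem_subset i)) (fun j hj => hg' i j hj)
  have h1 := fun i => h _ _ (𝒯.left_lt_right i) (k - 1) (by omega)
    (fun j => jetFn a b (k + 1) (j + 1) g)
    (fun j _ => L2.integrableOn _ (Mesh.elem_subset i)) (L2.integrableOn_sq _ (Mesh.elem_subset i))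
    (L2.integrableOn_sq _ (Mesh.elem_subset i)) (fun j hj => hg' i (j + 1) (by omega))
  have hG : ∀ i j, 0 ≤ ∫ y in Ioo (𝒯.left i) (𝒯.right i), jetFn a b (k + 1) j g y ^ 2 :=
    fun i j => integral_nonneg fun x => sq_nonneg _
  have hpow : ∀ i n, C * (𝒯.right i - 𝒯.left i) ^ n ≤ C * 𝒯.size ^ n := fun i n =>
    mul_le_mul_of_nonneg_left (pow_le_pow_left₀ (𝒯.len_pos i).le (𝒯.len_le_size i) n) hC.le
  refine ⟨?_, ?_, ?_, ?_⟩
  · exact sum_le_of_forall_le 𝒯 g (by positivity) fun i =>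
      (h0 i).1.trans (mul_le_mul_of_nonneg_right (hpow i _) (hG i _))
  · exact sum_le_of_forall_le 𝒯 g (by positivity) fun i =>
      (h0 i).2.1.trans (mul_le_mul_of_nonneg_right (hpow i _) (hG i _))
  · exact sum_le_of_forall_le 𝒯 g (by positivity) fun i =>
      (h0 i).2.2.trans (mul_le_mul_of_nonneg_right (hpow i _) (hG i _))
  · refine sum_le_of_forall_le 𝒯 g (j := k - 1 + 1 + 1) (by positivity) fun i => ?_
    have hη := (𝒯.len_pos i).le
    refine (mul_le_mul_of_nonneg_left (h1 i).1 (by positivity)).trans ?_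
    refine le_trans (le_of_eq ?_) (mul_le_mul_of_nonneg_right (hpow i (2 * k + 2)) (hG i _))
    have e : (𝒯.right i - 𝒯.left i) ^ (2 * k + 2) =
        (𝒯.right i - 𝒯.left i) ^ 3 * (𝒯.right i - 𝒯.left i) ^ (2 * (k - 1) + 1) := by
      rw [← pow_add]; congr 1; omega
    rw [e]; ring

end

/-! ### Small families of functions of time -/

/-- Families whose values and increments are of size `Y` in the sum of the squares. -/
structure IsSmall {N : ℕ} (T Y : ℝ) (x : ℝ → Fin N → ℝ) : Prop where
  le : ∀ t ∈ Icc 0 T, ∑ i, x t i ^ 2 ≤ Y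
  inc_le : ∀ t ∈ Icc 0 T, ∀ s ∈ Icc 0 T, ∑ i, (x t i - x s i) ^ 2 ≤ (t - s) ^ 2 * Y

section

variable {N : ℕ} {T Y A B W : ℝ} {x y : ℝ → Fin N → ℝ}

theorem sum_add_mul_sq_le {x y w : Fin N → ℝ} (hw : ∀ i, |w i| ≤ W) (hx : ∑ i, x i ^ 2 ≤ A)
    (hy : ∑ i, y i ^ 2 ≤ B) : ∑ i, (x i + w i * y i) ^ 2 ≤ 2 * A + 2 * W ^ 2 * B := by
  have h : ∀ i, (x i + w i * y i) ^ 2 ≤ 2 * x i ^ 2 + 2 * W ^ 2 * y i ^ 2 := fun i => by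
    have h1 : w i ^ 2 ≤ W ^ 2 := by
      rw [← sq_abs (w i)]; exact pow_le_pow_left₀ (abs_nonneg _) (hw i) 2
    nlinarith [sq_nonneg (x i - w i * y i), mul_le_mul_of_nonneg_right h1 (sq_nonneg (y i))]
  refine (Finset.sum_le_sum fun i _ => h i).trans ?_
  rw [Finset.sum_add_distrib, ← Finset.mul_sum, ← Finset.mul_sum]
  have := mul_le_mul_of_nonneg_left hy (by positivity : 0 ≤ 2 * W ^ 2)
  linarith

theorem IsSmall.add_mul (hx : IsSmall T (A * Y) x) (hy : IsSmall T (B * Y) y) {w : Fin N → ℝ}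
    (hw : ∀ i, |w i| ≤ W) :
    IsSmall T ((2 * A + 2 * W ^ 2 * B) * Y) fun t i => x t i + w i * y t i := by
  refine ⟨fun t ht => ?_, fun t ht s hs => ?_⟩
  · refine (sum_add_mul_sq_le hw (hx.le t ht) (hy.le t ht)).trans (le_of_eq (by ring))
  · have e : ∀ i, x t i + w i * y t i - (x s i + w i * y s i) =
        (x t i - x s i) + w i * (y t i - y s i) := fun i => by ring
    simp only [e]
    refine (sum_add_mul_sq_le hw (hx.inc_le t ht s hs) (hy.inc_le t ht s hs)).trans
      (le_of_eq (by ring))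

theorem IsSmall.mono (hx : IsSmall T A x) (h : A ≤ B) : IsSmall T B x :=
  ⟨fun t ht => (hx.le t ht).trans h,
    fun t ht s hs => (hx.inc_le t ht s hs).trans (mul_le_mul_of_nonneg_left h (sq_nonneg _))⟩

theorem isSmall_zero : IsSmall T (0 * Y) (fun _ _ => 0 : ℝ → Fin N → ℝ) :=
  ⟨fun t _ => by simp, fun t _ s _ => by simp⟩

theorem IsSmall.mul (hx : IsSmall T (A * Y) x) {w : Fin N → ℝ} (hw : ∀ i, |w i| ≤ W) :
    IsSmall T (2 * W ^ 2 * A * Y) fun t i => w i * x t i := by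
  have h := isSmall_zero.add_mul hx hw
  simpa using h

end

section

variable {a b : ℝ} {N : ℕ} {𝒯 : Mesh a b N} {T K : ℝ} {k : ℕ}

theorem IsLipJet.isSmall {J : ℝ → Jet a b (k + 1)} (hJ : IsLipJet 𝒯 T (k + 1) K J)
    {F : Fin N → Jet a b (k + 1) → ℝ} (hF : ∀ i g g', F i (g - g') = F i g - F i g') {C : ℝ}
    (hC : 0 ≤ C) (h : ∀ g, IsBrokenSobolev 𝒯 g → ∑ i, F i g ^ 2 ≤ C * ‖g‖ ^ 2) :
    IsSmall T (C * K ^ 2) fun t i => F i (J t) := by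
  refine ⟨fun t ht => (h _ (hJ.broken t ht)).trans ?_, fun t ht s hs => ?_⟩
  · exact mul_le_mul_of_nonneg_left (pow_le_pow_left₀ (norm_nonneg _) (hJ.bound t ht) 2) hC
  · simp only [← hF]
    refine (h _ ((hJ.broken t ht).sub (hJ.broken s hs))).trans ?_
    have := pow_le_pow_left₀ (norm_nonneg _) (hJ.lip s hs t ht) 2
    rw [mul_pow, sq_abs] at this
    refine (mul_le_mul_of_nonneg_left this hC).trans (le_of_eq (by ring))

/-- The value of the corrected projection of `p` with the corrector removed. -/
def zetaP (k : ℕ) (l r τ : ℝ) (gU gQ gP : Jet a b (k + 1)) : ℝ :=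
  jumpR k l r gP - τ * (jumpR k l r gQ - jumpL k l r gQ / legS k) +
    τ ^ 2 * (jumpR k l r gU - jumpL k l r gU / legS k)

/-- The source of the corrector equation. -/
def corrSrc (k : ℕ) (l r τ : ℝ) (gU gQ gP : Jet a b (k + 1)) : ℝ :=
  jumpL k l r gP - legS k * zetaP k l r τ gU gQ gP

/-- The amplitudes are linear combinations of end point projection errors with bounded coefficients,
hence inherit size and Lipschitz bounds in time from the jets. -/
theorem exists_isSmall (k : ℕ) (hk : 0 < k) (a b M : ℝ) : ∃ C : ℝ, 0 < C ∧
    ∀ (N : ℕ) (𝒯 : Mesh a b N) (T K : ℝ) (τ : Fin N → ℝ) (U Q P : ℝ → Jet a b (k + 1)),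
      (∀ i, |τ i| ≤ M) →
      IsLipJet 𝒯 T (k + 1) K U → IsLipJet 𝒯 T (k + 1) K Q → IsLipJet 𝒯 T (k + 1) K P →
      IsSmall T (C * (𝒯.size ^ (2 * k + 1) * K ^ 2))
        (fun t i => jumpL k (𝒯.left i) (𝒯.right i) (U t) / legS k) ∧
      IsSmall T (C * (𝒯.size ^ (2 * k + 1) * K ^ 2))
        (fun t i => zetaP k (𝒯.left i) (𝒯.right i) (τ i) (U t) (Q t) (P t)) ∧
      IsSmall T (C * (𝒯.size ^ (2 * k + 1) * K ^ 2))
        (fun t i => corrSrc k (𝒯.left i) (𝒯.right i) (τ i) (U t) (Q t) (P t)) := by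
  obtain ⟨C, hC, h⟩ := exists_sum_jump_le k hk a b
  set s := legS k with hs
  set C₁ : ℝ := 2 * |1 / s| ^ 2 * C with hC₁
  set C₂ : ℝ := 2 * C + 2 * |-1| ^ 2 * C₁ with hC₂
  set C₃ : ℝ := 2 * (2 * C + 2 * M ^ 2 * C₂) + 2 * (M ^ 2) ^ 2 * C₂ with hC₃
  set C₄ : ℝ := 2 * C + 2 * |s| ^ 2 * C₃ with hC₄
  have hC₁0 : 0 ≤ C₁ := by positivity
  have hC₂0 : 0 ≤ C₂ := by positivity
  have hC₃0 : 0 ≤ C₃ := by positivity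
  have hC₄0 : 0 ≤ C₄ := by positivity
  refine ⟨C₁ + C₃ + C₄ + 1, by positivity, fun N 𝒯 T K τ U Q P hτ hU hQ hP => ?_⟩
  set Y := 𝒯.size ^ (2 * k + 1) * K ^ 2 with hY
  have hsz := 𝒯.size_nonneg
  have hY0 : 0 ≤ Y := by positivity
  have sL : ∀ J : ℝ → Jet a b (k + 1), IsLipJet 𝒯 T (k + 1) K J →
      IsSmall T (C * Y) fun t i => jumpL k (𝒯.left i) (𝒯.right i) (J t) := fun J hJ => by
    refine (hJ.isSmall (F := fun i => jumpL k (𝒯.left i) (𝒯.right i))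
      (fun i => jumpL_sub (Mesh.elem_subset i)) (by positivity)
      fun g hg => (h N 𝒯 g hg).1).mono (le_of_eq ?_)
    rw [hY]; ring
  have sR : ∀ J : ℝ → Jet a b (k + 1), IsLipJet 𝒯 T (k + 1) K J →
      IsSmall T (C * Y) fun t i => jumpR k (𝒯.left i) (𝒯.right i) (J t) := fun J hJ => by
    refine (hJ.isSmall (F := fun i => jumpR k (𝒯.left i) (𝒯.right i))
      (fun i => jumpR_sub (Mesh.elem_subset i)) (by positivity)
      fun g hg => (h N 𝒯 g hg).2.1).mono (le_of_eq ?_)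
    rw [hY]; ring
  have z1 : ∀ J : ℝ → Jet a b (k + 1), IsLipJet 𝒯 T (k + 1) K J →
      IsSmall T (C₁ * Y) fun t i => 1 / s * jumpL k (𝒯.left i) (𝒯.right i) (J t) := fun J hJ =>
    (sL J hJ).mul (w := fun _ => 1 / s) fun _ => le_rfl
  have z2 : ∀ J : ℝ → Jet a b (k + 1), IsLipJet 𝒯 T (k + 1) K J →
      IsSmall T (C₂ * Y) fun t i => jumpR k (𝒯.left i) (𝒯.right i) (J t) +
        -1 * (1 / s * jumpL k (𝒯.left i) (𝒯.right i) (J t)) := fun J hJ =>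
    (sR J hJ).add_mul (z1 J hJ) (w := fun _ => -1) fun _ => le_rfl
  have z3 : IsSmall T (C₃ * Y) fun t i =>
      zetaP k (𝒯.left i) (𝒯.right i) (τ i) (U t) (Q t) (P t) := by
    have := ((sR P hP).add_mul (z2 Q hQ) (w := fun i => -τ i) (W := M)
      (by simpa using hτ)).add_mul (z2 U hU) (w := fun i => τ i ^ 2) (W := M ^ 2)
      (fun i => by rw [abs_pow]; exact pow_le_pow_left₀ (abs_nonneg _) (hτ i) 2)
    convert this using 3 with t i
    simp only [zetaP, ← hs]; ring
  have z4 : IsSmall T (C₄ * Y) fun t i =>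
      corrSrc k (𝒯.left i) (𝒯.right i) (τ i) (U t) (Q t) (P t) := by
    have := (sL P hP).add_mul z3 (w := fun _ => -s) (W := |s|) (by simp)
    convert this using 3 with t i
    simp only [corrSrc, ← hs]; ring
  refine ⟨?_, z3.mono ?_, z4.mono ?_⟩
  · convert (z1 U hU).mono (B := (C₁ + C₃ + C₄ + 1) * Y) ?_ using 3 with t i
    · ring
    · exact mul_le_mul_of_nonneg_right (by linarith) hY0
  · exact mul_le_mul_of_nonneg_right (by linarith) hY0
  · exact mul_le_mul_of_nonneg_right (by linarith) hY0

end

/-! ### The error equations on one element -/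

/-- The amplitudes of L are forced by the fluxes. Without c the corrected u and q match the exact
values at the left end; c in u then requires -tL c in q for the left flux of q. The amplitude of p
is solved from the right flux of q, which gives ζp and the multiple -τ(tL + τ) of c. The left flux
of p then fails by δ = d + s K₀ c, where K₀ collects the stabilization parameters. The projections
themselves contribute nothing to the sources. -/
theorem isSol_of_equations {k : ℕ} {l r tL sL τ c c' K₀ ζut : ℝ} (hlr : l < r)
    (hτ : τ ≠ 0) {Pu Pq Pp Pt uh qh ph Dh : ℝ[X]} {uL uR qL qR pL pR uhL uhR qhL qhR phL phR : ℝ}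
    {F : ℝ[X] → ℝ} {e : ElemState} {ρuL ρuR ρqL ρqR ρpL ρpR ζp d : ℝ}
    (mPu : Pu ∈ Polynomial.degreeLT ℝ (k + 1)) (mPq : Pq ∈ Polynomial.degreeLT ℝ (k + 1))
    (mPp : Pp ∈ Polynomial.degreeLT ℝ (k + 1)) (mPt : Pt ∈ Polynomial.degreeLT ℝ (k + 1))
    (muh : uh ∈ Polynomial.degreeLT ℝ (k + 1)) (mqh : qh ∈ Polynomial.degreeLT ℝ (k + 1))
    (mph : ph ∈ Polynomial.degreeLT ℝ (k + 1)) (mDh : Dh ∈ Polynomial.degreeLT ℝ (k + 1))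
    (E1 : ∀ v ∈ Polynomial.degreeLT ℝ (k + 1), ip l r Pu (Polynomial.derivative v) + ip l r Pq v =
      uR * v.eval r - uL * v.eval l)
    (E2 : ∀ v ∈ Polynomial.degreeLT ℝ (k + 1), ip l r Pq (Polynomial.derivative v) + ip l r Pp v =
      qR * v.eval r - qL * v.eval l)
    (E3 : ∀ v ∈ Polynomial.degreeLT ℝ (k + 1), ip l r Pp (Polynomial.derivative v) + F v -
      ip l r Pt v = pR * v.eval r - pL * v.eval l)
    (D1 : ∀ v ∈ Polynomial.degreeLT ℝ (k + 1), ip l r qh v + ip l r uh (Polynomial.derivative v) =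
      uhR * v.eval r - uhL * v.eval l)
    (D2 : ∀ v ∈ Polynomial.degreeLT ℝ (k + 1), ip l r ph v + ip l r qh (Polynomial.derivative v) =
      qhR * v.eval r - qhL * v.eval l)
    (D3 : ∀ v ∈ Polynomial.degreeLT ℝ (k + 1), ip l r Dh v - ip l r ph (Polynomial.derivative v) +
      (phR * v.eval r - phL * v.eval l) = F v)
    (fp : phL = ph.eval l - sL * (uhL - uh.eval l)) (fq : qhL = qh.eval l - tL * (uhL - uh.eval l))
    (fr : qhR = qh.eval r + τ * (uhR - uh.eval r) + τ⁻¹ * (phR - ph.eval r))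
    (hρuL : ρuL = uL - Pu.eval l) (hρuR : ρuR = uR - Pu.eval r) (hρqL : ρqL = qL - Pq.eval l)
    (hρqR : ρqR = qR - Pq.eval r) (hρpL : ρpL = pL - Pp.eval l) (hρpR : ρpR = pR - Pp.eval r)
    (hζp : ζp = ρpR - τ * (ρqR - ρqL / legS k) + τ ^ 2 * (ρuR - ρuL / legS k))
    (hd : d = ρpL - legS k * ζp) (hK₀ : K₀ = τ ^ 2 + τ * tL - sL)
    (hc : legθ k * (r - l) * c' = -legS k ^ 2 * K₀ * c - legS k * d)
    (he : e = { u := Pu + (ρuL / legS k + c) • leg k l r - uh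
                q := Pq + (ρqL / legS k - tL * c) • leg k l r - qh
                p := Pp + (ζp - τ * (tL + τ) * c) • leg k l r - ph
                D := Pt + (ζut + c') • leg k l r - Dh
                ul := uL - uhL, ur := uR - uhR, ql := qL - qhL, qr := qR - qhR
                pl := pL - phL, pr := pR - phR, fu := ζut, fq := ρqL / legS k - tL * c
                fp := ζp - τ * (tL + τ) * c, δ := d + legS k * K₀ * c }) :
    e.IsSol k l r tL sL τ := by
  have hs := legS_ne k
  have hL := leg_mem (l := l) (r := r) k
  have hθ := legθ_pos k
  have hη : r - l ≠ 0 := sub_ne_zero.2 hlr.ne'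
  have ibp : ∀ w v : ℝ[X], ip l r (Polynomial.derivative w) v =
      w.eval r * v.eval r - w.eval l * v.eval l - ip l r w (Polynomial.derivative v) := fun w v => by
    have := ip_derivative_add (l := l) (r := r) w v
    linarith
  have hsm : ∀ x : ℝ, x • leg k l r ∈ Polynomial.degreeLT ℝ (k + 1) := fun x =>
    Submodule.smul_mem _ x hL
  have hl := leg_left (l := l) (r := r) k
  have hr := leg_right k hlr
  have hlegd : ∀ v ∈ Polynomial.degreeLT ℝ (k + 1),
      ip l r (leg k l r) (Polynomial.derivative v) = 0 := fun v hv => ip_leg_derivative hlr hv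
  subst he
  refine ⟨?_, ?_, ?_, ?_, fun v hv => ?_, fun v hv => ?_, fun v hv => ?_, ?_, ?_, ?_⟩
  · exact Submodule.sub_mem _ (Submodule.add_mem _ mPu (hsm _)) muh
  · exact Submodule.sub_mem _ (Submodule.add_mem _ mPq (hsm _)) mqh
  · exact Submodule.sub_mem _ (Submodule.add_mem _ mPp (hsm _)) mph
  · exact Submodule.sub_mem _ (Submodule.add_mem _ mPt (hsm _)) mDh
  · simp only [ibp, ip_sub_left, ip_add_left, ip_smul_left, hlegd v hv]
    linear_combination (-1) * E1 v hv + D1 v hv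
  · simp only [ibp, ip_sub_left, ip_add_left, ip_smul_left, hlegd v hv]
    linear_combination (-1) * E2 v hv + D2 v hv
  · have hc2 : c' = -(legS k * (d + legS k * K₀ * c) / (legθ k * (r - l))) := by
      field_simp
      linear_combination hc
    simp only [ibp, ip_sub_left, ip_add_left, ip_smul_left, hlegd v hv]
    rw [hc2]
    linear_combination (-1) * E3 v hv - D3 v hv
  · simp only [Polynomial.eval_sub, Polynomial.eval_add, Polynomial.eval_smul, smul_eq_mul, hl]
    rw [fq, hρuL, hρqL]
    field_simp
    ring
  · simp only [Polynomial.eval_sub, Polynomial.eval_add, Polynomial.eval_smul, smul_eq_mul, hl]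
    rw [fp, hd, hK₀, hρpL, hρuL]
    field_simp
    ring
  · simp only [Polynomial.eval_sub, Polynomial.eval_add, Polynomial.eval_smul, smul_eq_mul, hr]
    rw [fr, hζp, hρuL, hρuR, hρqL, hρqR, hρpR]
    field_simp
    ring

/-! ### Local form of the HDG equations -/

section

variable {a b : ℝ} {N : ℕ} {𝒯 : Mesh a b N} {k : ℕ}

theorem InW.mem {w : Fin N → ℝ[X]} (h : InW k w) (i : Fin N) :
    w i ∈ Polynomial.degreeLT ℝ (k + 1) := by
  rw [Polynomial.mem_degreeLT]
  exact (h i).trans_lt (by exact_mod_cast Nat.lt_succ_self k)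

theorem inW_of_mem {w : Fin N → ℝ[X]} (h : ∀ i, w i ∈ Polynomial.degreeLT ℝ (k + 1)) :
    InW k w := fun i => by
  have := Polynomial.mem_degreeLT.1 (h i)
  exact Order.lt_succ_iff.1 (by exact_mod_cast this)

theorem inW_single (i : Fin N) {v : ℝ[X]} (hv : v ∈ Polynomial.degreeLT ℝ (k + 1)) :
    InW k (Pi.single i v : Fin N → ℝ[X]) := by
  refine inW_of_mem fun j => ?_
  by_cases h : j = i
  · subst h; rwa [Pi.single_eq_same]
  · rw [Pi.single_eq_of_ne h]; exact Submodule.zero_mem _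

theorem inn_eq_of_forall_ne {φ w : Fin N → ℝ[X]} (i : Fin N) (h : ∀ j, j ≠ i → w j = 0) :
    inn 𝒯 φ w = ip (𝒯.left i) (𝒯.right i) (φ i) (w i) := by
  rw [inn, Finset.sum_eq_single i (fun j _ hj => by simp [h j hj]) (fun hi => by simp at hi),
    ip_eq_setIntegral (𝒯.left_lt_right i).le]
  rfl

theorem inn_single (φ : Fin N → ℝ[X]) (i : Fin N) (v : ℝ[X]) :
    inn 𝒯 φ (Pi.single i v) = ip (𝒯.left i) (𝒯.right i) (φ i) v := by
  rw [inn_eq_of_forall_ne i fun j hj => Pi.single_eq_of_ne hj _, Pi.single_eq_same]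

theorem inn_single_derivative (φ : Fin N → ℝ[X]) (i : Fin N) (v : ℝ[X]) :
    inn 𝒯 φ (fun j => ((Pi.single i v : Fin N → ℝ[X]) j).derivative) =
      ip (𝒯.left i) (𝒯.right i) (φ i) v.derivative := by
  rw [inn_eq_of_forall_ne i fun j hj => by rw [Pi.single_eq_of_ne hj, Polynomial.derivative_zero],
    Pi.single_eq_same]

theorem innFun_single (g : ℝ → ℝ) (i : Fin N) (v : ℝ[X]) :
    innFun 𝒯 g (Pi.single i v) = ∫ x in Ioo (𝒯.left i) (𝒯.right i), g x * v.eval x := by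
  rw [innFun, Finset.sum_eq_single i (fun j _ hj => by simp [Pi.single_eq_of_ne hj])
    (fun hi => by simp at hi), Pi.single_eq_same]
  rfl

theorem bdry_single (ηL ηR : Fin N → ℝ) (i : Fin N) (v : ℝ[X]) :
    bdry 𝒯 ηL ηR (Pi.single i v) = ηR i * v.eval (𝒯.right i) - ηL i * v.eval (𝒯.left i) := by
  rw [bdry, Finset.sum_eq_single i (fun j _ hj => by simp [Pi.single_eq_of_ne hj])
    (fun hi => by simp at hi), Pi.single_eq_same]

theorem bdryNode_single_interior {n : ℕ} (ηL ηR : Fin (n + 1) → ℝ) (j : Fin n) :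
    bdryNode ηL ηR (Pi.single j.castSucc.succ 1) = ηR j.castSucc - ηL j.succ := by
  rw [bdryNode, Finset.sum_sub_distrib, Finset.sum_eq_single j.castSucc,
    Finset.sum_eq_single j.succ, Pi.single_eq_same, ← Fin.succ_castSucc, Pi.single_eq_same, mul_one,
    mul_one]
  · intro i _ hi
    rw [Pi.single_eq_of_ne, mul_zero]
    rw [Fin.succ_castSucc]
    exact fun h => hi (Fin.castSucc_injective _ h)
  · simp
  · intro i _ hi
    rw [Pi.single_eq_of_ne, mul_zero]
    exact fun h => hi (Fin.succ_injective _ h)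
  · simp

theorem bdryNode_single_last {n : ℕ} (ηL ηR : Fin (n + 1) → ℝ) :
    bdryNode ηL ηR (Pi.single (Fin.last (n + 1)) 1) = ηR (Fin.last n) := by
  rw [bdryNode, Finset.sum_sub_distrib, Finset.sum_eq_single (Fin.last n), Finset.sum_eq_zero,
    Fin.succ_last, Pi.single_eq_same, mul_one, sub_zero]
  · intro i _
    rw [Pi.single_eq_of_ne (Fin.castSucc_lt_last i).ne, mul_zero]
  · intro i _ hi
    rw [Pi.single_eq_of_ne, mul_zero]
    rw [← Fin.succ_last]
    exact fun h => hi (Fin.succ_injective _ h)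
  · simp

/-- Conservativity at the interior nodes glues the one-sided traces to one nodal function; nothing
is required at the left boundary node. -/
theorem exists_nodal {n : ℕ} {ηL ηR : Fin (n + 1) → ℝ}
    (h : ∀ j : Fin n, ηR j.castSucc = ηL j.succ) : ∃ y : Fin (n + 1 + 1) → ℝ,
      y (Fin.last (n + 1)) = ηR (Fin.last n) ∧ ∀ i, ηL i = y i.castSucc ∧ ηR i = y i.succ := by
  refine ⟨Fin.cons (ηL 0) ηR, ?_, fun i => ⟨?_, by rw [Fin.cons_succ]⟩⟩
  · rw [← Fin.succ_last, Fin.cons_succ]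
  · induction i using Fin.cases with
    | zero => rw [Fin.castSucc_zero, Fin.cons_zero]
    | succ j => rw [← Fin.succ_castSucc, Fin.cons_succ, h j]

theorem exists_nodal_sub {n : ℕ} {ηL ηR : Fin (n + 1) → ℝ} (v : Fin (n + 1 + 1) → ℝ)
    (h : ∀ j : Fin n, ηR j.castSucc = ηL j.succ) : ∃ y : Fin (n + 1 + 1) → ℝ,
      y (Fin.last (n + 1)) = v (Fin.last (n + 1)) - ηR (Fin.last n) ∧
      ∀ i, v i.castSucc - ηL i = y i.castSucc ∧ v i.succ - ηR i = y i.succ := by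
  obtain ⟨y, h1, h2⟩ := exists_nodal h
  exact ⟨fun j => v j - y j, by simp only [h1], fun i => by rw [(h2 i).1, (h2 i).2]; simp⟩

end

/-! ### The discrete error -/

section

variable {a b : ℝ} {N : ℕ}

/-- The difference of the corrected projection of `(u, q, p, ut)` and of the discrete solution. The
families `c` and `c'` are the corrector and its derivative; `ζt`, `ζp`, `d` are the amplitudes
obtained from the projection errors. -/
def errorState (𝒯 : Mesh a b N) (τ : Stabilization N) (k : ℕ) (u q p ut : ℝ → ℝ) (s : Unknowns N)
    (D : Fin N → ℝ[X]) (c c' ζt ζp d : Fin N → ℝ) (i : Fin N) : ElemState where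
  u := proj k (𝒯.left i) (𝒯.right i) u +
    ((u (𝒯.left i) - (proj k (𝒯.left i) (𝒯.right i) u).eval (𝒯.left i)) / legS k + c i) •
      leg k (𝒯.left i) (𝒯.right i) - s.u i
  q := proj k (𝒯.left i) (𝒯.right i) q +
    ((q (𝒯.left i) - (proj k (𝒯.left i) (𝒯.right i) q).eval (𝒯.left i)) / legS k -
      τ.quL i * c i) • leg k (𝒯.left i) (𝒯.right i) - s.q i
  p := proj k (𝒯.left i) (𝒯.right i) p +
    (ζp i - τ.quR i * (τ.quL i + τ.quR i) * c i) • leg k (𝒯.left i) (𝒯.right i) - s.p i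
  D := proj k (𝒯.left i) (𝒯.right i) ut + (ζt i + c' i) • leg k (𝒯.left i) (𝒯.right i) - D i
  ul := u (𝒯.left i) - s.uhat i.castSucc
  ur := u (𝒯.right i) - s.uhat i.succ
  ql := q (𝒯.left i) - qhatL 𝒯 τ s i
  qr := q (𝒯.right i) - qhatR 𝒯 τ s i
  pl := p (𝒯.left i) - phatL 𝒯 τ s i
  pr := p (𝒯.right i) - s.phat i
  fu := ζt i
  fq := (q (𝒯.left i) - (proj k (𝒯.left i) (𝒯.right i) q).eval (𝒯.left i)) / legS k -
    τ.quL i * c i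
  fp := ζp i - τ.quR i * (τ.quL i + τ.quR i) * c i
  δ := d i + legS k * (τ.quR i ^ 2 + τ.quR i * τ.quL i - τ.puL i) * c i

variable {𝒯 : Mesh a b N} {k : ℕ} {τ : Stabilization N}

theorem integral_parts_elem {v w : ℝ → ℝ} (hv : ContinuousOn v (Icc a b))
    (hw : IntegrableOn w (Ioo a b)) (h : IsWeakDeriv 1 (Ioo a b) v w) (i : Fin N) (P : ℝ[X]) :
    (∫ x in Ioo (𝒯.left i) (𝒯.right i), v x * P.derivative.eval x) +
      ∫ x in Ioo (𝒯.left i) (𝒯.right i), w x * P.eval x =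
      v (𝒯.right i) * P.eval (𝒯.right i) - v (𝒯.left i) * P.eval (𝒯.left i) := by
  have hlr := 𝒯.left_lt_right i
  have h1 := h.mono (Mesh.elem_subset (𝒯 := 𝒯) i)
  have h2 := hv.mono (Mesh.Icc_subset (𝒯 := 𝒯) i)
  have h3 := hw.mono_set (Mesh.elem_subset (𝒯 := 𝒯) i)
  obtain ⟨e1, e2⟩ := h1.trace_eq hlr h2 h3
  rw [h1.integral_mul_deriv_add hlr (h2.integrableOn_Icc.mono_set Ioo_subset_Icc_self) h3, e1, e2]

/-- Consistency: the exact solution satisfies the elementwise identities with its own end point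
values, and polynomial tests do not distinguish it from its projections. Subtracting the method
gives homogeneous boundary conditions. -/
theorem errorState_isGlobalSol {u q p ut f : ℝ → ℝ} {uDa uDb qN : ℝ} {s : Unknowns N}
    {D : Fin N → ℝ[X]} {c c' ζt ζp d : Fin N → ℝ} (hab : a < b)
    (cu : ContinuousOn u (Icc a b)) (cq : ContinuousOn q (Icc a b)) (cp : ContinuousOn p (Icc a b))
    (iut : IntegrableOn ut (Ioo a b)) (ifi : IntegrableOn f (Ioo a b))
    (hq : IsWeakDeriv 1 (Ioo a b) u q) (hp : IsWeakDeriv 1 (Ioo a b) q p)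
    (hf : IsWeakDeriv 1 (Ioo a b) p fun x => f x - ut x)
    (hua : u a = uDa) (hub : u b = uDb) (hqb : q b = qN)
    (hS : IsHDGState 𝒯 τ s k uDa uDb qN D f) (hD : InW k D) (hτ : ∀ i, 0 < τ.quR i)
    (hτ1 : ∀ i, τ.quR i * τ.qpR i = 1)
    (hζp : ∀ i, ζp i = (p (𝒯.right i) - (proj k (𝒯.left i) (𝒯.right i) p).eval (𝒯.right i)) -
      τ.quR i * ((q (𝒯.right i) - (proj k (𝒯.left i) (𝒯.right i) q).eval (𝒯.right i)) -
        (q (𝒯.left i) - (proj k (𝒯.left i) (𝒯.right i) q).eval (𝒯.left i)) / legS k) +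
      τ.quR i ^ 2 * ((u (𝒯.right i) - (proj k (𝒯.left i) (𝒯.right i) u).eval (𝒯.right i)) -
        (u (𝒯.left i) - (proj k (𝒯.left i) (𝒯.right i) u).eval (𝒯.left i)) / legS k))
    (hd : ∀ i, d i = (p (𝒯.left i) - (proj k (𝒯.left i) (𝒯.right i) p).eval (𝒯.left i)) -
      legS k * ζp i)
    (hc : ∀ i, legθ k * (𝒯.right i - 𝒯.left i) * c' i =
      -legS k ^ 2 * (τ.quR i ^ 2 + τ.quR i * τ.quL i - τ.puL i) * c i - legS k * d i) :
    IsGlobalSol 𝒯 k τ (errorState 𝒯 τ k u q p ut s D c c' ζt ζp d) := by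
  have iq : IntegrableOn q (Ioo a b) := cq.integrableOn_Icc.mono_set Ioo_subset_Icc_self
  have iu : IntegrableOn u (Ioo a b) := cu.integrableOn_Icc.mono_set Ioo_subset_Icc_self
  have ip' : IntegrableOn p (Ioo a b) := cp.integrableOn_Icc.mono_set Ioo_subset_Icc_self
  have hsucc : ∀ {w : ℝ[X]}, w ∈ Polynomial.degreeLT ℝ (k + 1) →
      Polynomial.derivative w ∈ Polynomial.degreeLT ℝ (k + 1) := fun hw =>
    Polynomial.degreeLT_mono (Nat.le_succ k) (derivative_mem_degreeLT hw)
  have hsub := fun i => Mesh.elem_subset (𝒯 := 𝒯) i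
  refine ⟨fun i => ?_, ?_, ?_, ?_⟩
  · have hlr := 𝒯.left_lt_right i
    refine isSol_of_equations (F := fun v => ∫ x in Ioo (𝒯.left i) (𝒯.right i), f x * v.eval x)
      hlr (hτ i).ne' (proj_mem k) (proj_mem k) (proj_mem k) (proj_mem k) (hS.mem_u.mem i)
      (hS.mem_q.mem i) (hS.mem_p.mem i) (hD.mem i) (fun v hv => ?_) (fun v hv => ?_)
      (fun v hv => ?_) (fun v hv => ?_) (fun v hv => ?_) (fun v hv => ?_) ?_ ?_ ?_ rfl rfl rfl rfl
      rfl rfl (hζp i) (hd i) rfl (hc i) rfl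
    · rw [proj_spec hlr (iu.mono_set (hsub i)) k (hsucc hv),
        proj_spec hlr (iq.mono_set (hsub i)) k hv]
      exact integral_parts_elem cu iq hq i v
    · rw [proj_spec hlr (iq.mono_set (hsub i)) k (hsucc hv),
        proj_spec hlr (ip'.mono_set (hsub i)) k hv]
      exact integral_parts_elem cq ip' hp i v
    · rw [proj_spec hlr (ip'.mono_set (hsub i)) k (hsucc hv),
        proj_spec hlr (iut.mono_set (hsub i)) k hv, ← integral_parts_elem cp (ifi.sub iut) hf i v,
        add_sub_assoc, ← integral_sub (IntegrableOn.mul_polynomial (ifi.mono_set (hsub i)) v)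
          (IntegrableOn.mul_polynomial (iut.mono_set (hsub i)) v)]
      refine congrArg _ (integral_congr_ae (Filter.Eventually.of_forall fun x => ?_))
      simp only [Pi.sub_apply, sub_mul]
    · have := hS.eq_q _ (inW_single i hv)
      rw [inn_single, inn_single_derivative, bdry_single] at this
      linarith
    · have := hS.eq_p _ (inW_single i hv)
      rw [inn_single, inn_single_derivative, bdry_single] at this
      linarith
    · have := hS.eq_u _ (inW_single i hv)
      rw [inn_single, inn_single_derivative, bdry_single, innFun_single] at this
      exact this
    · rw [phatL]; ring
    · rw [qhatL]; ring
    · rw [qhatR, mul_one, mul_one, ← eq_inv_of_mul_eq_one_right (hτ1 i)]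
  · refine ⟨fun j => u (𝒯.node j) - s.uhat j, ?_, ?_, fun i => ⟨rfl, rfl⟩⟩
    · simp only
      rw [𝒯.node_zero, hS.uhat_a, hua, sub_self]
    · simp only
      rw [𝒯.node_last, hS.uhat_b, hub, sub_self]
  · cases N with
    -- A mesh without elements would force a = b.
    | zero =>
      have h0 := 𝒯.node_zero
      have h1 := 𝒯.node_last
      exact absurd (h0.symm.trans h1) hab.ne
    | succ n =>
      obtain ⟨y, h1, h2⟩ := exists_nodal_sub (ηL := qhatL 𝒯 τ s) (ηR := qhatR 𝒯 τ s)
        (fun j => q (𝒯.node j)) fun j => by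
          have := hS.trans_q (Pi.single j.castSucc.succ 1)
            (Pi.single_eq_of_ne (Fin.succ_ne_zero _).symm _)
          rw [bdryNode_single_interior, Pi.single_eq_of_ne, mul_zero] at this
          · exact sub_eq_zero.1 this
          · rw [Fin.succ_castSucc]; exact (Fin.castSucc_lt_last _).ne'
      refine ⟨y, ?_, h2⟩
      have := hS.trans_q (Pi.single (Fin.last (n + 1)) 1)
        (Pi.single_eq_of_ne (Fin.last_pos).ne _)
      rw [bdryNode_single_last, Pi.single_eq_same, mul_one] at this
      rw [h1, this, 𝒯.node_last, hqb, sub_self]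
  · cases N with
    | zero =>
      have h0 := 𝒯.node_zero
      have h1 := 𝒯.node_last
      exact absurd (h0.symm.trans h1) hab.ne
    | succ n =>
      obtain ⟨y, -, h2⟩ := exists_nodal_sub (ηL := phatL 𝒯 τ s) (ηR := s.phat)
        (fun j => p (𝒯.node j)) fun j => by
          have := hS.trans_p (Pi.single j.castSucc.succ 1)
            (Pi.single_eq_of_ne (Fin.succ_ne_zero _).symm _) (Pi.single_eq_of_ne (by
              rw [Fin.succ_castSucc]; exact (Fin.castSucc_lt_last _).ne') _)
          rw [bdryNode_single_interior] at this
          exact sub_eq_zero.1 this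
      exact ⟨y, h2⟩

/-- At time zero the same p and trace of p occur in the third equations of both the evolution and
the stationary method; subtraction leaves an `L²` identity for D - u. -/
theorem IsHDGState.sub_eq_proj {u ut f g : ℝ → ℝ} {uDa uDb qN : ℝ} {s : Unknowns N}
    {D : Fin N → ℝ[X]} (iu : IntegrableOn u (Ioo a b)) (iut : IntegrableOn ut (Ioo a b))
    (ifi : IntegrableOn f (Ioo a b)) (hS : IsHDGState 𝒯 τ s k uDa uDb qN D f)
    (hD : InW k D) (hS' : IsHDGState 𝒯 τ s k uDa uDb qN s.u g)
    (hg : g =ᵐ[volume.restrict (Ioo a b)] fun x => u x + (f x - ut x)) (i : Fin N) :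
    D i - s.u i =
      proj k (𝒯.left i) (𝒯.right i) ut - proj k (𝒯.left i) (𝒯.right i) u := by
  have hlr := 𝒯.left_lt_right i
  have hsub := Mesh.elem_subset (𝒯 := 𝒯) i
  refine eq_of_ip_eq hlr (Submodule.sub_mem _ (hD.mem i) (hS.mem_u.mem i))
    (Submodule.sub_mem _ (proj_mem k) (proj_mem k)) fun v hv => ?_
  have e1 := hS.eq_u _ (inW_single i hv)
  have e2 := hS'.eq_u _ (inW_single i hv)
  rw [inn_single, innFun_single] at e1 e2
  rw [ip_sub_left, ip_sub_left, proj_spec hlr (iut.mono_set hsub) k hv,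
    proj_spec hlr (iu.mono_set hsub) k hv]
  have e3 : ∫ x in Ioo (𝒯.left i) (𝒯.right i), g x * v.eval x =
      (∫ x in Ioo (𝒯.left i) (𝒯.right i), u x * v.eval x) +
      ((∫ x in Ioo (𝒯.left i) (𝒯.right i), f x * v.eval x) -
        ∫ x in Ioo (𝒯.left i) (𝒯.right i), ut x * v.eval x) := by
    have h1 := IntegrableOn.mul_polynomial (iu.mono_set hsub) v
    have h2 := IntegrableOn.mul_polynomial (ifi.mono_set hsub) v
    have h3 := IntegrableOn.mul_polynomial (iut.mono_set hsub) v
    have h4 : IntegrableOn (fun x => f x * v.eval x - ut x * v.eval x)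
        (Ioo (𝒯.left i) (𝒯.right i)) := h2.sub h3
    rw [setIntegral_mul_congr (ae_elem_of_ae i hg), ← integral_sub h2 h3,
      ← integral_add h1 h4]
    refine integral_congr_ae (Filter.Eventually.of_forall fun x => ?_)
    simp only; ring
  rw [e3] at e2
  linarith

/-- Coefficients above degree k vanish for all times, hence so do their derivatives. -/
theorem IsHDGSolution.inW_ut {T : ℝ} (hT : 0 < T) {d : ProblemData} {d3u₀ : ℝ → ℝ}
    {S : ℝ → Unknowns N} {ut : ℝ → Fin N → ℝ[X]} (h : IsHDGSolution 𝒯 τ k T d d3u₀ S ut) :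
    ∀ t ∈ Icc 0 T, InW k (ut t) := by
  intro t ht i
  rw [Polynomial.degree_le_iff_coeff_zero]
  intro m hm
  have h1 := h.time_deriv t ht i m
  have h2 : HasDerivWithinAt (fun r => ((S r).u i).coeff m) 0 (Icc 0 T) t := by
    have h3 : ∀ r ∈ Icc 0 T, ((S r).u i).coeff m = 0 := fun r hr =>
      Polynomial.coeff_eq_zero_of_degree_lt (((h.equations r hr).mem_u i).trans_lt hm)
    exact (hasDerivWithinAt_const t (Icc 0 T) (0 : ℝ)).congr h3 (h3 t ht)
  exact ((uniqueDiffOn_Icc hT) t ht).eq_deriv _ h1 h2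

end

/-! ### The error of the method solves the discrete evolution problem -/

section

variable {a b : ℝ} {N : ℕ} {𝒯 : Mesh a b N} {k : ℕ}

theorem jump_eq {v w : ℝ → ℝ} {g : Jet a b (k + 1)} (hv : ContinuousOn v (Icc a b))
    (h : IsWeakDeriv 1 (Ioo a b) v w)
    (h0 : v =ᵐ[volume.restrict (Ioo a b)] jetFn a b (k + 1) 0 g)
    (h1 : w =ᵐ[volume.restrict (Ioo a b)] jetFn a b (k + 1) 1 g) (i : Fin N) :
    v (𝒯.left i) - (proj k (𝒯.left i) (𝒯.right i) v).eval (𝒯.left i) =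
        jumpL k (𝒯.left i) (𝒯.right i) g ∧
      v (𝒯.right i) - (proj k (𝒯.left i) (𝒯.right i) v).eval (𝒯.right i) =
        jumpR k (𝒯.left i) (𝒯.right i) g := by
  have hlr := 𝒯.left_lt_right i
  have e0 : v =ᵐ[volume.restrict (Ioo (𝒯.left i) (𝒯.right i))] jetFn a b (k + 1) 0 g :=
    ae_elem_of_ae i h0
  have e1 : w =ᵐ[volume.restrict (Ioo (𝒯.left i) (𝒯.right i))] jetFn a b (k + 1) 1 g :=
    ae_elem_of_ae i h1
  have hw : IntegrableOn w (Ioo (𝒯.left i) (𝒯.right i)) :=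
    (L2.integrableOn _ (Mesh.elem_subset i)).congr e1.symm
  obtain ⟨t1, t2⟩ := (h.mono (Mesh.elem_subset (𝒯 := 𝒯) i)).trace_eq hlr
    (hv.mono (Mesh.Icc_subset i)) hw
  rw [jumpL, jumpR, rhoL, rhoR, ← traceL_congr e0 e1, ← traceR_congr e0 e1, ← proj_congr k e0,
    t1, t2]
  exact ⟨rfl, rfl⟩

theorem Mesh.lenSum_add_mul_le {x w z : Fin N → ℝ} {A B W : ℝ} (hw : ∀ i, |w i| ≤ W)
    (hx : ∑ i, x i ^ 2 ≤ A) (hz : (𝒯.lenSum fun i => z i ^ 2) ≤ B) :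
    (𝒯.lenSum fun i => (x i + w i * z i) ^ 2) ≤ 2 * (𝒯.size * A) + 2 * W ^ 2 * B := by
  have h : ∀ i, (𝒯.right i - 𝒯.left i) * (x i + w i * z i) ^ 2 ≤
      2 * ((𝒯.right i - 𝒯.left i) * x i ^ 2) +
        2 * W ^ 2 * ((𝒯.right i - 𝒯.left i) * z i ^ 2) := fun i => by
    have hη := (𝒯.len_pos i).le
    have h1 : w i ^ 2 ≤ W ^ 2 := by
      rw [← sq_abs (w i)]; exact pow_le_pow_left₀ (abs_nonneg _) (hw i) 2
    have h2 : (x i + w i * z i) ^ 2 ≤ 2 * x i ^ 2 + 2 * W ^ 2 * z i ^ 2 := by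
      nlinarith [sq_nonneg (x i - w i * z i), mul_le_mul_of_nonneg_right h1 (sq_nonneg (z i))]
    refine (mul_le_mul_of_nonneg_left h2 hη).trans (le_of_eq (by ring))
  refine (Finset.sum_le_sum fun i _ => h i).trans ?_
  rw [Finset.sum_add_distrib, ← Finset.mul_sum, ← Finset.mul_sum]
  have h3 := (𝒯.lenSum_le fun i => sq_nonneg (x i)).trans
    (mul_le_mul_of_nonneg_left hx 𝒯.size_nonneg)
  have h4 := mul_le_mul_of_nonneg_left hz (by positivity : 0 ≤ 2 * W ^ 2)
  rw [Mesh.lenSum] at h3 h4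
  linarith

theorem Mesh.size_pos (𝒯 : Mesh a b N) (hab : a < b) : 0 < 𝒯.size := by
  have h := 𝒯.sum_len
  have : ∃ i : Fin N, True := by
    by_contra! hne
    rw [Finset.sum_eq_zero fun i _ => (hne i).elim] at h
    linarith
  obtain ⟨i, -⟩ := this
  exact (𝒯.len_pos i).trans_le (𝒯.len_le_size i)

/-- The lower bound 1/2, due to sL ≤ -1/2, makes the corrector equation damped. -/
theorem ElemAdm.corr_bounds {M tL sL tR : ℝ} (h : ElemAdm M tL sL tR) :
    1 / 2 ≤ tR ^ 2 + tR * tL - sL ∧ tR ^ 2 + tR * tL - sL ≤ M ^ 2 + M + 2 ∧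
      |tR| ≤ M ∧ |(-tL)| ≤ 1 ∧ |-(tR * (tL + tR))| ≤ M * (1 + M) := by
  have h1 := h.tL_nonneg
  have h2 := h.tL_le
  have h3 := h.sL_ge
  have h4 := h.sL_le
  have h5 := h.tR_pos
  have h6 := h.tR_le
  have h7 : 0 ≤ tR * tL := by positivity
  refine ⟨by nlinarith, by nlinarith, by rwa [abs_of_pos h5], ?_, ?_⟩
  · rwa [abs_neg, abs_of_nonneg h1]
  · rw [abs_neg, abs_of_nonneg (by positivity)]
    have := h.one_le
    exact mul_le_mul h6 (by linarith) (by positivity) (by linarith)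

theorem sq_div_add_mul_le (y z s : ℝ) {t : ℝ} (h0 : 0 ≤ t) (h1 : t ≤ 1) :
    (y / s + -t * z) ^ 2 ≤ 2 / s ^ 2 * y ^ 2 + 2 * z ^ 2 := by
  have h2 : t ^ 2 ≤ 1 := pow_le_one₀ h0 h1
  have e1 : 2 / s ^ 2 * y ^ 2 = 2 * (y / s) ^ 2 := by rw [div_pow]; ring
  rw [e1]
  nlinarith [sq_nonneg (y / s - -t * z), mul_le_mul_of_nonneg_right h2 (sq_nonneg z)]

variable {T K M : ℝ} {d : ProblemData} {u ut q p : ℝ → ℝ → ℝ}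
  {U U' Q P : ℝ → Jet a b (k + 1)} {τ : Stabilization N} {d3u₀ : ℝ → ℝ}

theorem IsRegular.integrable_ut (hR : IsRegular 𝒯 T k K d u ut q p U U' Q P) {t : ℝ}
    (ht : t ∈ Icc 0 T) : IntegrableOn (ut t) (Ioo a b) :=
  (L2.integrableOn _ subset_rfl).congr (hR.ut_eq t ht).symm

theorem IsRegular.hasDerivWithinAt (hR : IsRegular 𝒯 T k K d u ut q p U U' Q P) {t : ℝ}
    (ht : t ∈ Icc 0 T) : HasDerivWithinAt U (U' t) (Icc 0 T) t :=
  hasDerivWithinAt_of_norm_le fun x hx => hR.deriv_U t ht x hx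

theorem IsRegular.jump_u (hR : IsRegular 𝒯 T k K d u ut q p U U' Q P)
    (hsol : IsExactSolution a b T d u ut q p) {t : ℝ} (ht : t ∈ Icc 0 T) (i : Fin N) :
    u t (𝒯.left i) - (proj k (𝒯.left i) (𝒯.right i) (u t)).eval (𝒯.left i) =
        jumpL k (𝒯.left i) (𝒯.right i) (U t) ∧
      u t (𝒯.right i) - (proj k (𝒯.left i) (𝒯.right i) (u t)).eval (𝒯.right i) =
        jumpR k (𝒯.left i) (𝒯.right i) (U t) :=
  jump_eq (hsol.cont_u t ht) (hsol.eq_q t ht) (hR.u_eq t ht) (hR.ux_eq t ht) i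

theorem IsRegular.jump_q (hR : IsRegular 𝒯 T k K d u ut q p U U' Q P)
    (hsol : IsExactSolution a b T d u ut q p) {t : ℝ} (ht : t ∈ Icc 0 T) (i : Fin N) :
    q t (𝒯.left i) - (proj k (𝒯.left i) (𝒯.right i) (q t)).eval (𝒯.left i) =
        jumpL k (𝒯.left i) (𝒯.right i) (Q t) ∧
      q t (𝒯.right i) - (proj k (𝒯.left i) (𝒯.right i) (q t)).eval (𝒯.right i) =
        jumpR k (𝒯.left i) (𝒯.right i) (Q t) :=
  jump_eq (hsol.cont_q t ht) (hsol.eq_p t ht) (hR.q_eq t ht) (hR.qx_eq t ht) i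

theorem IsRegular.jump_p (hR : IsRegular 𝒯 T k K d u ut q p U U' Q P)
    (hsol : IsExactSolution a b T d u ut q p) {t : ℝ} (ht : t ∈ Icc 0 T) (i : Fin N) :
    p t (𝒯.left i) - (proj k (𝒯.left i) (𝒯.right i) (p t)).eval (𝒯.left i) =
        jumpL k (𝒯.left i) (𝒯.right i) (P t) ∧
      p t (𝒯.right i) - (proj k (𝒯.left i) (𝒯.right i) (p t)).eval (𝒯.right i) =
        jumpR k (𝒯.left i) (𝒯.right i) (P t) :=
  jump_eq (hsol.cont_p t ht) (hsol.eq_u t ht) (hR.p_eq t ht) (hR.px_eq t ht) i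

/-- The second difference of `zeta_q` is controlled by that of the jet of `u`. -/
theorem IsRegular.sum_second_difference_le (hR : IsRegular 𝒯 T k K d u ut q p U U' Q P)
    {C : ℝ} (hC : 0 ≤ C)
    (h : ∀ g : Jet a b (k + 1), IsBrokenSobolev 𝒯 g →
      ∑ i, (𝒯.right i - 𝒯.left i) ^ 3 * rhoL k (𝒯.left i) (𝒯.right i) (jetFn a b (k + 1) 1 g)
        (jetFn a b (k + 1) 2 g) ^ 2 ≤ C * 𝒯.size ^ (2 * k + 2) * ‖g‖ ^ 2)
    {σ : ℝ} (hσ : 0 < σ) {s : ℝ} (hs : s ∈ Icc 0 (T - 2 * σ)) :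
    ∑ i, (𝒯.right i - 𝒯.left i) ^ 3 * (jumpL k (𝒯.left i) (𝒯.right i) (Q (s + 2 * σ)) -
      2 * jumpL k (𝒯.left i) (𝒯.right i) (Q (s + σ)) +
        jumpL k (𝒯.left i) (𝒯.right i) (Q s)) ^ 2 ≤
      σ ^ 4 * (4 * C * (𝒯.size ^ (2 * k + 2) * K ^ 2)) := by
  have m0 : s ∈ Icc 0 T := ⟨hs.1, by linarith [hs.2]⟩
  have m1 : s + σ ∈ Icc 0 T := ⟨by linarith [hs.1], by linarith [hs.2]⟩
  have m2 : s + 2 * σ ∈ Icc 0 T := ⟨by linarith [hs.1], by linarith [hs.2]⟩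
  -- The trace error of q is that of the first derivative of the jet of u, so its second difference
  -- is a functional of this second difference G, of norm at most 2 K σ² by two Taylor expansions at
  -- the middle time.
  set G := (U (s + 2 * σ) - U (s + σ)) - (U (s + σ) - U s) with hG
  have hGb : IsBrokenSobolev 𝒯 G :=
    ((hR.lip_U.broken _ m2).sub (hR.lip_U.broken _ m1)).sub
      ((hR.lip_U.broken _ m1).sub (hR.lip_U.broken _ m0))
  have hQU : ∀ t ∈ Icc 0 T, jetFn a b (k + 1) 0 (Q t) = jetFn a b (k + 1) 1 (U t) := fun t ht =>
    Lp.ext ((hR.q_eq t ht).symm.trans (hR.ux_eq t ht))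
  have e : ∀ i, jumpL k (𝒯.left i) (𝒯.right i) (Q (s + 2 * σ)) -
      2 * jumpL k (𝒯.left i) (𝒯.right i) (Q (s + σ)) + jumpL k (𝒯.left i) (𝒯.right i) (Q s) =
      rhoL k (𝒯.left i) (𝒯.right i) (jetFn a b (k + 1) 1 G) (jetFn a b (k + 1) 2 G) := by
    intro i
    obtain ⟨L, hL⟩ := exists_clm_rhoL (s := k + 1) (Mesh.elem_subset (𝒯 := 𝒯) i) k 1 2
    have e1 : ∀ t ∈ Icc 0 T, jumpL k (𝒯.left i) (𝒯.right i) (Q t) = L (U t) := fun t ht => by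
      rw [jumpL, hQU t ht, ← hR.uxx_eq t ht, hL]
    rw [← hL, hG, map_sub, map_sub, map_sub, e1 _ m0, e1 _ m1, e1 _ m2]
    ring
  have hn : ‖G‖ ≤ 2 * K * σ ^ 2 := by
    have h1 := hR.deriv_U (s + σ) m1 (s + 2 * σ) m2
    have h2 := hR.deriv_U (s + σ) m1 s m0
    have e2 : G = (U (s + 2 * σ) - U (s + σ) - (s + 2 * σ - (s + σ)) • U' (s + σ)) +
        (U s - U (s + σ) - (s - (s + σ)) • U' (s + σ)) := by
      have e3 : s + 2 * σ - (s + σ) = σ := by ring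
      have e4 : s - (s + σ) = -σ := by ring
      rw [hG, e3, e4, neg_smul]; abel
    rw [e2]
    refine (norm_add_le _ _).trans ((add_le_add h1 h2).trans (le_of_eq ?_))
    ring
  simp only [e]
  refine (h G hGb).trans ?_
  have hsz := 𝒯.size_nonneg
  have h3 := pow_le_pow_left₀ (norm_nonneg G) hn 2
  refine (mul_le_mul_of_nonneg_left h3 (by positivity)).trans (le_of_eq ?_)
  ring

-- Assembles projection errors and corrector into an evolution whose sources have size h^{k+1}. Each
-- amplitude, weighted by length, is of this order because end point errors are of order h^{k+1/2}
-- in the sum of squares.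
set_option maxHeartbeats 2000000 in
theorem exists_isEvolution (k : ℕ) (hk : 0 < k) (a b : ℝ) (hab : a < b) (M : ℝ) :
    ∃ C : ℝ, 0 < C ∧ ∀ (N : ℕ) (𝒯 : Mesh a b N) (T K : ℝ) (d : ProblemData)
      (u ut q p : ℝ → ℝ → ℝ) (U U' Q P : ℝ → Jet a b (k + 1)) (τ : Stabilization N)
      (d3u₀ : ℝ → ℝ) (S : ℝ → Unknowns N) (uht : ℝ → Fin N → ℝ[X]), 0 < T → 0 ≤ K →
      IsWeakDeriv 3 (Ioo a b) d.u₀ d3u₀ →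
      IsExactSolution a b T d u ut q p → IsRegular 𝒯 T k K d u ut q p U U' Q P → τ.Adm M →
      (∀ i, τ.quR i * τ.qpR i = 1) → IsHDGSolution 𝒯 τ k T d d3u₀ S uht →
      ∃ (e : ℝ → Fin N → ElemState) (αu αq αp αt : ℝ → Fin N → ℝ) (ρ : Fin N → ℝ),
        IsEvolution 𝒯 k τ T (C * (𝒯.size ^ (k + 1) * K)) e ∧
        (∀ i, (e 0 i).D = (e 0 i).u + ρ i • leg k (𝒯.left i) (𝒯.right i)) ∧
        (𝒯.lenSum fun i => ρ i ^ 2) ≤ (C * (𝒯.size ^ (k + 1) * K)) ^ 2 ∧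
        ∀ t ∈ Icc 0 T,
          (∀ i, (e t i).u = proj k (𝒯.left i) (𝒯.right i) (u t) +
            αu t i • leg k (𝒯.left i) (𝒯.right i) - (S t).u i) ∧
          (∀ i, (e t i).q = proj k (𝒯.left i) (𝒯.right i) (q t) +
            αq t i • leg k (𝒯.left i) (𝒯.right i) - (S t).q i) ∧
          (∀ i, (e t i).p = proj k (𝒯.left i) (𝒯.right i) (p t) +
            αp t i • leg k (𝒯.left i) (𝒯.right i) - (S t).p i) ∧
          (∀ i, (e t i).D = proj k (𝒯.left i) (𝒯.right i) (ut t) +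
            αt t i • leg k (𝒯.left i) (𝒯.right i) - uht t i) ∧
          (𝒯.lenSum fun i => αu t i ^ 2) ≤ (C * (𝒯.size ^ (k + 1) * K)) ^ 2 ∧
          (𝒯.lenSum fun i => αq t i ^ 2) ≤ (C * (𝒯.size ^ (k + 1) * K)) ^ 2 ∧
          (𝒯.lenSum fun i => αp t i ^ 2) ≤ (C * (𝒯.size ^ (k + 1) * K)) ^ 2 ∧
          (𝒯.lenSum fun i => αt t i ^ 2) ≤ (C * (𝒯.size ^ (k + 1) * K)) ^ 2 := by
  obtain ⟨C₀, hC₀, hjump⟩ := exists_sum_jump_le k hk a b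
  obtain ⟨C₁, hC₁, hsmall⟩ := exists_isSmall k hk a b M
  set s := legS k with hs
  set θ := legθ k with hθdef
  have hs0 : s ≠ 0 := legS_ne k
  have hθ : 0 < θ := legθ_pos k
  have hs2 : 0 < s ^ 2 := by positivity
  obtain ⟨C₂, hC₂, hcorr⟩ := exists_isCorrector hs0 hθ (M ^ 2 + M + 2)
  set W := M * (1 + M) with hW
  set V := |s| * (M ^ 2 + M + 2) with hV
  -- A common bound for all source, increment and amplitude estimates below.
  set CH := 20 * C₁ + 10 * (C₂ * C₁) + 4 * (W ^ 2 * (C₂ * C₁)) + (θ / s) ^ 2 * (C₂ * C₁) +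
    2 * (V ^ 2 * (C₂ * C₁)) + 8 * C₀ / s ^ 2 with hCH
  have hCH0 : 0 < CH := by positivity
  refine ⟨√CH, Real.sqrt_pos.2 hCH0, fun N 𝒯 T K d u ut q p U U' Q P τ d3u₀ S uht hT hK hd3 hsol hR
    hτ hτ1 hS => ?_⟩
  have hh := 𝒯.size_pos hab
  set X := 𝒯.size ^ (2 * k + 2) * K ^ 2 with hX
  have hX0 : 0 ≤ X := by positivity
  have hH : (√CH * (𝒯.size ^ (k + 1) * K)) ^ 2 = CH * X := by
    rw [mul_pow, Real.sq_sqrt hCH0.le, hX]; ring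
  rw [hH]
  have hadm := fun i => (hτ i).corr_bounds
  obtain ⟨zu, zp, zd⟩ := hsmall N 𝒯 T K τ.quR U Q P (fun i => (hadm i).2.2.1) hR.lip_U hR.lip_Q
    hR.lip_P
  obtain ⟨zt, -, -⟩ := hsmall N 𝒯 T K τ.quR U' Q P (fun i => (hadm i).2.2.1) hR.lip_U' hR.lip_Q
    hR.lip_P
  obtain ⟨zq, -, -⟩ := hsmall N 𝒯 T K τ.quR Q Q P (fun i => (hadm i).2.2.1) hR.lip_Q hR.lip_Q
    hR.lip_P
  set κ : Fin N → ℝ := fun i => τ.quR i ^ 2 + τ.quR i * τ.quL i - τ.puL i with hκ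
  set Y := C₁ * (𝒯.size ^ (2 * k + 1) * K ^ 2) with hY
  have hhY : 𝒯.size * Y = C₁ * X := by rw [hY, hX]; ring
  obtain ⟨c, c', hc⟩ := hcorr N (fun i => 𝒯.right i - 𝒯.left i) κ 𝒯.size T Y _ hT hh
    (fun i => 𝒯.len_pos i) (fun i => 𝒯.len_le_size i) (fun i => (hadm i).1)
    (fun i => (hadm i).2.1) zd.le zd.inc_le
  have hB : C₂ * 𝒯.size * Y = C₂ * C₁ * X := by rw [mul_assoc, hhY]; ring
  rw [hB] at hc
  set ζu : ℝ → Fin N → ℝ := fun t i => jumpL k (𝒯.left i) (𝒯.right i) (U t) / s with hζu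
  set ζt : ℝ → Fin N → ℝ := fun t i => jumpL k (𝒯.left i) (𝒯.right i) (U' t) / s with hζt
  set ζq : ℝ → Fin N → ℝ := fun t i => jumpL k (𝒯.left i) (𝒯.right i) (Q t) / s with hζq
  set ζp : ℝ → Fin N → ℝ := fun t i =>
    zetaP k (𝒯.left i) (𝒯.right i) (τ.quR i) (U t) (Q t) (P t) with hζp
  set δ₁ : ℝ → Fin N → ℝ := fun t i =>
    corrSrc k (𝒯.left i) (𝒯.right i) (τ.quR i) (U t) (Q t) (P t) with hδ₁
  set e : ℝ → Fin N → ElemState := fun t => errorState 𝒯 τ k (u t) (q t) (p t) (ut t) (S t) (uht t)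
    (c t) (c' t) (ζt t) (ζp t) (δ₁ t) with he
  have hfq : ∀ t ∈ Icc 0 T, ∀ i, (e t i).fq = ζq t i + -τ.quL i * c t i := fun t ht i => by
    simp only [he, errorState, hζq]
    rw [(hR.jump_q hsol ht i).1]; ring
  have hfp : ∀ t i, (e t i).fp = ζp t i + -(τ.quR i * (τ.quL i + τ.quR i)) * c t i :=
    fun t i => by simp only [he, errorState]; ring
  have hδ : ∀ t i, (e t i).δ = δ₁ t i + s * κ i * c t i := fun t i => by
    simp only [he, errorState, hκ, hs]
  have hfu : ∀ t i, (e t i).fu = ζt t i := fun t i => rfl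
  -- By the corrector equation δ is proportional to η c', which explains why the sources may contain
  -- δ² divided by the length.
  have hδ' : ∀ t ∈ Icc 0 T, ∀ i, (e t i).δ ^ 2 / (𝒯.right i - 𝒯.left i) =
      (θ / s) ^ 2 * ((𝒯.right i - 𝒯.left i) * c' t i ^ 2) := fun t ht i => by
    have h1 := hc.ode t ht i
    have hη := 𝒯.len_pos i
    have h2 : (e t i).δ = -(θ * (𝒯.right i - 𝒯.left i) * c' t i) / s := by
      rw [h1, hδ]; field_simp; ring
    rw [h2]; field_simp
  have hu1 : ∀ i, |s * κ i| ≤ V := fun i => by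
    rw [hV, abs_mul]
    refine mul_le_mul_of_nonneg_left ?_ (abs_nonneg s)
    rw [abs_of_nonneg (by linarith [(hadm i).1])]
    exact (hadm i).2.1
  have hm1 : ∀ _ : Fin N, |(-1 : ℝ)| ≤ 1 := fun _ => by simp
  have h11 : ∀ _ : Fin N, |(1 : ℝ)| ≤ 1 := fun _ => by simp
  have x1 : 0 ≤ C₁ * X := by positivity
  have x2 : 0 ≤ C₂ * C₁ * X := by positivity
  have x3 : 0 ≤ W ^ 2 * (C₂ * C₁ * X) := by positivity
  have x4 : 0 ≤ (θ / s) ^ 2 * (C₂ * C₁ * X) := by positivity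
  have x5 : 0 ≤ V ^ 2 * (C₂ * C₁ * X) := by positivity
  have x6 : 0 ≤ 8 * C₀ / s ^ 2 * X := by positivity
  have hCHX : CH * X = 20 * (C₁ * X) + 10 * (C₂ * C₁ * X) + 4 * (W ^ 2 * (C₂ * C₁ * X)) +
      (θ / s) ^ 2 * (C₂ * C₁ * X) + 2 * (V ^ 2 * (C₂ * C₁ * X)) + 8 * C₀ / s ^ 2 * X := by
    rw [hCH]; ring
  have hlq : ∀ t ∈ Icc 0 T, (𝒯.lenSum fun i => (e t i).fq ^ 2) ≤
      2 * (C₁ * X) + 2 * (C₂ * C₁ * X) := fun t ht => by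
    have := 𝒯.lenSum_add_mul_le (fun i => (hadm i).2.2.2.1) (zq.le t ht) (hc.le t ht)
    rw [hhY] at this
    simp only [hfq t ht]
    linarith
  have hlp : ∀ t ∈ Icc 0 T, (𝒯.lenSum fun i => (e t i).fp ^ 2) ≤
      2 * (C₁ * X) + 2 * (W ^ 2 * (C₂ * C₁ * X)) := fun t ht => by
    have := 𝒯.lenSum_add_mul_le (fun i => (hadm i).2.2.2.2) (zp.le t ht) (hc.le t ht)
    rw [hhY] at this
    simp only [hfp]
    linarith
  refine ⟨e, fun t i => (u t (𝒯.left i) -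
      (proj k (𝒯.left i) (𝒯.right i) (u t)).eval (𝒯.left i)) / s + c t i, fun t i => (e t i).fq,
    fun t i => (e t i).fp, fun t i => ζt t i + c' t i,
    fun i => (ζt 0 i + -1 * ζu 0 i) + -1 * c 0 i, ?_, ?_, ?_, ?_⟩
  · refine ⟨fun t ht => ?_, fun t ht i m => ?_, fun t ht => ?_, fun t ht r hr => ?_,
      fun σ hσ r hr => ?_⟩
    · refine errorState_isGlobalSol hab (hsol.cont_u t ht) (hsol.cont_q t ht) (hsol.cont_p t ht)
        (hR.integrable_ut ht) ((hsol.source t ht).integrable (by norm_num)) (hsol.eq_q t ht)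
        (hsol.eq_p t ht) (hsol.eq_u t ht) (hsol.boundary_a t ht) (hsol.boundary_b t ht)
        (hsol.boundary_q t ht) (hS.equations t ht) (hS.inW_ut hT t ht)
        (fun i => (hτ i).tR_pos) hτ1 (fun i => ?_) (fun i => ?_) fun i => hc.ode t ht i
      · rw [(hR.jump_u hsol ht i).1, (hR.jump_u hsol ht i).2, (hR.jump_q hsol ht i).1,
          (hR.jump_q hsol ht i).2, (hR.jump_p hsol ht i).2]
        rfl
      · rw [(hR.jump_p hsol ht i).1]
        rfl
    · have hsub := Mesh.elem_subset (𝒯 := 𝒯) i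
      have hU := hR.hasDerivWithinAt ht
      have d1 := hasDerivWithinAt_coeff_proj hsub m hU
      have d2 := hasDerivWithinAt_jumpL hsub hU
      have d3 := (((d2.div_const s).add (hc.deriv t ht i)).mul_const
        ((leg k (𝒯.left i) (𝒯.right i)).coeff m))
      have d4 := (d1.add d3).sub (hS.time_deriv t ht i m)
      have hcongr : ∀ r ∈ Icc 0 T, (e r i).u.coeff m =
          (proj k (𝒯.left i) (𝒯.right i) (jetFn a b (k + 1) 0 (U r))).coeff m +
          (jumpL k (𝒯.left i) (𝒯.right i) (U r) / s + c r i) *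
            (leg k (𝒯.left i) (𝒯.right i)).coeff m - ((S r).u i).coeff m := by
        intro r hr
        simp only [he, errorState, Polynomial.coeff_sub, Polynomial.coeff_add,
          Polynomial.coeff_smul, smul_eq_mul]
        rw [(hR.jump_u hsol hr i).1, proj_congr k (ae_elem_of_ae i (hR.u_eq r hr))]
      refine (d4.congr hcongr (hcongr t ht)).congr_deriv ?_
      simp only [he, errorState, Polynomial.coeff_sub, Polynomial.coeff_add,
        Polynomial.coeff_smul, smul_eq_mul]
      rw [proj_congr k (ae_elem_of_ae i (hR.ut_eq t ht))]
    · have e1 : srcSum 𝒯 (e t) = 𝒯.lenSum (fun i => ζt t i ^ 2) + 𝒯.lenSum (fun i => (e t i).fq ^ 2) +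
          𝒯.lenSum (fun i => (e t i).fp ^ 2) +
          (θ / s) ^ 2 * 𝒯.lenSum (fun i => c' t i ^ 2) := by
        simp only [srcSum, Mesh.lenSum, Finset.mul_sum, ← Finset.sum_add_distrib]
        refine Finset.sum_congr rfl fun i _ => ?_
        rw [ElemState.src, hδ' t ht, hfu]; ring
      have l1 := (𝒯.lenSum_le fun i => sq_nonneg (ζt t i)).trans
        (mul_le_mul_of_nonneg_left (zt.le t ht) hh.le)
      rw [hhY] at l1
      have l4 : (θ / s) ^ 2 * 𝒯.lenSum (fun i => c' t i ^ 2) ≤ (θ / s) ^ 2 * (C₂ * C₁ * X) :=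
        mul_le_mul_of_nonneg_left (hc.deriv_le t ht) (by positivity)
      rw [e1, hH, hCHX]
      linarith [hlq t ht, hlp t ht]
    · have e1 : srcSum' 𝒯 (fun i => e t i - e r i) =
          𝒯.lenSum (fun i => (ζt t i - ζt r i) ^ 2) +
          𝒯.lenSum (fun i => ((ζq t i - ζq r i) + -τ.quL i * (c t i - c r i)) ^ 2) +
          𝒯.lenSum (fun i => ((ζp t i - ζp r i) +
            -(τ.quR i * (τ.quL i + τ.quR i)) * (c t i - c r i)) ^ 2) +
          𝒯.lenSum (fun i => ((δ₁ t i - δ₁ r i) + s * κ i * (c t i - c r i)) ^ 2) := by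
        simp only [srcSum', Mesh.lenSum, ← Finset.sum_add_distrib]
        refine Finset.sum_congr rfl fun i _ => ?_
        have a1 : (e t i - e r i).fu = ζt t i - ζt r i := rfl
        have a2 : (e t i - e r i).fq = (e t i).fq - (e r i).fq := rfl
        have a3 : (e t i - e r i).fp = (e t i).fp - (e r i).fp := rfl
        have a4 : (e t i - e r i).δ = (e t i).δ - (e r i).δ := rfl
        rw [a1, a2, a3, a4, hfq t ht, hfq r hr, hfp, hfp, hδ, hδ]
        ring
      have l1 := (𝒯.lenSum_le fun i => sq_nonneg (ζt t i - ζt r i)).trans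
        (mul_le_mul_of_nonneg_left (zt.inc_le t ht r hr) hh.le)
      have l2 := 𝒯.lenSum_add_mul_le (fun i => (hadm i).2.2.2.1) (zq.inc_le t ht r hr)
        (hc.inc_le t ht r hr)
      have l3 := 𝒯.lenSum_add_mul_le (fun i => (hadm i).2.2.2.2) (zp.inc_le t ht r hr)
        (hc.inc_le t ht r hr)
      have l4 := 𝒯.lenSum_add_mul_le hu1 (zd.inc_le t ht r hr) (hc.inc_le t ht r hr)
      have e2 : 𝒯.size * ((t - r) ^ 2 * Y) = (t - r) ^ 2 * (C₁ * X) := by rw [mul_left_comm, hhY]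
      rw [e2] at l1 l2 l3 l4
      rw [e1, hH, hCHX]
      have hq2 : 0 ≤ (t - r) ^ 2 := sq_nonneg _
      refine (add_le_add (add_le_add (add_le_add l1 l2) l3) l4).trans ?_
      have : (t - r) ^ 2 * (C₁ * X) + (2 * ((t - r) ^ 2 * (C₁ * X)) +
          2 * 1 ^ 2 * ((t - r) ^ 2 * (C₂ * C₁ * X))) + (2 * ((t - r) ^ 2 * (C₁ * X)) +
          2 * (M * (1 + M)) ^ 2 * ((t - r) ^ 2 * (C₂ * C₁ * X))) +
          (2 * ((t - r) ^ 2 * (C₁ * X)) + 2 * V ^ 2 * ((t - r) ^ 2 * (C₂ * C₁ * X))) =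
          (t - r) ^ 2 * (7 * (C₁ * X) + 2 * (C₂ * C₁ * X) + 2 * (W ^ 2 * (C₂ * C₁ * X)) +
            2 * (V ^ 2 * (C₂ * C₁ * X))) := by rw [hW]; ring
      rw [this]
      refine mul_le_mul_of_nonneg_left ?_ hq2
      linarith
    · have m0 : r ∈ Icc 0 T := ⟨hr.1, by linarith [hr.2]⟩
      have m1 : r + σ ∈ Icc 0 T := ⟨by linarith [hr.1], by linarith [hr.2]⟩
      have m2 : r + 2 * σ ∈ Icc 0 T := ⟨by linarith [hr.1], by linarith [hr.2]⟩
      have l1 := hR.sum_second_difference_le hC₀.le (fun g hg => (hjump N 𝒯 g hg).2.2.2) hσ hr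
      have l2 := hc.inc2_le σ hσ r hr
      have hterm : ∀ i, (𝒯.right i - 𝒯.left i) ^ 3 *
          ((e (r + 2 * σ) i).fq - 2 * (e (r + σ) i).fq + (e r i).fq) ^ 2 ≤
          2 / s ^ 2 * ((𝒯.right i - 𝒯.left i) ^ 3 *
            (jumpL k (𝒯.left i) (𝒯.right i) (Q (r + 2 * σ)) -
              2 * jumpL k (𝒯.left i) (𝒯.right i) (Q (r + σ)) +
              jumpL k (𝒯.left i) (𝒯.right i) (Q r)) ^ 2) +
          2 * ((𝒯.right i - 𝒯.left i) ^ 3 *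
            (c (r + 2 * σ) i - 2 * c (r + σ) i + c r i) ^ 2) := by
        intro i
        rw [hfq _ m0, hfq _ m1, hfq _ m2]
        simp only [hζq]
        generalize jumpL k (𝒯.left i) (𝒯.right i) (Q (r + 2 * σ)) = y2
        generalize jumpL k (𝒯.left i) (𝒯.right i) (Q (r + σ)) = y1
        generalize jumpL k (𝒯.left i) (𝒯.right i) (Q r) = y0
        have hη : 0 ≤ (𝒯.right i - 𝒯.left i) ^ 3 := pow_nonneg (𝒯.len_pos i).le 3
        have e1 : y2 / s + -τ.quL i * c (r + 2 * σ) i - 2 * (y1 / s + -τ.quL i * c (r + σ) i) +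
            (y0 / s + -τ.quL i * c r i) = (y2 - 2 * y1 + y0) / s +
            -τ.quL i * (c (r + 2 * σ) i - 2 * c (r + σ) i + c r i) := by ring
        rw [e1]
        generalize c (r + 2 * σ) i - 2 * c (r + σ) i + c r i = z
        generalize y2 - 2 * y1 + y0 = y
        have e3 := sq_div_add_mul_le y z s (hτ i).tL_nonneg (hτ i).tL_le
        refine (mul_le_mul_of_nonneg_left e3 hη).trans (le_of_eq (by ring))
      refine (Finset.sum_le_sum fun i _ => hterm i).trans ?_
      rw [Finset.sum_add_distrib, ← Finset.mul_sum, ← Finset.mul_sum]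
      have l3 := mul_le_mul_of_nonneg_left l1 (by positivity : 0 ≤ 2 / s ^ 2)
      have l4 : 2 / s ^ 2 * (σ ^ 4 * (4 * C₀ * (𝒯.size ^ (2 * k + 2) * K ^ 2))) =
          σ ^ 4 * (8 * C₀ / s ^ 2 * X) := by rw [hX]; ring
      rw [l4] at l3
      refine (add_le_add l3 (mul_le_mul_of_nonneg_left l2 zero_le_two)).trans ?_
      rw [hH, hCHX]
      have : σ ^ 4 * (8 * C₀ / s ^ 2 * X) + 2 * (σ ^ 4 * (C₂ * C₁ * X)) =
          σ ^ 4 * (8 * C₀ / s ^ 2 * X + 2 * (C₂ * C₁ * X)) := by ring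
      rw [this]
      refine mul_le_mul_of_nonneg_left ?_ (by positivity)
      linarith
  · intro i
    have h0 : (0 : ℝ) ∈ Icc 0 T := left_mem_Icc.2 hT.le
    -- The third weak derivative of the initial value is f - u_t at time zero, so the stationary
    -- right-hand side equals u + f - u_t.
    have hw := ((hsol.eq_q 0 h0).comp (hsol.eq_p 0 h0)).comp (hsol.eq_u 0 h0)
    have hu0 : u 0 =ᵐ[volume.restrict (Ioo a b)] d.u₀ := by
      filter_upwards [ae_restrict_mem measurableSet_Ioo] with x hx
      exact hsol.initial x (Ioo_subset_Icc_self hx)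
    have h3 := hd3.unique isOpen_Ioo (hw.congr hu0 (Filter.EventuallyEq.refl _ _))
    have hg : (fun x => d.u₀ x + d3u₀ x) =ᵐ[volume.restrict (Ioo a b)]
        fun x => u 0 x + (d.f 0 x - ut 0 x) := by
      filter_upwards [hu0, h3] with x e1 e2
      rw [e1, e2]
    have h4 := (hS.equations 0 h0).sub_eq_proj
      ((hsol.cont_u 0 h0).integrableOn_Icc.mono_set Ioo_subset_Icc_self) (hR.integrable_ut h0)
      ((hsol.source 0 h0).integrable (by norm_num)) (hS.inW_ut hT 0 h0) hS.initial hg i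
    have h5 := hc.deriv_zero i
    simp only [he, errorState]
    -- Since c' vanishes at time zero, D - u reduces to ρ L with ρ = ζt - ζu - c.
    rw [(hR.jump_u hsol h0 i).1, h5, sub_eq_iff_eq_add.1 h4, ← hs]
    have h6 : jumpL k (𝒯.left i) (𝒯.right i) (U 0) / s = ζu 0 i := rfl
    rw [h6, add_zero, add_smul, add_smul, add_smul, neg_one_mul, neg_one_mul, neg_smul, neg_smul]
    abel
  · have h0 : (0 : ℝ) ∈ Icc 0 T := left_mem_Icc.2 hT.le
    have l1 := sum_add_mul_sq_le (w := fun _ => -1) hm1 (zt.le 0 h0) (zu.le 0 h0)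
    have l2 := 𝒯.lenSum_add_mul_le (w := fun _ => -1) hm1 l1 (hc.le 0 h0)
    refine l2.trans ?_
    rw [hCHX]
    have : 2 * (𝒯.size * (2 * Y + 2 * 1 ^ 2 * Y)) = 8 * (𝒯.size * Y) := by ring
    rw [this, hhY]
    linarith
  · intro t ht
    refine ⟨fun i => rfl, fun i => rfl, fun i => rfl, fun i => rfl, ?_, ?_, ?_, ?_⟩
    · have l1 := 𝒯.lenSum_add_mul_le (w := fun _ => 1) h11 (zu.le t ht) (hc.le t ht)
      rw [hhY] at l1
      simp only [(hR.jump_u hsol ht _).1]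
      simp only [one_mul] at l1
      refine l1.trans ?_
      rw [hCHX]; linarith
    · refine (hlq t ht).trans ?_
      rw [hCHX]; linarith
    · refine (hlp t ht).trans ?_
      rw [hCHX]; linarith
    · have l1 := 𝒯.lenSum_add_mul_le (w := fun _ => 1) h11 (zt.le t ht) (hc.deriv_le t ht)
      rw [hhY] at l1
      simp only [one_mul] at l1
      refine l1.trans ?_
      rw [hCHX]; linarith

end

/-! ### The error estimate -/

section

variable {a b : ℝ} {N : ℕ} {𝒯 : Mesh a b N} {k : ℕ}

theorem Mesh.elem_disjoint {i j : Fin N} (h : i ≠ j) : Disjoint (𝒯.elem i) (𝒯.elem j) := by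
  wlog hij : i < j generalizing i j
  · exact (this h.symm (lt_of_le_of_ne (not_lt.1 hij) h.symm)).symm
  refine Set.disjoint_left.2 fun x hx hy => ?_
  have h1 : 𝒯.node i.succ ≤ 𝒯.node j.castSucc := 𝒯.strictMono.monotone (by
    rw [Fin.le_def]; simpa using hij)
  exact (hx.2.trans_le h1).not_gt hy.1

theorem Mesh.toFun_eq (w : Fin N → ℝ[X]) {i : Fin N} {x : ℝ} (hx : x ∈ 𝒯.elem i) :
    𝒯.toFun w x = (w i).eval x := by
  rw [Mesh.toFun, Finset.sum_eq_single i, indicator_of_mem hx]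
  · intro j _ hj
    exact indicator_of_notMem (fun h => Set.disjoint_left.1 (Mesh.elem_disjoint hj) h hx) _
  · simp

theorem Mesh.measurable_toFun (w : Fin N → ℝ[X]) : Measurable (𝒯.toFun w) := by
  unfold Mesh.toFun
  exact Finset.measurable_fun_sum _ fun i _ =>
    (w i).continuous.measurable.indicator measurableSet_Ioo

theorem Mesh.iUnion_elem_ae_eq (𝒯 : Mesh a b N) : (⋃ i, 𝒯.elem i) =ᵐ[volume] Ioo a b := by
  have h : ∀ᵐ x : ℝ, ∀ j, x ≠ 𝒯.node j := ae_all_iff.2 fun j => by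
    simp [ae_iff]
  filter_upwards [h] with x hx
  refine propext ⟨fun h => ?_, fun h => ?_⟩
  · obtain ⟨i, hi⟩ := mem_iUnion.1 h
    exact Mesh.elem_subset i hi
  · obtain ⟨i, hi⟩ := Mesh.exists_mem_elem h hx
    exact mem_iUnion.2 ⟨i, hi⟩

theorem l2Error_le {v : ℝ → ℝ} {w : Fin N → ℝ[X]} {B : ℝ} (hB : 0 ≤ B)
    (hv : AEStronglyMeasurable v (volume.restrict (Ioo a b)))
    (hi : ∀ i, IntegrableOn (fun x => (v x - (w i).eval x) ^ 2) (Ioo (𝒯.left i) (𝒯.right i)))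
    (h : ∑ i, ∫ x in Ioo (𝒯.left i) (𝒯.right i), (v x - (w i).eval x) ^ 2 ≤ B ^ 2) :
    l2Error 𝒯 v w ≤ ENNReal.ofReal B := by
  have hm : AEStronglyMeasurable (fun x => v x - 𝒯.toFun w x) (volume.restrict (Ioo a b)) :=
    hv.sub (Mesh.measurable_toFun w).aestronglyMeasurable
  have hc : ∀ i, EqOn (fun x => (v x - (w i).eval x) ^ 2) (fun x => (v x - 𝒯.toFun w x) ^ 2)
      (𝒯.elem i) := fun i x hx => by simp only [Mesh.toFun_eq w hx]
  have hi' : ∀ i, IntegrableOn (fun x => (v x - 𝒯.toFun w x) ^ 2) (𝒯.elem i) := fun i =>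
    (hi i).congr_fun (hc i) measurableSet_Ioo
  have hr : volume.restrict (Ioo a b) = volume.restrict (⋃ i, 𝒯.elem i) :=
    Measure.restrict_congr_set 𝒯.iUnion_elem_ae_eq.symm
  have hint : Integrable (fun x => (v x - 𝒯.toFun w x) ^ 2) (volume.restrict (Ioo a b)) := by
    rw [hr]
    exact integrableOn_finite_iUnion.2 hi'
  have hL : MemLp (fun x => v x - 𝒯.toFun w x) 2 (volume.restrict (Ioo a b)) :=
    (memLp_two_iff_integrable_sq hm).2 hint
  have he : ∫ x in Ioo a b, (v x - 𝒯.toFun w x) ^ 2 =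
      ∑ i, ∫ x in Ioo (𝒯.left i) (𝒯.right i), (v x - (w i).eval x) ^ 2 := by
    rw [hr, integral_iUnion_fintype (s := 𝒯.elem) (fun _ => measurableSet_Ioo)
      (fun i j hij => Mesh.elem_disjoint hij) hi']
    exact Finset.sum_congr rfl fun i _ => (setIntegral_congr_fun measurableSet_Ioo (hc i)).symm
  rw [l2Error, hL.eLpNorm_eq_integral_rpow_norm (by norm_num) (by norm_num)]
  refine ENNReal.ofReal_le_ofReal ?_
  have e2 : ∫ x in Ioo a b, ‖v x - 𝒯.toFun w x‖ ^ (2 : ℝ≥0∞).toReal =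
      ∫ x in Ioo a b, (v x - 𝒯.toFun w x) ^ 2 :=
    integral_congr_ae (.of_forall fun x => by simp)
  rw [e2, he]
  have e3 : (2 : ℝ≥0∞).toReal⁻¹ = 1 / 2 := by norm_num
  rw [e3, ← Real.sqrt_eq_rpow]
  exact Real.sqrt_le_iff.2 ⟨hB, h⟩

/-- The error is bounded by those of the projection and of the discrete functions. -/
theorem l2Error_le_of_eq {v : ℝ → ℝ} {g : Jet a b (k + 1)} {e w : Fin N → ℝ[X]} {α : Fin N → ℝ}
    {A B E R : ℝ} (hR : 0 ≤ R) (hvg : v =ᵐ[volume.restrict (Ioo a b)] jetFn a b (k + 1) 0 g)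
    (he : ∀ i, e i = proj k (𝒯.left i) (𝒯.right i) v +
      α i • leg k (𝒯.left i) (𝒯.right i) - w i)
    (hA : ∑ i, ∫ x in Ioo (𝒯.left i) (𝒯.right i), (jetFn a b (k + 1) 0 g x -
      (proj k (𝒯.left i) (𝒯.right i) (jetFn a b (k + 1) 0 g)).eval x) ^ 2 ≤ A)
    (hB : (𝒯.lenSum fun i => α i ^ 2) ≤ B) (hE : 𝒯.normSq e ≤ E)
    (hABE : 3 * A + 3 * (legθ k * B) + 3 * E ≤ R ^ 2) :
    l2Error 𝒯 v w ≤ ENNReal.ofReal R := by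
  set G := jetFn a b (k + 1) 0 g with hG
  have hGi : ∀ i, MemLp G 2 (volume.restrict (Ioo (𝒯.left i) (𝒯.right i))) := fun i =>
    (Lp.memLp G).mono_measure (Measure.restrict_mono (Mesh.elem_subset i) le_rfl)
  have hpoly : ∀ (i : Fin N) (y : ℝ[X]),
      MemLp (fun x => y.eval x) 2 (volume.restrict (Ioo (𝒯.left i) (𝒯.right i))) := fun i y => by
    have h1 : IntegrableOn (fun x => y.eval x ^ 2) (Ioo (𝒯.left i) (𝒯.right i)) :=
      ((y.continuous.pow 2).integrableOn_Icc).mono_set Ioo_subset_Icc_self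
    exact (memLp_two_iff_integrable_sq y.continuous.aestronglyMeasurable).2 h1
  have hcongr : ∀ i, (fun x => (G x - (w i).eval x) ^ 2) =ᵐ[volume.restrict
      (Ioo (𝒯.left i) (𝒯.right i))] fun x => (v x - (w i).eval x) ^ 2 := fun i => by
    filter_upwards [ae_elem_of_ae i hvg] with x hx
    rw [hx]
  have hint : ∀ (i : Fin N) (y : ℝ[X]),
      IntegrableOn (fun x => (G x - y.eval x) ^ 2) (Ioo (𝒯.left i) (𝒯.right i)) := fun i y =>
    ((hGi i).sub (hpoly i y)).integrable_sq
  have hip : ∀ (i : Fin N) (y : ℝ[X]),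
      ∫ x in Ioo (𝒯.left i) (𝒯.right i), y.eval x ^ 2 = ip (𝒯.left i) (𝒯.right i) y y :=
    fun i y => by
      rw [ip_eq_setIntegral (𝒯.left_lt_right i).le]
      simp only [sq]
  refine l2Error_le hR ((Lp.aestronglyMeasurable G).congr hvg.symm)
    (fun i => (hint i (w i)).congr (hcongr i)) (le_trans ?_ hABE)
  have hi : ∀ i, ∫ x in Ioo (𝒯.left i) (𝒯.right i), (v x - (w i).eval x) ^ 2 ≤
      3 * (∫ x in Ioo (𝒯.left i) (𝒯.right i),
        (G x - (proj k (𝒯.left i) (𝒯.right i) G).eval x) ^ 2) +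
      3 * (legθ k * ((𝒯.right i - 𝒯.left i) * α i ^ 2)) +
      3 * ip (𝒯.left i) (𝒯.right i) (e i) (e i) := by
    intro i
    set π := proj k (𝒯.left i) (𝒯.right i) G
    set L := leg k (𝒯.left i) (𝒯.right i)
    have hei : e i = π + α i • L - w i := by
      rw [he i, proj_congr k (ae_elem_of_ae i hvg)]
    have i1 := hint i π
    have i2 : IntegrableOn (fun x => L.eval x ^ 2) (Ioo (𝒯.left i) (𝒯.right i)) :=
      (hpoly i L).integrable_sq
    have i3 : IntegrableOn (fun x => (e i).eval x ^ 2) (Ioo (𝒯.left i) (𝒯.right i)) :=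
      (hpoly i (e i)).integrable_sq
    rw [← integral_congr_ae (hcongr i)]
    have hle : ∫ x in Ioo (𝒯.left i) (𝒯.right i), (G x - (w i).eval x) ^ 2 ≤
        ∫ x in Ioo (𝒯.left i) (𝒯.right i), (3 * (G x - π.eval x) ^ 2 +
          3 * α i ^ 2 * L.eval x ^ 2 + 3 * (e i).eval x ^ 2) := by
      refine setIntegral_mono (hint i (w i))
        (((i1.const_mul 3).add (i2.const_mul (3 * α i ^ 2))).add (i3.const_mul 3)) fun x => ?_
      have h1 : (w i).eval x = π.eval x + α i * L.eval x - (e i).eval x := by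
        rw [hei]; simp
      simp only [h1]
      generalize G x = g
      generalize π.eval x = y
      generalize L.eval x = z
      generalize (e i).eval x = r
      nlinarith [sq_nonneg ((g - y) + α i * z), sq_nonneg ((g - y) - r),
        sq_nonneg (α i * z + r)]
    have j1 : Integrable (fun x => 3 * (G x - π.eval x) ^ 2)
        (volume.restrict (Ioo (𝒯.left i) (𝒯.right i))) := i1.const_mul 3
    have j2 : Integrable (fun x => 3 * α i ^ 2 * L.eval x ^ 2)
        (volume.restrict (Ioo (𝒯.left i) (𝒯.right i))) := i2.const_mul _
    have j3 : Integrable (fun x => 3 * (e i).eval x ^ 2)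
        (volume.restrict (Ioo (𝒯.left i) (𝒯.right i))) := i3.const_mul 3
    have j4 : Integrable (fun x => 3 * (G x - π.eval x) ^ 2 + 3 * α i ^ 2 * L.eval x ^ 2)
        (volume.restrict (Ioo (𝒯.left i) (𝒯.right i))) := j1.add j2
    rw [integral_add j4 j3, integral_add j1 j2, integral_const_mul, integral_const_mul,
      integral_const_mul, hip, hip, leg_self k (𝒯.left_lt_right i)] at hle
    refine hle.trans (le_of_eq (by ring))
  refine (Finset.sum_le_sum fun i _ => hi i).trans ?_
  rw [Finset.sum_add_distrib, Finset.sum_add_distrib, ← Finset.mul_sum, ← Finset.mul_sum,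
    ← Finset.mul_sum, ← Finset.mul_sum]
  have h1 := mul_le_mul_of_nonneg_left hB (legθ_pos k).le
  rw [Mesh.lenSum] at h1
  rw [Mesh.normSq] at hE
  linarith

/-- `max M 1` supplies the condition `1 ≤ M` used for absorbing constants; √(1 - tL²) ≤ 1 gives the
lower bound -2 for sL. -/
theorem Stabilization.Admissible.adm {τ : Stabilization N} (h : τ.Admissible) {M : ℝ}
    (hM : ∀ i, M⁻¹ ≤ τ.quR i ∧ τ.quR i ≤ M) : τ.Adm (max M 1) := fun i => by
  obtain ⟨h1, h2⟩ := hM i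
  have h3 := h.quR_pos i
  have hM0 : 0 < M := h3.trans_le h2
  have h4 := h.quL_mem i
  have h5 : √(1 - τ.quL i ^ 2) ≤ 1 := Real.sqrt_le_one.2 (by linarith [sq_nonneg (τ.quL i)])
  exact
    { one_le := le_max_right _ _
      tL_nonneg := h4.1
      tL_le := h4.2
      sL_ge := by linarith [(h.puL_mem i).1]
      sL_le := (h.puL_mem i).2
      tR_pos := h3
      tR_le := h2.trans (le_max_left _ _)
      tR_inv_le := (inv_le_of_inv_le₀ hM0 h1).trans (le_max_left _ _) }

theorem MemBochnerSobolev.mono {T K K' : ℝ} {m s : ℕ} {v : ℝ → ℝ → ℝ} (hK : K ≤ K')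
    (h : MemBochnerSobolev 𝒯 T m s K v) : MemBochnerSobolev 𝒯 T m s K' v := by
  obtain ⟨D, h1, h2, h3⟩ := h
  refine ⟨D, h1, fun j => ⟨(h2 j).1, ?_⟩, h3⟩
  filter_upwards [(h2 j).2] with t ht
  exact ⟨ht.1, ht.2.trans hK⟩

end

end

end HDG

/-! ### The error estimate for the method. -/

open HDG in
theorem theorem2p4 (k : ℕ) (hk : 0 < k) (a b T : ℝ) (hab : a < b) (hT : 0 < T)
    (d : HDG.ProblemData) (d3u₀ : ℝ → ℝ) (hd3u₀ : HDG.IsWeakDeriv 3 (Ioo a b) d.u₀ d3u₀)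
    (u ut q p : ℝ → ℝ → ℝ) (hsol : HDG.IsExactSolution a b T d u ut q p) (K M : ℝ) :
    ∃ C h₀ : ℝ, 0 < h₀ ∧
      ∀ (N : ℕ) (𝒯 : HDG.Mesh a b N) (τ : HDG.Stabilization N), 𝒯.size < h₀ →
        HDG.MemBochnerSobolev 𝒯 T 2 (k + 1) K u →
        HDG.MemBochnerSobolev 𝒯 T 1 (k + 1) K q →
        HDG.MemBochnerSobolev 𝒯 T 1 (k + 1) K p →
        τ.Admissible → (∀ i, M⁻¹ ≤ τ.quR i ∧ τ.quR i ≤ M) →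
        ∀ (S : ℝ → HDG.Unknowns N) (uht : ℝ → Fin N → ℝ[X]),
          HDG.IsHDGSolution 𝒯 τ k T d d3u₀ S uht →
          ∀ t ∈ Icc 0 T,
            HDG.l2Error 𝒯 (u t) (S t).u + HDG.l2Error 𝒯 (q t) (S t).q +
                HDG.l2Error 𝒯 (p t) (S t).p + HDG.l2Error 𝒯 (ut t) (uht t) ≤
              ENNReal.ofReal (C * 𝒯.size ^ (k + 1)) := by
  obtain ⟨C₀, hC₀, hproj⟩ := exists_sum_jump_le k hk a b
  obtain ⟨C₁, hC₁, hevol⟩ := exists_isEvolution k hk a b hab (max M 1)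
  obtain ⟨C₂, h₀, hC₂, hh₀, hle⟩ :=
    exists_evolution_le k hk a b hab (max M 1) (le_max_right _ _) T hT
  set θ := legθ k
  have hθ : 0 < θ := legθ_pos k
  -- K carries no sign assumption; enlarging it to a nonnegative number only weakens the regularity
  -- hypotheses.
  set K' := max K 0
  have hK' : 0 ≤ K' := le_max_right _ _
  set Cs := 3 * C₀ + 3 * (θ * C₁ ^ 2) + 3 * (C₂ * C₁ ^ 2)
  have hCs : 0 ≤ Cs := by positivity
  refine ⟨4 * (√Cs * K'), h₀, hh₀, fun N 𝒯 τ hsize hu hq hp hτ hM S uht hS t ht => ?_⟩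
  obtain ⟨U, U', Q, P, hR⟩ := hsol.isRegular hk hT hK' (hu.mono (le_max_left _ _))
    (hq.mono (le_max_left _ _)) (hp.mono (le_max_left _ _))
  have hadm := hτ.adm hM
  obtain ⟨e, αu, αq, αp, αt, ρ, he, hρ, hρs, hall⟩ := hevol N 𝒯 T K' d u ut q p U U' Q P τ d3u₀ S
    uht hT hK' hd3u₀ hsol hR hadm hτ.quR_mul_qpR hS
  have hb := hle N 𝒯 τ e ρ _ hsize hadm he hρ hρs t ht
  obtain ⟨eu, eq, ep, et, bu, bq, bp, bt⟩ := hall t ht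
  have hsz := 𝒯.size_nonneg
  set X := 𝒯.size ^ (2 * k + 2) * K' ^ 2 with hX
  have hH : (C₁ * (𝒯.size ^ (k + 1) * K')) ^ 2 = C₁ ^ 2 * X := by rw [hX]; ring
  rw [hH] at hb bu bq bp bt
  set R := √Cs * (𝒯.size ^ (k + 1) * K') with hRdef
  have hR0 : 0 ≤ R := by positivity
  -- Each error splits into projection error, Legendre correction and discrete error; R² is three
  -- times the sum of their squared bounds.
  have hRX : 3 * (C₀ * X) + 3 * (θ * (C₁ ^ 2 * X)) + 3 * (C₂ * (C₁ ^ 2 * X)) ≤ R ^ 2 := by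
    have e1 : R ^ 2 = Cs * X := by rw [hRdef, mul_pow, Real.sq_sqrt hCs, hX]; ring
    rw [e1]
    exact le_of_eq (by ring)
  have hj : ∀ J : ℝ → Jet a b (k + 1), IsLipJet 𝒯 T (k + 1) K' J →
      ∑ i, ∫ x in Ioo (𝒯.left i) (𝒯.right i), (jetFn a b (k + 1) 0 (J t) x -
        (proj k (𝒯.left i) (𝒯.right i) (jetFn a b (k + 1) 0 (J t))).eval x) ^ 2 ≤ C₀ * X := by
    intro J hJ
    refine (hproj N 𝒯 (J t) (hJ.broken t ht)).2.2.1.trans ?_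
    rw [hX, ← mul_assoc]
    exact mul_le_mul_of_nonneg_left (pow_le_pow_left₀ (norm_nonneg _) (hJ.bound t ht) 2)
      (by positivity)
  have nu := 𝒯.normSq_nonneg fun i => (e t i).u
  have nq := 𝒯.normSq_nonneg fun i => (e t i).q
  have np := 𝒯.normSq_nonneg fun i => (e t i).p
  have nt := 𝒯.normSq_nonneg fun i => (e t i).D
  have l1 := l2Error_le_of_eq hR0 (hR.u_eq t ht) eu (hj U hR.lip_U) bu (by linarith) hRX
  have l2 := l2Error_le_of_eq hR0 (hR.q_eq t ht) eq (hj Q hR.lip_Q) bq (by linarith) hRX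
  have l3 := l2Error_le_of_eq hR0 (hR.p_eq t ht) ep (hj P hR.lip_P) bp (by linarith) hRX
  have l4 := l2Error_le_of_eq hR0 (hR.ut_eq t ht) et (hj U' hR.lip_U') bt (by linarith) hRX
  refine (add_le_add (add_le_add (add_le_add l1 l2) l3) l4).trans (le_of_eq ?_)
  rw [← ENNReal.ofReal_add hR0 hR0, ← ENNReal.ofReal_add (by positivity) hR0,
    ← ENNReal.ofReal_add (by positivity) hR0, hRdef]
  congr 1
  ring
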